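/- Let $T>0$ and let $g=g(t,x)\in W^{1,\infty}(\mathbb{R}^+,W^{3,\infty}(\mathbb{R}))$ be real-valued with $g\ge\alpha$ for some constant $\alpha>0$. Then there exist positive functions $C_1,C_2$ of two variables, depending only on $g$ and $T$, with the following property. Let $u,\tilde u\in L^\infty(0,T;H^1_{\mathrm{loc}}(\mathbb{R},S^2))$ be two solutions, in the sense of distributions, of the generalized Schrödinger map equation $$\partial_t u=\partial_x\left(u\wedge g\,\partial_x u\right)=u\wedge\partial_x\left(g\,\partial_x u\right)\quad\text{on }[0,T]\times\mathbb{R}$$ ($\wedge$ being the vector product of $\mathbb{R}^3$), with initial data $u_0,\tilde u_0:\mathbb{R}\to S^2$, respectively. Assume that $u_0-\tilde u_0\in H^2(\mathbb{R})$ and that $\partial_x u,\partial_x\tilde u\in L^\infty(0,T;H^2(\mathbb{R}))$. Then for almost every $t\in\,]0,T[$, $$\|u(t,\cdot)-\tilde u(t,\cdot)\|_{H^1(\mathbb{R})}\le C_1\|u_0-\tilde u_0\|_{H^1(\mathbb{R})},\qquad \|u(t,\cdot)-\tilde u(t,\cdot)\|_{H^2(\mathbb{R})}\le C_2\|u_0-\tilde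 u_0\|_{H^2(\mathbb{R})},$$ where $C_i=C_i\bigl(\|u_0'\|_{H^2(\mathbb{R})},\|\tilde u_0'\|_{H^2(\mathbb{R})}\bigr)$ for $i=1,2$, $u_0'$ and $\tilde u_0'$ denoting the derivatives of $u_0$ and $\tilde u_0$. In particular $u(t,\cdot)-\tilde u(t,\cdot)\in H^2(\mathbb{R})$ for almost every $t$. -/

import Mathlib

open MeasureTheory Set
open scoped ENNReal NNReal Matrix Distributions

namespace SchrodingerMap

/-- Euclidean space `ℝ³`. -/
abbrev E3 : Type := EuclideanSpace ℝ (Fin 3)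

/-- The vector product on `ℝ³`. -/
noncomputable def wedge (a b : E3) : E3 := WithLp.toLp 2 (a.ofLp ⨯₃ b.ofLp)

/-! ### Sobolev spaces on the line -/

/-- `f'` is the distributional derivative of `f : ℝ → ℝ³`, both being locally integrable. -/
structure HasWeakDeriv (f f' : ℝ → E3) : Prop where
  locInt : LocallyIntegrable f volume
  locInt' : LocallyIntegrable f' volume
  integral_eq : ∀ φ : 𝓓((⊤ : TopologicalSpace.Opens ℝ), ℝ),
    ∫ x, deriv φ x • f x = -∫ x, φ x • f' x

/-- `F 0 = f, F 1, …, F k` are the successive weak derivatives of `f`. -/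
def IsWeakDerivChain (k : ℕ) (f : ℝ → E3) (F : ℕ → ℝ → E3) : Prop :=
  F 0 = f ∧ ∀ j < k, HasWeakDeriv (F j) (F (j + 1))

/-- The `H^k(ℝ)` norm `(∑_{j ≤ k} ‖∂^j f‖²_{L²})^{1/2}`, with value `∞` if the weak derivatives up
to order `k` do not all exist or are not all square integrable. Weak derivatives being unique up
to null sets, the infimum runs over one value at most. -/
noncomputable def sobolevNorm (k : ℕ) (f : ℝ → E3) : ℝ≥0∞ :=
  ⨅ (F : ℕ → ℝ → E3) (_ : IsWeakDerivChain k f F),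
    (∑ j ∈ Finset.range (k + 1), eLpNorm (F j) 2 volume ^ 2) ^ (1 / 2 : ℝ)

/-- `f ∈ H^k(ℝ)`. -/
def MemSobolev (k : ℕ) (f : ℝ → E3) : Prop :=
  AEStronglyMeasurable f volume ∧ sobolevNorm k f < ∞

/-! ### Functions of time and space -/

/-- Lebesgue measure on `]0,T[ × ℝ`. -/
noncomputable def slab (T : ℝ) : Measure (ℝ × ℝ) :=
  (volume.restrict (Ioo 0 T)).prod volume

/-- `w ∈ L^∞(0,T; H^k(ℝ))`. -/
def MemLinftySobolev (T : ℝ) (k : ℕ) (w : ℝ → ℝ → E3) : Prop :=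
  AEStronglyMeasurable (fun p : ℝ × ℝ => w p.1 p.2) (slab T) ∧
    ∃ M : ℝ≥0, ∀ᵐ t ∂(volume.restrict (Ioo 0 T)), sobolevNorm k (w t) ≤ M

/-- The open set `]0,∞[ × ℝ` of the `(t,x)` plane. -/
def posTime : TopologicalSpace.Opens (ℝ × ℝ) :=
  ⟨{p | 0 < p.1}, isOpen_lt continuous_const continuous_fst⟩

/-- `f'` is the distributional derivative of `f` in the direction `e` on `]0,∞[ × ℝ`. -/
structure HasWeakPartial (e : ℝ × ℝ) (f f' : ℝ × ℝ → ℝ) : Prop where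
  locInt : LocallyIntegrableOn f posTime volume
  locInt' : LocallyIntegrableOn f' posTime volume
  integral_eq : ∀ φ : 𝓓(posTime, ℝ),
    ∫ p, fderiv ℝ φ p e * f p = -∫ p, φ p * f' p

/-- `g ∈ W^{1,∞}(ℝ⁺, W^{m,∞}(ℝ))`: the function `G i j = ∂_t^i ∂_x^j g` is in
`L^∞(]0,∞[ × ℝ)` for `i ≤ 1` and `j ≤ m`. -/
def MemW1infty (m : ℕ) (g : ℝ → ℝ → ℝ) : Prop :=
  ∃ G : ℕ → ℕ → ℝ × ℝ → ℝ,
    G 0 0 = (fun p => g p.1 p.2) ∧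
    (∀ i ≤ 1, ∀ j ≤ m, MemLp (G i j) ∞ (volume.restrict (posTime : Set (ℝ × ℝ)))) ∧
    HasWeakPartial (1, 0) (G 0 0) (G 1 0) ∧
    ∀ i ≤ 1, ∀ j < m, HasWeakPartial (0, 1) (G i j) (G i (j + 1))

/-- The open set `]-∞,T[ × ℝ`; its test functions restrict to those of `[0,T[ × ℝ`. -/
def beforeTime (T : ℝ) : TopologicalSpace.Opens (ℝ × ℝ) :=
  ⟨{p | p.1 < T}, isOpen_lt continuous_fst continuous_const⟩

/-- `u ∈ L^∞(0,T; H¹_loc(ℝ, S²))`, with weak spatial derivative `ux`, is a solution (in the sense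
of distributions) of `∂_t u = ∂_x (u ∧ g ∂_x u) = u ∧ ∂_x (g ∂_x u)` on `[0,T] × ℝ` with initial
datum `u₀ : ℝ → S²`. -/
structure IsSolution (g : ℝ → ℝ → ℝ) (T : ℝ) (u₀ : ℝ → E3) (u ux : ℝ → ℝ → E3) : Prop where
  meas_init : AEStronglyMeasurable u₀ volume
  sphere_init : ∀ᵐ x, ‖u₀ x‖ = 1
  meas : AEStronglyMeasurable (fun p : ℝ × ℝ => u p.1 p.2) (slab T)
  sphere : ∀ᵐ p ∂(slab T), ‖u p.1 p.2‖ = 1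
  meas_deriv : AEStronglyMeasurable (fun p : ℝ × ℝ => ux p.1 p.2) (slab T)
  hasWeakDeriv : ∀ᵐ t ∂(volume.restrict (Ioo 0 T)), HasWeakDeriv (u t) (ux t)
  locBound : ∀ R > 0, ∃ M : ℝ≥0, ∀ᵐ t ∂(volume.restrict (Ioo 0 T)),
    ∫⁻ x in Icc (-R) R, ‖ux t x‖ₑ ^ 2 ≤ M
  equation : ∀ φ : 𝓓(beforeTime T, ℝ),
    (∫ p, fderiv ℝ φ p (1, 0) • u p.1 p.2 ∂(slab T)) + ∫ x, φ (0, x) • u₀ x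
      = ∫ p, fderiv ℝ φ p (0, 1) • (g p.1 p.2 • wedge (u p.1 p.2) (ux p.1 p.2)) ∂(slab T)

end SchrodingerMap

open SchrodingerMap

set_option linter.unusedSectionVars false

open MeasureTheory Set
open scoped ENNReal NNReal Matrix Distributions
open Filter
open scoped Topology ContDiff

namespace SchrodingerMap

/-! ### Products of absolutely continuous functions -/

variable {E F G : Type*} [NormedAddCommGroup E] [NormedSpace ℝ E] [CompleteSpace E]
  [NormedAddCommGroup F] [NormedSpace ℝ F] [CompleteSpace F]
  [NormedAddCommGroup G] [NormedSpace ℝ G] [CompleteSpace G]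

/-! Write p = (g u_x)_x, so that u_t = v = u ∧ p. For two solutions u and y put w = u − y, q = (g
y_x)_x and z = (g w_x)_x = p − q. The proof is a chain of energy estimates closed by Gronwall's
lemma. Two facts carry it. First, p · (u ∧ p) = 0, which removes the terms of highest order. Second,
u lives on the sphere, so the components of u_x, u_xx, u_xxx along u are 0, −|u_x|² and −3 u_x ·
u_xx: one order lower than they look.

A priori bounds. The hypotheses bound the derivatives of a solution by some M, but the constants may
depend on the data only. So u_x, u_xx, u_xxx are first bounded in L² by the data
(`Sol.exists_bound`), in three stages. (1) ∫ g |u_x|² varies only through g_t. (2) The rate of ‖p‖²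
contains the integral of −2 g p_x · (u_x ∧ p), which Gronwall cannot absorb. Subtracting 5/4 of ∫ (g
|u_x|²)² turns its top order part into an exact x-derivative (`CoefSlice.integral_second_energy`).
(3) The third derivative is reached through time. The norm of u_xxx is controlled by that of v_x
(`CoefSlice.l2_three_le`), and v_x is estimated by applying the H¹ energy to the quotients W =
(u(t+h) − u(t))/h and letting h tend to 0 (`Sol.exists_increment_energy`, `Sol.exists_bound_three`),
so that no space derivative beyond the third is needed. The dangerous term is the integral of g W_x
· (W ∧ p_x). One writes p_x = (u · p_x) u − u ∧ v_x − g |u_x|² u_x and uses that W is almost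
tangent, W · u = −h |W|²/2.

Differences. One has w_t = u ∧ z + w ∧ q. The H¹ energy of w closes at once with the bounds above
(`Sol.exists_difference_one`). At the H² level the rate of ‖z‖² is −2 times the integral of z_x · (g
w_x)_t. Here z_x contains w_xxx, which is bounded in L² but is not small with the H² norm of w. Each
determinant containing z_x is therefore expanded along u (`det3_decomp`). The factors z_x · u, w · u
= |w|²/2 and p_x · u are of lower order, and what still contains z_x without such smallness is
removed by an integration by parts (`diff_identity`, `CoefSlice.integral_diff_le`). Gronwall for
‖z‖² then gives the second estimate (`Sol.exists_difference_two`).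

Regularity. All derivatives are weak. Functions are handled as primitives in x on almost every time
slice (`WD`) and as primitives in t on almost every line (`TP`). A two-variable du Bois-Reymond
lemma (`exists_ae_eq_primitive_of_tensor`) brings the distributional hypotheses to this form, and
jointly measurable representatives are chosen once and for all (`exists_coef`, `exists_sol`). The
energy of ζ_x when ζ_t is merely in L² is obtained with difference quotients in space
(`TP.deriv_energy`). -/

theorem absolutelyContinuousOnInterval_bilin (B : E →L[ℝ] F →L[ℝ] G) {f : ℝ → E} {g : ℝ → F}
    {a b : ℝ} (hf : AbsolutelyContinuousOnInterval f a b)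
    (hg : AbsolutelyContinuousOnInterval g a b) :
    AbsolutelyContinuousOnInterval (fun x => B (f x) (g x)) a b := by
  obtain ⟨C, hC⟩ := hf.exists_bound
  obtain ⟨D, hD⟩ := hg.exists_bound
  unfold AbsolutelyContinuousOnInterval at hf hg
  apply squeeze_zero' ?_ ?_
    (by simpa using (hg.const_mul (‖B‖ * C)).add (hf.const_mul (‖B‖ * D)))
  · exact Filter.Eventually.of_forall <| fun _ ↦ Finset.sum_nonneg (fun i hi ↦ dist_nonneg)
  rw [eventually_inf_principal]
  filter_upwards with (n, I) hnI
  simp only [Finset.mul_sum, ← Finset.sum_add_distrib]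
  gcongr with i hi
  simp only [AbsolutelyContinuousOnInterval.disjWithin, mem_ofPred_eq] at hnI
  have h1 := hC _ (hnI.left i hi |>.left)
  have h2 := hD _ (hnI.left i hi |>.right)
  rw [dist_eq_norm, dist_eq_norm, dist_eq_norm]
  have : B (f (I i).1) (g (I i).1) - B (f (I i).2) (g (I i).2)
      = B (f (I i).1) (g (I i).1 - g (I i).2) + B (f (I i).1 - f (I i).2) (g (I i).2) := by
    simp
  rw [this]
  refine (norm_add_le _ _).trans (add_le_add ?_ ?_)
  · exact (B.le_opNorm₂ _ _).trans (by gcongr)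
  · refine (B.le_opNorm₂ _ _).trans ?_
    calc _ ≤ ‖B‖ * ‖f (I i).1 - f (I i).2‖ * D := by gcongr
      _ = _ := by ring

/-- Increments of the primitive of f are dominated by those of the primitive of ‖f‖, for which the
scalar statement applies. -/
theorem absolutelyContinuousOnInterval_integral {f : ℝ → E} {a b : ℝ}
    (h : IntervalIntegrable f volume a b) :
    AbsolutelyContinuousOnInterval (fun x ↦ ∫ v in a..x, f v) a b := by
  have hN := h.norm.absolutelyContinuousOnInterval_intervalIntegral (c := a) left_mem_uIcc
  unfold AbsolutelyContinuousOnInterval at hN ⊢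
  refine squeeze_zero' ?_ ?_ hN
  · exact Filter.Eventually.of_forall <| fun _ ↦ Finset.sum_nonneg (fun i hi ↦ dist_nonneg)
  rw [eventually_inf_principal]
  filter_upwards with (n, I) hnI
  gcongr with i hi
  simp only [AbsolutelyContinuousOnInterval.disjWithin, mem_ofPred_eq] at hnI
  have h1 := (hnI.left i hi |>.left)
  have h2 := (hnI.left i hi |>.right)
  have i1 : ∀ x ∈ uIcc a b, IntervalIntegrable f volume a x := fun x hx =>
    h.mono_set (uIcc_subset_uIcc left_mem_uIcc hx)
  rw [dist_eq_norm, dist_eq_norm, intervalIntegral.integral_interval_sub_left (i1 _ h1) (i1 _ h2),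
    intervalIntegral.integral_interval_sub_left (i1 _ h1).norm (i1 _ h2).norm, Real.norm_eq_abs]
  exact intervalIntegral.norm_integral_le_abs_integral_norm

theorem absolutelyContinuousOnInterval_const (a : E) (c d : ℝ) :
    AbsolutelyContinuousOnInterval (fun _ : ℝ => a) c d :=
  LipschitzOnWith.absolutelyContinuousOnInterval (K := 0) (LipschitzWith.const a).lipschitzOnWith

/-- Integration by parts for derivatives that are only integrable. The difference of the two sides
is absolutely continuous with zero derivative almost everywhere, hence constant. The product rules
`WD.bilin` and `TP.bilin` and the integrating factor in `gronwall_ae` all rest on it. -/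
theorem intervalIntegral_bilin (B : E →L[ℝ] F →L[ℝ] G) {f' : ℝ → E} {g' : ℝ → F} (a : E) (b : F)
    {c d : ℝ} (hf : IntervalIntegrable f' volume c d) (hg : IntervalIntegrable g' volume c d) :
    IntervalIntegrable (fun s => B (f' s) (b + ∫ r in c..s, g' r)
        + B (a + ∫ r in c..s, f' r) (g' s)) volume c d ∧
    B (a + ∫ s in c..d, f' s) (b + ∫ s in c..d, g' s) = B a b + ∫ s in c..d,
      (B (f' s) (b + ∫ r in c..s, g' r) + B (a + ∫ r in c..s, f' r) (g' s)) := by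
  have acf := absolutelyContinuousOnInterval_integral hf
  have acg := absolutelyContinuousOnInterval_integral hg
  have acF := (absolutelyContinuousOnInterval_const a c d).fun_add acf
  have acG := (absolutelyContinuousOnInterval_const b c d).fun_add acg
  have hii : IntervalIntegrable (fun s => B (f' s) (b + ∫ r in c..s, g' r)
        + B (a + ∫ r in c..s, f' r) (g' s)) volume c d := by
    obtain ⟨C, hC⟩ := acF.exists_bound
    obtain ⟨D, hD⟩ := acG.exists_bound
    have mF : AEStronglyMeasurable (fun s => a + ∫ r in c..s, f' r)
        (volume.restrict (uIoc c d)) :=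
      (acF.continuousOn.mono uIoc_subset_uIcc).aestronglyMeasurable measurableSet_uIoc
    have mG : AEStronglyMeasurable (fun s => b + ∫ r in c..s, g' r)
        (volume.restrict (uIoc c d)) :=
      (acG.continuousOn.mono uIoc_subset_uIcc).aestronglyMeasurable measurableSet_uIoc
    refine IntervalIntegrable.add ?_ ?_
    · rw [intervalIntegrable_iff] at hf ⊢
      refine Integrable.mono' (hf.norm.const_mul (‖B‖ * D))
        (B.aestronglyMeasurable_comp₂ hf.1 mG) ?_
      refine (ae_restrict_iff' measurableSet_uIoc).2 (Eventually.of_forall fun s hs => ?_)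
      refine (B.le_opNorm₂ _ _).trans ?_
      calc _ ≤ ‖B‖ * ‖f' s‖ * D := by gcongr; exact hD s (uIoc_subset_uIcc hs)
        _ = _ := by ring
    · rw [intervalIntegrable_iff] at hg ⊢
      refine Integrable.mono' (hg.norm.const_mul (‖B‖ * C))
        (B.aestronglyMeasurable_comp₂ mF hg.1) ?_
      refine (ae_restrict_iff' measurableSet_uIoc).2 (Eventually.of_forall fun s hs => ?_)
      refine (B.le_opNorm₂ _ _).trans ?_
      gcongr; exact hC s (uIoc_subset_uIcc hs)
  refine ⟨hii, ?_⟩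
  have acH := absolutelyContinuousOnInterval_integral hii
  have acD := (absolutelyContinuousOnInterval_bilin B acF acG).fun_sub acH
  obtain ⟨k, hk⟩ := acD.const_of_ae_hasDerivAt_zero (by
    filter_upwards [hf.ae_hasDerivAt_integral, hg.ae_hasDerivAt_integral,
      hii.ae_hasDerivAt_integral] with x h1 h2 h3 hx
    have d1 := (h1 hx c (by simp)).const_add a
    have d2 := (h2 hx c (by simp)).const_add b
    have d3 := h3 hx c (by simp)
    have := (B.hasDerivAt_of_bilinear (fun _ => d1) (fun _ => d2)).sub d3
    rwa [add_comm, sub_self] at this)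
  have h1 := hk c (by simp)
  have h2 := hk d (by simp)
  simp only [intervalIntegral.integral_same, add_zero, sub_zero] at h1
  rw [← h1, sub_eq_iff_eq_add] at h2
  exact h2

end SchrodingerMap

namespace SchrodingerMap

/-! ### Functions that are primitives of locally integrable functions -/

variable {E F G : Type*} [NormedAddCommGroup E] [NormedSpace ℝ E] [CompleteSpace E]
  [NormedAddCommGroup F] [NormedSpace ℝ F] [CompleteSpace F]
  [NormedAddCommGroup G] [NormedSpace ℝ G] [CompleteSpace G]

/-- `f` agrees almost everywhere with a primitive of the locally integrable function `f'`. -/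
structure WD (f f' : ℝ → E) : Prop where
  loc : LocallyIntegrable f' volume
  eq : ∃ c, ∀ᵐ x, f x = c + ∫ t in (0:ℝ)..x, f' t

theorem _root_.MeasureTheory.LocallyIntegrable.intervalIntegrable' {f : ℝ → E}
    (h : LocallyIntegrable f volume) (a b : ℝ) : IntervalIntegrable f volume a b :=
  (h.integrableOn_isCompact isCompact_uIcc).intervalIntegrable

theorem continuous_add_primitive {f : ℝ → E} (h : LocallyIntegrable f volume) (c : E) :
    Continuous fun x => c + ∫ t in (0:ℝ)..x, f t :=
  continuous_const.add (intervalIntegral.continuous_primitive (fun a b => h.intervalIntegrable' a b) 0)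

theorem WD.locallyIntegrable {f f' : ℝ → E} (h : WD f f') : LocallyIntegrable f volume := by
  obtain ⟨c, hc⟩ := h.eq
  exact (continuous_add_primitive h.loc c).locallyIntegrable.congr (hc.mono fun x hx => hx.symm)

theorem WD.congr {f f' g g' : ℝ → E} (h : WD f f') (h1 : f =ᵐ[volume] g) (h2 : f' =ᵐ[volume] g') :
    WD g g' := by
  refine ⟨h.loc.congr h2, ?_⟩
  obtain ⟨c, hc⟩ := h.eq
  refine ⟨c, ?_⟩
  filter_upwards [hc, h1] with x hx h1x
  rw [← h1x, hx]
  congr 1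
  exact intervalIntegral.integral_congr_ae (h2.mono fun y hy _ => hy)

theorem WD.const (c : E) : WD (fun _ => c) (fun _ => 0) :=
  ⟨(continuous_const).locallyIntegrable, c, by simp⟩

theorem WD.add {f f' g g' : ℝ → E} (hf : WD f f') (hg : WD g g') :
    WD (fun x => f x + g x) (fun x => f' x + g' x) := by
  refine ⟨hf.loc.add hg.loc, ?_⟩
  obtain ⟨c, hc⟩ := hf.eq
  obtain ⟨d, hd⟩ := hg.eq
  refine ⟨c + d, ?_⟩
  filter_upwards [hc, hd] with x h1 h2
  rw [h1, h2, intervalIntegral.integral_add (hf.loc.intervalIntegrable' _ _)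
    (hg.loc.intervalIntegrable' _ _)]
  abel

theorem WD.clm {f f' : ℝ → E} (A : E →L[ℝ] F) (hf : WD f f') :
    WD (fun x => A (f x)) (fun x => A (f' x)) := by
  refine ⟨?_, ?_⟩
  · rw [locallyIntegrable_iff]
    intro K hK
    exact A.integrable_comp (hf.loc.integrableOn_isCompact hK)
  obtain ⟨c, hc⟩ := hf.eq
  refine ⟨A c, ?_⟩
  filter_upwards [hc] with x h1
  rw [h1, map_add, A.intervalIntegral_comp_comm (hf.loc.intervalIntegrable' _ _)]

theorem WD.const_smul {f f' : ℝ → E} (a : ℝ) (hf : WD f f') :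
    WD (fun x => a • f x) (fun x => a • f' x) :=
  hf.clm (a • ContinuousLinearMap.id ℝ E)

theorem WD.neg {f f' : ℝ → E} (hf : WD f f') : WD (fun x => - f x) (fun x => - f' x) :=
  hf.clm (- ContinuousLinearMap.id ℝ E)

theorem WD.sub {f f' g g' : ℝ → E} (hf : WD f f') (hg : WD g g') :
    WD (fun x => f x - g x) (fun x => f' x - g' x) := by
  simpa only [sub_eq_add_neg] using hf.add hg.neg

theorem WD.bilin (B : E →L[ℝ] F →L[ℝ] G) {f f' : ℝ → E} {g g' : ℝ → F} (hf : WD f f')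
    (hg : WD g g') :
    WD (fun x => B (f x) (g x)) (fun x => B (f' x) (g x) + B (f x) (g' x)) := by
  obtain ⟨c, hc⟩ := hf.eq
  obtain ⟨d, hd⟩ := hg.eq
  have key : WD (fun x => B (c + ∫ t in (0:ℝ)..x, f' t) (d + ∫ t in (0:ℝ)..x, g' t))
      (fun s => B (f' s) (d + ∫ r in (0:ℝ)..s, g' r) + B (c + ∫ r in (0:ℝ)..s, f' r) (g' s)) := by
    have h := fun y => intervalIntegral_bilin B c d (hf.loc.intervalIntegrable' 0 y)
      (hg.loc.intervalIntegrable' 0 y)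
    refine ⟨?_, B c d, Eventually.of_forall fun x => (h x).2⟩
    rw [locallyIntegrable_iff]
    intro K hK
    obtain ⟨R, hR⟩ := hK.isBounded.subset_closedBall 0
    have i1 := (h (-|R|)).1.symm.trans (h |R|).1
    rw [intervalIntegrable_iff_integrableOn_Icc_of_le (by linarith [abs_nonneg R])] at i1
    refine i1.mono_set (hR.trans fun x hx => ?_)
    rw [Metric.mem_closedBall, dist_zero_right, Real.norm_eq_abs] at hx
    exact abs_le.1 (hx.trans (le_abs_self R))
  refine key.congr ?_ ?_
  · filter_upwards [hc, hd] with x h1 h2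
    rw [h1, h2]
  · filter_upwards [hc, hd] with x h1 h2
    rw [h1, h2]

theorem WD.smul {f f' : ℝ → ℝ} {g g' : ℝ → E} (hf : WD f f') (hg : WD g g') :
    WD (fun x => f x • g x) (fun x => f' x • g x + f x • g' x) :=
  hf.bilin (ContinuousLinearMap.lsmul ℝ ℝ) hg

theorem WD.mul {f f' g g' : ℝ → ℝ} (hf : WD f f') (hg : WD g g') :
    WD (fun x => f x * g x) (fun x => f' x * g x + f x * g' x) :=
  hf.smul hg

theorem WD.of_contDiff {φ : ℝ → E} (h : ContDiff ℝ 1 φ) : WD φ (deriv φ) := by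
  have hc : Continuous (deriv φ) := h.continuous_deriv le_rfl
  refine ⟨hc.locallyIntegrable, φ 0, Eventually.of_forall fun x => ?_⟩
  rw [intervalIntegral.integral_deriv_eq_sub (fun y _ => (h.differentiable (by simp)).differentiableAt)
    (hc.intervalIntegrable _ _)]
  abel

/-- If the limit were not zero, ‖f‖ would exceed ‖c‖/2 on a half-line, a set of infinite measure. -/
theorem tendsto_zero_of_integrable_of_tendsto {f : ℝ → E} (hf : Integrable f) {l : Filter ℝ}
    (hl : l = atTop ∨ l = atBot) {c : E} (h : Tendsto f l (𝓝 c)) : c = 0 := by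
  by_contra hne
  have hpos : 0 < ‖c‖ := norm_pos_iff.2 hne
  have h2 := (h.norm.eventually (lt_mem_nhds (half_lt_self hpos)))
  have hfin := hf.norm.measure_gt_lt_top (half_pos hpos)
  rcases hl with rfl | rfl
  · obtain ⟨N, hN⟩ := eventually_atTop.1 h2
    have : volume (Ici N) ≤ volume {x | ‖c‖ / 2 < ‖f x‖} := measure_mono fun x hx => hN x hx
    simp at this
    exact absurd hfin (by rw [this]; simp)
  · obtain ⟨N, hN⟩ := eventually_atBot.1 h2
    have : volume (Iic N) ≤ volume {x | ‖c‖ / 2 < ‖f x‖} := measure_mono fun x hx => hN x hx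
    simp at this
    exact absurd hfin (by rw [this]; simp)

/-- An integrable function with integrable derivative: the two half-line integrals of the
derivative. -/
theorem WD.ae_eq_integral {f f' : ℝ → E} (h : WD f f') (hf : Integrable f) (hf' : Integrable f') :
    ∀ᵐ x, f x = ∫ t in Iic x, f' t ∧ f x = - ∫ t in Ioi x, f' t := by
  obtain ⟨c, hc⟩ := h.eq
  have hF : Integrable (fun x => c + ∫ t in (0:ℝ)..x, f' t) := hf.congr hc
  have t1 : Tendsto (fun x => c + ∫ t in (0:ℝ)..x, f' t) atTop (𝓝 (c + ∫ t in Ioi 0, f' t)) :=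
    tendsto_const_nhds.add
      (intervalIntegral_tendsto_integral_Ioi 0 hf'.integrableOn tendsto_id)
  have t2 : Tendsto (fun x => c + ∫ t in (0:ℝ)..x, f' t) atBot (𝓝 (c + -∫ t in Iic 0, f' t)) := by
    refine tendsto_const_nhds.add ?_
    have := (intervalIntegral_tendsto_integral_Iic 0 hf'.integrableOn tendsto_id).neg
    refine this.congr fun x => ?_
    rw [intervalIntegral.integral_symm]; simp
  have e1 := tendsto_zero_of_integrable_of_tendsto hF (Or.inl rfl) t1
  have e2 := tendsto_zero_of_integrable_of_tendsto hF (Or.inr rfl) t2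
  filter_upwards [hc] with x hx
  have h1 : f x = ∫ t in Iic x, f' t := by
    rw [hx, ← sub_eq_zero, ← e2,
      ← intervalIntegral.integral_Iic_sub_Iic hf'.integrableOn hf'.integrableOn]
    abel
  refine ⟨h1, ?_⟩
  have s1 := intervalIntegral.integral_Iic_add_Ioi (b := x) hf'.integrableOn hf'.integrableOn
  have s2 := intervalIntegral.integral_Iic_add_Ioi (b := 0) hf'.integrableOn hf'.integrableOn
  rw [← sub_eq_zero, sub_neg_eq_add, h1, s1, ← s2, ← sub_eq_zero.2 (e1.trans e2.symm)]
  abel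

theorem WD.integral_eq_zero {f f' : ℝ → E} (h : WD f f') (hf : Integrable f)
    (hf' : Integrable f') : ∫ x, f' x = 0 := by
  obtain ⟨x, h1, h2⟩ := (h.ae_eq_integral hf hf').exists
  rw [← intervalIntegral.integral_Iic_add_Ioi (b := x) hf'.integrableOn hf'.integrableOn, ← h1]
  rw [h2]; simp

/-- The half-lines on either side of x each bound f; adding the two bounds yields the factor 1/2. It
cancels the factor 2 in the derivative of |f|² and makes `WD.ae_sq_le` free of constants. -/
theorem WD.ae_norm_le {f f' : ℝ → E} (h : WD f f') (hf : Integrable f)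
    (hf' : Integrable f') : ∀ᵐ x, ‖f x‖ ≤ (∫ x, ‖f' x‖) / 2 := by
  filter_upwards [h.ae_eq_integral hf hf'] with x hx
  have a1 : ‖f x‖ ≤ ∫ t in Iic x, ‖f' t‖ := by
    rw [hx.1]; exact norm_integral_le_integral_norm _
  have a2 : ‖f x‖ ≤ ∫ t in Ioi x, ‖f' t‖ := by
    rw [hx.2, norm_neg]; exact norm_integral_le_integral_norm _
  have := intervalIntegral.integral_Iic_add_Ioi (b := x) hf'.norm.integrableOn hf'.norm.integrableOn
  linarith

theorem WD.weak {f f' : ℝ → E} (h : WD f f') {φ : ℝ → ℝ} (hφ : ContDiff ℝ 1 φ)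
    (hs : HasCompactSupport φ) : ∫ x, deriv φ x • f x = - ∫ x, φ x • f' x := by
  have hp := (WD.of_contDiff hφ).smul h
  have i1 : Integrable fun x => deriv φ x • f x :=
    h.locallyIntegrable.integrable_smul_left_of_hasCompactSupport
      (hφ.continuous_deriv le_rfl) hs.deriv
  have i2 : Integrable fun x => φ x • f' x :=
    h.loc.integrable_smul_left_of_hasCompactSupport hφ.continuous hs
  have i0 : Integrable fun x => φ x • f x :=
    h.locallyIntegrable.integrable_smul_left_of_hasCompactSupport hφ.continuous hs
  have := hp.integral_eq_zero i0 (i1.add i2)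
  rw [integral_add i1 i2] at this
  exact eq_neg_of_add_eq_zero_left this

theorem WD.unique {f f' g g' : ℝ → E} (h1 : WD f f') (h2 : WD g g') (hfg : f =ᵐ[volume] g) :
    f' =ᵐ[volume] g' := by
  have h := (h1.sub (h2.congr hfg.symm EventuallyEq.rfl))
  have := ae_eq_zero_of_integral_contDiff_smul_eq_zero h.loc (fun φ hφ hs => by
    have := h.weak (hφ.of_le (by norm_cast)) hs
    simpa using this)
  filter_upwards [this] with x hx using sub_eq_zero.1 hx

end SchrodingerMap

namespace SchrodingerMap

/-! ### From weak to strong derivatives in time -/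

variable {E F G : Type*} [NormedAddCommGroup E] [NormedSpace ℝ E] [CompleteSpace E]
  [NormedAddCommGroup F] [NormedSpace ℝ F] [CompleteSpace F]
  [NormedAddCommGroup G] [NormedSpace ℝ G] [CompleteSpace G]

theorem contDiff_primitive {φ : ℝ → ℝ} (hφ : ContDiff ℝ ∞ φ) (m : ℝ) :
    ContDiff ℝ ∞ (fun t => ∫ s in m..t, φ s) ∧ deriv (fun t => ∫ s in m..t, φ s) = φ := by
  have hd : ∀ t, HasDerivAt (fun t => ∫ s in m..t, φ s) (φ t) t := fun t =>
    intervalIntegral.integral_hasDerivAt_right (hφ.continuous.intervalIntegrable _ _)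
      (hφ.continuous.stronglyMeasurableAtFilter _ _) hφ.continuous.continuousAt
  have he : deriv (fun t => ∫ s in m..t, φ s) = φ := funext fun t => (hd t).deriv
  refine ⟨?_, he⟩
  rw [contDiff_infty_iff_deriv, he]
  exact ⟨fun t => (hd t).differentiableAt, hφ⟩

/-- The primitive taken from the least point of the support vanishes beyond the greatest point
because the mean of φ is zero. Order-connectedness keeps the interval between these two points
inside I. -/
theorem exists_primitive_testFunction {I : Set ℝ} (hI : I.OrdConnected) {φ : ℝ → ℝ}
    (hφ : ContDiff ℝ ∞ φ) (hs : HasCompactSupport φ) (hsub : tsupport φ ⊆ I)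
    (h0 : ∫ x, φ x = 0) : ∃ a : ℝ → ℝ, ContDiff ℝ ∞ a ∧ HasCompactSupport a ∧ tsupport a ⊆ I ∧
      deriv a = φ := by
  rcases (tsupport φ).eq_empty_or_nonempty with he | hne
  · refine ⟨0, contDiff_const, HasCompactSupport.zero, by simp, ?_⟩
    rw [tsupport_eq_empty_iff] at he
    rw [he]; ext x; simp
  obtain ⟨m, hm, hmin⟩ := hs.isCompact.exists_isLeast hne
  obtain ⟨M, hM, hmax⟩ := hs.isCompact.exists_isGreatest hne
  have hz : ∀ x, x ∉ Icc m M → φ x = 0 := fun x hx => by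
    by_contra h
    have := subset_tsupport φ (Function.mem_support.2 h)
    exact hx ⟨hmin this, hmax this⟩
  have hsupp : ∀ t, t ∉ Icc m M → ∫ s in m..t, φ s = 0 := by
    intro t ht
    rcases lt_or_ge t m with h | h
    · apply intervalIntegral.integral_zero_ae
      refine (measure_eq_zero_iff_ae_notMem.1 (measure_singleton m)).mono fun x hx hx' => ?_
      rw [uIoc_of_ge h.le] at hx'
      exact hz x fun h' => hx (le_antisymm hx'.2 h'.1)
    · have hMt : M < t := by by_contra h'; exact ht ⟨h, not_lt.1 h'⟩
      rw [intervalIntegral.integral_of_le h, ← h0]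
      apply setIntegral_eq_integral_of_ae_compl_eq_zero
      refine (measure_eq_zero_iff_ae_notMem.1 (measure_singleton m)).mono fun x hx hx' => ?_
      refine hz x fun h' => hx' ⟨lt_of_le_of_ne h'.1 fun h => hx h.symm, h'.2.trans hMt.le⟩
  have hts : tsupport (fun t => ∫ s in m..t, φ s) ⊆ Icc m M := by
    refine closure_minimal (fun x hx => ?_) isClosed_Icc
    by_contra h
    exact hx (hsupp x h)
  obtain ⟨h1, h2⟩ := contDiff_primitive hφ m
  exact ⟨_, h1, isCompact_Icc.of_isClosed_subset (isClosed_tsupport _) hts,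
    hts.trans (hI.out (hsub hm) (hsub hM)), h2⟩

/-- A locally integrable function on a product of open sets vanishing against all tensor products
of test functions vanishes. -/
theorem ae_eq_zero_of_integral_tensor {h : ℝ × ℝ → E} (hh : LocallyIntegrable h volume)
    {I J : Set ℝ} (hI : IsOpen I) (hJ : IsOpen J)
    (H : ∀ a b : ℝ → ℝ, ContDiff ℝ ∞ a → HasCompactSupport a → tsupport a ⊆ I →
      ContDiff ℝ ∞ b → HasCompactSupport b → tsupport b ⊆ J →
      ∫ p : ℝ × ℝ, (a p.1 * b p.2) • h p = 0) :
    ∀ᵐ p : ℝ × ℝ, p.1 ∈ I → p.2 ∈ J → h p = 0 := by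
  have key : ∀ p : ℝ × ℝ, ∀ R > 0, Metric.closedBall p.1 R ⊆ I → Metric.closedBall p.2 R ⊆ J →
      ∀ r, 0 < r → r < R → ∫ q in Metric.closedBall p r, h q = 0 := by
    intro p R hR hpI hpJ r hr hrR
    -- Bumps equal to 1 on the ball of radius r and supported in radius c n, which decreases to r.
    -- Their products tend to the indicator of a closed ball of the sup norm on the plane, which is
    -- a product of intervals.
    let c : ℕ → ℝ := fun n => r + (R - r) / (n + 1)
    have hc : ∀ n, r < c n := fun n => by
      have : 0 < (R - r) / (n + 1) := div_pos (by linarith) (by positivity)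
      simp only [c]; linarith
    have hcR : ∀ n, c n ≤ R := fun n => by
      have : (R - r) / (n + 1) ≤ (R - r) := div_le_self (by linarith) (by linarith [n.cast_nonneg (α := ℝ)])
      simp only [c]; linarith
    have hclim : Tendsto c atTop (𝓝 r) := by
      have := (tendsto_const_div_atTop_nhds_zero_nat (R - r)).comp (tendsto_add_atTop_nat 1)
      have h2 := this.const_add r
      simp only [add_zero] at h2
      refine h2.congr fun n => ?_
      simp [c]
    let φ : ∀ (x : ℝ) (n : ℕ), ContDiffBump x := fun x n => ⟨r, c n, hr, hc n⟩
    have hts : ∀ x n, tsupport (φ x n) ⊆ Metric.closedBall x R := fun x n => by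
      rw [(φ x n).tsupport_eq]; exact Metric.closedBall_subset_closedBall (hcR n)
    have hz : ∀ n, ∫ q : ℝ × ℝ, (φ p.1 n q.1 * φ p.2 n q.2) • h q = 0 := fun n =>
      H _ _ (φ p.1 n).contDiff (φ p.1 n).hasCompactSupport ((hts _ _).trans hpI)
        (φ p.2 n).contDiff (φ p.2 n).hasCompactSupport ((hts _ _).trans hpJ)
    have hpt : ∀ x y : ℝ, Tendsto (fun n => φ x n y) atTop
        (𝓝 ((Metric.closedBall x r).indicator (fun _ => (1:ℝ)) y)) := by
      intro x y
      by_cases hy : y ∈ Metric.closedBall x r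
      · rw [indicator_of_mem hy]
        refine tendsto_const_nhds.congr fun n => ((φ x n).one_of_mem_closedBall hy).symm
      · rw [indicator_of_notMem hy]
        rw [Metric.mem_closedBall, not_le] at hy
        refine tendsto_const_nhds.congr' ?_
        filter_upwards [hclim.eventually (gt_mem_nhds hy)] with n hn
        exact ((φ x n).zero_of_le_dist hn.le).symm
    have hlim : Tendsto (fun n => ∫ q : ℝ × ℝ, (φ p.1 n q.1 * φ p.2 n q.2) • h q) atTop
        (𝓝 (∫ q, (Metric.closedBall p r).indicator h q)) := by
      refine tendsto_integral_of_dominated_convergence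
        (fun q => (Metric.closedBall p R).indicator (fun q => ‖h q‖) q) (fun n => ?_) ?_ ?_ ?_
      · refine AEStronglyMeasurable.smul ?_ hh.aestronglyMeasurable
        exact (((φ p.1 n).continuous.comp continuous_fst).mul
          ((φ p.2 n).continuous.comp continuous_snd)).aestronglyMeasurable
      · exact (integrable_indicator_iff measurableSet_closedBall).2
          (hh.integrableOn_isCompact (isCompact_closedBall p R)).norm
      · refine fun n => Eventually.of_forall fun q => ?_
        by_cases hq : q ∈ Metric.closedBall p R
        · rw [indicator_of_mem hq, norm_smul, norm_mul, Real.norm_of_nonneg (φ p.1 n).nonneg,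
            Real.norm_of_nonneg (φ p.2 n).nonneg]
          exact mul_le_of_le_one_left (norm_nonneg _)
            (mul_le_one₀ (φ p.1 n).le_one (φ p.2 n).nonneg (φ p.2 n).le_one)
        · rw [indicator_of_notMem hq]
          rw [← closedBall_prod_same] at hq
          have : φ p.1 n q.1 * φ p.2 n q.2 = 0 := by
            by_contra hne
            exact hq ⟨hts _ n (subset_tsupport _ (left_ne_zero_of_mul hne)),
              hts _ n (subset_tsupport _ (right_ne_zero_of_mul hne))⟩
          simp [this]
      · refine Eventually.of_forall fun q => ?_
        have := ((hpt p.1 q.1).mul (hpt p.2 q.2)).smul_const (h q)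
        convert! this using 2
        rw [← closedBall_prod_same]
        by_cases h1 : q.1 ∈ Metric.closedBall p.1 r <;> by_cases h2 : q.2 ∈ Metric.closedBall p.2 r
          <;> simp [indicator, h1, h2, Set.mem_prod]
    simp only [hz] at hlim
    rw [← integral_indicator measurableSet_closedBall]
    exact tendsto_nhds_unique hlim tendsto_const_nhds
  -- Lebesgue differentiation: almost every value of h is a limit of averages over small balls, and
  -- all of these vanish.
  filter_upwards [IsUnifLocDoublingMeasure.ae_tendsto_average volume hh 1] with p hp h1 h2
  obtain ⟨R1, hR1, hb1⟩ := Metric.nhds_basis_closedBall.mem_iff.1 (hI.mem_nhds h1)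
  obtain ⟨R2, hR2, hb2⟩ := Metric.nhds_basis_closedBall.mem_iff.1 (hJ.mem_nhds h2)
  have hR : 0 < min R1 R2 := lt_min hR1 hR2
  have := @hp ℝ (𝓝[>] 0) (fun _ => p) id tendsto_id
    (eventually_mem_nhdsWithin.mono fun r hr => by
      simp only [id, one_mul]; exact Metric.mem_closedBall_self (le_of_lt hr))
  refine tendsto_nhds_unique this (tendsto_const_nhds.congr' ?_)
  filter_upwards [Ioo_mem_nhdsGT hR] with r hr
  rw [setAverage_eq, id, key p _ hR ((Metric.closedBall_subset_closedBall (min_le_left _ _)).trans hb1)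
    ((Metric.closedBall_subset_closedBall (min_le_right _ _)).trans hb2) r hr.1 hr.2, smul_zero]

theorem stronglyMeasurable_primitive {f : ℝ × ℝ → E} (hf : StronglyMeasurable f) (a : ℝ) :
    StronglyMeasurable fun p : ℝ × ℝ => ∫ s in a..p.1, f (s, p.2) := by
  have h1 : ∀ S : Set ((ℝ × ℝ) × ℝ), MeasurableSet S →
      StronglyMeasurable fun p : ℝ × ℝ => ∫ s, S.indicator (fun q => f (q.2, q.1.2)) (p, s) := by
    intro S hS
    refine StronglyMeasurable.integral_prod_right (f := fun p s =>
      S.indicator (fun q : (ℝ × ℝ) × ℝ => f (q.2, q.1.2)) (p, s)) ?_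
    exact (hf.comp_measurable (by fun_prop : Measurable fun q : (ℝ × ℝ) × ℝ => (q.2, q.1.2))).indicator hS
  have m1 : MeasurableSet {q : (ℝ × ℝ) × ℝ | a < q.2 ∧ q.2 ≤ q.1.1} :=
    (measurableSet_lt measurable_const measurable_snd).inter
      (measurableSet_le measurable_snd (by fun_prop))
  have m2 : MeasurableSet {q : (ℝ × ℝ) × ℝ | q.1.1 < q.2 ∧ q.2 ≤ a} :=
    (measurableSet_lt (by fun_prop) measurable_snd).inter
      (measurableSet_le measurable_snd measurable_const)
  convert! (h1 _ m1).sub (h1 _ m2) using 2 with p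
  rw [intervalIntegral, ← integral_indicator measurableSet_Ioc, ← integral_indicator measurableSet_Ioc]
  rfl

theorem locallyIntegrable_comp_snd {C : ℝ → E} (hC : LocallyIntegrable C volume) :
    LocallyIntegrable (fun p : ℝ × ℝ => C p.2) volume := by
  rw [locallyIntegrable_iff]
  intro K hK
  have h2 : IntegrableOn C (Prod.snd '' K) volume :=
    hC.integrableOn_isCompact (hK.image continuous_snd)
  have hc1 := hK.image continuous_fst
  have : IsFiniteMeasure ((volume : Measure ℝ).restrict (Prod.fst '' K)) :=
    ⟨by rw [Measure.restrict_apply_univ]; exact hc1.measure_lt_top⟩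
  have := h2.comp_snd ((volume : Measure ℝ).restrict (Prod.fst '' K))
  rw [Measure.prod_restrict] at this
  exact IntegrableOn.mono_set this fun p hp => ⟨mem_image_of_mem _ hp, mem_image_of_mem _ hp⟩

theorem locallyIntegrable_integral_fst {D : ℝ × ℝ → E} (hD : LocallyIntegrable D volume)
    {ψ : ℝ → ℝ} (hψ : Continuous ψ) (hs : HasCompactSupport ψ) :
    LocallyIntegrable (fun x => ∫ t, ψ t • D (t, x)) volume := by
  rw [locallyIntegrable_iff]
  intro K hK
  have hint : IntegrableOn (fun p : ℝ × ℝ => ψ p.1 • D p) (tsupport ψ ×ˢ K) volume :=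
    (hD.integrableOn_isCompact (hs.isCompact.prod hK)).continuousOn_smul
      (hψ.comp continuous_fst).continuousOn (hs.isCompact.prod hK)
  rw [IntegrableOn, Measure.volume_eq_prod, ← Measure.prod_restrict] at hint
  refine hint.integral_prod_right.congr (Eventually.of_forall fun x => ?_)
  refine setIntegral_eq_integral_of_forall_compl_eq_zero fun t ht => ?_
  rw [image_eq_zero_of_notMem_tsupport ht, zero_smul]

theorem integrable_tensor_smul {D : ℝ × ℝ → E} (hD : LocallyIntegrable D volume)
    {a b : ℝ → ℝ} (ha : Continuous a) (has : HasCompactSupport a)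
    (hb : Continuous b) (hbs : HasCompactSupport b) :
    Integrable fun p : ℝ × ℝ => (a p.1 * b p.2) • D p := by
  refine hD.integrable_smul_left_of_hasCompactSupport
    ((ha.comp continuous_fst).mul (hb.comp continuous_snd)) ?_
  refine HasCompactSupport.intro (has.isCompact.prod hbs.isCompact) fun p hp => ?_
  by_contra hne
  exact hp ⟨subset_tsupport _ (left_ne_zero_of_mul hne), subset_tsupport _ (right_ne_zero_of_mul hne)⟩

/-- The du Bois-Reymond argument with a parameter. Let ψ be a bump of mass one in I. For a test
function φ the function φ − (∫ φ) ψ has a compactly supported primitive in I, so testing D with φ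
amounts to testing it with (∫ φ) ψ. Hence D agrees with its ψ-average in time, a function of x
alone. -/
theorem exists_ae_eq_snd_of_integral_tensor_deriv {D : ℝ × ℝ → E}
    (hD : LocallyIntegrable D volume) {I J : Set ℝ} (hI : IsOpen I) (hIc : I.OrdConnected)
    {t₀ : ℝ} (ht₀ : t₀ ∈ I) (hJ : IsOpen J)
    (H : ∀ a b : ℝ → ℝ, ContDiff ℝ ∞ a → HasCompactSupport a → tsupport a ⊆ I →
      ContDiff ℝ ∞ b → HasCompactSupport b → tsupport b ⊆ J →
      ∫ p : ℝ × ℝ, (deriv a p.1 * b p.2) • D p = 0) :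
    ∃ C : ℝ → E, ∀ᵐ p : ℝ × ℝ, p.1 ∈ I → p.2 ∈ J → D p = C p.2 := by
  obtain ⟨R, hR, hRI⟩ := Metric.nhds_basis_closedBall.mem_iff.1 (hI.mem_nhds ht₀)
  let ψb : ContDiffBump t₀ := ⟨R / 2, R, by linarith, by linarith⟩
  let ψ : ℝ → ℝ := ψb.normed volume
  have ψc : ContDiff ℝ ∞ ψ := ψb.contDiff_normed
  have ψs : HasCompactSupport ψ := ψb.hasCompactSupport_normed
  have ψt : tsupport ψ ⊆ I := by rw [ψb.tsupport_normed_eq]; exact hRI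
  have ψ1 : ∫ x, ψ x = 1 := ψb.integral_normed
  let C : ℝ → E := fun x => ∫ t, ψ t • D (t, x)
  have hC : LocallyIntegrable C volume := locallyIntegrable_integral_fst hD ψc.continuous ψs
  refine ⟨C, ?_⟩
  have := ae_eq_zero_of_integral_tensor (hD.sub (locallyIntegrable_comp_snd hC)) hI hJ
    (fun φ b φc φs φt bc bs bt => ?_)
  · filter_upwards [this] with p hp h1 h2
    exact sub_eq_zero.1 (hp h1 h2)
  have iD := integrable_tensor_smul hD φc.continuous φs bc.continuous bs
  have iC := integrable_tensor_smul (locallyIntegrable_comp_snd hC) φc.continuous φs bc.continuous bs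
  simp only [Pi.sub_apply, smul_sub]
  rw [integral_sub iD iC, sub_eq_zero]
  have iψ := integrable_tensor_smul hD ψc.continuous ψs bc.continuous bs
  set c := ∫ x, φ x with hc
  obtain ⟨a, ac, as, at', ad⟩ := exists_primitive_testFunction hIc (φ := fun x => φ x - c * ψ x)
    (φc.sub (contDiff_const.mul ψc)) (φs.sub ψs.mul_left)
    ((tsupport_sub _ _).trans (union_subset φt ((tsupport_mul_subset_right).trans ψt))) (by
      rw [integral_sub (φc.continuous.integrable_of_hasCompactSupport φs)
        ((ψc.continuous.integrable_of_hasCompactSupport ψs).const_mul c), integral_const_mul, ψ1,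
        mul_one, ← hc, sub_self])
  have h0 := H a b ac as at' bc bs bt
  rw [ad] at h0
  have e1 : ∫ p : ℝ × ℝ, (φ p.1 * b p.2) • D p = c • ∫ p : ℝ × ℝ, (ψ p.1 * b p.2) • D p := by
    rw [← integral_smul, ← sub_eq_zero, ← integral_sub iD (by exact iψ.smul c), ← h0]
    refine integral_congr_ae (Eventually.of_forall fun p => ?_)
    simp only [smul_smul, ← sub_smul]
    congr 1; ring
  rw [e1]
  rw [Measure.volume_eq_prod] at iψ iC ⊢
  rw [integral_prod_symm _ iψ, integral_prod_symm _ iC, ← integral_smul]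
  refine integral_congr_ae (Eventually.of_forall fun x => ?_)
  simp only
  rw [integral_smul_const, integral_mul_const, ← hc, ← smul_smul]
  congr 1
  change _ = b x • ∫ t, ψ t • D (t, x)
  rw [← integral_smul]
  refine integral_congr_ae (Eventually.of_forall fun t => ?_)
  simp only [smul_smul, mul_comm]

theorem locallyIntegrable_primitive {f : ℝ × ℝ → E} (hm : StronglyMeasurable f)
    (hf : LocallyIntegrable f volume) (a : ℝ) :
    LocallyIntegrable (fun p : ℝ × ℝ => ∫ s in a..p.1, f (s, p.2)) volume := by
  rw [locallyIntegrable_iff]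
  intro K hK
  -- Adding the point (a, a) to K makes a single square contain K and every time segment that starts
  -- at a.
  obtain ⟨R, hR⟩ := (hK.union (isCompact_singleton (x := (a, a)))).isBounded.subset_closedBall 0
  have ha : |a| ≤ R := by
    have := hR (Or.inr rfl)
    simpa using this
  rw [show (0 : ℝ × ℝ) = ((0 : ℝ), (0 : ℝ)) from rfl, ← closedBall_prod_same] at hR
  set S := Metric.closedBall (0:ℝ) R
  have hfin : IsFiniteMeasure ((volume : Measure ℝ).restrict S) :=
    ⟨by rw [Measure.restrict_apply_univ]; exact measure_closedBall_lt_top⟩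
  have h1 : IntegrableOn f (S ×ˢ S) volume :=
    hf.integrableOn_isCompact ((isCompact_closedBall _ _).prod (isCompact_closedBall _ _))
  rw [IntegrableOn, Measure.volume_eq_prod, ← Measure.prod_restrict] at h1
  have h2 := h1.norm.integral_prod_right.comp_snd ((volume : Measure ℝ).restrict S)
  rw [Measure.prod_restrict] at h2
  have h1' := h1.prod_left_ae
  refine IntegrableOn.mono_set (t := S ×ˢ S) ?_ (subset_union_left.trans hR)
  refine Integrable.mono' h2 (stronglyMeasurable_primitive hm a).aestronglyMeasurable ?_
  have h3 : ∀ᵐ p : ℝ × ℝ ∂((volume.restrict S).prod (volume.restrict S)),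
      Integrable (fun x => f (x, p.2)) (volume.restrict S) :=
    Measure.quasiMeasurePreserving_snd.ae h1'
  rw [Measure.prod_restrict] at h3
  filter_upwards [h3, ae_restrict_mem (measurableSet_closedBall.prod measurableSet_closedBall)]
    with p hp hpS
  have hsub : uIoc a p.1 ⊆ S := fun x hx => by
    have h4 : |p.1| ≤ R := by simpa [S] using hpS.1
    have := uIoc_subset_uIcc hx
    rw [mem_uIcc] at this
    rw [abs_le] at ha h4
    simp only [S, Metric.mem_closedBall, dist_zero_right, Real.norm_eq_abs, abs_le]
    constructor <;> rcases this with h | h <;> linarith [h.1, h.2]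
  rw [intervalIntegral.norm_intervalIntegral_eq]
  refine (norm_integral_le_integral_norm _).trans ?_
  exact setIntegral_mono_set hp.norm (Eventually.of_forall fun x => norm_nonneg _)
    (LE.le.eventuallyLE hsub)

/-- Functions with a weak partial derivative, tested against tensor products, are primitives along
almost every line. -/
theorem exists_ae_eq_primitive_of_tensor {f f' : ℝ × ℝ → E}
    (hf : LocallyIntegrable f volume) (hm : StronglyMeasurable f')
    (hf' : LocallyIntegrable f' volume) {I J : Set ℝ} (hI : IsOpen I)
    (hIc : I.OrdConnected) {t₀ : ℝ} (ht₀ : t₀ ∈ I) (hJ : IsOpen J)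
    (H : ∀ a b : ℝ → ℝ, ContDiff ℝ ∞ a → HasCompactSupport a → tsupport a ⊆ I →
      ContDiff ℝ ∞ b → HasCompactSupport b → tsupport b ⊆ J →
      ∫ p : ℝ × ℝ, (deriv a p.1 * b p.2) • f p = - ∫ p : ℝ × ℝ, (a p.1 * b p.2) • f' p) :
    ∃ C : ℝ → E, ∀ᵐ p : ℝ × ℝ, p.1 ∈ I → p.2 ∈ J → f p = C p.2 + ∫ s in t₀..p.1, f' (s, p.2) := by
  have hP := locallyIntegrable_primitive hm hf' t₀
  suffices hT : ∀ a b : ℝ → ℝ, ContDiff ℝ ∞ a → HasCompactSupport a → tsupport a ⊆ I →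
      ContDiff ℝ ∞ b → HasCompactSupport b → tsupport b ⊆ J →
      ∫ p : ℝ × ℝ, (deriv a p.1 * b p.2) • (f p - ∫ s in t₀..p.1, f' (s, p.2)) = 0 by
    obtain ⟨C, hC⟩ := exists_ae_eq_snd_of_integral_tensor_deriv (hf.sub hP) hI hIc ht₀ hJ hT
    refine ⟨C, ?_⟩
    filter_upwards [hC] with p hp h1 h2
    rw [← hp h1 h2]; simp
  intro a b ac as at' bc bs bt
  have adc : Continuous (deriv a) := ac.continuous_deriv (by simp)
  have i1 := integrable_tensor_smul hf adc as.deriv bc.continuous bs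
  have i2 := integrable_tensor_smul hP adc as.deriv bc.continuous bs
  have i3 := integrable_tensor_smul hf' ac.continuous as bc.continuous bs
  simp only [smul_sub]
  rw [integral_sub i1 i2, H a b ac as at' bc bs bt, sub_eq_zero]
  rw [Measure.volume_eq_prod] at i2 i3 ⊢
  rw [integral_prod_symm _ i2, integral_prod_symm _ i3, ← integral_neg]
  have hloc : ∀ᵐ x : ℝ, LocallyIntegrable (fun s => f' (s, x)) volume := by
    have : ∀ n : ℕ, ∀ᵐ x : ℝ, x ∈ Metric.closedBall (0:ℝ) n →
        IntegrableOn (fun s => f' (s, x)) (Metric.closedBall (0:ℝ) n) volume := fun n => by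
      have h1 : IntegrableOn f' (Metric.closedBall (0:ℝ) n ×ˢ Metric.closedBall (0:ℝ) n) volume :=
        hf'.integrableOn_isCompact ((isCompact_closedBall _ _).prod (isCompact_closedBall _ _))
      rw [IntegrableOn, Measure.volume_eq_prod, ← Measure.prod_restrict] at h1
      exact (ae_restrict_iff' measurableSet_closedBall).1 h1.prod_left_ae
    filter_upwards [ae_all_iff.2 this] with x hx
    rw [locallyIntegrable_iff]
    intro K hK
    obtain ⟨R, hR⟩ := (hK.union (isCompact_singleton (x := x))).isBounded.subset_closedBall 0
    obtain ⟨n, hn⟩ := exists_nat_ge R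
    have hR' := hR.trans (Metric.closedBall_subset_closedBall hn)
    exact (hx n (hR' (Or.inr rfl))).mono_set (subset_union_left.trans hR')
  refine integral_congr_ae ?_
  filter_upwards [hloc] with x hx
  have w : WD (fun t => ∫ s in t₀..t, f' (s, x)) (fun s => f' (s, x)) := by
    refine ⟨hx, ∫ s in t₀..0, f' (s, x), Eventually.of_forall fun t => ?_⟩
    exact (intervalIntegral.integral_add_adjacent_intervals (hx.intervalIntegrable' _ _)
      (hx.intervalIntegrable' _ _)).symm
  have := w.weak (ac.of_le (by norm_cast)) as
  simp only [mul_comm _ (b x), ← smul_smul]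
  rw [integral_smul, integral_smul, this, smul_neg]

end SchrodingerMap

namespace SchrodingerMap

/-! ### Vector algebra -/

theorem inner_eq_sum (a b : E3) : inner ℝ a b = a 0 * b 0 + a 1 * b 1 + a 2 * b 2 := by
  rw [PiLp.inner_apply, Fin.sum_univ_three]
  simp only [RCLike.inner_apply, conj_trivial]
  ring

theorem wedge_zero (a b : E3) : (wedge a b) 0 = a 1 * b 2 - a 2 * b 1 := by
  simp [wedge, cross_apply]

theorem wedge_one (a b : E3) : (wedge a b) 1 = a 2 * b 0 - a 0 * b 2 := by
  simp [wedge, cross_apply]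

theorem wedge_two (a b : E3) : (wedge a b) 2 = a 0 * b 1 - a 1 * b 0 := by
  simp [wedge, cross_apply]

theorem E3.ext {a b : E3} (h0 : a 0 = b 0) (h1 : a 1 = b 1) (h2 : a 2 = b 2) : a = b := by
  ext i; fin_cases i <;> assumption

theorem norm_sq_eq (a : E3) : ‖a‖ ^ 2 = a 0 * a 0 + a 1 * a 1 + a 2 * a 2 := by
  rw [← real_inner_self_eq_norm_sq, inner_eq_sum]

theorem norm_wedge_le (a b : E3) : ‖wedge a b‖ ≤ ‖a‖ * ‖b‖ := by
  refine le_of_sq_le_sq ?_ (by positivity)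
  rw [mul_pow, norm_sq_eq, norm_sq_eq, norm_sq_eq, wedge_zero, wedge_one, wedge_two]
  nlinarith [sq_nonneg (a 0 * b 0 + a 1 * b 1 + a 2 * b 2)]

/-- The vector product as a continuous bilinear map. -/
noncomputable def wedgeL : E3 →L[ℝ] E3 →L[ℝ] E3 :=
  LinearMap.mkContinuous₂ (LinearMap.mk₂ ℝ wedge
    (fun a b c => by
      apply E3.ext <;> simp only [wedge_zero, wedge_one, wedge_two, PiLp.add_apply] <;> ring)
    (fun c a b => by
      apply E3.ext <;> simp only [wedge_zero, wedge_one, wedge_two, PiLp.smul_apply, smul_eq_mul]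
        <;> ring)
    (fun a b c => by
      apply E3.ext <;> simp only [wedge_zero, wedge_one, wedge_two, PiLp.add_apply] <;> ring)
    (fun c a b => by
      apply E3.ext <;> simp only [wedge_zero, wedge_one, wedge_two, PiLp.smul_apply, smul_eq_mul]
        <;> ring)) 1 (fun a b => by
      rw [one_mul]; exact norm_wedge_le a b)

theorem wedgeL_apply (a b : E3) : wedgeL a b = wedge a b := rfl

theorem wedge_add_right (a b c : E3) : wedge a (b + c) = wedge a b + wedge a c := by
  simp only [← wedgeL_apply, map_add]

theorem wedge_sub_left (a b c : E3) : wedge (a - b) c = wedge a c - wedge b c := by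
  simp only [← wedgeL_apply, map_sub, sub_apply]

theorem wedge_sub_right (a b c : E3) : wedge a (b - c) = wedge a b - wedge a c := by
  simp only [← wedgeL_apply, map_sub]

theorem wedge_smul_left (r : ℝ) (a b : E3) : wedge (r • a) b = r • wedge a b := by
  simp only [← wedgeL_apply, map_smul, smul_apply]

theorem wedge_smul_right (r : ℝ) (a b : E3) : wedge a (r • b) = r • wedge a b := by
  simp only [← wedgeL_apply, map_smul]

theorem wedge_self (a : E3) : wedge a a = 0 := by
  apply E3.ext <;> simp only [wedge_zero, wedge_one, wedge_two, PiLp.zero_apply] <;> ring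

/-- The determinant of three vectors. -/
noncomputable def det3 (a b c : E3) : ℝ := inner ℝ a (wedge b c)

theorem det3_eq (a b c : E3) : det3 a b c =
    a 0 * (b 1 * c 2 - b 2 * c 1) + a 1 * (b 2 * c 0 - b 0 * c 2) + a 2 * (b 0 * c 1 - b 1 * c 0) := by
  rw [det3, inner_eq_sum, wedge_zero, wedge_one, wedge_two]

theorem abs_det3_le (a b c : E3) : |det3 a b c| ≤ ‖a‖ * ‖b‖ * ‖c‖ := by
  refine (abs_real_inner_le_norm _ _).trans ?_
  rw [mul_assoc]
  exact mul_le_mul_of_nonneg_left (norm_wedge_le _ _) (norm_nonneg _)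

theorem det3_self_left (a b : E3) : det3 a a b = 0 := by rw [det3_eq]; ring
theorem det3_self_right (a b : E3) : det3 a b b = 0 := by rw [det3_eq]; ring
theorem det3_self_outer (a b : E3) : det3 a b a = 0 := by rw [det3_eq]; ring
theorem det3_cycle (a b c : E3) : det3 a b c = det3 b c a := by rw [det3_eq, det3_eq]; ring
theorem det3_swap_right (a b c : E3) : det3 a b c = - det3 a c b := by rw [det3_eq, det3_eq]; ring

/-- This is the identity det(Pa, b, c) + det(a, Pb, c) + det(a, b, Pc) = tr(P) det(a, b, c) for the
projection P onto the line of u, whose trace is |u|² = 1. It exchanges a vector of high order for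
its component along u, which is of lower order for maps into the sphere. -/
theorem det3_decomp (u a b c : E3) (hu : ‖u‖ = 1) : det3 a b c =
    inner ℝ a u * det3 u b c + inner ℝ b u * det3 a u c + inner ℝ c u * det3 a b u := by
  have h : u 0 * u 0 + u 1 * u 1 + u 2 * u 2 = 1 := by rw [← norm_sq_eq, hu]; norm_num
  simp only [det3_eq, inner_eq_sum]
  linear_combination (-(a 0 * (b 1 * c 2 - b 2 * c 1) + a 1 * (b 2 * c 0 - b 0 * c 2)
    + a 2 * (b 0 * c 1 - b 1 * c 0))) * h

theorem wedge_wedge (a b c : E3) :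
    wedge a (wedge b c) = inner ℝ a c • b - inner ℝ a b • c := by
  apply E3.ext <;> simp only [wedge_zero, wedge_one, wedge_two, PiLp.sub_apply, PiLp.smul_apply,
    smul_eq_mul, inner_eq_sum] <;> ring

/-! ### `L²` norms -/

variable {E F G : Type*} [NormedAddCommGroup E] [NormedSpace ℝ E] [CompleteSpace E]
  [NormedAddCommGroup F] [NormedSpace ℝ F] [CompleteSpace F]
  [NormedAddCommGroup G] [NormedSpace ℝ G] [CompleteSpace G]

/-- The `L²(ℝ)` norm as a real number. -/
noncomputable def l2 (f : ℝ → E) : ℝ := (eLpNorm f 2 volume).toReal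

theorem l2_nonneg (f : ℝ → E) : 0 ≤ l2 f := ENNReal.toReal_nonneg

theorem l2_sq {f : ℝ → E} (hf : MemLp f 2) : l2 f ^ 2 = ∫ x, ‖f x‖ ^ 2 := by
  have h := hf.eLpNorm_eq_integral_rpow_norm (by norm_num) (by norm_num)
  rw [l2, h, ENNReal.toReal_ofReal (by positivity)]
  simp only [ENNReal.toReal_ofNat, Real.rpow_two]
  rw [← one_div, ← Real.sqrt_eq_rpow]
  exact Real.sq_sqrt (integral_nonneg fun x => by positivity)

theorem l2_congr {f g : ℝ → E} (h : f =ᵐ[volume] g) : l2 f = l2 g := by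
  rw [l2, l2, eLpNorm_congr_ae h]

theorem l2_add_le {f g : ℝ → E} (hf : MemLp f 2) (hg : MemLp g 2) :
    l2 (fun x => f x + g x) ≤ l2 f + l2 g := by
  rw [l2, l2, l2, ← ENNReal.toReal_add hf.2.ne hg.2.ne]
  exact ENNReal.toReal_mono (ENNReal.add_ne_top.2 ⟨hf.2.ne, hg.2.ne⟩)
    (eLpNorm_add_le hf.1 hg.1 (by norm_num))

theorem l2_sub_le {f g : ℝ → E} (hf : MemLp f 2) (hg : MemLp g 2) :
    l2 (fun x => f x - g x) ≤ l2 f + l2 g := by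
  rw [l2, l2, l2, ← ENNReal.toReal_add hf.2.ne hg.2.ne]
  exact ENNReal.toReal_mono (ENNReal.add_ne_top.2 ⟨hf.2.ne, hg.2.ne⟩)
    (eLpNorm_sub_le hf.1 hg.1 (by norm_num))

theorem l2_norm (f : ℝ → E) : l2 (fun x => ‖f x‖) = l2 f := by
  rw [l2, l2, eLpNorm_norm]

theorem l2_const_smul (c : ℝ) (f : ℝ → E) : l2 (fun x => c • f x) = |c| * l2 f := by
  rw [l2, l2]
  have := eLpNorm_const_smul c f 2 volume
  rw [show (fun x => c • f x) = c • f from rfl, this, ENNReal.toReal_mul]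
  simp

theorem memLp_of_le {f : ℝ → E} {g : ℝ → F} {c : ℝ} (hf : AEStronglyMeasurable f volume)
    (hg : MemLp g 2) (h : ∀ᵐ x, ‖f x‖ ≤ c * ‖g x‖) : MemLp f 2 :=
  hg.of_le_mul hf h

theorem l2_le {f : ℝ → E} {g : ℝ → F} {c : ℝ} (hc : 0 ≤ c) 
    (hg : MemLp g 2) (h : ∀ᵐ x, ‖f x‖ ≤ c * ‖g x‖) : l2 f ≤ c * l2 g := by
  have := eLpNorm_le_mul_eLpNorm_of_ae_le_mul h 2
  rw [l2, l2, ← ENNReal.toReal_ofReal hc, ← ENNReal.toReal_mul]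
  exact ENNReal.toReal_mono (ENNReal.mul_ne_top ENNReal.ofReal_ne_top hg.2.ne) this

theorem integrable_norm_mul_norm {f : ℝ → E} {g : ℝ → F} (hf : MemLp f 2) (hg : MemLp g 2) :
    Integrable fun x => ‖f x‖ * ‖g x‖ :=
  hf.norm.integrable_mul hg.norm

theorem integral_norm_mul_le {f : ℝ → E} {g : ℝ → F} (hf : MemLp f 2) (hg : MemLp g 2) :
    ∫ x, ‖f x‖ * ‖g x‖ ≤ l2 f * l2 g := by
  have := integral_mul_norm_le_Lp_mul_Lq (p := 2) (q := 2) (μ := (volume : Measure ℝ))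
    (f := fun x => ‖f x‖) (g := fun x => ‖g x‖) (by exact Real.HolderConjugate.two_two)
    (by simpa using hf.norm) (by simpa using hg.norm)
  simp only [norm_norm] at this
  refine this.trans (le_of_eq ?_)
  simp only [Real.rpow_two]
  rw [← l2_sq hf, ← l2_sq hg, ← Real.sqrt_eq_rpow, ← Real.sqrt_eq_rpow, Real.sqrt_sq (l2_nonneg _),
    Real.sqrt_sq (l2_nonneg _)]

theorem integrable_of_le_mul {H : ℝ → G} {f : ℝ → E} {g : ℝ → F} {c : ℝ}
    (hH : AEStronglyMeasurable H volume) (hf : MemLp f 2) (hg : MemLp g 2)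
    (h : ∀ᵐ x, ‖H x‖ ≤ c * (‖f x‖ * ‖g x‖)) : Integrable H :=
  Integrable.mono' ((integrable_norm_mul_norm hf hg).const_mul c) hH h

theorem norm_integral_le_mul {H : ℝ → G} {f : ℝ → E} {g : ℝ → F} {c : ℝ} (hc : 0 ≤ c)
    (hf : MemLp f 2) (hg : MemLp g 2)
    (h : ∀ᵐ x, ‖H x‖ ≤ c * (‖f x‖ * ‖g x‖)) : ‖∫ x, H x‖ ≤ c * (l2 f * l2 g) := by
  refine (norm_integral_le_of_norm_le ((integrable_norm_mul_norm hf hg).const_mul c) h).trans ?_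
  rw [integral_const_mul]
  exact mul_le_mul_of_nonneg_left (integral_norm_mul_le hf hg) hc

theorem integral_norm_le_mul {H : ℝ → G} {f : ℝ → E} {g : ℝ → F} {c : ℝ} (hc : 0 ≤ c)
    (hf : MemLp f 2) (hg : MemLp g 2)
    (h : ∀ᵐ x, ‖H x‖ ≤ c * (‖f x‖ * ‖g x‖)) : ∫ x, ‖H x‖ ≤ c * (l2 f * l2 g) := by
  have := norm_integral_le_mul (H := fun x => ‖H x‖) hc hf hg (by simpa using h)
  exact (le_abs_self _).trans this

/-! ### Weak derivatives of products -/

protected theorem WD.inner {f f' g g' : ℝ → E3} (hf : WD f f') (hg : WD g g') :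
    WD (fun x => inner ℝ (f x) (g x)) (fun x => inner ℝ (f' x) (g x) + inner ℝ (f x) (g' x)) :=
  hf.bilin (innerSL ℝ) hg

protected theorem WD.wedge {f f' g g' : ℝ → E3} (hf : WD f f') (hg : WD g g') :
    WD (fun x => wedge (f x) (g x)) (fun x => wedge (f' x) (g x) + wedge (f x) (g' x)) :=
  hf.bilin wedgeL hg

protected theorem WD.det3 {f f' g g' h h' : ℝ → E3} (hf : WD f f') (hg : WD g g') (hh : WD h h') :
    WD (fun x => det3 (f x) (g x) (h x))
      (fun x => det3 (f' x) (g x) (h x) + det3 (f x) (g' x) (h x) + det3 (f x) (g x) (h' x)) := by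
  refine (hf.inner (hg.wedge hh)).congr EventuallyEq.rfl (Eventually.of_forall fun x => ?_)
  simp only [SchrodingerMap.det3, inner_add_right]
  ring

theorem WD.ae_sq_le {f f' : ℝ → E3} (h : WD f f') (hf : MemLp f 2) (hf' : MemLp f' 2) :
    ∀ᵐ x, ‖f x‖ ^ 2 ≤ l2 f * l2 f' := by
  have w := h.inner h
  have hb : ∀ x, ‖inner ℝ (f' x) (f x) + inner ℝ (f x) (f' x)‖ ≤ 2 * (‖f x‖ * ‖f' x‖) := fun x => by
    rw [real_inner_comm, ← two_mul, norm_mul, Real.norm_ofNat]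
    gcongr
    exact abs_real_inner_le_norm _ _
  have i1 : Integrable fun x => inner ℝ (f' x) (f x) + inner ℝ (f x) (f' x) :=
    integrable_of_le_mul ((hf'.1.inner hf.1).add (hf.1.inner hf'.1)) hf hf'
      (Eventually.of_forall hb)
  have i2 : Integrable fun x => inner ℝ (f x) (f x) := by
    refine integrable_of_le_mul (c := 1) (hf.1.inner hf.1) hf hf (Eventually.of_forall fun x => ?_)
    rw [one_mul]; exact abs_real_inner_le_norm _ _
  filter_upwards [w.ae_norm_le i2 i1] with x hx
  rw [real_inner_self_eq_norm_sq, Real.norm_of_nonneg (by positivity)] at hx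
  have := integral_norm_le_mul (by norm_num) hf hf' (Eventually.of_forall hb)
  linarith

end SchrodingerMap

namespace SchrodingerMap

/-! ### Primitives in time with values in function spaces -/

variable {E F G : Type*} [NormedAddCommGroup E] [NormedSpace ℝ E] [CompleteSpace E]
  [NormedAddCommGroup F] [NormedSpace ℝ F] [CompleteSpace F]
  [NormedAddCommGroup G] [NormedSpace ℝ G] [CompleteSpace G]

/-- Joint strong measurability of a function of time and space. -/
def JM (f : ℝ → ℝ → E) : Prop := StronglyMeasurable (Function.uncurry f)

theorem JM.slice {f : ℝ → ℝ → E} (h : JM f) (t : ℝ) : StronglyMeasurable (f t) :=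
  h.comp_measurable measurable_prodMk_left

theorem JM.slice' {f : ℝ → ℝ → E} (h : JM f) (x : ℝ) : StronglyMeasurable (fun t => f t x) :=
  StronglyMeasurable.comp_measurable h (measurable_prodMk_right (y := x))

theorem JM.const {f : ℝ → E} (h : StronglyMeasurable f) : JM (fun _ x => f x) :=
  h.comp_measurable measurable_snd

theorem JM.add {f g : ℝ → ℝ → E} (hf : JM f) (hg : JM g) : JM (fun t x => f t x + g t x) :=
  StronglyMeasurable.add hf hg

theorem JM.sub {f g : ℝ → ℝ → E} (hf : JM f) (hg : JM g) : JM (fun t x => f t x - g t x) :=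
  StronglyMeasurable.sub hf hg

theorem JM.bilin {f : ℝ → ℝ → E} {g : ℝ → ℝ → F} (B : E →L[ℝ] F →L[ℝ] G) (hf : JM f)
    (hg : JM g) : JM (fun t x => B (f t x) (g t x)) :=
  B.continuous₂.comp_stronglyMeasurable (StronglyMeasurable.prodMk hf hg)

theorem JM.smul {f : ℝ → ℝ → ℝ} {g : ℝ → ℝ → E} (hf : JM f) (hg : JM g) :
    JM (fun t x => f t x • g t x) := StronglyMeasurable.smul hf hg

theorem JM.mul {f g : ℝ → ℝ → ℝ} (hf : JM f) (hg : JM g) :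
    JM (fun t x => f t x * g t x) := StronglyMeasurable.mul hf hg

theorem JM.const_smul {f : ℝ → ℝ → E} (c : ℝ) (hf : JM f) : JM (fun t x => c • f t x) :=
  StronglyMeasurable.const_smul hf c

protected theorem JM.inner {H : Type*} [NormedAddCommGroup H] [InnerProductSpace ℝ H] [CompleteSpace H]
    {f g : ℝ → ℝ → H} (hf : JM f) (hg : JM g) :
    JM (fun t x => inner ℝ (f t x) (g t x)) := hf.bilin (innerSL ℝ) hg

protected theorem JM.wedge {f g : ℝ → ℝ → E3} (hf : JM f) (hg : JM g) :
    JM (fun t x => wedge (f t x) (g t x)) := hf.bilin wedgeL hg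

theorem JM.shift {f : ℝ → ℝ → E} (hf : JM f) (h k : ℝ) : JM (fun t x => f (t + h) (x + k)) :=
  hf.comp_measurable ((measurable_fst.add_const h).prodMk (measurable_snd.add_const k))

theorem JM.time_shift {f : ℝ → ℝ → E} (hf : JM f) (h : ℝ) : JM (fun t x => f (t + h) x) :=
  hf.comp_measurable ((measurable_fst.add_const h).prodMk measurable_snd)

theorem JM.primitive {f : ℝ → ℝ → E} (hf : JM f) (a : ℝ) : JM (fun t x => ∫ s in a..t, f s x) :=
  stronglyMeasurable_primitive hf a

/-- `f` is a primitive in time of `f'` on `]0,T[` with initial value `f₀`. -/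
def TP (T : ℝ) (f : ℝ → ℝ → E) (f₀ : ℝ → E) (f' : ℝ → ℝ → E) : Prop :=
  ∀ᵐ x : ℝ, IntegrableOn (fun s => f' s x) (Ioo 0 T) ∧
    ∀ᵐ t ∂(volume.restrict (Ioo 0 T)), f t x = f₀ x + ∫ s in (0:ℝ)..t, f' s x

theorem intervalIntegrable_of_Ioo {f : ℝ → E} {T a b : ℝ} (hf : IntegrableOn f (Ioo 0 T))
    (ha : a ∈ Icc 0 T) (hb : b ∈ Icc 0 T) : IntervalIntegrable f volume a b := by
  rw [intervalIntegrable_iff]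
  rw [← integrableOn_Icc_iff_integrableOn_Ioo] at hf
  exact hf.mono_set (uIoc_subset_uIcc.trans (uIcc_subset_Icc ha hb))

theorem TP.bilin {T : ℝ} (B : E →L[ℝ] F →L[ℝ] G) {f f' : ℝ → ℝ → E} {f₀ : ℝ → E}
    {g g' : ℝ → ℝ → F} {g₀ : ℝ → F} (hT : 0 < T) (hf : TP T f f₀ f') (hg : TP T g g₀ g') :
    TP T (fun t x => B (f t x) (g t x)) (fun x => B (f₀ x) (g₀ x))
      (fun t x => B (f' t x) (g t x) + B (f t x) (g' t x)) := by
  filter_upwards [hf, hg] with x hx1 hx2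
  obtain ⟨i1, e1⟩ := hx1
  obtain ⟨i2, e2⟩ := hx2
  have key := fun t (ht : t ∈ Icc 0 T) => intervalIntegral_bilin B (f₀ x) (g₀ x)
    (intervalIntegrable_of_Ioo i1 (left_mem_Icc.2 hT.le) ht)
    (intervalIntegrable_of_Ioo i2 (left_mem_Icc.2 hT.le) ht)
  have hcong : (fun s => B (f' s x) (g₀ x + ∫ r in (0:ℝ)..s, g' r x)
        + B (f₀ x + ∫ r in (0:ℝ)..s, f' r x) (g' s x)) =ᵐ[volume.restrict (Ioo 0 T)]
      fun t => B (f' t x) (g t x) + B (f t x) (g' t x) := by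
    filter_upwards [e1, e2] with t h1 h2
    rw [h1, h2]
  constructor
  · have := (key T (right_mem_Icc.2 hT.le)).1
    rw [intervalIntegrable_iff_integrableOn_Ioo_of_le hT.le] at this
    exact this.congr hcong
  · filter_upwards [e1, e2, ae_restrict_mem measurableSet_Ioo] with t h1 h2 ht
    rw [h1, h2, (key t (Ioo_subset_Icc_self ht)).2]
    congr 1
    apply intervalIntegral.integral_congr_ae
    rw [EventuallyEq, ae_restrict_iff' measurableSet_Ioo] at hcong
    filter_upwards [hcong] with s hs hs'
    rw [uIoc_of_le ht.1.le] at hs'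
    exact hs ⟨hs'.1, hs'.2.trans_lt ht.2⟩

theorem TP.clm {T : ℝ} (A : E →L[ℝ] F) {f f' : ℝ → ℝ → E} {f₀ : ℝ → E}
    (hf : TP T f f₀ f') :
    TP T (fun t x => A (f t x)) (fun x => A (f₀ x)) (fun t x => A (f' t x)) := by
  filter_upwards [hf] with x hx
  refine ⟨A.integrable_comp hx.1, ?_⟩
  filter_upwards [hx.2, ae_restrict_mem measurableSet_Ioo] with t ht ht'
  rw [ht, map_add, A.intervalIntegral_comp_comm
    (intervalIntegrable_of_Ioo hx.1 (by simp; linarith [ht'.1, ht'.2]) (Ioo_subset_Icc_self ht'))]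

theorem TP.add {T : ℝ} {f f' g g' : ℝ → ℝ → E} {f₀ g₀ : ℝ → E}
    (hf : TP T f f₀ f') (hg : TP T g g₀ g') :
    TP T (fun t x => f t x + g t x) (fun x => f₀ x + g₀ x) (fun t x => f' t x + g' t x) := by
  filter_upwards [hf, hg] with x hx hy
  refine ⟨hx.1.add hy.1, ?_⟩
  filter_upwards [hx.2, hy.2, ae_restrict_mem measurableSet_Ioo] with t h1 h2 ht'
  have h0 : (0:ℝ) ∈ Icc 0 T := by simp; linarith [ht'.1, ht'.2]
  rw [h1, h2, intervalIntegral.integral_add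
    (intervalIntegrable_of_Ioo hx.1 h0 (Ioo_subset_Icc_self ht'))
    (intervalIntegrable_of_Ioo hy.1 h0 (Ioo_subset_Icc_self ht'))]
  abel

theorem TP.sub {T : ℝ} {f f' g g' : ℝ → ℝ → E} {f₀ g₀ : ℝ → E}
    (hf : TP T f f₀ f') (hg : TP T g g₀ g') :
    TP T (fun t x => f t x - g t x) (fun x => f₀ x - g₀ x) (fun t x => f' t x - g' t x) := by
  have := hf.add (hg.clm (- ContinuousLinearMap.id ℝ E))
  simpa [sub_eq_add_neg] using this

theorem TP.const (T : ℝ) (f₀ : ℝ → E) : TP T (fun _ x => f₀ x) f₀ (fun _ _ => 0) := by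
  refine Eventually.of_forall fun x => ⟨by simp, by simp⟩

theorem TP.congr {T : ℝ} {f f' g g' : ℝ → ℝ → E} {f₀ g₀ : ℝ → E} (h : TP T f f₀ f')
    (h1 : ∀ t x, f t x = g t x) (h2 : ∀ x, f₀ x = g₀ x) (h3 : ∀ t x, f' t x = g' t x) :
    TP T g g₀ g' := by
  obtain rfl : f = g := funext fun t => funext (h1 t)
  obtain rfl : f₀ = g₀ := funext h2
  obtain rfl : f' = g' := funext fun t => funext (h3 t)
  exact h

theorem TP.smul {T : ℝ} {f f' : ℝ → ℝ → ℝ} {f₀ : ℝ → ℝ}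
    {g g' : ℝ → ℝ → E} {g₀ : ℝ → E} (hT : 0 < T) (hf : TP T f f₀ f') (hg : TP T g g₀ g') :
    TP T (fun t x => f t x • g t x) (fun x => f₀ x • g₀ x)
      (fun t x => f' t x • g t x + f t x • g' t x) :=
  TP.bilin (ContinuousLinearMap.lsmul ℝ ℝ) hT hf hg

theorem TP.mul {T : ℝ} {f f' g g' : ℝ → ℝ → ℝ} {f₀ g₀ : ℝ → ℝ} (hT : 0 < T)
    (hf : TP T f f₀ f') (hg : TP T g g₀ g') :
    TP T (fun t x => f t x * g t x) (fun x => f₀ x * g₀ x)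
      (fun t x => f' t x * g t x + f t x * g' t x) := hf.smul hT hg

protected theorem TP.inner {H : Type*} [NormedAddCommGroup H] [InnerProductSpace ℝ H] [CompleteSpace H]
    {T : ℝ} {f f' g g' : ℝ → ℝ → H} {f₀ g₀ : ℝ → H} (hT : 0 < T)
    (hf : TP T f f₀ f') (hg : TP T g g₀ g') :
    TP T (fun t x => inner ℝ (f t x) (g t x)) (fun x => inner ℝ (f₀ x) (g₀ x))
      (fun t x => inner ℝ (f' t x) (g t x) + inner ℝ (f t x) (g' t x)) :=
  (TP.bilin (innerSL ℝ) hT hf hg).congr (fun _ _ => rfl) (fun _ => rfl) (fun _ _ => rfl)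

/-- `TP` speaks of almost every line in time; the energies need almost every time slice. Joint
measurability of the equality set allows the two quantifiers to be exchanged. -/
theorem TP.ae_ae {T : ℝ} {f f' : ℝ → ℝ → E} {f₀ : ℝ → E} (h : TP T f f₀ f') (hf : JM f)
    (hf' : JM f') (hf₀ : StronglyMeasurable f₀) :
    ∀ᵐ t ∂(volume.restrict (Ioo 0 T)), ∀ᵐ x : ℝ, f t x = f₀ x + ∫ s in (0:ℝ)..t, f' s x := by
  have hm : MeasurableSet {p : ℝ × ℝ | f p.1 p.2 = f₀ p.2 + ∫ s in (0:ℝ)..p.1, f' s p.2} :=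
    StronglyMeasurable.measurableSet_eq_fun hf ((JM.const hf₀).add (hf'.primitive 0))
  rw [Measure.ae_ae_comm hm]
  filter_upwards [h] with x hx using hx.2

theorem integrable_slab {T : ℝ} {f : ℝ → ℝ → E} (hf : JM f) {C : ℝ}
    (h : ∀ᵐ t ∂(volume.restrict (Ioo 0 T)), Integrable (f t) ∧ ∫ x, ‖f t x‖ ≤ C) :
    Integrable (Function.uncurry f) (slab T) := by
  rw [slab, integrable_prod_iff hf.aestronglyMeasurable]
  refine ⟨h.mono fun t ht => ht.1, ?_⟩
  refine Integrable.mono' (integrable_const C) ?_ ?_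
  · exact (StronglyMeasurable.norm hf).integral_prod_right.aestronglyMeasurable
  · filter_upwards [h] with t ht
    rw [Real.norm_of_nonneg (integral_nonneg fun x => norm_nonneg _)]
    exact ht.2

theorem TP.integral {T : ℝ} {f f' : ℝ → ℝ → E} {f₀ : ℝ → E} (h : TP T f f₀ f')
    (hf : JM f) (hf' : JM f') (hf₀ : StronglyMeasurable f₀) (hi₀ : Integrable f₀)
    (hi : Integrable (Function.uncurry f') (slab T)) :
    IntegrableOn (fun t => ∫ x, f' t x) (Ioo 0 T) ∧
    ∀ᵐ t ∂(volume.restrict (Ioo 0 T)),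
      ∫ x, f t x = (∫ x, f₀ x) + ∫ s in (0:ℝ)..t, ∫ x, f' s x := by
  refine ⟨hi.integral_prod_left, ?_⟩
  filter_upwards [h.ae_ae hf hf' hf₀, ae_restrict_mem measurableSet_Ioo] with t ht htT
  rw [integral_congr_ae ht]
  have hi' : Integrable (Function.uncurry f') ((volume.restrict (Ioc 0 t)).prod volume) := by
    have hsub : Ioc 0 t ⊆ Ioo 0 T := fun s hs => ⟨hs.1, hs.2.trans_lt htT.2⟩
    exact hi.mono_measure (Measure.prod_mono (Measure.restrict_mono hsub le_rfl) le_rfl)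
  have e : ∀ x, ∫ s in (0:ℝ)..t, f' s x = ∫ s in Ioc 0 t, f' s x := fun x =>
    intervalIntegral.integral_of_le htT.1.le
  simp only [e]
  rw [integral_add hi₀ (by exact hi'.integral_prod_right),
    intervalIntegral.integral_of_le htT.1.le]
  congr 1
  exact integral_integral_swap hi'.swap

theorem eLpNorm_two_sq {X : Type*} [MeasurableSpace X] (f : X → E) (μ : Measure X) :
    eLpNorm f 2 μ ^ 2 = ∫⁻ x, ‖f x‖ₑ ^ 2 ∂μ := by
  rw [eLpNorm_eq_lintegral_rpow_enorm_toReal (by norm_num) (by norm_num), ENNReal.toReal_ofNat,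
    ← ENNReal.rpow_natCast, ← ENNReal.rpow_mul]
  norm_num

/-- Cauchy-Schwarz in s followed by Tonelli. For a bound uniform in s this loses nothing against
Minkowski's inequality: one root of b − a comes from each of the two steps. -/
theorem memLp_integral {f : ℝ → ℝ → E} (hf : JM f) {a b M : ℝ} (hab : a ≤ b) (hM : 0 ≤ M)
    (h : ∀ᵐ s ∂(volume.restrict (Ioo a b)), MemLp (f s) 2 ∧ l2 (f s) ≤ M) :
    (∀ᵐ x : ℝ, IntegrableOn (fun s => f s x) (Ioo a b)) ∧
    MemLp (fun x => ∫ s in a..b, f s x) 2 ∧ l2 (fun x => ∫ s in a..b, f s x) ≤ (b - a) * M := by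
  have h1 : ∀ x, (∫⁻ s in Ioo a b, ‖f s x‖ₑ) ^ 2 ≤
      ENNReal.ofReal (b - a) * ∫⁻ s in Ioo a b, ‖f s x‖ₑ ^ 2 := by
    intro x
    have := eLpNorm_le_eLpNorm_mul_rpow_measure_univ (μ := volume.restrict (Ioo a b))
      (p := 1) (q := 2) (by norm_num) (hf.slice' x).aestronglyMeasurable
    rw [eLpNorm_one_eq_lintegral_enorm] at this
    refine (pow_le_pow_left' this 2).trans (le_of_eq ?_)
    rw [mul_pow, eLpNorm_two_sq, mul_comm]
    congr 1
    rw [← ENNReal.rpow_natCast, ← ENNReal.rpow_mul]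
    norm_num
  have hmeas : Measurable (Function.uncurry fun s x => ‖f s x‖ₑ ^ 2) :=
    (StronglyMeasurable.enorm hf).pow_const 2
  have h2 : ∫⁻ x, (∫⁻ s in Ioo a b, ‖f s x‖ₑ) ^ 2 ≤ ENNReal.ofReal ((b - a) * M) ^ 2 := by
    refine (lintegral_mono h1).trans ?_
    rw [lintegral_const_mul _ (by
      have : Measurable (Function.uncurry fun x s => ‖f s x‖ₑ ^ 2) := hmeas.comp measurable_swap
      exact this.lintegral_prod_right')]
    rw [lintegral_lintegral_swap (f := fun x s => ‖f s x‖ₑ ^ 2)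
      (by exact (hmeas.comp measurable_swap).aemeasurable)]
    have : ∫⁻ s in Ioo a b, ∫⁻ x, ‖f s x‖ₑ ^ 2 ≤ ∫⁻ s in Ioo a b, ENNReal.ofReal M ^ 2 := by
      refine lintegral_mono_ae (h.mono fun s hs => ?_)
      rw [← eLpNorm_two_sq]
      refine pow_le_pow_left' ?_ 2
      exact (ENNReal.le_ofReal_iff_toReal_le hs.1.2.ne hM).2 hs.2
    refine (mul_le_mul_right this _).trans (le_of_eq ?_)
    rw [lintegral_const, Measure.restrict_apply_univ, Real.volume_Ioo,
      ENNReal.ofReal_mul (by linarith)]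
    ring
  have hm1 : Measurable fun x => ∫⁻ s in Ioo a b, ‖f s x‖ₑ := by
    have : Measurable (Function.uncurry fun x s => ‖f s x‖ₑ) :=
      (StronglyMeasurable.enorm hf).comp measurable_swap
    exact this.lintegral_prod_right'
  have hii : ∀ᵐ x : ℝ, IntegrableOn (fun s => f s x) (Ioo a b) := by
    have := ae_lt_top (hm1.pow_const 2) (h2.trans_lt (by simp)).ne
    filter_upwards [this] with x hx
    refine ⟨(hf.slice' x).aestronglyMeasurable, ?_⟩
    by_contra hne
    rw [HasFiniteIntegral, not_lt, top_le_iff] at hne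
    simp [hne] at hx
  have hb : eLpNorm (fun x => ∫ s in a..b, f s x) 2 volume ≤ ENNReal.ofReal ((b - a) * M) := by
    rw [← ENNReal.pow_le_pow_left_iff two_ne_zero, eLpNorm_two_sq]
    refine (lintegral_mono fun x => ?_).trans h2
    refine pow_le_pow_left' ?_ 2
    rw [intervalIntegral.integral_of_le hab, integral_Ioc_eq_integral_Ioo]
    exact enorm_integral_le_lintegral_enorm _
  have hsm : StronglyMeasurable fun x => ∫ s in a..b, f s x := (hf.primitive a).slice b
  refine ⟨hii, ⟨hsm.aestronglyMeasurable, hb.trans_lt (by simp)⟩, ?_⟩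
  exact ENNReal.toReal_le_of_le_ofReal (mul_nonneg (by linarith) hM) hb

/-- Y is only integrable and the inequality holds only almost everywhere. Its right-hand side is
nevertheless a primitive, so it can be multiplied by exp(−C s) and integrated by parts with
`intervalIntegral_bilin`; the inequality for Y is inserted under the integral. -/
theorem gronwall_ae {T A C : ℝ} {Y b : ℝ → ℝ} (hT : 0 < T) (hC : 0 ≤ C)
    (hY : IntegrableOn Y (Ioo 0 T)) (hb : IntegrableOn b (Ioo 0 T))
    (hb0 : ∀ᵐ t ∂(volume.restrict (Ioo 0 T)), 0 ≤ b t)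
    (h : ∀ᵐ t ∂(volume.restrict (Ioo 0 T)), Y t ≤ A + ∫ s in (0:ℝ)..t, (C * Y s + b s)) :
    ∀ᵐ t ∂(volume.restrict (Ioo 0 T)), Y t ≤ Real.exp (C * t) * (A + ∫ s in (0:ℝ)..t, b s) := by
  have hk : IntegrableOn (fun s => C * Y s + b s) (Ioo 0 T) := (hY.const_mul C).add hb
  have hexp : ∀ s : ℝ, 1 + ∫ r in (0:ℝ)..s, (-C * Real.exp (-C * r)) = Real.exp (-C * s) := by
    intro s
    have hd : ∀ r ∈ uIcc 0 s, HasDerivAt (fun r => Real.exp (-C * r)) (-C * Real.exp (-C * r)) r :=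
      fun r _ => by
        have := ((hasDerivAt_id r).const_mul (-C)).exp
        simpa [mul_comm] using this
    rw [intervalIntegral.integral_eq_sub_of_hasDerivAt hd (by
      apply Continuous.intervalIntegrable; fun_prop)]
    simp
  filter_upwards [h, ae_restrict_mem measurableSet_Ioo] with t ht htT
  have h0 : (0:ℝ) ∈ Icc 0 T := left_mem_Icc.2 hT.le
  have ii := intervalIntegrable_of_Ioo hk h0 (Ioo_subset_Icc_self htT)
  have ib := intervalIntegrable_of_Ioo hb h0 (Ioo_subset_Icc_self htT)
  have key := intervalIntegral_bilin (ContinuousLinearMap.mul ℝ ℝ) (1:ℝ) A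
    (f' := fun r => -C * Real.exp (-C * r)) (c := 0) (d := t)
    (by apply Continuous.intervalIntegrable; fun_prop) ii
  simp only [hexp, ContinuousLinearMap.mul_apply', one_mul] at key
  obtain ⟨k1, k2⟩ := key
  have hle : ∫ s in (0:ℝ)..t, (-C * Real.exp (-C * s) * (A + ∫ r in (0:ℝ)..s, (C * Y r + b r))
      + Real.exp (-C * s) * (C * Y s + b s)) ≤ ∫ s in (0:ℝ)..t, b s := by
    refine intervalIntegral.integral_mono_ae_restrict htT.1.le k1 ib ?_
    rw [← Measure.restrict_congr_set Ioo_ae_eq_Icc]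
    have hsub : Ioo 0 t ⊆ Ioo 0 T := Ioo_subset_Ioo_right htT.2.le
    filter_upwards [ae_restrict_of_ae_restrict_of_subset hsub h,
      ae_restrict_of_ae_restrict_of_subset hsub hb0, ae_restrict_mem measurableSet_Ioo]
      with s hs hbs hs0
    have e0 : 0 < Real.exp (-C * s) := Real.exp_pos _
    have e1 : Real.exp (-C * s) ≤ 1 := Real.exp_le_one_iff.2 (by nlinarith [hs0.1])
    have : -C * Real.exp (-C * s) * (A + ∫ r in (0:ℝ)..s, (C * Y r + b r))
      + Real.exp (-C * s) * (C * Y s + b s) = Real.exp (-C * s) * b s - Real.exp (-C * s) * (C *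
        ((A + ∫ r in (0:ℝ)..s, (C * Y r + b r)) - Y s)) := by ring
    rw [this]
    have p1 : 0 ≤ Real.exp (-C * s) * (C * ((A + ∫ r in (0:ℝ)..s, (C * Y r + b r)) - Y s)) :=
      mul_nonneg e0.le (mul_nonneg hC (by linarith))
    have p2 : Real.exp (-C * s) * b s ≤ b s := mul_le_of_le_one_left hbs e1
    linarith
  have hfin : Real.exp (-C * t) * (A + ∫ s in (0:ℝ)..t, (C * Y s + b s)) ≤
      A + ∫ s in (0:ℝ)..t, b s := by rw [k2]; linarith
  have e2 : Real.exp (C * t) * Real.exp (-C * t) = 1 := by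
    rw [← Real.exp_add]; simp
  calc Y t ≤ 1 * (A + ∫ s in (0:ℝ)..t, (C * Y s + b s)) := by rw [one_mul]; exact ht
    _ = Real.exp (C * t) * (Real.exp (-C * t) * (A + ∫ s in (0:ℝ)..t, (C * Y s + b s))) := by
        rw [← e2]; ring
    _ ≤ _ := by gcongr

end SchrodingerMap

namespace SchrodingerMap

/-! ### Difference quotients in space -/

variable {E F G : Type*} [NormedAddCommGroup E] [NormedSpace ℝ E] [CompleteSpace E]
  [NormedAddCommGroup F] [NormedSpace ℝ F] [CompleteSpace F]
  [NormedAddCommGroup G] [NormedSpace ℝ G] [CompleteSpace G]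

theorem memLp_translate {f : ℝ → E} (hf : MemLp f 2) (r : ℝ) :
    MemLp (fun x => f (x + r)) 2 ∧ l2 (fun x => f (x + r)) = l2 f := by
  have hmp : MeasurePreserving (fun x : ℝ => x + r) volume volume := measurePreserving_add_right _ r
  refine ⟨hf.comp_measurePreserving hmp, ?_⟩
  rw [l2, l2, ← eLpNorm_comp_measurePreserving hf.1 hmp]
  rfl

theorem tendsto_l2_translate {f : ℝ → E} (hf : MemLp f 2) :
    Tendsto (fun r : ℝ => l2 (fun x => f (x + r) - f x)) (𝓝 0) (𝓝 0) := by
  have : Fact ((2 : ℝ≥0∞) ≠ ⊤) := ⟨by norm_num⟩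
  have hc : Continuous fun r : ℝ => (DomAddAct.mk r) +ᵥ (hf.toLp f) :=
    DomAddAct.continuous_mk.vadd continuous_const
  have h0 := ((hc.tendsto 0).sub_const (hf.toLp f)).norm
  have e0 : DomAddAct.mk (0:ℝ) +ᵥ hf.toLp f = hf.toLp f := by
    rw [DomAddAct.mk_zero, zero_vadd]
  rw [e0, sub_self, norm_zero] at h0
  refine h0.congr fun r => ?_
  have hr := (memLp_translate hf r).1
  have e1 : DomAddAct.mk r +ᵥ hf.toLp f = hr.toLp _ := by
    refine (DomAddAct.mk_vadd_toLp r hf).trans (MemLp.toLp_congr _ _ ?_)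
    exact Eventually.of_forall fun x => by simp [add_comm]
  rw [e1, ← MemLp.toLp_sub, Lp.norm_toLp]
  rfl

/-- Difference quotient in space. -/
noncomputable def dq (δ : ℝ) (f : ℝ → E) (x : ℝ) : E := δ⁻¹ • (f (x + δ) - f x)

theorem WD.translate {f f' : ℝ → E} (h : WD f f') (r : ℝ) :
    WD (fun x => f (x + r)) (fun x => f' (x + r)) := by
  have hmp : MeasurePreserving (fun x : ℝ => x + r) volume volume := measurePreserving_add_right _ r
  refine ⟨?_, ?_⟩
  · rw [locallyIntegrable_iff]
    intro K hK
    have hemb : MeasurableEmbedding (fun x : ℝ => x + r) := measurableEmbedding_addRight r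
    have := (hmp.integrableOn_image hemb (f := f') (s := K)).1
      (h.loc.integrableOn_isCompact (hK.image (by fun_prop)))
    exact this
  · obtain ⟨c, hc⟩ := h.eq
    refine ⟨c + ∫ t in (0:ℝ)..r, f' t, ?_⟩
    filter_upwards [hmp.quasiMeasurePreserving.ae hc] with x hx
    rw [hx, intervalIntegral.integral_comp_add_right, zero_add, add_assoc,
      intervalIntegral.integral_add_adjacent_intervals (h.loc.intervalIntegrable' _ _)
      (h.loc.intervalIntegrable' _ _)]

protected theorem WD.dq {f f' : ℝ → E} (h : WD f f') (δ : ℝ) : WD (dq δ f) (dq δ f') :=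
  ((h.translate δ).sub h).const_smul δ⁻¹

theorem WD.dq_ae_eq {f f' : ℝ → E} (h : WD f f') {δ : ℝ} :
    ∀ᵐ x, SchrodingerMap.dq δ f x = δ⁻¹ • ∫ s in (0:ℝ)..δ, f' (x + s) := by
  have hmp : MeasurePreserving (fun x : ℝ => x + δ) volume volume := measurePreserving_add_right _ δ
  obtain ⟨c, hc⟩ := h.eq
  filter_upwards [hc, hmp.quasiMeasurePreserving.ae hc] with x h1 h2
  rw [SchrodingerMap.dq, h1, h2, intervalIntegral.integral_comp_add_left, add_zero,
    add_sub_add_left_eq_sub, intervalIntegral.integral_interval_sub_left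
    (h.loc.intervalIntegrable' _ _) (h.loc.intervalIntegrable' _ _)]

theorem memLp_dq {f : ℝ → E} (hf : MemLp f 2) (δ : ℝ) : MemLp (dq δ f) 2 :=
  ((memLp_translate hf δ).1.sub hf).const_smul δ⁻¹

theorem JM.spaceTranslate {f : ℝ → E} (hf : StronglyMeasurable f) : JM (fun s x => f (x + s)) :=
  hf.comp_measurable (measurable_snd.add measurable_fst)

theorem WD.l2_dq_le {f f' : ℝ → E} (h : WD f f') (hm : StronglyMeasurable f') (hf' : MemLp f' 2)
    {δ : ℝ} (hδ : 0 < δ) : MemLp (SchrodingerMap.dq δ f) 2 ∧ l2 (SchrodingerMap.dq δ f) ≤ l2 f' := by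
  obtain ⟨-, m, hl⟩ := memLp_integral (JM.spaceTranslate hm) hδ.le (l2_nonneg f')
    (Eventually.of_forall fun s => ⟨(memLp_translate hf' s).1, (memLp_translate hf' s).2.le⟩)
  refine ⟨(memLp_congr_ae h.dq_ae_eq).2 (m.const_smul δ⁻¹), ?_⟩
  rw [l2_congr h.dq_ae_eq, l2_const_smul, abs_of_pos (by positivity)]
  rw [sub_zero] at hl
  calc _ ≤ δ⁻¹ * (δ * l2 f') := by gcongr
    _ = l2 f' := by field_simp

theorem WD.l2_dq_sub_le {f f' : ℝ → E} (h : WD f f') (hm : StronglyMeasurable f')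
    (hf' : MemLp f' 2) {δ ε : ℝ} (hδ : 0 < δ) (hε : 0 ≤ ε)
    (hmod : ∀ r ∈ Ioo 0 δ, l2 (fun x => f' (x + r) - f' x) ≤ ε) :
    l2 (fun x => SchrodingerMap.dq δ f x - f' x) ≤ ε := by
  have jm : JM (fun s x => f' (x + s) - f' x) := (JM.spaceTranslate hm).sub (JM.const hm)
  obtain ⟨hi, m, hl⟩ := memLp_integral jm hδ.le hε
    ((ae_restrict_iff' measurableSet_Ioo).2 (Eventually.of_forall fun s hs =>
      ⟨(memLp_translate hf' s).1.sub hf', hmod s hs⟩))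
  have e : (fun x => SchrodingerMap.dq δ f x - f' x) =ᵐ[volume]
      fun x => δ⁻¹ • ∫ s in (0:ℝ)..δ, (f' (x + s) - f' x) := by
    filter_upwards [h.dq_ae_eq (δ := δ), hi] with x hx hix
    rw [hx]
    have i1 : IntervalIntegrable (fun s => f' (x + s)) volume 0 δ := by
      rw [intervalIntegrable_iff_integrableOn_Ioo_of_le hδ.le]
      refine Integrable.congr (hix.add (integrableOn_const (C := f' x) (by simp)))
        (Eventually.of_forall fun s => by simp)
    rw [intervalIntegral.integral_sub i1 (by simp), intervalIntegral.integral_const, smul_sub,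
      smul_smul, sub_zero, inv_mul_cancel₀ hδ.ne', one_smul]
  rw [l2_congr e, l2_const_smul, abs_of_pos (by positivity)]
  rw [sub_zero] at hl
  calc _ ≤ δ⁻¹ * (δ * ε) := by gcongr
    _ = ε := by field_simp

theorem WD.tendsto_dq {f f' : ℝ → E} (h : WD f f') (hm : StronglyMeasurable f')
    (hf' : MemLp f' 2) :
    Tendsto (fun δ => l2 (fun x => SchrodingerMap.dq δ f x - f' x)) (𝓝[>] 0) (𝓝 0) := by
  rw [Metric.tendsto_nhdsWithin_nhds]
  intro ε hε
  obtain ⟨d, hd, hd'⟩ := Metric.tendsto_nhds_nhds.1 (tendsto_l2_translate hf') (ε / 2) (half_pos hε)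
  refine ⟨d, hd, fun {δ} hδ hδd => ?_⟩
  rw [mem_Ioi] at hδ
  rw [Real.dist_0_eq_abs, abs_of_pos hδ] at hδd
  rw [Real.dist_0_eq_abs, abs_of_nonneg (l2_nonneg _)]
  refine (h.l2_dq_sub_le hm hf' hδ (half_pos hε).le fun r hr => ?_).trans_lt (half_lt_self hε)
  have := hd' (x := r) (by rw [Real.dist_0_eq_abs, abs_of_pos hr.1]; exact hr.2.trans hδd)
  rw [Real.dist_0_eq_abs, abs_of_nonneg (l2_nonneg _)] at this
  exact this.le

/-- Compare the double quotient of f with the quotient of f', and that with f''. Each error is an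
average over increments below δ of a translation modulus, and both moduli are controlled by that of
f''. -/
theorem WD.tendsto_dq_dq {f f' f'' : ℝ → E} (h : WD f f') (h' : WD f' f'')
    (hm : StronglyMeasurable f') (hm' : StronglyMeasurable f'')
    (hf' : MemLp f' 2) (hf'' : MemLp f'' 2) :
    Tendsto (fun δ => l2 (fun x => SchrodingerMap.dq δ (SchrodingerMap.dq δ f) x - f'' x))
      (𝓝[>] 0) (𝓝 0) := by
  rw [Metric.tendsto_nhdsWithin_nhds]
  intro ε hε
  obtain ⟨d, hd, hd'⟩ := Metric.tendsto_nhds_nhds.1 (tendsto_l2_translate hf'') (ε / 3)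
    (by positivity)
  refine ⟨d, hd, fun {δ} hδ hδd => ?_⟩
  rw [mem_Ioi] at hδ
  rw [Real.dist_0_eq_abs, abs_of_pos hδ] at hδd
  rw [Real.dist_0_eq_abs, abs_of_nonneg (l2_nonneg _)]
  have hmod : ∀ r ∈ Ioo 0 δ, l2 (fun x => f'' (x + r) - f'' x) ≤ ε / 3 := fun r hr => by
    have := hd' (x := r) (by rw [Real.dist_0_eq_abs, abs_of_pos hr.1]; exact hr.2.trans hδd)
    rw [Real.dist_0_eq_abs, abs_of_nonneg (l2_nonneg _)] at this
    exact this.le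
  have b1 := h'.l2_dq_sub_le hm' hf'' hδ (by positivity) hmod
  have smdq : ∀ {φ : ℝ → E}, StronglyMeasurable φ → StronglyMeasurable (SchrodingerMap.dq δ φ) :=
    fun hφ => ((hφ.comp_measurable (measurable_id.add_const δ)).sub hφ).const_smul δ⁻¹
  have b2 := (h.dq δ).l2_dq_sub_le (smdq hm) (memLp_dq hf' δ) hδ (ε := ε / 3) (by positivity)
    (fun r hr => by
      -- Translations commute with difference quotients, so the translation modulus of the quotient
      -- of f' is at most that of f''.
      have e : (fun x => SchrodingerMap.dq δ f' (x + r) - SchrodingerMap.dq δ f' x)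
          = SchrodingerMap.dq δ (fun x => f' (x + r) - f' x) := by
        ext x
        simp only [SchrodingerMap.dq, ← smul_sub]
        rw [add_right_comm]; congr 1; abel
      rw [e]
      have sm : StronglyMeasurable (fun x => f'' (x + r) - f'' x) :=
        (hm'.comp_measurable (measurable_id.add_const r)).sub hm'
      exact (((h'.translate r).sub h').l2_dq_le sm
        ((memLp_translate hf'' r).1.sub hf'') hδ).2.trans (hmod r hr))
  have m1 := memLp_dq hf' δ
  have m2 := (h.dq δ).l2_dq_le (smdq hm) m1 hδ
  have := l2_add_le (m2.1.sub m1) (m1.sub hf'')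
  simp only [Pi.sub_apply, sub_add_sub_cancel] at this
  refine this.trans_lt ?_
  have : l2 (SchrodingerMap.dq δ (SchrodingerMap.dq δ f) - SchrodingerMap.dq δ f') ≤ ε / 3 := b2
  have : l2 (SchrodingerMap.dq δ f' - f'') ≤ ε / 3 := b1
  linarith

theorem TP.translate {T : ℝ} {f f' : ℝ → ℝ → E} {f₀ : ℝ → E} (h : TP T f f₀ f') (r : ℝ) :
    TP T (fun t x => f t (x + r)) (fun x => f₀ (x + r)) (fun t x => f' t (x + r)) :=
  (measurePreserving_add_right volume r).quasiMeasurePreserving.ae h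

protected theorem TP.dq {T : ℝ} {f f' : ℝ → ℝ → E} {f₀ : ℝ → E} (h : TP T f f₀ f') (δ : ℝ) :
    TP T (fun t x => dq δ (f t) x) (dq δ f₀) (fun t x => dq δ (f' t) x) :=
  ((h.translate δ).sub h).clm (δ⁻¹ • ContinuousLinearMap.id ℝ E)

protected theorem JM.dq {f : ℝ → ℝ → E} (h : JM f) (δ : ℝ) : JM (fun t x => dq δ (f t) x) := by
  have h1 : JM (fun t x => f t (x + δ)) := by
    have := h.shift 0 δ
    simpa using this
  exact (h1.sub h).const_smul δ⁻¹

/-- Discrete integration by parts: the integrand is the difference quotient of the scalar product,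
whose integral vanishes by translation invariance. -/
theorem integral_inner_dq {a b : ℝ → E3} (ha : MemLp a 2) (hb : MemLp b 2) (δ : ℝ) :
    ∫ x, inner ℝ (dq δ a x) (b x) + inner ℝ (a (x + δ)) (dq δ b x) = 0 := by
  have key : ∀ {p q : ℝ → E3}, MemLp p 2 → MemLp q 2 → Integrable fun x => inner ℝ (p x) (q x) :=
    fun {p q} hp hq => integrable_of_le_mul (c := 1) (hp.1.inner hq.1) hp hq
      (Eventually.of_forall fun x => by rw [one_mul]; exact abs_real_inner_le_norm _ _)
  have e : ∀ x, inner ℝ (dq δ a x) (b x) + inner ℝ (a (x + δ)) (dq δ b x) =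
      δ⁻¹ * (inner ℝ (a (x + δ)) (b (x + δ)) - inner ℝ (a x) (b x)) := fun x => by
    simp only [dq, inner_smul_left, inner_smul_right, inner_sub_left, inner_sub_right]
    simp; ring
  simp only [e]
  rw [integral_const_mul, integral_sub (key (memLp_translate ha δ).1 (memLp_translate hb δ).1)
    (key ha hb), integral_add_right_eq_self (fun x => (inner ℝ (a x) (b x) : ℝ)), sub_self, mul_zero]

theorem integrable_inner {H : Type*} [NormedAddCommGroup H] [InnerProductSpace ℝ H] [CompleteSpace H]
    {p q : ℝ → H} (hp : MemLp p 2) (hq : MemLp q 2) :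
    Integrable fun x => inner ℝ (p x) (q x) :=
  integrable_of_le_mul (c := 1) (hp.1.inner hq.1) hp hq
    (Eventually.of_forall fun x => by rw [one_mul]; exact abs_real_inner_le_norm _ _)

theorem abs_integral_inner_le {H : Type*} [NormedAddCommGroup H] [InnerProductSpace ℝ H] [CompleteSpace H]
    {p q : ℝ → H} (hp : MemLp p 2) (hq : MemLp q 2) :
    |∫ x, inner ℝ (p x) (q x)| ≤ l2 p * l2 q := by
  have := norm_integral_le_mul (H := fun x => (inner ℝ (p x) (q x) : ℝ)) (c := 1) zero_le_one hp hq
    (Eventually.of_forall fun x => by rw [one_mul]; exact abs_real_inner_le_norm _ _)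
  rwa [one_mul] at this

theorem integral_norm_inner_le {H : Type*} [NormedAddCommGroup H] [InnerProductSpace ℝ H] [CompleteSpace H]
    {p q : ℝ → H} (hp : MemLp p 2) (hq : MemLp q 2) :
    ∫ x, ‖(inner ℝ (p x) (q x) : ℝ)‖ ≤ l2 p * l2 q := by
  have := integral_norm_le_mul (H := fun x => (inner ℝ (p x) (q x) : ℝ)) (c := 1) zero_le_one hp hq
    (Eventually.of_forall fun x => by rw [one_mul]; exact abs_real_inner_le_norm _ _)
  rwa [one_mul] at this

theorem l2_sq_inner {H : Type*} [NormedAddCommGroup H] [InnerProductSpace ℝ H] [CompleteSpace H]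
    {f : ℝ → H} (hf : MemLp f 2) : l2 f ^ 2 = ∫ x, inner ℝ (f x) (f x) := by
  rw [l2_sq hf]; simp only [real_inner_self_eq_norm_sq]

/-- Evolution of `∫ |ζ_x|²` for `ζ ∈ L^∞ H²` with `ζ_t ∈ L^∞ L²`. -/
theorem TP.deriv_energy {T M : ℝ} (hT : 0 < T) {ζ ζ1 ζ2 ζt : ℝ → ℝ → E3} {ζ0 ζ01 : ℝ → E3}
    (h : TP T ζ ζ0 ζt) (m0 : JM ζ) (m2 : JM ζ2) (m1 : JM ζ1) (mt : JM ζt)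
    (sm0 : StronglyMeasurable ζ0) (sm01 : StronglyMeasurable ζ01) (w0 : WD ζ0 ζ01)
    (L0 : MemLp ζ0 2) (L01 : MemLp ζ01 2)
    (hs : ∀ᵐ t ∂(volume.restrict (Ioo 0 T)), WD (ζ t) (ζ1 t) ∧ WD (ζ1 t) (ζ2 t) ∧
      MemLp (ζ t) 2 ∧ (MemLp (ζ1 t) 2 ∧ l2 (ζ1 t) ≤ M) ∧ (MemLp (ζ2 t) 2 ∧ l2 (ζ2 t) ≤ M) ∧
      MemLp (ζt t) 2 ∧ l2 (ζt t) ≤ M) :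
    ∀ᵐ t ∂(volume.restrict (Ioo 0 T)), l2 (ζ1 t) ^ 2 ≤ l2 ζ01 ^ 2 +
      ∫ s in (0:ℝ)..t, -2 * ∫ x, inner ℝ (ζ2 s x) (ζt s x) := by
  let δ : ℕ → ℝ := fun n => 1 / ((n : ℝ) + 1)
  have hδ : ∀ n, 0 < δ n := fun n => by positivity
  have hδl : Tendsto δ atTop (𝓝[>] 0) :=
    tendsto_nhdsWithin_iff.2 ⟨tendsto_one_div_add_atTop_nhds_zero_nat,
      Eventually.of_forall fun n => hδ n⟩
  -- The rate of the discrete energy after one quotient has been moved off ζt. In this form ζt need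
  -- only be square integrable, and the limit δ → 0 puts two derivatives on ζ.
  let J : ℕ → ℝ → ℝ := fun n s =>
    -2 * ∫ x, inner ℝ (ζt s (x + δ n)) (dq (δ n) (dq (δ n) (ζ s)) x)
  have step : ∀ n, ∀ᵐ t ∂(volume.restrict (Ioo 0 T)), l2 (dq (δ n) (ζ t)) ^ 2 =
      l2 (dq (δ n) ζ0) ^ 2 + ∫ s in (0:ℝ)..t, J n s := by
    intro n
    have hD := h.dq (δ n)
    have hE := TP.inner hT hD hD
    have L0d := memLp_dq L0 (δ n)
    have smd : StronglyMeasurable (dq (δ n) ζ0) := (JM.dq (JM.const sm0) (δ n)).slice 0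
    have hint := hE.integral ((m0.dq _).inner (m0.dq _))
      (((mt.dq _).inner (m0.dq _)).add ((m0.dq _).inner (mt.dq _)))
      (smd.inner smd) (integrable_inner L0d L0d)
      (integrable_slab (((mt.dq _).inner (m0.dq _)).add ((m0.dq _).inner (mt.dq _)))
        -- This bound blows up as δ tends to 0. It only serves to justify Fubini for each fixed δ.
        (C := 2 * ((δ n)⁻¹ * (2 * M) * M)) (by
        filter_upwards [hs] with t ⟨a1, a2, a3, a4, a5, a6, a7⟩
        have b1 := memLp_dq a6 (δ n)
        have b2 := memLp_dq a3 (δ n)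
        refine ⟨(integrable_inner b1 b2).add (integrable_inner b2 b1), ?_⟩
        have c1 : l2 (dq (δ n) (ζ t)) ≤ M :=
          (a1.l2_dq_le (m1.slice t) a4.1 (hδ n)).2.trans a4.2
        have c2 : l2 (dq (δ n) (ζt t)) ≤ (δ n)⁻¹ * (2 * M) := by
          have := l2_sub_le (memLp_translate a6 (δ n)).1 a6
          rw [(memLp_translate a6 (δ n)).2] at this
          have e : l2 (dq (δ n) (ζt t)) = |(δ n)⁻¹| * l2 (fun x => ζt t (x + δ n) - ζt t x) :=
            l2_const_smul _ _
          rw [e, abs_of_pos (inv_pos.2 (hδ n))]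
          have := inv_pos.2 (hδ n)
          gcongr
          linarith
        have e : ∀ x, inner ℝ (dq (δ n) (ζt t) x) (dq (δ n) (ζ t) x)
            + inner ℝ (dq (δ n) (ζ t) x) (dq (δ n) (ζt t) x)
            = 2 * inner ℝ (dq (δ n) (ζt t) x) (dq (δ n) (ζ t) x) := fun x => by
          rw [real_inner_comm]; ring
        simp only [e, norm_mul, Real.norm_ofNat]
        rw [integral_const_mul]
        have := integral_norm_inner_le b1 b2
        have hM : 0 ≤ M := (l2_nonneg _).trans c1
        have : l2 (dq (δ n) (ζt t)) * l2 (dq (δ n) (ζ t)) ≤ (δ n)⁻¹ * (2 * M) * M :=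
          mul_le_mul c2 c1 (l2_nonneg _) (by have := hδ n; positivity)
        linarith))
    filter_upwards [hint.2, hs, ae_restrict_mem measurableSet_Ioo] with t ht ⟨_, _, a3, _⟩ htT
    rw [l2_sq_inner (memLp_dq a3 _), l2_sq_inner L0d, ht]
    congr 1
    apply intervalIntegral.integral_congr_ae
    rw [ae_restrict_iff' measurableSet_Ioo] at hs
    filter_upwards [hs] with s hs' hst
    rw [uIoc_of_le htT.1.le] at hst
    obtain ⟨a1, a2, a3, a4, a5, a6, a7⟩ := hs' ⟨hst.1, hst.2.trans_lt htT.2⟩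
    have b1 := memLp_dq a6 (δ n)
    have b2 := memLp_dq a3 (δ n)
    have key := integral_inner_dq a6 b2 (δ n)
    rw [integral_add (integrable_inner b1 b2)
      (integrable_inner (memLp_translate a6 (δ n)).1 (memLp_dq b2 (δ n)))] at key
    have e : ∀ x, inner ℝ (dq (δ n) (ζt s) x) (dq (δ n) (ζ s) x)
        + inner ℝ (dq (δ n) (ζ s) x) (dq (δ n) (ζt s) x)
        = 2 * inner ℝ (dq (δ n) (ζt s) x) (dq (δ n) (ζ s) x) := fun x => by
      rw [real_inner_comm]; ring
    simp only [e]
    rw [integral_const_mul]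
    simp only [J]
    linarith
  filter_upwards [ae_all_iff.2 step, hs, ae_restrict_mem measurableSet_Ioo] with t ht
    ⟨a1, a2, a3, a4, a5, a6, a7⟩ htT
  have lim1 : Tendsto (fun n => l2 (dq (δ n) (ζ t)) ^ 2) atTop (𝓝 (l2 (ζ1 t) ^ 2)) := by
    refine Tendsto.pow ?_ 2
    rw [tendsto_iff_dist_tendsto_zero]
    refine squeeze_zero (fun _ => dist_nonneg) (fun n => ?_)
      ((a1.tendsto_dq (m1.slice t) a4.1).comp hδl)
    have b := memLp_dq a3 (δ n)
    rw [Real.dist_eq, abs_sub_le_iff]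
    have e1 := l2_add_le (b.sub a4.1) a4.1
    have e2 := l2_sub_le b (b.sub a4.1)
    simp only [Pi.sub_apply, sub_add_cancel, sub_sub_cancel] at e1 e2
    have e3 : l2 (dq (δ n) (ζ t) - ζ1 t) = l2 (fun x => dq (δ n) (ζ t) x - ζ1 t x) := rfl
    rw [e3] at e1 e2
    have e1' : l2 (dq (δ n) (ζ t)) ≤ l2 (fun x => dq (δ n) (ζ t) x - ζ1 t x) + l2 (ζ1 t) := e1
    have e2' : l2 (ζ1 t) ≤ l2 (dq (δ n) (ζ t)) + l2 (fun x => dq (δ n) (ζ t) x - ζ1 t x) := e2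
    simp only [Function.comp]
    constructor <;> linarith
  have lim2 : Tendsto (fun n => ∫ s in (0:ℝ)..t, J n s) atTop
      (𝓝 (∫ s in (0:ℝ)..t, -2 * ∫ x, inner ℝ (ζ2 s x) (ζt s x))) := by
    refine intervalIntegral.tendsto_integral_filter_of_dominated_convergence
      (fun _ => 2 * (M * M)) (Eventually.of_forall fun n => ?_) (Eventually.of_forall fun n => ?_)
      (by simp) ?_
    · have : JM (fun s x => (inner ℝ (ζt s (x + δ n)) (dq (δ n) (dq (δ n) (ζ s)) x) : ℝ)) := by
        refine JM.inner ?_ ((m0.dq _).dq _)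
        have := mt.shift 0 (δ n)
        simpa using this
      exact (this.integral_prod_right.const_mul _).aestronglyMeasurable
    · rw [ae_restrict_iff' measurableSet_Ioo] at hs
      filter_upwards [hs] with s hs' hst
      rw [uIoc_of_le htT.1.le] at hst
      obtain ⟨a1, a2, a3, a4, a5, a6, a7⟩ := hs' ⟨hst.1, hst.2.trans_lt htT.2⟩
      have b2 := memLp_dq (memLp_dq a3 (δ n)) (δ n)
      have c := abs_integral_inner_le (memLp_translate a6 (δ n)).1 b2
      rw [(memLp_translate a6 (δ n)).2] at c
      have smd : StronglyMeasurable (dq (δ n) (ζ1 s)) := (m1.dq (δ n)).slice s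
      have d1 := ((a1.dq (δ n)).l2_dq_le smd (memLp_dq a4.1 _) (hδ n)).2
      have d2 := (a2.l2_dq_le (m2.slice s) a5.1 (hδ n)).2
      have hM : 0 ≤ M := (l2_nonneg _).trans a7
      have : l2 (ζt s) * l2 (dq (δ n) (dq (δ n) (ζ s))) ≤ M * M :=
        mul_le_mul a7 (by linarith [a5.2]) (l2_nonneg _) hM
      rw [norm_mul, norm_neg, Real.norm_ofNat, Real.norm_eq_abs]
      linarith
    · rw [ae_restrict_iff' measurableSet_Ioo] at hs
      filter_upwards [hs] with s hs' hst
      rw [uIoc_of_le htT.1.le] at hst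
      obtain ⟨a1, a2, a3, a4, a5, a6, a7⟩ := hs' ⟨hst.1, hst.2.trans_lt htT.2⟩
      refine Tendsto.const_mul _ ?_
      rw [tendsto_iff_dist_tendsto_zero]
      have t1 := (a1.tendsto_dq_dq a2 (m1.slice s) (m2.slice s) a4.1 a5.1).comp hδl
      have t2 := (tendsto_l2_translate a6).comp (hδl.mono_right nhdsWithin_le_nhds)
      have t3 := (t1.const_mul (l2 (ζt s))).add (t2.mul_const (l2 (ζ2 s)))
      rw [mul_zero, zero_mul, add_zero] at t3
      refine squeeze_zero (fun _ => dist_nonneg) (fun n => ?_) t3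
      have b2 := memLp_dq (memLp_dq a3 (δ n)) (δ n)
      have bt := (memLp_translate a6 (δ n)).1
      have e : ∀ x, inner ℝ (ζt s (x + δ n)) (dq (δ n) (dq (δ n) (ζ s)) x)
          - inner ℝ (ζ2 s x) (ζt s x)
          = inner ℝ (ζt s (x + δ n)) (dq (δ n) (dq (δ n) (ζ s)) x - ζ2 s x)
            + inner ℝ (ζt s (x + δ n) - ζt s x) (ζ2 s x) := fun x => by
        rw [inner_sub_right, inner_sub_left, real_inner_comm (ζt s x)]
        ring
      rw [Real.dist_eq, ← integral_sub (integrable_inner bt b2) (integrable_inner a5.1 a6)]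
      simp only [e]
      refine le_of_eq_of_le (congrArg abs (integral_add (integrable_inner bt (b2.sub a5.1))
        (integrable_inner (bt.sub a6) a5.1))) ?_
      refine (abs_add_le _ _).trans (add_le_add ?_ ?_)
      · have := abs_integral_inner_le bt (b2.sub a5.1)
        rw [(memLp_translate a6 (δ n)).2] at this
        exact this
      · exact abs_integral_inner_le (bt.sub a6) a5.1
  -- The initial energy is not passed to the limit: the quotient of ζ0 has norm at most that of its
  -- derivative, which suffices for an inequality.
  have lim3 := lim2.const_add (l2 ζ01 ^ 2)
  refine le_of_tendsto_of_tendsto' lim1 lim3 fun n => ?_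
  rw [ht n]
  gcongr
  · exact l2_nonneg _
  · exact (w0.l2_dq_le sm01 L01 (hδ n)).2

end SchrodingerMap

namespace SchrodingerMap

/-! ### Energy identities -/

variable {E F G : Type*} [NormedAddCommGroup E] [NormedSpace ℝ E] [CompleteSpace E]
  [NormedAddCommGroup F] [NormedSpace ℝ F] [CompleteSpace F]
  [NormedAddCommGroup G] [NormedSpace ℝ G] [CompleteSpace G]

theorem JM.integrableOn_integral {f : ℝ → ℝ → E} (hf : JM f) {T C : ℝ}
    (h : ∀ᵐ t ∂(volume.restrict (Ioo 0 T)), ‖∫ x, f t x‖ ≤ C) :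
    IntegrableOn (fun t => ∫ x, f t x) (Ioo 0 T) :=
  Integrable.mono' (integrable_const C) hf.integral_prod_right.aestronglyMeasurable h

theorem JM.integrableOn_l2_sq {f : ℝ → ℝ → E} (hf : JM f) {T M : ℝ}
    (h : ∀ᵐ t ∂(volume.restrict (Ioo 0 T)), MemLp (f t) 2 ∧ l2 (f t) ≤ M) :
    IntegrableOn (fun t => l2 (f t) ^ 2) (Ioo 0 T) := by
  have h1 : JM (fun t x => ‖f t x‖ ^ 2) := (StronglyMeasurable.norm hf).pow 2
  refine (h1.integrableOn_integral (C := M ^ 2) ?_).congr ?_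
  · filter_upwards [h] with t ht
    rw [← l2_sq ht.1, Real.norm_of_nonneg (by positivity)]
    exact pow_le_pow_left₀ (l2_nonneg _) ht.2 2
  · filter_upwards [h] with t ht
    rw [l2_sq ht.1]

theorem intervalIntegral_mono_ae {T t : ℝ} (ht : t ∈ Ioo 0 T) {f g : ℝ → ℝ}
    (hf : IntegrableOn f (Ioo 0 T)) (hg : IntegrableOn g (Ioo 0 T))
    (h : ∀ᵐ s ∂(volume.restrict (Ioo 0 T)), f s ≤ g s) :
    ∫ s in (0:ℝ)..t, f s ≤ ∫ s in (0:ℝ)..t, g s := by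
  have h0 : (0:ℝ) ∈ Icc 0 T := ⟨le_rfl, (ht.1.trans ht.2).le⟩
  have i1 := intervalIntegrable_of_Ioo hf h0 (Ioo_subset_Icc_self ht)
  have i2 := intervalIntegrable_of_Ioo hg h0 (Ioo_subset_Icc_self ht)
  rw [intervalIntegral.integral_of_le ht.1.le, intervalIntegral.integral_of_le ht.1.le]
  refine setIntegral_mono_ae_restrict i1.1 i2.1 ?_
  rw [EventuallyLE, ae_restrict_iff' measurableSet_Ioc]
  rw [ae_restrict_iff' measurableSet_Ioo] at h
  filter_upwards [h] with s hs hst using hs ⟨hst.1, hst.2.trans_lt ht.2⟩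

theorem intervalIntegral_congr_slab {T t : ℝ} (ht : t ∈ Ioo 0 T) {f g : ℝ → E}
    (h : ∀ᵐ s ∂(volume.restrict (Ioo 0 T)), f s = g s) :
    ∫ s in (0:ℝ)..t, f s = ∫ s in (0:ℝ)..t, g s := by
  apply intervalIntegral.integral_congr_ae
  rw [ae_restrict_iff' measurableSet_Ioo] at h
  filter_upwards [h] with s hs hst
  rw [uIoc_of_le ht.1.le] at hst
  exact hs ⟨hst.1, hst.2.trans_lt ht.2⟩

theorem gronwall_of_le {T A B C : ℝ} {Y J : ℝ → ℝ} (hT : 0 < T) (hA : 0 ≤ A) (hB : 0 ≤ B)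
    (hC : 0 ≤ C) (hY : IntegrableOn Y (Ioo 0 T)) (hJ : IntegrableOn J (Ioo 0 T))
    (h : ∀ᵐ t ∂(volume.restrict (Ioo 0 T)), Y t ≤ A + ∫ s in (0:ℝ)..t, J s)
    (hle : ∀ᵐ t ∂(volume.restrict (Ioo 0 T)), J t ≤ C * Y t + B) :
    ∀ᵐ t ∂(volume.restrict (Ioo 0 T)), Y t ≤ Real.exp (C * T) * (A + T * B) := by
  have hB' : IntegrableOn (fun _ : ℝ => B) (Ioo 0 T) := integrableOn_const (by simp)
  have key := gronwall_ae (A := A) (b := fun _ => B) hT hC hY hB' (Eventually.of_forall fun _ => hB)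
    (by
      filter_upwards [h, ae_restrict_mem measurableSet_Ioo] with t ht htT
      have := intervalIntegral_mono_ae htT hJ ((hY.const_mul C).add hB') hle
      exact ht.trans (by simpa using this))
  filter_upwards [key, ae_restrict_mem measurableSet_Ioo] with t ht htT
  refine ht.trans ?_
  rw [intervalIntegral.integral_const, sub_zero, smul_eq_mul]
  have := htT.1; have := htT.2
  gcongr

theorem WD.integral_inner {a a' b b' : ℝ → E3} (ha : WD a a') (hb : WD b b')
    (la : MemLp a 2) (la' : MemLp a' 2) (lb : MemLp b 2) (lb' : MemLp b' 2) :
    ∫ x, inner ℝ (a x) (b' x) = - ∫ x, inner ℝ (a' x) (b x) := by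
  have i1 := integrable_inner la' lb
  have i2 := integrable_inner la lb'
  have := (ha.inner hb).integral_eq_zero (integrable_inner la lb) (i1.add i2)
  rw [integral_add i1 i2] at this
  linarith

theorem memLp_bdd_smul {g : ℝ → ℝ} {f : ℝ → E} {K : ℝ} (hg : AEStronglyMeasurable g volume)
    (hb : ∀ᵐ x, |g x| ≤ K) (hf : MemLp f 2) : MemLp (fun x => g x • f x) 2 := by
  refine memLp_of_le (c := K) (hg.smul hf.1) hf (hb.mono fun x hx => ?_)
  rw [norm_smul]
  exact mul_le_mul_of_nonneg_right hx (norm_nonneg _)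

theorem l2_bdd_smul_le {g : ℝ → ℝ} {f : ℝ → E} {K : ℝ} (hK : 0 ≤ K)
    (hb : ∀ᵐ x, |g x| ≤ K) (hf : MemLp f 2) : l2 (fun x => g x • f x) ≤ K * l2 f := by
  refine l2_le hK hf (hb.mono fun x hx => ?_)
  rw [norm_smul]
  exact mul_le_mul_of_nonneg_right hx (norm_nonneg _)

/-- A general Hilbert space is allowed because the lemma is used twice over: for vector fields with
weight g or 1, and with values in ℝ and weight 1 for the scalar g |u_x|², which yields the quartic
energy. -/
theorem TP.weighted_energy {H : Type*} [NormedAddCommGroup H] [InnerProductSpace ℝ H]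
    [CompleteSpace H] {T K M : ℝ} (hT : 0 < T) (hK : 0 ≤ K) {g gt : ℝ → ℝ → ℝ} {gi : ℝ → ℝ}
    {f f' : ℝ → ℝ → H} {f0 : ℝ → H} (hg : TP T g gi gt) (mg : JM g) (mgt : JM gt)
    (mgi : StronglyMeasurable gi) (bg : ∀ t x, |g t x| ≤ K) (bgt : ∀ t x, |gt t x| ≤ K)
    (bgi : ∀ x, |gi x| ≤ K) (hf : TP T f f0 f') (mf : JM f) (mf' : JM f')
    (mf0 : StronglyMeasurable f0) (l0 : MemLp f0 2)
    (hs : ∀ᵐ t ∂(volume.restrict (Ioo 0 T)), (MemLp (f t) 2 ∧ l2 (f t) ≤ M) ∧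
      MemLp (f' t) 2 ∧ l2 (f' t) ≤ M) :
    IntegrableOn (fun t => (∫ x, gt t x * ‖f t x‖ ^ 2) + 2 * ∫ x, g t x * inner ℝ (f t x) (f' t x))
      (Ioo 0 T) ∧
    ∀ᵐ t ∂(volume.restrict (Ioo 0 T)), ∫ x, g t x * ‖f t x‖ ^ 2 = (∫ x, gi x * ‖f0 x‖ ^ 2) +
      ∫ s in (0:ℝ)..t, ((∫ x, gt s x * ‖f s x‖ ^ 2)
        + 2 * ∫ x, g s x * inner ℝ (f s x) (f' s x)) := by
  have hE : TP T (fun t x => g t x * ‖f t x‖ ^ 2) (fun x => gi x * ‖f0 x‖ ^ 2)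
      (fun t x => gt t x * ‖f t x‖ ^ 2 + 2 * (g t x * inner ℝ (f t x) (f' t x))) := by
    refine (hg.mul hT (TP.inner hT hf hf)).congr (fun t x => ?_) (fun x => ?_) (fun t x => ?_)
    · rw [real_inner_self_eq_norm_sq]
    · rw [real_inner_self_eq_norm_sq]
    · rw [real_inner_self_eq_norm_sq, real_inner_comm (f t x) (f' t x)]; ring
  have m1 : JM (fun t x => gt t x * ‖f t x‖ ^ 2) := mgt.mul ((StronglyMeasurable.norm mf).pow 2)
  have m2 : JM (fun t x => g t x * inner ℝ (f t x) (f' t x)) := mg.mul (mf.inner mf')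
  have m2' : JM (fun t x => 2 * (g t x * inner ℝ (f t x) (f' t x))) := m2.const_smul (2:ℝ)
  have sq : ∀ {k : ℝ → ℝ} {a b : ℝ → H}, StronglyMeasurable k → (∀ x, |k x| ≤ K) → MemLp a 2 →
      MemLp b 2 → Integrable (fun x => k x * inner ℝ (a x) (b x)) ∧
      ∫ x, ‖k x * inner ℝ (a x) (b x)‖ ≤ K * (l2 a * l2 b) := by
    intro k a b sk hk ha hb
    have bd : ∀ x, ‖k x * inner ℝ (a x) (b x)‖ ≤ K * (‖a x‖ * ‖b x‖) := fun x => by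
      rw [norm_mul]
      exact mul_le_mul (hk x) (abs_real_inner_le_norm _ _) (norm_nonneg _) hK
    exact ⟨integrable_of_le_mul (sk.aestronglyMeasurable.mul (ha.1.inner hb.1)) ha hb
      (Eventually.of_forall bd), integral_norm_le_mul hK ha hb (Eventually.of_forall bd)⟩
  have sl : ∀ᵐ t ∂(volume.restrict (Ioo 0 T)),
      Integrable (fun x => gt t x * ‖f t x‖ ^ 2) ∧
      Integrable (fun x => 2 * (g t x * inner ℝ (f t x) (f' t x))) ∧
      ∫ x, ‖gt t x * ‖f t x‖ ^ 2 + 2 * (g t x * inner ℝ (f t x) (f' t x))‖ ≤ 3 * (K * (M * M)) := by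
    filter_upwards [hs] with t ⟨⟨a1, a2⟩, b1, b2⟩
    have s1 := sq (mgt.slice t) (bgt t) a1 a1
    have s2 := sq (mg.slice t) (bg t) a1 b1
    simp only [real_inner_self_eq_norm_sq] at s1
    have i2 := s2.1.const_mul 2
    refine ⟨s1.1, i2, ?_⟩
    have hM : 0 ≤ M := (l2_nonneg _).trans a2
    have c1 : l2 (f t) * l2 (f t) ≤ M * M := mul_le_mul a2 a2 (l2_nonneg _) hM
    have c2 : l2 (f t) * l2 (f' t) ≤ M * M := mul_le_mul a2 b2 (l2_nonneg _) hM
    calc _ ≤ ∫ x, (‖gt t x * ‖f t x‖ ^ 2‖ + 2 * ‖g t x * inner ℝ (f t x) (f' t x)‖) := by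
          refine integral_mono_of_nonneg (Eventually.of_forall fun x => norm_nonneg _)
            (s1.1.norm.add (s2.1.norm.const_mul 2)) (Eventually.of_forall fun x => ?_)
          refine (norm_add_le _ _).trans ?_
          rw [norm_mul 2, Real.norm_ofNat]
      _ = (∫ x, ‖gt t x * ‖f t x‖ ^ 2‖) + 2 * ∫ x, ‖g t x * inner ℝ (f t x) (f' t x)‖ := by
          rw [integral_add s1.1.norm (s2.1.norm.const_mul 2), integral_const_mul]
      _ ≤ K * (M * M) + 2 * (K * (M * M)) := by
          have d1 := s1.2.trans (mul_le_mul_of_nonneg_left c1 hK)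
          have d2 := s2.2.trans (mul_le_mul_of_nonneg_left c2 hK)
          linarith
      _ = _ := by ring
  have e : ∀ᵐ t ∂(volume.restrict (Ioo 0 T)),
      ∫ x, (gt t x * ‖f t x‖ ^ 2 + 2 * (g t x * inner ℝ (f t x) (f' t x))) =
      (∫ x, gt t x * ‖f t x‖ ^ 2) + 2 * ∫ x, g t x * inner ℝ (f t x) (f' t x) := by
    filter_upwards [sl] with t ht
    rw [integral_add ht.1 ht.2.1, integral_const_mul]
  have i0 := (sq mgi bgi l0 l0).1
  simp only [real_inner_self_eq_norm_sq] at i0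
  have := hE.integral (mg.mul ((StronglyMeasurable.norm mf).pow 2)) (m1.add m2')
    (mgi.mul (mf0.norm.pow 2)) i0
    (integrable_slab (m1.add m2') (sl.mono fun t ht => ⟨ht.1.add ht.2.1, ht.2.2⟩))
  refine ⟨this.1.congr e, ?_⟩
  filter_upwards [this.2, ae_restrict_mem measurableSet_Ioo] with t ht htT
  rw [ht, intervalIntegral_congr_slab htT e]

/-- Bounded coefficients `g, g_x, g_xx` on a time slice, `g` being positive. -/
structure CoefSlice (α K : ℝ) (g g1 g2 : ℝ → ℝ) : Prop where
  pos : 0 < α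
  lower : ∀ x, α ≤ g x
  bg : ∀ x, |g x| ≤ K
  bg1 : ∀ x, |g1 x| ≤ K
  bg2 : ∀ x, |g2 x| ≤ K
  sm : StronglyMeasurable g
  sm1 : StronglyMeasurable g1
  sm2 : StronglyMeasurable g2
  wd : WD g g1
  wd1 : WD g1 g2

/-- A regular coefficient on `]0,T[ × ℝ` with its derivatives and its trace at time `0`. -/
structure Coef (T α K : ℝ) where
  (g g1 g2 gt gt1 gt2 : ℝ → ℝ → ℝ)
  (gi gi1 gi2 : ℝ → ℝ)
  mg : JM g
  mg1 : JM g1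
  mg2 : JM g2
  mgt : JM gt
  mgt1 : JM gt1
  mgt2 : JM gt2
  bgt : ∀ t x, |gt t x| ≤ K
  bgt1 : ∀ t x, |gt1 t x| ≤ K
  bgt2 : ∀ t x, |gt2 t x| ≤ K
  lower : ∀ t x, α ≤ g t x
  bg : ∀ t x, |g t x| ≤ K
  slice : ∀ᵐ t ∂(volume.restrict (Ioo 0 T)), CoefSlice α K (g t) (g1 t) (g2 t)
  wdt : ∀ᵐ t ∂(volume.restrict (Ioo 0 T)), WD (gt t) (gt1 t)
  init : CoefSlice α K gi gi1 gi2
  tp : TP T g gi gt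
  tp1 : TP T g1 gi1 gt1
  tp2 : TP T g2 gi2 gt2

theorem CoefSlice.K_nonneg {α K : ℝ} {g g1 g2 : ℝ → ℝ} (c : CoefSlice α K g g1 g2) : 0 ≤ K :=
  (abs_nonneg _).trans (c.bg 0)

/-- The flux derivative `(g f_x)_x`. -/
def fluxD (g g1 : ℝ → ℝ) (f1 f2 : ℝ → E3) (x : ℝ) : E3 := g x • f2 x + g1 x • f1 x

/-- The second derivative of the flux `g f_x`. -/
def fluxDD (g g1 g2 : ℝ → ℝ) (f1 f2 f3 : ℝ → E3) (x : ℝ) : E3 :=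
  g x • f3 x + (2 * g1 x) • f2 x + g2 x • f1 x

theorem CoefSlice.wd_flux {α K : ℝ} {g g1 g2 : ℝ → ℝ} (c : CoefSlice α K g g1 g2)
    {f1 f2 : ℝ → E3} (h : WD f1 f2) : WD (fun x => g x • f1 x) (fluxD g g1 f1 f2) :=
  (c.wd.smul h).congr EventuallyEq.rfl (Eventually.of_forall fun _ => add_comm _ _)

theorem CoefSlice.memLp_flux {α K : ℝ} {g g1 g2 : ℝ → ℝ} (c : CoefSlice α K g g1 g2)
    {f1 f2 : ℝ → E3} (h1 : MemLp f1 2) (h2 : MemLp f2 2) : MemLp (fluxD g g1 f1 f2) 2 ∧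
      l2 (fluxD g g1 f1 f2) ≤ K * (l2 f1 + l2 f2) := by
  have m1 := memLp_bdd_smul c.sm.aestronglyMeasurable (Eventually.of_forall c.bg) h2
  have m2 := memLp_bdd_smul c.sm1.aestronglyMeasurable (Eventually.of_forall c.bg1) h1
  refine ⟨m1.add m2, (l2_add_le m1 m2).trans ?_⟩
  have := l2_bdd_smul_le c.K_nonneg (Eventually.of_forall c.bg) h2
  have := l2_bdd_smul_le c.K_nonneg (Eventually.of_forall c.bg1) h1
  linarith

theorem CoefSlice.memLp_smul {α K : ℝ} {g g1 g2 : ℝ → ℝ} (c : CoefSlice α K g g1 g2)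
    {f : ℝ → E3} (h : MemLp f 2) : MemLp (fun x => g x • f x) 2 :=
  memLp_bdd_smul c.sm.aestronglyMeasurable (Eventually.of_forall c.bg) h

theorem CoefSlice.wd_fluxD {α K : ℝ} {g g1 g2 : ℝ → ℝ} (c : CoefSlice α K g g1 g2)
    {f1 f2 f3 : ℝ → E3} (h : WD f1 f2) (h' : WD f2 f3) : WD (fluxD g g1 f1 f2)
      (fluxDD g g1 g2 f1 f2 f3) :=
  ((c.wd.smul h').add (c.wd1.smul h)).congr EventuallyEq.rfl (Eventually.of_forall fun x => by
    simp only [fluxDD, two_mul, add_smul]; abel)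

theorem CoefSlice.memLp_fluxDD {α K : ℝ} {g g1 g2 : ℝ → ℝ} (c : CoefSlice α K g g1 g2)
    {f1 f2 f3 : ℝ → E3} (h1 : MemLp f1 2) (h2 : MemLp f2 2) (h3 : MemLp f3 2) :
    MemLp (fluxDD g g1 g2 f1 f2 f3) 2 ∧
      l2 (fluxDD g g1 g2 f1 f2 f3)
        ≤ K * (l2 f1 + 2 * l2 f2 + l2 f3) := by
  have b (x) : |2 * g1 x| ≤ 2 * K := by
    rw [abs_mul, abs_two]; linarith [c.bg1 x]
  have m3 := memLp_bdd_smul c.sm.aestronglyMeasurable (Eventually.of_forall c.bg) h3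
  have m2 := memLp_bdd_smul (c.sm1.const_mul 2).aestronglyMeasurable (Eventually.of_forall b) h2
  have m1 := memLp_bdd_smul c.sm2.aestronglyMeasurable (Eventually.of_forall c.bg2) h1
  refine ⟨(m3.add m2).add m1, (l2_add_le (m3.add m2) m1).trans ?_⟩
  have := l2_add_le m3 m2
  have := l2_bdd_smul_le c.K_nonneg (Eventually.of_forall c.bg) h3
  have := l2_bdd_smul_le (by linarith [c.K_nonneg]) (Eventually.of_forall b) h2
  have := l2_bdd_smul_le c.K_nonneg (Eventually.of_forall c.bg2) h1
  have e : l2 (fluxDD g g1 g2 f1 f2 f3) =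
    l2 (fun x => ((fun x => g x • f3 x) + fun x => (2 * g1 x) • f2 x) x + g2 x • f1 x) := rfl
  simp only [Pi.add_def] at *
  linarith

/-- The `L²` pairing behind the `H¹` energy identity. -/
theorem CoefSlice.integral_energy {α K : ℝ} {g g1 g2 : ℝ → ℝ} (c : CoefSlice α K g g1 g2)
    {U w1 w2 wt wt1 N N1 : ℝ → E3} (h1 : WD w1 w2) (ht : WD wt wt1) (hN : WD N N1)
    (m1 : MemLp w1 2) (m2 : MemLp w2 2) (mt : MemLp wt 2) (mt1 : MemLp wt1 2)
    (mN : MemLp N 2) (mN1 : MemLp N1 2)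
    (he : ∀ᵐ x, wt x = wedge (U x) (fluxD g g1 w1 w2 x) + N x) :
    ∫ x, g x * inner ℝ (w1 x) (wt1 x) = ∫ x, g x * inner ℝ (w1 x) (N1 x) := by
  have hf := c.wd_flux h1
  have mf := c.memLp_smul m1
  have mf' := (c.memLp_flux m1 m2).1
  have e1 := hf.integral_inner ht mf mf' mt mt1
  have e2 := hf.integral_inner hN mf mf' mN mN1
  have e3 : ∫ x, inner ℝ (fluxD g g1 w1 w2 x) (wt x) = ∫ x, inner ℝ (fluxD g g1 w1 w2 x) (N x) := by
    refine integral_congr_ae (he.mono fun x hx => ?_)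
    simp only
    rw [hx, inner_add_right]
    have := det3_self_outer (fluxD g g1 w1 w2 x) (U x)
    rw [det3] at this
    rw [this, zero_add]
  simp only [real_inner_smul_left] at e1 e2
  rw [e1, e2, e3]

/-- Counterpart of `CoefSlice.integral_energy` for the L² norm of w itself. Cycling the determinant
moves U onto w. After an integration by parts g w_x meets w_x ∧ U, which contributes nothing, and w
∧ U_x, which is all that remains. -/
theorem CoefSlice.integral_energy_zero {α K : ℝ} {g g1 g2 : ℝ → ℝ} (c : CoefSlice α K g g1 g2)
    {U U1 w w1 w2 wt N : ℝ → E3} (h : WD w w1) (h1 : WD w1 w2) (hU : WD U U1)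
    (bU : ∀ᵐ x, ‖U x‖ ≤ 1) {M : ℝ} (bU1 : ∀ᵐ x, ‖U1 x‖ ≤ M) (sU1 : AEStronglyMeasurable U1 volume)
    (m : MemLp w 2) (m1 : MemLp w1 2) (m2 : MemLp w2 2) (mN : MemLp N 2)
    (he : ∀ᵐ x, wt x = wedge (U x) (fluxD g g1 w1 w2 x) + N x) :
    ∫ x, inner ℝ (w x) (wt x) = (∫ x, - (g x * det3 (w1 x) (w x) (U1 x)))
      + ∫ x, inner ℝ (w x) (N x) := by
  have hf := c.wd_flux h1
  have mf := c.memLp_smul m1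
  have mf' := (c.memLp_flux m1 m2).1
  have hp := h.wedge hU
  have sw : ∀ {a b : ℝ → E3}, AEStronglyMeasurable a volume → AEStronglyMeasurable b volume →
      AEStronglyMeasurable (fun x => wedge (a x) (b x)) volume := fun ha hb =>
    wedgeL.continuous₂.comp_aestronglyMeasurable (ha.prodMk hb)
  have sU : AEStronglyMeasurable U volume := hU.locallyIntegrable.aestronglyMeasurable
  have p1 : MemLp (fun x => wedge (w x) (U x)) 2 := by
    refine memLp_of_le (c := 1) (sw m.1 sU) m (bU.mono fun x hx => ?_)
    refine (norm_wedge_le _ _).trans ?_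
    rw [mul_comm]
    exact mul_le_mul_of_nonneg_right hx (norm_nonneg _)
  have p2 : MemLp (fun x => wedge (w1 x) (U x)) 2 := by
    refine memLp_of_le (c := 1) (sw m1.1 sU) m1 (bU.mono fun x hx => ?_)
    refine (norm_wedge_le _ _).trans ?_
    rw [mul_comm]
    exact mul_le_mul_of_nonneg_right hx (norm_nonneg _)
  have p3 : MemLp (fun x => wedge (w x) (U1 x)) 2 := by
    refine memLp_of_le (c := M) (sw m.1 sU1) m (bU1.mono fun x hx => ?_)
    refine (norm_wedge_le _ _).trans ?_
    rw [mul_comm]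
    exact mul_le_mul_of_nonneg_right hx (norm_nonneg _)
  have e1 := hf.integral_inner hp mf mf' p1 (p2.add p3)
  have e2 : ∫ x, inner ℝ (w x) (wt x) = ∫ x, (inner ℝ (fluxD g g1 w1 w2 x) (wedge (w x) (U x))
      + inner ℝ (w x) (N x)) := by
    refine integral_congr_ae (he.mono fun x hx => ?_)
    simp only
    rw [hx, inner_add_right]
    have := det3_cycle (fluxD g g1 w1 w2 x) (w x) (U x)
    rw [det3, det3] at this
    rw [this]
  rw [e2, integral_add (integrable_inner mf' p1) (integrable_inner m mN)]
  congr 1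
  rw [← neg_eq_iff_eq_neg.2 e1, ← integral_neg]
  refine integral_congr_ae (Eventually.of_forall fun x => ?_)
  simp only
  rw [real_inner_smul_left, inner_add_right]
  have := det3_self_left (w1 x) (U x)
  rw [det3] at this
  rw [this, zero_add, det3]

end SchrodingerMap

namespace SchrodingerMap

/-! ### Solutions of the Schrödinger map equation -/

/-- The velocity `u ∧ (g u_x)_x`. -/
noncomputable def vel (g g1 : ℝ → ℝ) (u u1 u2 : ℝ → E3) (x : ℝ) : E3 :=
  wedge (u x) (fluxD g g1 u1 u2 x)

/-- The space derivative of the velocity. -/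
noncomputable def velD (g g1 g2 : ℝ → ℝ) (u u1 u2 u3 : ℝ → E3) (x : ℝ) : E3 :=
  wedge (u1 x) (fluxD g g1 u1 u2 x) + wedge (u x) (fluxDD g g1 g2 u1 u2 u3 x)

/-- A map into the sphere whose first derivative belongs to `H²`. -/
structure MapSlice (u u1 u2 u3 : ℝ → E3) : Prop where
  sph : ∀ x, ‖u x‖ = 1
  sm : StronglyMeasurable u
  sm1 : StronglyMeasurable u1
  sm2 : StronglyMeasurable u2
  sm3 : StronglyMeasurable u3
  wd : WD u u1
  wd1 : WD u1 u2
  wd2 : WD u2 u3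
  m1 : MemLp u1 2
  m2 : MemLp u2 2
  m3 : MemLp u3 2

/-- A regular solution of the Schrödinger map equation with coefficient `c`. -/
structure Sol {T α K : ℝ} (c : Coef T α K) (M : ℝ) where
  (u u1 u2 u3 : ℝ → ℝ → E3)
  (i0 i1 i2 i3 : ℝ → E3)
  ju : JM u
  ju1 : JM u1
  ju2 : JM u2
  ju3 : JM u3
  slice : ∀ᵐ t ∂(volume.restrict (Ioo 0 T)), MapSlice (u t) (u1 t) (u2 t) (u3 t) ∧
    l2 (u1 t) ≤ M ∧ l2 (u2 t) ≤ M ∧ l2 (u3 t) ≤ M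
  init : MapSlice i0 i1 i2 i3
  tp : TP T u i0 (fun t => vel (c.g t) (c.g1 t) (u t) (u1 t) (u2 t))
  tp1 : TP T u1 i1 (fun t => velD (c.g t) (c.g1 t) (c.g2 t) (u t) (u1 t) (u2 t) (u3 t))

/-! ### Normal components of the derivatives of a sphere-valued map -/

namespace MapSlice

variable {u u1 u2 u3 : ℝ → E3}

/-- Differentiate |u|² = 1 and use uniqueness of weak derivatives. Repeating this gives the normal
components of u2 and u3 below, each expressed by derivatives of lower order. -/
theorem inner_one (s : MapSlice u u1 u2 u3) : ∀ᵐ x, inner ℝ (u x) (u1 x) = 0 := by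
  have h := (s.wd.inner s.wd).unique (WD.const (1:ℝ))
    (Eventually.of_forall fun x => by simp only [real_inner_self_eq_norm_sq, s.sph, one_pow])
  filter_upwards [h] with x hx
  rw [real_inner_comm] at hx
  linarith

theorem inner_two (s : MapSlice u u1 u2 u3) : ∀ᵐ x, inner ℝ (u x) (u2 x) = - ‖u1 x‖ ^ 2 := by
  have h := (s.wd.inner s.wd1).unique (WD.const (0:ℝ)) s.inner_one
  filter_upwards [h] with x hx
  rw [real_inner_self_eq_norm_sq] at hx
  linarith

theorem inner_three (s : MapSlice u u1 u2 u3) :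
    ∀ᵐ x, inner ℝ (u x) (u3 x) = - 3 * inner ℝ (u1 x) (u2 x) := by
  have h := ((s.wd.inner s.wd2).add (s.wd1.inner s.wd1)).unique (WD.const (0:ℝ)) (by
    filter_upwards [s.inner_two] with x hx
    rw [hx, real_inner_self_eq_norm_sq]; ring)
  filter_upwards [h] with x hx
  rw [real_inner_comm (u1 x) (u2 x)] at hx
  linarith

theorem ae_norm_u1_sq_le (s : MapSlice u u1 u2 u3) : ∀ᵐ x, ‖u1 x‖ ^ 2 ≤ l2 u1 * l2 u2 :=
  s.wd1.ae_sq_le s.m1 s.m2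

theorem ae_norm_u1_le (s : MapSlice u u1 u2 u3) {M : ℝ} (h1 : l2 u1 ≤ M) (h2 : l2 u2 ≤ M) :
    ∀ᵐ x, ‖u1 x‖ ≤ M := by
  have hM := (l2_nonneg u1).trans h1
  filter_upwards [s.ae_norm_u1_sq_le] with x hx
  refine le_of_sq_le_sq (hx.trans ?_) hM
  rw [sq]
  exact mul_le_mul h1 h2 (l2_nonneg _) hM

end MapSlice

theorem aestronglyMeasurable_wedge {a b : ℝ → E3} (ha : AEStronglyMeasurable a volume)
    (hb : AEStronglyMeasurable b volume) :
    AEStronglyMeasurable (fun x => wedge (a x) (b x)) volume :=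
  wedgeL.continuous₂.comp_aestronglyMeasurable (ha.prodMk hb)

theorem memLp_wedge_left {a b : ℝ → E3} {M : ℝ} (hM : 0 ≤ M) (ha : AEStronglyMeasurable a volume)
    (h : ∀ᵐ x, ‖a x‖ ≤ M) (hb : MemLp b 2) : MemLp (fun x => wedge (a x) (b x)) 2 ∧
      l2 (fun x => wedge (a x) (b x)) ≤ M * l2 b := by
  have hle : ∀ᵐ x, ‖wedge (a x) (b x)‖ ≤ M * ‖b x‖ := h.mono fun x hx =>
    (norm_wedge_le _ _).trans (mul_le_mul_of_nonneg_right hx (norm_nonneg _))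
  exact ⟨memLp_of_le (aestronglyMeasurable_wedge ha hb.1) hb hle, l2_le hM hb hle⟩

section slices

variable {α K : ℝ} {g g1 g2 : ℝ → ℝ} {u u1 u2 u3 : ℝ → E3}

theorem CoefSlice.wd_vel (c : CoefSlice α K g g1 g2) (s : MapSlice u u1 u2 u3) :
    WD (vel g g1 u u1 u2) (velD g g1 g2 u u1 u2 u3) :=
  s.wd.wedge (c.wd_fluxD s.wd1 s.wd2)

theorem CoefSlice.memLp_vel (c : CoefSlice α K g g1 g2) (s : MapSlice u u1 u2 u3) :
    MemLp (vel g g1 u u1 u2) 2 ∧ l2 (vel g g1 u u1 u2) ≤ K * (l2 u1 + l2 u2) := by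
  have h := c.memLp_flux s.m1 s.m2
  have h' := memLp_wedge_left zero_le_one s.sm.aestronglyMeasurable
    (Eventually.of_forall fun x => (s.sph x).le) h.1
  refine ⟨h'.1, h'.2.trans ?_⟩
  rw [one_mul]
  exact h.2

theorem CoefSlice.memLp_velD (c : CoefSlice α K g g1 g2) (s : MapSlice u u1 u2 u3)
    {M : ℝ} (h1 : l2 u1 ≤ M) (h2 : l2 u2 ≤ M) (h3 : l2 u3 ≤ M) :
    MemLp (velD g g1 g2 u u1 u2 u3) 2 ∧
      l2 (velD g g1 g2 u u1 u2 u3) ≤ M * (K * (M + M)) + K * (M + 2 * M + M) := by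
  have hK := c.K_nonneg
  have hM := (l2_nonneg u1).trans h1
  have h := c.memLp_flux s.m1 s.m2
  have h' := memLp_wedge_left hM s.sm1.aestronglyMeasurable (s.ae_norm_u1_le h1 h2) h.1
  have k := c.memLp_fluxDD s.m1 s.m2 s.m3
  have k' := memLp_wedge_left zero_le_one s.sm.aestronglyMeasurable
    (Eventually.of_forall fun x => (s.sph x).le) k.1
  refine ⟨h'.1.add k'.1, (l2_add_le h'.1 k'.1).trans (add_le_add (h'.2.trans ?_) (k'.2.trans ?_))⟩
  · refine mul_le_mul_of_nonneg_left (h.2.trans ?_) hM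
    gcongr
  · rw [one_mul]
    refine k.2.trans ?_
    gcongr

end slices

theorem JM.fluxD {g g1 : ℝ → ℝ → ℝ} {u1 u2 : ℝ → ℝ → E3} (hg : JM g) (hg1 : JM g1) (h1 : JM u1)
    (h2 : JM u2) : JM (fun t => fluxD (g t) (g1 t) (u1 t) (u2 t)) :=
  (hg.smul h2).add (hg1.smul h1)

theorem JM.fluxDD {g g1 g2 : ℝ → ℝ → ℝ} {u1 u2 u3 : ℝ → ℝ → E3} (hg : JM g) (hg1 : JM g1)
    (hg2 : JM g2) (h1 : JM u1) (h2 : JM u2) (h3 : JM u3) :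
    JM (fun t => fluxDD (g t) (g1 t) (g2 t) (u1 t) (u2 t) (u3 t)) :=
  ((hg.smul h3).add ((hg1.const_smul (2:ℝ)).smul h2)).add (hg2.smul h1)

namespace Sol

variable {T α K M : ℝ} {c : Coef T α K} (s : Sol c M)

/-- The field `(g u_x)_x` of a solution. -/
noncomputable def p (t : ℝ) : ℝ → E3 := fluxD (c.g t) (c.g1 t) (s.u1 t) (s.u2 t)
/-- The space derivative of `(g u_x)_x`. -/
noncomputable def p1 (t : ℝ) : ℝ → E3 := fluxDD (c.g t) (c.g1 t) (c.g2 t) (s.u1 t) (s.u2 t) (s.u3 t)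
/-- The time derivative of a solution. -/
noncomputable def v (t : ℝ) : ℝ → E3 := vel (c.g t) (c.g1 t) (s.u t) (s.u1 t) (s.u2 t)
/-- The time derivative of the space derivative of a solution. -/
noncomputable def v1 (t : ℝ) : ℝ → E3 :=
  velD (c.g t) (c.g1 t) (c.g2 t) (s.u t) (s.u1 t) (s.u2 t) (s.u3 t)

theorem jp : JM s.p := JM.fluxD c.mg c.mg1 s.ju1 s.ju2
theorem jp1 : JM s.p1 := JM.fluxDD c.mg c.mg1 c.mg2 s.ju1 s.ju2 s.ju3
theorem jv : JM s.v := s.ju.wedge s.jp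
theorem jv1 : JM s.v1 := (s.ju1.wedge s.jp).add (s.ju.wedge s.jp1)

end Sol

theorem Coef.gi_le {T α K : ℝ} (c : Coef T α K) : 0 < α ∧ 0 ≤ K := ⟨c.init.pos, c.init.K_nonneg⟩

theorem integral_mul_sq_le {k : ℝ → ℝ} {K : ℝ} {f : ℝ → E3} (sk : StronglyMeasurable k)
    (hk : ∀ x, |k x| ≤ K) (hf : MemLp f 2) :
    Integrable (fun x => k x * ‖f x‖ ^ 2) ∧ ∫ x, k x * ‖f x‖ ^ 2 ≤ K * l2 f ^ 2 := by
  have hK : 0 ≤ K := (abs_nonneg _).trans (hk 0)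
  have b : ∀ x, ‖k x * ‖f x‖ ^ 2‖ ≤ K * (‖f x‖ * ‖f x‖) := fun x => by
    rw [norm_mul, norm_pow, norm_norm, sq]
    exact mul_le_mul_of_nonneg_right (hk x) (by positivity)
  refine ⟨integrable_of_le_mul (sk.aestronglyMeasurable.mul (hf.1.norm.pow 2)) hf hf
    (Eventually.of_forall b), ?_⟩
  have := norm_integral_le_mul hK hf hf (Eventually.of_forall b)
  rw [sq (l2 f)]
  exact (le_abs_self _).trans this

theorem CoefSlice.le_integral {α K : ℝ} {g g1 g2 : ℝ → ℝ} (c : CoefSlice α K g g1 g2) {f : ℝ → E3}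
    (hf : MemLp f 2) : α * l2 f ^ 2 ≤ ∫ x, g x * ‖f x‖ ^ 2 := by
  rw [l2_sq hf, ← integral_const_mul]
  have i : Integrable fun x => ‖f x‖ ^ 2 := by
    simpa only [sq] using integrable_norm_mul_norm hf hf
  exact integral_mono (i.const_mul _) (integral_mul_sq_le c.sm c.bg hf).1 fun x =>
    mul_le_mul_of_nonneg_right (c.lower x) (by positivity)

/-- Since p · (u ∧ p) = 0, the energy ∫ g |u_x|² changes only by ∫ g_t |u_x|², and Gronwall applies
at rate K/α. The bound is chosen before M and the solution; this uniformity is what the a priori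
estimates are for. -/
theorem Sol.exists_bound_one {T α K : ℝ} (hT : 0 < T) (c : Coef T α K) (A : ℝ) :
    ∃ B, 0 ≤ B ∧ ∀ (M : ℝ) (s : Sol c M), l2 s.i1 ≤ A →
      ∀ᵐ t ∂(volume.restrict (Ioo 0 T)), l2 (s.u1 t) ≤ B := by
  obtain ⟨hα, hK⟩ := c.gi_le
  refine ⟨Real.sqrt (Real.exp (K / α * T) * (K / α * A ^ 2 + T * 0)), Real.sqrt_nonneg _,
    fun M s hA => ?_⟩
  -- The qualitative bound M makes the energies integrable and does not enter the result.
  set M' := max M (M * (K * (M + M)) + K * (M + 2 * M + M))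
  have hE := TP.weighted_energy hT hK c.tp c.mg c.mgt c.init.sm c.bg c.bgt c.init.bg s.tp1
    s.ju1 s.jv1 s.init.sm1 s.init.m1 (M := M') (by
      filter_upwards [s.slice, c.slice] with t ⟨h, b1, b2, b3⟩ hc
      have := hc.memLp_velD h b1 b2 b3
      exact ⟨⟨h.m1, b1.trans (le_max_left _ _)⟩, this.1, this.2.trans (le_max_right _ _)⟩)
  have key : ∀ᵐ t ∂(volume.restrict (Ioo 0 T)),
      l2 (s.u1 t) ^ 2 ≤ Real.exp (K / α * T) * (K / α * A ^ 2 + T * 0) := by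
    refine gronwall_of_le hT (by positivity) le_rfl (by positivity)
      (s.ju1.integrableOn_l2_sq (M := M) (s.slice.mono fun t h => ⟨h.1.m1, h.2.1⟩))
      (hE.1.const_mul α⁻¹) ?_ ?_
    · filter_upwards [hE.2, s.slice, c.slice] with t ht ⟨h, _⟩ hc
      rw [intervalIntegral.integral_const_mul]
      have h1 := hc.le_integral h.m1
      have h2 := (integral_mul_sq_le c.init.sm c.init.bg s.init.m1).2
      have h3 : l2 s.i1 ^ 2 ≤ A ^ 2 := pow_le_pow_left₀ (l2_nonneg _) hA 2
      have h4 := h2.trans (mul_le_mul_of_nonneg_left h3 hK)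
      rw [ht] at h1
      have : l2 (s.u1 t) ^ 2 = α⁻¹ * (α * l2 (s.u1 t) ^ 2) := by field_simp
      rw [this]
      refine (mul_le_mul_of_nonneg_left (h1.trans (add_le_add_left h4 _)) (by positivity)).trans
        (le_of_eq ?_)
      rw [mul_add]
      congr 1
      field_simp
    · filter_upwards [s.slice, c.slice] with t ⟨h, b1, b2, b3⟩ hc
      have h1 := hc.integral_energy (U := s.u t) (N := fun _ => 0) (N1 := fun _ => 0) h.wd1
        (hc.wd_vel h) (WD.const 0) h.m1 h.m2
        (hc.memLp_vel h).1 (hc.memLp_velD h b1 b2 b3).1 MemLp.zero' MemLp.zero'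
        (Eventually.of_forall fun x => by rw [add_zero]; rfl)
      simp only [inner_zero_right, mul_zero, integral_zero] at h1
      have h2 := (integral_mul_sq_le (c.mgt.slice t) (c.bgt t) h.m1).2
      have h3 : ∫ x, c.g t x * inner ℝ (s.u1 t x)
          (velD (c.g t) (c.g1 t) (c.g2 t) (s.u t) (s.u1 t) (s.u2 t) (s.u3 t) x) = 0 := h1
      rw [h3, mul_zero, add_zero, add_zero]
      refine (mul_le_mul_of_nonneg_left h2 (by positivity)).trans (le_of_eq ?_)
      field_simp
  filter_upwards [key] with t ht
  exact Real.le_sqrt_of_sq_le ht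

end SchrodingerMap

namespace SchrodingerMap

/-! ### The second energy identity -/

/-- Multiples of u1 drop out of the determinant, and then so does the u2 part of the first entry,
leaving g² det(u3, u1, u2). Expanding it along u replaces every factor by a known normal component
and leaves only the determinants of u, u1, u3 and of u, u1, u2. -/
theorem det3_flux_flux (g g1 g2 : ℝ) {u u1 u2 u3 : E3} (h0 : ‖u‖ = 1) (o1 : inner ℝ u u1 = 0)
    (o2 : inner ℝ u u2 = - ‖u1‖ ^ 2) (o3 : inner ℝ u u3 = -3 * inner ℝ u1 u2) :
    det3 (g • u3 + (2 * g1) • u2 + g2 • u1) u1 (g • u2 + g1 • u1) =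
      g ^ 2 * (‖u1‖ ^ 2 * det3 u u1 u3 - 3 * inner ℝ u1 u2 * det3 u u1 u2) := by
  have e1 : det3 (g • u3 + (2 * g1) • u2 + g2 • u1) u1 (g • u2 + g1 • u1) =
      g ^ 2 * det3 u3 u1 u2 := by
    simp only [det3_eq, PiLp.add_apply, PiLp.smul_apply, smul_eq_mul]; ring
  rw [e1, det3_decomp u u3 u1 u2 h0, real_inner_comm u u3, real_inner_comm u u1,
    real_inner_comm u u2, o1, o2, o3, det3_cycle u u1 u3, det3_cycle u1 u3 u,
    det3_swap_right u3 u1 u]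
  ring

theorem inner_velD_u1 (g g1 g2 : ℝ) (u u1 u2 u3 : E3) :
    inner ℝ u1 (wedge u1 (g • u2 + g1 • u1) + wedge u (g • u3 + (2 * g1) • u2 + g2 • u1)) =
      - (g * det3 u u1 u3 + 2 * g1 * det3 u u1 u2) := by
  simp only [det3_eq, inner_eq_sum, wedge_zero, wedge_one, wedge_two, PiLp.add_apply,
    PiLp.smul_apply, smul_eq_mul]; ring

theorem inner_velD_p1 (u u1 p p1 : E3) :
    inner ℝ p1 (wedge u1 p + wedge u p1) = det3 p1 u1 p := by
  simp only [det3_eq, inner_eq_sum, wedge_zero, wedge_one, wedge_two, PiLp.add_apply]; ring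

section slices

variable {α K : ℝ} {g g1 g2 : ℝ → ℝ} {u u1 u2 u3 : ℝ → E3}

/-- The sup bound |u1|² ≤ ‖u1‖ ‖u2‖ is used on one of the two squares only. The quartic integral is
then linear in ‖u2‖, so it can be absorbed by ‖p‖² in `Sol.exists_bound_two`. -/
theorem MapSlice.abs_integral_quartic_le (s : MapSlice u u1 u2 u3) {k l : ℝ → ℝ}
    (hk : ∀ x, |k x| ≤ K) (hl : ∀ x, |l x| ≤ K) {B : ℝ} (hB : l2 u1 ≤ B) :
    |∫ x, (k x * ‖u1 x‖ ^ 2) * (l x * ‖u1 x‖ ^ 2)| ≤ K ^ 2 * (B * l2 u2 * B ^ 2) := by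
  have hK : 0 ≤ K := (abs_nonneg _).trans (hk 0)
  have n1 := l2_nonneg u1
  have n2 := l2_nonneg u2
  have hB0 := n1.trans hB
  have := norm_integral_le_mul (H := fun x => (k x * ‖u1 x‖ ^ 2) * (l x * ‖u1 x‖ ^ 2))
    (c := K ^ 2 * (B * l2 u2)) (by positivity) s.m1 s.m1 (s.ae_norm_u1_sq_le.mono fun x hx => by
      have h1 := hk x
      have h2 := hl x
      have hx' := hx.trans (mul_le_mul_of_nonneg_right hB n2)
      rw [norm_mul, norm_mul, norm_mul, norm_pow, norm_norm, Real.norm_eq_abs, Real.norm_eq_abs]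
      calc |k x| * ‖u1 x‖ ^ 2 * (|l x| * ‖u1 x‖ ^ 2) ≤
            K * (B * l2 u2) * (K * ‖u1 x‖ ^ 2) := by gcongr
        _ = _ := by ring)
  rw [Real.norm_eq_abs] at this
  refine this.trans ?_
  have : l2 u1 * l2 u1 ≤ B * B := mul_le_mul hB hB n1 hB0
  calc _ ≤ K ^ 2 * (B * l2 u2) * (B * B) := by gcongr
    _ = _ := by ring

theorem MapSlice.memLp_bdd_mul_sq (s : MapSlice u u1 u2 u3) {k : ℝ → ℝ} (sk : StronglyMeasurable k)
    (hk : ∀ x, |k x| ≤ K) {M : ℝ} (bM : ∀ᵐ x, ‖u1 x‖ ≤ M) :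
    MemLp (fun x => k x * ‖u1 x‖ ^ 2) 2 ∧ l2 (fun x => k x * ‖u1 x‖ ^ 2) ≤ K * M * l2 u1 := by
  have hK : 0 ≤ K := (abs_nonneg _).trans (hk 0)
  obtain ⟨x0, h0⟩ := bM.exists
  have hM := (norm_nonneg _).trans h0
  have h : ∀ᵐ x, ‖k x * ‖u1 x‖ ^ 2‖ ≤ K * M * ‖u1 x‖ := bM.mono fun x hx => by
    rw [norm_mul, norm_pow, norm_norm, sq, ← mul_assoc, Real.norm_eq_abs]
    have := hk x
    gcongr
  exact ⟨memLp_of_le (sk.aestronglyMeasurable.mul (s.m1.1.norm.pow 2)) s.m1 h,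
    l2_le (by positivity) s.m1 h⟩

theorem MapSlice.memLp_bdd_mul_inner (s : MapSlice u u1 u2 u3) {k : ℝ → ℝ}
    (sk : StronglyMeasurable k) (hk : ∀ x, |k x| ≤ K) {M : ℝ} (bM : ∀ᵐ x, ‖u1 x‖ ≤ M)
    {v1 : ℝ → E3} (mv1 : MemLp v1 2) :
    MemLp (fun x => k x * (2 * inner ℝ (u1 x) (v1 x))) 2 ∧
      l2 (fun x => k x * (2 * inner ℝ (u1 x) (v1 x))) ≤ K * (2 * M) * l2 v1 := by
  have hK : 0 ≤ K := (abs_nonneg _).trans (hk 0)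
  obtain ⟨x0, h0⟩ := bM.exists
  have hM := (norm_nonneg _).trans h0
  have h : ∀ᵐ x, ‖k x * (2 * inner ℝ (u1 x) (v1 x))‖ ≤ K * (2 * M) * ‖v1 x‖ := bM.mono fun x hx => by
    rw [norm_mul, norm_mul, Real.norm_ofNat, Real.norm_eq_abs, Real.norm_eq_abs]
    have h1 := hk x
    have h2 : |inner ℝ (u1 x) (v1 x)| ≤ M * ‖v1 x‖ := (abs_real_inner_le_norm _ _).trans
      (mul_le_mul_of_nonneg_right hx (norm_nonneg _))
    rw [mul_assoc, mul_assoc]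
    gcongr
  exact ⟨memLp_of_le (sk.aestronglyMeasurable.mul ((s.m1.1.inner mv1.1).const_mul 2)) mv1 h,
    l2_le (by positivity) mv1 h⟩

/-- The left-hand side is the rate of ‖p‖² − (5/4) ∫ (g |u1|²)². Put X2 = det(u, u1, u2) and X3 =
det(u, u1, u3). The first energy contributes −2 g³ (|u1|² X3 − 3 (u1 · u2) X2), the second 5 g²
|u1|² (g X3 + 2 g1 X2). Together they make 3 g³ (|u1|² X3 + 2 (u1 · u2) X2) plus a multiple of g1,
that is, three times the derivative of g³ |u1|² X2 plus g² g1 |u1|² X2. The coefficient 5/4 is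
chosen for this. What remains is at most quadratic in ‖u2‖, as Gronwall requires. -/
theorem CoefSlice.integral_second_energy (c : CoefSlice α K g g1 g2) (s : MapSlice u u1 u2 u3)
    {gt gt1 : ℝ → ℝ} (st : StronglyMeasurable gt) (st1 : StronglyMeasurable gt1)
    (bt : ∀ x, |gt x| ≤ K) (bt1 : ∀ x, |gt1 x| ≤ K) (ht : WD gt gt1) {B : ℝ} (hB : l2 u1 ≤ B) :
    -2 * (∫ x, inner ℝ (fluxDD g g1 g2 u1 u2 u3 x)
        (gt x • u1 x + g x • velD g g1 g2 u u1 u2 u3 x))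
      - 5 / 2 * ∫ x, (g x * ‖u1 x‖ ^ 2) * (gt x * ‖u1 x‖ ^ 2
        + g x * (2 * inner ℝ (u1 x) (velD g g1 g2 u u1 u2 u3 x))) ≤
      2 * (K * (B + l2 u2) * (K * (B + l2 u2))) + 5 / 2 * (K ^ 2 * (B * l2 u2 * B ^ 2))
        + K ^ 3 * (B * l2 u2) ^ 2 := by
  have hK := c.K_nonneg
  have hB0 := (l2_nonneg u1).trans hB
  have n1 := l2_nonneg u1
  have n2 := l2_nonneg u2
  set p := fluxD g g1 u1 u2 with hp
  set p1 := fluxDD g g1 g2 u1 u2 u3 with hp1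
  set v1 := velD g g1 g2 u u1 u2 u3 with hv1
  have mp := c.memLp_flux s.m1 s.m2
  have mp1 := (c.memLp_fluxDD s.m1 s.m2 s.m3).1
  have wp : WD p p1 := c.wd_fluxD s.wd1 s.wd2
  have mv1 : MemLp v1 2 := (c.memLp_velD s ((le_max_left _ _).trans (le_max_left _ (l2 u3)))
    ((le_max_right _ _).trans (le_max_left _ _)) (le_max_right _ _)).1
  have ub := s.ae_norm_u1_sq_le
  have uM : ∀ᵐ x, ‖u1 x‖ ^ 2 ≤ B * l2 u2 := ub.mono fun x hx =>
    hx.trans (mul_le_mul_of_nonneg_right hB n2)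
  -- first term
  have mgt := memLp_bdd_smul st.aestronglyMeasurable (Eventually.of_forall bt) s.m1
  have mgt1 := memLp_bdd_smul st1.aestronglyMeasurable (Eventually.of_forall bt1) s.m1
  have mgt2 := memLp_bdd_smul st.aestronglyMeasurable (Eventually.of_forall bt) s.m2
  have mgv := c.memLp_smul mv1
  -- The factor p1 contains the third derivative; an integration by parts replaces it by p.
  have t1 : ∫ x, inner ℝ (p1 x) (gt x • u1 x) = - ∫ x, inner ℝ (p x) (gt1 x • u1 x + gt x • u2 x) := by
    have := wp.integral_inner (ht.smul s.wd1) mp.1 mp1 mgt (mgt1.add mgt2)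
    rw [this, neg_neg]
  have t1' : |∫ x, inner ℝ (p x) (gt1 x • u1 x + gt x • u2 x)|
      ≤ K * (B + l2 u2) * (K * (B + l2 u2)) := by
    refine (abs_integral_inner_le mp.1 (mgt1.add mgt2)).trans ?_
    have a1 := l2_add_le mgt1 mgt2
    have a2 := l2_bdd_smul_le hK (Eventually.of_forall bt1) s.m1
    have a3 := l2_bdd_smul_le hK (Eventually.of_forall bt) s.m2
    have a4 : l2 p ≤ K * (B + l2 u2) := mp.2.trans (by gcongr)
    have a5 : K * l2 u1 ≤ K * B := by gcongr
    have a6 : l2 ((fun x => gt1 x • u1 x) + fun x => gt x • u2 x) ≤ K * (B + l2 u2) := by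
      refine a1.trans ?_
      linarith
    exact mul_le_mul a4 a6 (l2_nonneg _) (by positivity)
  -- the quartic energy
  set M := max (l2 u1) (l2 u2)
  have hM : 0 ≤ M := n1.trans (le_max_left _ _)
  have bM := s.ae_norm_u1_le (le_max_left (l2 u1) (l2 u2)) (le_max_right _ _)
  have sqm : AEStronglyMeasurable (fun x => ‖u1 x‖ ^ 2) volume := s.m1.1.norm.pow 2
  have mmu := (s.memLp_bdd_mul_sq c.sm c.bg bM).1
  have mm1 := (s.memLp_bdd_mul_sq st bt bM).1
  have mm2 := (s.memLp_bdd_mul_inner c.sm c.bg bM mv1).1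
  have i1 := integrable_inner mp1 mgt
  have i2 := integrable_inner mp1 mgv
  have j1 : Integrable (fun x => (g x * ‖u1 x‖ ^ 2) * (gt x * ‖u1 x‖ ^ 2)) :=
    mmu.integrable_mul mm1
  have j2 : Integrable (fun x => (g x * ‖u1 x‖ ^ 2) * (g x * (2 * inner ℝ (u1 x) (v1 x)))) :=
    mmu.integrable_mul mm2
  have hbound := s.abs_integral_quartic_le c.bg bt hB
  have hX : ∀ x, |det3 (u x) (u1 x) (u2 x)| ≤ ‖u1 x‖ * ‖u2 x‖ := fun x => by
    have := abs_det3_le (u x) (u1 x) (u2 x)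
    rwa [s.sph, one_mul] at this
  let R : ℝ → ℝ := fun x => g x ^ 2 * g1 x * ‖u1 x‖ ^ 2 * det3 (u x) (u1 x) (u2 x)
  have sX : AEStronglyMeasurable (fun x => det3 (u x) (u1 x) (u2 x)) volume :=
    s.sm.aestronglyMeasurable.inner (aestronglyMeasurable_wedge s.m1.1 s.m2.1)
  have hR : ∀ᵐ x, ‖R x‖ ≤ K ^ 3 * (B * l2 u2) * (‖u1 x‖ * ‖u2 x‖) := uM.mono fun x hx => by
    have h1 := c.bg x
    have h2 := c.bg1 x
    have h3 := hX x
    simp only [R, norm_mul, norm_pow, Real.norm_eq_abs, abs_norm]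
    calc |g x| ^ 2 * |g1 x| * ‖u1 x‖ ^ 2 * |det3 (u x) (u1 x) (u2 x)|
        ≤ K ^ 2 * K * (B * l2 u2) * (‖u1 x‖ * ‖u2 x‖) := by gcongr
      _ = _ := by ring
  have sg2 : AEStronglyMeasurable (fun x => g x ^ 2 * g1 x) volume :=
    (c.sm.aestronglyMeasurable.pow 2).mul c.sm1.aestronglyMeasurable
  have iR : Integrable R := integrable_of_le_mul ((sg2.mul sqm).mul sX) s.m1 s.m2 hR
  have bR : |∫ x, R x| ≤ K ^ 3 * (B * l2 u2) ^ 2 := by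
    refine (norm_integral_le_mul (by positivity) s.m1 s.m2 hR).trans ?_
    calc _ ≤ K ^ 3 * (B * l2 u2) * (B * l2 u2) := by gcongr
      _ = _ := by ring
  -- S is the exact primitive: three times its derivative is the combined integrand `Fn` minus the
  -- remainder `R`.
  let S : ℝ → ℝ := fun x => (g x * g x * g x) * (inner ℝ (u1 x) (u1 x) * det3 (u x) (u1 x) (u2 x))
  have wS := ((c.wd.mul c.wd).mul c.wd).mul ((s.wd1.inner s.wd1).mul (s.wd.det3 s.wd1 s.wd2))
  have iS : Integrable S := by
    refine integrable_of_le_mul (c := K ^ 3 * (B * l2 u2)) ?_ s.m1 s.m2 (uM.mono fun x hx => ?_)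
    · exact ((c.sm.aestronglyMeasurable.mul c.sm.aestronglyMeasurable).mul
        c.sm.aestronglyMeasurable).mul ((s.m1.1.inner s.m1.1).mul sX)
    · have h1 := c.bg x
      have h3 := hX x
      simp only [S, norm_mul, real_inner_self_eq_norm_sq, norm_pow, Real.norm_eq_abs, abs_norm]
      calc |g x| * |g x| * |g x| * (‖u1 x‖ ^ 2 * |det3 (u x) (u1 x) (u2 x)|)
          ≤ K * K * K * ((B * l2 u2) * (‖u1 x‖ * ‖u2 x‖)) := by gcongr
        _ = _ := by ring
  let Fn : ℝ → ℝ := fun x => -2 * inner ℝ (p1 x) (g x • v1 x)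
    - 5 / 2 * ((g x * ‖u1 x‖ ^ 2) * (g x * (2 * inner ℝ (u1 x) (v1 x))))
  have iF : Integrable Fn := (i2.const_mul (-2)).sub (j2.const_mul (5 / 2))
  have iS' := ((iF.sub iR).const_mul (1 / 3)).congr (g := fun x =>
      ((g1 x * g x + g x * g1 x) * g x + g x * g x * g1 x) *
        (inner ℝ (u1 x) (u1 x) * det3 (u x) (u1 x) (u2 x)) +
      g x * g x * g x *
        ((inner ℝ (u2 x) (u1 x) + inner ℝ (u1 x) (u2 x)) * det3 (u x) (u1 x) (u2 x) +
          inner ℝ (u1 x) (u1 x) * (det3 (u1 x) (u1 x) (u2 x) + det3 (u x) (u2 x) (u2 x)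
            + det3 (u x) (u1 x) (u3 x)))) (by
    filter_upwards [s.inner_one, s.inner_two, s.inner_three] with x o1 o2 o3
    have a1 := det3_flux_flux (g x) (g1 x) (g2 x) (s.sph x) o1 o2 o3
    have a2 : inner ℝ (p1 x) (v1 x) = _ := (inner_velD_p1 (u x) (u1 x) (p x) (p1 x)).trans a1
    have a3 : inner ℝ (u1 x) (v1 x) = _ := inner_velD_u1 (g x) (g1 x) (g2 x) (u x) (u1 x) (u2 x) (u3 x)
    simp only [Fn, R, Pi.sub_apply]
    rw [real_inner_smul_right, a2, a3, det3_self_left, det3_self_right, real_inner_self_eq_norm_sq,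
      real_inner_comm (u1 x) (u2 x)]
    ring)
  have z := wS.integral_eq_zero iS iS'
  have hS' : ∫ x, 1 / 3 * (Fn x - R x) = 0 := by
    rw [← z]
    refine integral_congr_ae ?_
    filter_upwards [s.inner_one, s.inner_two, s.inner_three] with x o1 o2 o3
    have a1 := det3_flux_flux (g x) (g1 x) (g2 x) (s.sph x) o1 o2 o3
    have a2 : inner ℝ (p1 x) (v1 x) = _ := (inner_velD_p1 (u x) (u1 x) (p x) (p1 x)).trans a1
    have a3 : inner ℝ (u1 x) (v1 x) = _ := inner_velD_u1 (g x) (g1 x) (g2 x) (u x) (u1 x) (u2 x) (u3 x)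
    simp only [Fn, R]
    rw [real_inner_smul_right, a2, a3, det3_self_left, det3_self_right, real_inner_self_eq_norm_sq,
      real_inner_comm (u1 x) (u2 x)]
    ring
  rw [integral_const_mul, integral_sub iF iR] at hS'
  have hF : ∫ x, Fn x = -2 * (∫ x, inner ℝ (p1 x) (g x • v1 x))
      - 5 / 2 * ∫ x, (g x * ‖u1 x‖ ^ 2) * (g x * (2 * inner ℝ (u1 x) (v1 x))) := by
    rw [← integral_const_mul, ← integral_const_mul, ← integral_sub (i2.const_mul _) (j2.const_mul _)]
  simp only [inner_add_right, mul_add]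
  rw [integral_add i1 i2, integral_add j1 j2, t1]
  have e1 := abs_le.1 t1'
  have e2 := abs_le.1 hbound
  have e3 := abs_le.1 bR
  simp only [inner_add_right] at e1 ⊢
  linarith [e1.1, e1.2, e2.1, e2.2, e3.1, e3.2]

theorem CoefSlice.l2_two_le (c : CoefSlice α K g g1 g2) (s : MapSlice u u1 u2 u3) :
    α * l2 u2 ≤ l2 (fluxD g g1 u1 u2) + K * l2 u1 := by
  have m1 := memLp_bdd_smul c.sm1.aestronglyMeasurable (Eventually.of_forall c.bg1) s.m1
  have mp := (c.memLp_flux s.m1 s.m2).1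
  have b1 := l2_bdd_smul_le c.K_nonneg (Eventually.of_forall c.bg1) s.m1
  have b2 := l2_sub_le mp m1
  have b3 : l2 u2 ≤ α⁻¹ * l2 (fun x => fluxD g g1 u1 u2 x - g1 x • u1 x) := by
    refine l2_le (inv_nonneg.2 c.pos.le) (mp.sub m1) (Eventually.of_forall fun x => ?_)
    have hα := c.pos
    have hl := c.lower x
    rw [fluxD, add_sub_cancel_right, norm_smul, Real.norm_of_nonneg (hα.le.trans hl),
      ← div_eq_inv_mul, le_div_iff₀ hα, mul_comm]
    exact mul_le_mul_of_nonneg_right hl (norm_nonneg _)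
  rw [← div_eq_inv_mul, le_div_iff₀ c.pos, mul_comm] at b3
  linarith

end slices

/-- The quartic energy enters with a minus sign. Its value at time t is moved to the right-hand side
and estimated there, while its initial value has the favourable sign and is dropped. -/
theorem Sol.second_energy_le {T α K M : ℝ} (hT : 0 < T) {c : Coef T α K} (s : Sol c M) {B : ℝ}
    (hB : ∀ᵐ t ∂(volume.restrict (Ioo 0 T)), l2 (s.u1 t) ≤ B) : ∃ J : ℝ → ℝ,
    IntegrableOn J (Ioo 0 T) ∧
    (∀ᵐ t ∂(volume.restrict (Ioo 0 T)), l2 (s.p t) ^ 2 ≤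
      5 / 4 * (K ^ 2 * (B * l2 (s.u2 t) * B ^ 2)) + l2 (fluxD c.gi c.gi1 s.i1 s.i2) ^ 2
        + ∫ r in (0:ℝ)..t, J r) ∧
    ∀ᵐ t ∂(volume.restrict (Ioo 0 T)), J t ≤ 2 * (K * (B + l2 (s.u2 t)) * (K * (B + l2 (s.u2 t))))
      + 5 / 2 * (K ^ 2 * (B * l2 (s.u2 t) * B ^ 2)) + K ^ 3 * (B * l2 (s.u2 t)) ^ 2 := by
  obtain ⟨hα, hK⟩ := c.gi_le
  set V := M * (K * (M + M)) + K * (M + 2 * M + M) with hV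
  have hdiff := TP.deriv_energy (M := K * M + K * (M + M) + K * (M + 2 * M + M) + (K * M + K * V)) hT
    (ζ1 := s.p) (ζ2 := s.p1) (ζ01 := fluxD c.gi c.gi1 s.i1 s.i2)
    (TP.smul hT c.tp s.tp1) (c.mg.smul s.ju1) s.jp1 s.jp
    ((c.mgt.smul s.ju1).add (c.mg.smul s.jv1)) (c.init.sm.smul s.init.sm1)
    ((JM.fluxD (JM.const c.init.sm) (JM.const c.init.sm1) (JM.const s.init.sm1)
      (JM.const s.init.sm2)).slice 0) (c.init.wd_flux s.init.wd1) (c.init.memLp_smul s.init.m1)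
    (c.init.memLp_flux s.init.m1 s.init.m2).1 (by
      filter_upwards [s.slice, c.slice] with t ⟨h, b1, b2, b3⟩ hc
      have hM := (l2_nonneg _).trans b1
      have a1 := hc.memLp_flux h.m1 h.m2
      have a2 := hc.memLp_fluxDD h.m1 h.m2 h.m3
      have a3 := hc.memLp_velD h b1 b2 b3
      have a4 := memLp_bdd_smul (c.mgt.slice t).aestronglyMeasurable
        (Eventually.of_forall (c.bgt t)) h.m1
      have a5 := l2_bdd_smul_le hK (Eventually.of_forall (c.bgt t)) h.m1
      have a6 := l2_bdd_smul_le hK (Eventually.of_forall hc.bg) a3.1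
      have hV0 : 0 ≤ V := (l2_nonneg _).trans a3.2
      have x1 : K * (l2 (s.u1 t) + l2 (s.u2 t)) ≤ K * (M + M) := by gcongr
      have x2 : K * (l2 (s.u1 t) + 2 * l2 (s.u2 t) + l2 (s.u3 t)) ≤ K * (M + 2 * M + M) := by gcongr
      have x3 : K * l2 (s.u1 t) ≤ K * M := by gcongr
      have x4 : K * l2 (velD (c.g t) (c.g1 t) (c.g2 t) (s.u t) (s.u1 t) (s.u2 t) (s.u3 t)) ≤ K * V :=
        mul_le_mul_of_nonneg_left a3.2 hK
      have y1 : 0 ≤ K * M := by positivity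
      have y2 : 0 ≤ K * (M + M) := by positivity
      have y3 : 0 ≤ K * (M + 2 * M + M) := by positivity
      have y4 : 0 ≤ K * V := by positivity
      refine ⟨hc.wd_flux h.wd1, hc.wd_fluxD h.wd1 h.wd2, hc.memLp_smul h.m1,
        ⟨a1.1, a1.2.trans (by linarith)⟩, ⟨a2.1, a2.2.trans (by linarith)⟩,
        a4.add (hc.memLp_smul a3.1), (l2_add_le a4 (hc.memLp_smul a3.1)).trans (by linarith)⟩)
  have hmu : TP T (fun t x => c.g t x * ‖s.u1 t x‖ ^ 2) (fun x => c.gi x * ‖s.i1 x‖ ^ 2)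
      (fun t x => c.gt t x * ‖s.u1 t x‖ ^ 2 + c.g t x * (2 * inner ℝ (s.u1 t x) (s.v1 t x))) := by
    refine (TP.mul hT c.tp (TP.inner hT s.tp1 s.tp1)).congr (fun t x => ?_) (fun x => ?_)
      (fun t x => ?_)
    · rw [real_inner_self_eq_norm_sq]
    · rw [real_inner_self_eq_norm_sq]
    · rw [real_inner_self_eq_norm_sq, real_inner_comm (s.u1 t x), Sol.v1]; ring
  have jm : JM (fun t x => ‖s.u1 t x‖ ^ 2) := (StronglyMeasurable.norm s.ju1).pow 2
  have init_mu := s.init.memLp_bdd_mul_sq c.init.sm c.init.bg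
    (s.init.ae_norm_u1_le (le_max_left _ (l2 s.i2)) (le_max_right _ _))
  -- The quartic energy is the plain L² energy of the scalar function g |u1|².
  have hq := TP.weighted_energy (M := K * M * M + K * (2 * M) * V) hT zero_le_one
    (g := fun _ _ => 1) (gi := fun _ => 1) (gt := fun _ _ => 0) (TP.const T _)
    stronglyMeasurable_const stronglyMeasurable_const stronglyMeasurable_const (by simp) (by simp)
    (by simp) hmu (c.mg.mul jm) ((c.mgt.mul jm).add
      (c.mg.mul ((s.ju1.inner s.jv1).const_smul (2:ℝ)))) (c.init.sm.mul (s.init.sm1.norm.pow 2))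
    init_mu.1 (by
      filter_upwards [s.slice, c.slice] with t ⟨h, b1, b2, b3⟩ hc
      have hM := (l2_nonneg _).trans b1
      have bM := h.ae_norm_u1_le b1 b2
      have a3 := hc.memLp_velD h b1 b2 b3
      have d1 := h.memLp_bdd_mul_sq hc.sm hc.bg bM
      have d2 := h.memLp_bdd_mul_sq (c.mgt.slice t) (c.bgt t) bM
      have d3 := h.memLp_bdd_mul_inner hc.sm hc.bg bM a3.1
      have hV0 : 0 ≤ V := (l2_nonneg _).trans a3.2
      have x1 : K * M * l2 (s.u1 t) ≤ K * M * M := by gcongr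
      have x2 : K * (2 * M) * l2 (velD (c.g t) (c.g1 t) (c.g2 t) (s.u t) (s.u1 t) (s.u2 t) (s.u3 t))
        ≤ K * (2 * M) * V := mul_le_mul_of_nonneg_left a3.2 (by positivity)
      have y : 0 ≤ K * (2 * M) * V := by positivity
      exact ⟨⟨d1.1, d1.2.trans (by linarith)⟩, d2.1.add d3.1,
        (l2_add_le d2.1 d3.1).trans (by linarith [d2.2, d3.2])⟩)
  simp only [zero_mul, integral_zero, zero_add, one_mul] at hq
  have jz : JM (fun t x => c.gt t x • s.u1 t x + c.g t x • s.v1 t x) :=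
    (c.mgt.smul s.ju1).add (c.mg.smul s.jv1)
  have hJa : IntegrableOn (fun t => -2 * ∫ x, inner ℝ (s.p1 t x)
      (c.gt t x • s.u1 t x + c.g t x • s.v1 t x)) (Ioo 0 T) := by
    refine ((s.jp1.inner jz).integrableOn_integral
      (C := K * (M + 2 * M + M) * (K * M + K * V)) ?_).const_mul (-2)
    filter_upwards [s.slice, c.slice] with t ⟨h, b1, b2, b3⟩ hc
    have hM := (l2_nonneg _).trans b1
    have a2 := hc.memLp_fluxDD h.m1 h.m2 h.m3
    have a3 := hc.memLp_velD h b1 b2 b3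
    have a4 := memLp_bdd_smul (c.mgt.slice t).aestronglyMeasurable
        (Eventually.of_forall (c.bgt t)) h.m1
    have a5 := l2_bdd_smul_le hK (Eventually.of_forall (c.bgt t)) h.m1
    have a6 := l2_bdd_smul_le hK (Eventually.of_forall hc.bg) a3.1
    refine (abs_integral_inner_le a2.1 (a4.add (hc.memLp_smul a3.1))).trans ?_
    have x2 : K * (l2 (s.u1 t) + 2 * l2 (s.u2 t) + l2 (s.u3 t)) ≤ K * (M + 2 * M + M) := by gcongr
    have x3 : K * l2 (s.u1 t) ≤ K * M := by gcongr
    have x4 : K * l2 (velD (c.g t) (c.g1 t) (c.g2 t) (s.u t) (s.u1 t) (s.u2 t) (s.u3 t)) ≤ K * V :=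
      mul_le_mul_of_nonneg_left a3.2 hK
    exact mul_le_mul (a2.2.trans x2) ((l2_add_le a4 (hc.memLp_smul a3.1)).trans (by linarith))
      (l2_nonneg _) (by positivity)
  refine ⟨_, hJa.sub (hq.1.const_mul (5 / 4)), ?_, ?_⟩
  · filter_upwards [hdiff, hq.2, s.slice, hB, ae_restrict_mem measurableSet_Ioo, c.slice]
      with t h1 h2 ⟨h, _⟩ hBt htT hc
    have q1 := h.abs_integral_quartic_le hc.bg hc.bg hBt
    have q0 : 0 ≤ ∫ x, ‖c.gi x * ‖s.i1 x‖ ^ 2‖ ^ 2 := integral_nonneg fun x => by positivity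
    have e : ∫ x, ‖c.g t x * ‖s.u1 t x‖ ^ 2‖ ^ 2 =
        ∫ x, (c.g t x * ‖s.u1 t x‖ ^ 2) * (c.g t x * ‖s.u1 t x‖ ^ 2) := by
      congr 1; ext x; rw [Real.norm_eq_abs, sq_abs, sq]
    rw [e] at h2
    have h0 : (0:ℝ) ∈ Icc 0 T := ⟨le_rfl, hT.le⟩
    simp only [Pi.sub_apply]
    rw [intervalIntegral.integral_sub
      (intervalIntegrable_of_Ioo hJa h0 (Ioo_subset_Icc_self htT))
      (intervalIntegrable_of_Ioo (hq.1.const_mul (5 / 4)) h0 (Ioo_subset_Icc_self htT)),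
      intervalIntegral.integral_const_mul (5 / 4)]
    have q1' := (abs_le.1 q1).2
    have h1' : l2 (s.p t) ^ 2 ≤ l2 (fluxD c.gi c.gi1 s.i1 s.i2) ^ 2 + ∫ r in (0:ℝ)..t,
      -2 * ∫ x, inner ℝ (s.p1 r x) (c.gt r x • s.u1 r x + c.g r x • s.v1 r x) := h1
    linarith
  · filter_upwards [s.slice, c.slice, c.wdt, hB] with t ⟨h, b1, b2, b3⟩ hc hwt hBt
    refine le_trans (le_of_eq ?_) (hc.integral_second_energy h (c.mgt.slice t) (c.mgt1.slice t) (c.bgt t)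
      (c.bgt1 t) hwt hBt)
    have e : ∀ a b : ℝ, inner ℝ a b = a * b := fun a b => mul_comm b a
    simp only [e, Pi.sub_apply, Sol.p1, Sol.v1]
    ring

theorem Sol.exists_bound_two {T α K : ℝ} (hT : 0 < T) (c : Coef T α K) (A B : ℝ) (hB0 : 0 ≤ B) :
    ∃ D, 0 ≤ D ∧ ∀ (M : ℝ) (s : Sol c M), l2 s.i1 ≤ A → l2 s.i2 ≤ A →
      (∀ᵐ t ∂(volume.restrict (Ioo 0 T)), l2 (s.u1 t) ≤ B) →
      ∀ᵐ t ∂(volume.restrict (Ioo 0 T)), l2 (s.u2 t) ≤ D := by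
  obtain ⟨hα, hK⟩ := c.gi_le
  set A' := 2 / α ^ 2 * ((5 / 2 * K ^ 2 * B ^ 3) ^ 2 / (2 * α ^ 2) + 2 * (K * (A + A)) ^ 2
    + 2 * K ^ 2 * B ^ 2) with hA'
  set C := 4 / α ^ 2 * (4 * K ^ 2 + 5 / 2 * K ^ 2 * B ^ 3 + K ^ 3 * B ^ 2) with hC
  set B' := 4 / α ^ 2 * (4 * K ^ 2 * B ^ 2 + 5 / 2 * K ^ 2 * B ^ 3) with hB'
  refine ⟨Real.sqrt (Real.exp (C * T) * (A' + T * B')), Real.sqrt_nonneg _,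
    fun M s hA1 hA2 hB => ?_⟩
  obtain ⟨J, hJ, h1, h2⟩ := s.second_energy_le hT hB
  have key : ∀ᵐ t ∂(volume.restrict (Ioo 0 T)),
      l2 (s.u2 t) ^ 2 ≤ Real.exp (C * T) * (A' + T * B') := by
    refine gronwall_of_le hT (by positivity) (by positivity) (by positivity)
      (s.ju2.integrableOn_l2_sq (M := M) (s.slice.mono fun t h => ⟨h.1.m2, h.2.2.1⟩))
      (hJ.const_mul (4 / α ^ 2)) ?_ ?_
    · filter_upwards [h1, hB, s.slice, c.slice] with t ht hBt ⟨h, _⟩ hc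
      rw [intervalIntegral.integral_const_mul]
      have n2 := l2_nonneg (s.u2 t)
      have e1 := hc.l2_two_le h
      have e2 : l2 (fluxD c.gi c.gi1 s.i1 s.i2) ≤ K * (A + A) :=
        (c.init.memLp_flux s.init.m1 s.init.m2).2.trans (by gcongr)
      have e3 := pow_le_pow_left₀ (l2_nonneg _) e2 2
      set y := l2 (s.u2 t)
      set P := l2 (s.p t)
      have e4 : α * y ≤ P + K * B := e1.trans (by
        have : K * l2 (s.u1 t) ≤ K * B := by gcongr
        exact add_le_add le_rfl this)
      have e5 : (α * y) ^ 2 ≤ 2 * P ^ 2 + 2 * (K * B) ^ 2 :=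
        (pow_le_pow_left₀ (by positivity) e4 2).trans (by nlinarith [sq_nonneg (P - K * B)])
      set I := ∫ r in (0:ℝ)..t, J r
      -- Young's inequality: the quartic term is linear in y, so half of (α y)² absorbs it at the
      -- price of a constant.
      have e6 : 5 / 2 * K ^ 2 * B ^ 3 * y ≤ (α * y) ^ 2 / 2
          + (5 / 2 * K ^ 2 * B ^ 3) ^ 2 / (2 * α ^ 2) := by
        have := sq_nonneg (α * y - (5 / 2 * K ^ 2 * B ^ 3) / α)
        have h3 : α * y * ((5 / 2 * K ^ 2 * B ^ 3) / α) = 5 / 2 * K ^ 2 * B ^ 3 * y := by field_simp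
        have h4 : ((5 / 2 * K ^ 2 * B ^ 3) / α) ^ 2 / 2 = (5 / 2 * K ^ 2 * B ^ 3) ^ 2 / (2 * α ^ 2) := by
          field_simp
        rw [← h3, ← h4]
        nlinarith
      have e7 : (α * y) ^ 2 / 2 ≤ (5 / 2 * K ^ 2 * B ^ 3) ^ 2 / (2 * α ^ 2) + 2 * (K * (A + A)) ^ 2
          + 2 * K ^ 2 * B ^ 2 + 2 * I := by
        have : 5 / 4 * (K ^ 2 * (B * y * B ^ 2)) = 1 / 2 * (5 / 2 * K ^ 2 * B ^ 3 * y) := by ring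
        nlinarith
      have e8 : y ^ 2 = 2 / α ^ 2 * ((α * y) ^ 2 / 2) := by field_simp
      rw [e8, hA', show (4:ℝ) / α ^ 2 * I = 2 / α ^ 2 * (2 * I) by ring, ← mul_add]
      exact mul_le_mul_of_nonneg_left e7 (by positivity)
    · filter_upwards [h2] with t ht
      rw [hC, hB', mul_assoc, ← mul_add]
      refine mul_le_mul_of_nonneg_left (ht.trans ?_) (by positivity)
      set y := l2 (s.u2 t)
      have z1 : 0 ≤ K ^ 2 * (B - y) ^ 2 := by positivity
      have z2 : 0 ≤ K ^ 2 * B ^ 3 * ((y - 1) ^ 2) := by positivity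
      have z3 : 0 ≤ K ^ 2 * B ^ 3 * (1 + y ^ 2) := by positivity
      nlinarith
  filter_upwards [key] with t ht
  exact Real.le_sqrt_of_sq_le ht

end SchrodingerMap

namespace SchrodingerMap

/-! ### The first energy of a linear problem and restriction in time -/

/-- A time slice of a solution of `w_t = U ∧ (g w_x)_x + N`. -/
structure LinearSlice (g g1 : ℝ → ℝ) (M B : ℝ) (U U1 w w1 w2 wt wt1 N N1 : ℝ → E3) : Prop where
  wd : WD w w1
  wd1 : WD w1 w2
  wdt : WD wt wt1
  wdN : WD N N1
  wdU : WD U U1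
  mU1 : AEStronglyMeasurable U1 volume
  bU : ∀ᵐ x, ‖U x‖ ≤ 1
  bU1 : ∀ᵐ x, ‖U1 x‖ ≤ B
  m : MemLp w 2
  b : l2 w ≤ M
  m1 : MemLp w1 2
  b1 : l2 w1 ≤ M
  m2 : MemLp w2 2
  mt : MemLp wt 2
  bt : l2 wt ≤ M
  mt1 : MemLp wt1 2
  bt1 : l2 wt1 ≤ M
  mN : MemLp N 2
  mN1 : MemLp N1 2
  eq : ∀ᵐ x, wt x = wedge (U x) (fluxD g g1 w1 w2 x) + N x

/-- Three linear problems share this energy: the increment from the datum, the quotient in time, and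
the difference of two solutions. The top order term disappears, and the forcing is left as two
integrals because each of the three uses estimates it in its own way. The L² part is added because N
involves w itself. -/
theorem h1_energy {T α K M B : ℝ} (hT : 0 < T) (hB : 0 ≤ B) (c : Coef T α K)
    {U U1 w w1 w2 wt wt1 N N1 : ℝ → ℝ → E3} {w0 w01 : ℝ → E3}
    (tp : TP T w w0 wt) (tp1 : TP T w1 w01 wt1) (jw : JM w) (jw1 : JM w1) (jt : JM wt)
    (jt1 : JM wt1) (s0 : StronglyMeasurable w0) (s01 : StronglyMeasurable w01)
    (m0 : MemLp w0 2) (m01 : MemLp w01 2)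
    (hs : ∀ᵐ t ∂(volume.restrict (Ioo 0 T)), LinearSlice (c.g t) (c.g1 t) M B (U t) (U1 t) (w t)
      (w1 t) (w2 t) (wt t) (wt1 t) (N t) (N1 t)) :
    ∃ J : ℝ → ℝ, IntegrableOn J (Ioo 0 T) ∧
    (∀ᵐ t ∂(volume.restrict (Ioo 0 T)), α * l2 (w1 t) ^ 2 + l2 (w t) ^ 2 ≤
      K * l2 w01 ^ 2 + l2 w0 ^ 2 + ∫ s in (0:ℝ)..t, J s) ∧
    ∀ᵐ t ∂(volume.restrict (Ioo 0 T)), J t ≤ K * l2 (w1 t) ^ 2 + 2 * (K * B * (l2 (w1 t) * l2 (w t)))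
      + 2 * (∫ x, c.g t x * inner ℝ (w1 t x) (N1 t x)) + 2 * ∫ x, inner ℝ (w t x) (N t x) := by
  obtain ⟨hα, hK⟩ := c.gi_le
  have E1 := TP.weighted_energy hT hK c.tp c.mg c.mgt c.init.sm c.bg c.bgt c.init.bg tp1 jw1 jt1
    s01 m01 (M := M) (hs.mono fun t h => ⟨⟨h.m1, h.b1⟩, h.mt1, h.bt1⟩)
  have E0 := TP.weighted_energy (g := fun _ _ => 1) (gi := fun _ => 1) (gt := fun _ _ => 0)
    hT zero_le_one (TP.const T _) stronglyMeasurable_const stronglyMeasurable_const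
    stronglyMeasurable_const (by simp) (by simp) (by simp) tp jw jt s0 m0 (M := M)
    (hs.mono fun t h => ⟨⟨h.m, h.b⟩, h.mt, h.bt⟩)
  simp only [zero_mul, integral_zero, zero_add, one_mul] at E0
  refine ⟨_, E1.1.add E0.1, ?_, ?_⟩
  · filter_upwards [E1.2, E0.2, hs, c.slice, ae_restrict_mem measurableSet_Ioo]
      with t h1 h0 h hc htT
    have h00 : (0:ℝ) ∈ Icc 0 T := ⟨le_rfl, hT.le⟩
    simp only [Pi.add_apply]
    rw [intervalIntegral.integral_add
      (intervalIntegrable_of_Ioo E1.1 h00 (Ioo_subset_Icc_self htT))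
      (intervalIntegrable_of_Ioo E0.1 h00 (Ioo_subset_Icc_self htT))]
    have a1 := hc.le_integral h.m1
    have a2 := (integral_mul_sq_le c.init.sm c.init.bg m01).2
    rw [l2_sq h.m, l2_sq m0]
    linarith
  · filter_upwards [hs, c.slice] with t h hc
    have a1 := (integral_mul_sq_le (c.mgt.slice t) (c.bgt t) h.m1).2
    have a2 := hc.integral_energy h.wd1 h.wdt h.wdN h.m1 h.m2 h.mt h.mt1 h.mN h.mN1 h.eq
    have a3 := hc.integral_energy_zero h.wd h.wd1 h.wdU h.bU h.bU1 h.mU1 h.m h.m1 h.m2 h.mN h.eq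
    have a4 : |∫ x, - (c.g t x * det3 (w1 t x) (w t x) (U1 t x))| ≤
        K * B * (l2 (w1 t) * l2 (w t)) := by
      refine norm_integral_le_mul (H := fun x => - (c.g t x * det3 (w1 t x) (w t x) (U1 t x)))
        (by positivity) h.m1 h.m (h.bU1.mono fun x hx => ?_)
      have b1 := abs_det3_le (w1 t x) (w t x) (U1 t x)
      have b2 := hc.bg x
      rw [norm_neg, norm_mul, Real.norm_eq_abs, Real.norm_eq_abs]
      calc |c.g t x| * |det3 (w1 t x) (w t x) (U1 t x)|
          ≤ K * (‖w1 t x‖ * ‖w t x‖ * B) := by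
            have : |det3 (w1 t x) (w t x) (U1 t x)| ≤ ‖w1 t x‖ * ‖w t x‖ * B :=
              b1.trans (by gcongr)
            gcongr
        _ = _ := by ring
    simp only [Pi.add_apply]
    rw [a2, a3]
    have := (abs_le.1 a4).2
    linarith

theorem TP.mono {E : Type*} [NormedAddCommGroup E] [NormedSpace ℝ E] {T S : ℝ} (hST : S ≤ T)
    {f f' : ℝ → ℝ → E} {f₀ : ℝ → E} (h : TP T f f₀ f') : TP S f f₀ f' := by
  have hs : Ioo 0 S ⊆ Ioo 0 T := Ioo_subset_Ioo_right hST
  filter_upwards [h] with x hx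
  exact ⟨hx.1.mono_set hs, ae_restrict_of_ae_restrict_of_subset hs hx.2⟩

/-- Restriction of a coefficient to a shorter time interval. -/
def Coef.restrict {T α K : ℝ} (c : Coef T α K) {S : ℝ} (hS : S ≤ T) : Coef S α K where
  g := c.g
  g1 := c.g1
  g2 := c.g2
  gt := c.gt
  gt1 := c.gt1
  gt2 := c.gt2
  gi := c.gi
  gi1 := c.gi1
  gi2 := c.gi2
  mg := c.mg
  mg1 := c.mg1
  mg2 := c.mg2
  mgt := c.mgt
  mgt1 := c.mgt1
  mgt2 := c.mgt2
  bgt := c.bgt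
  bgt1 := c.bgt1
  bgt2 := c.bgt2
  lower := c.lower
  bg := c.bg
  slice := ae_restrict_of_ae_restrict_of_subset (Ioo_subset_Ioo_right hS) c.slice
  wdt := ae_restrict_of_ae_restrict_of_subset (Ioo_subset_Ioo_right hS) c.wdt
  init := c.init
  tp := c.tp.mono hS
  tp1 := c.tp1.mono hS
  tp2 := c.tp2.mono hS

end SchrodingerMap

namespace SchrodingerMap

/-! ### Increments in time -/

variable {E : Type*} [NormedAddCommGroup E] [NormedSpace ℝ E] [CompleteSpace E]

theorem ae_Ioo_shift {T h : ℝ} (hh : 0 < h) {P : ℝ → Prop}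
    (H : ∀ᵐ t ∂(volume.restrict (Ioo 0 T)), P t) :
    ∀ᵐ t ∂(volume.restrict (Ioo 0 (T - h))), P (t + h) := by
  rw [ae_restrict_iff' measurableSet_Ioo] at H ⊢
  filter_upwards [(measurePreserving_add_right volume h).quasiMeasurePreserving.ae H] with t ht htI
  exact ht ⟨by linarith [htI.1], by linarith [htI.2]⟩

theorem ae_Ioo_mono {T S : ℝ} (hS : S ≤ T) {P : ℝ → Prop}
    (H : ∀ᵐ t ∂(volume.restrict (Ioo 0 T)), P t) :
    ∀ᵐ t ∂(volume.restrict (Ioo 0 S)), P t :=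
  ae_restrict_of_ae_restrict_of_subset (Ioo_subset_Ioo_right hS) H

theorem TP.shift {T : ℝ} {f f' : ℝ → ℝ → E} {f₀ : ℝ → E} (H : TP T f f₀ f') (jf : JM f)
    (jf' : JM f') (s0 : StronglyMeasurable f₀) :
    ∀ᵐ h ∂(volume.restrict (Ioo 0 T)),
      TP (T - h) (fun t x => f (t + h) x) (f h) (fun t x => f' (t + h) x) := by
  filter_upwards [H.ae_ae jf jf' s0, ae_restrict_mem measurableSet_Ioo] with h hh hI
  filter_upwards [hh, H] with x h1 ⟨hx1, hx2⟩
  have hmp : MeasurePreserving (fun t : ℝ => t + h) volume volume := measurePreserving_add_right _ h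
  have hint : IntegrableOn (fun s => f' (s + h) x) (Ioo 0 (T - h)) := by
    have := (hmp.integrableOn_comp_preimage (measurableEmbedding_addRight h)
      (f := fun s => f' s x) (s := Ioo h T)).2 (hx1.mono_set (Ioo_subset_Ioo_left hI.1.le))
    simp only [preimage_add_const_Ioo, sub_self] at this
    exact this
  refine ⟨hint, ?_⟩
  filter_upwards [ae_Ioo_shift hI.1 hx2, ae_restrict_mem measurableSet_Ioo] with t ht htI
  have e0 : (0:ℝ) ∈ Icc 0 T := ⟨le_rfl, (hI.1.trans hI.2).le⟩
  have eh : h ∈ Icc 0 T := Ioo_subset_Icc_self hI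
  have et : t + h ∈ Icc 0 T := ⟨by linarith [htI.1, hI.1], by linarith [htI.2]⟩
  rw [ht, h1, intervalIntegral.integral_comp_add_right (fun s => f' s x), zero_add, add_assoc,
    intervalIntegral.integral_add_adjacent_intervals (intervalIntegrable_of_Ioo hx1 e0 eh)
      (intervalIntegrable_of_Ioo hx1 eh et)]

theorem TP.l2_increment {T V h : ℝ} (hV : 0 ≤ V) (hh : 0 < h) {f f' : ℝ → ℝ → E} {f₀ : ℝ → E}
    (H : TP T f f₀ f') (jf : JM f) (jf' : JM f') (s0 : StronglyMeasurable f₀)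
    (hs : ∀ᵐ t ∂(volume.restrict (Ioo 0 T)), MemLp (f' t) 2 ∧ l2 (f' t) ≤ V) :
    ∀ᵐ t ∂(volume.restrict (Ioo 0 (T - h))), MemLp (fun x => f (t + h) x - f t x) 2 ∧
      l2 (fun x => f (t + h) x - f t x) ≤ h * V := by
  have H' := H.ae_ae jf jf' s0
  filter_upwards [ae_Ioo_shift hh H', ae_Ioo_mono (by linarith) H',
    ae_restrict_mem measurableSet_Ioo] with t h1 h2 htI
  have hsub : Ioo t (t + h) ⊆ Ioo 0 T := Ioo_subset_Ioo htI.1.le (by linarith [htI.2])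
  obtain ⟨-, m, hl⟩ := memLp_integral jf' (by linarith : t ≤ t + h) hV
    (ae_restrict_of_ae_restrict_of_subset hsub hs)
  have e : (fun x => f (t + h) x - f t x) =ᵐ[volume] fun x => ∫ s in t..(t + h), f' s x := by
    filter_upwards [h1, h2, H] with x e1 e2 ⟨hx, _⟩
    have e0 : (0:ℝ) ∈ Icc 0 T := ⟨le_rfl, by linarith [htI.1, htI.2]⟩
    have eh : t ∈ Icc 0 T := ⟨htI.1.le, by linarith [htI.2]⟩
    have et : t + h ∈ Icc 0 T := ⟨by linarith [htI.1], by linarith [htI.2]⟩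
    rw [e1, e2, add_sub_add_left_eq_sub, intervalIntegral.integral_interval_sub_left
      (intervalIntegrable_of_Ioo hx e0 et) (intervalIntegrable_of_Ioo hx e0 eh)]
  rw [l2_congr e]
  refine ⟨(memLp_congr_ae e).2 m, hl.trans (by rw [add_sub_cancel_left])⟩

theorem TP.l2_sub_init {T V : ℝ} (hV : 0 ≤ V) {f f' : ℝ → ℝ → E} {f₀ : ℝ → E}
    (H : TP T f f₀ f') (jf : JM f) (jf' : JM f') (s0 : StronglyMeasurable f₀)
    (hs : ∀ᵐ t ∂(volume.restrict (Ioo 0 T)), MemLp (f' t) 2 ∧ l2 (f' t) ≤ V) :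
    ∀ᵐ t ∂(volume.restrict (Ioo 0 T)), MemLp (fun x => f t x - f₀ x) 2 ∧
      l2 (fun x => f t x - f₀ x) ≤ t * V := by
  filter_upwards [H.ae_ae jf jf' s0, ae_restrict_mem measurableSet_Ioo] with t h1 htI
  have hsub : Ioo 0 t ⊆ Ioo 0 T := Ioo_subset_Ioo_right htI.2.le
  obtain ⟨-, m, hl⟩ := memLp_integral jf' htI.1.le hV
    (ae_restrict_of_ae_restrict_of_subset hsub hs)
  have e : (fun x => f t x - f₀ x) =ᵐ[volume] fun x => ∫ s in (0:ℝ)..t, f' s x := by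
    filter_upwards [h1] with x e1
    rw [e1, add_sub_cancel_left]
  rw [l2_congr e]
  refine ⟨(memLp_congr_ae e).2 m, hl.trans (by rw [sub_zero])⟩

theorem memLp_fluxD_of_ae {g g1 : ℝ → ℝ} {K : ℝ} (hK : 0 ≤ K) (sg : StronglyMeasurable g)
    (sg1 : StronglyMeasurable g1) (b : ∀ᵐ x, |g x| ≤ K) (b1 : ∀ᵐ x, |g1 x| ≤ K)
    {f1 f2 : ℝ → E3} (h1 : MemLp f1 2) (h2 : MemLp f2 2) : MemLp (fluxD g g1 f1 f2) 2 ∧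
      l2 (fluxD g g1 f1 f2) ≤ K * (l2 f1 + l2 f2) := by
  have m1 := memLp_bdd_smul sg.aestronglyMeasurable b h2
  have m2 := memLp_bdd_smul sg1.aestronglyMeasurable b1 h1
  refine ⟨m1.add m2, (l2_add_le m1 m2).trans ?_⟩
  have := l2_bdd_smul_le hK b h2
  have := l2_bdd_smul_le hK b1 h1
  linarith

theorem memLp_fluxDD_of_ae {g g1 g2 : ℝ → ℝ} {K : ℝ} (hK : 0 ≤ K) (sg : StronglyMeasurable g)
    (sg1 : StronglyMeasurable g1) (sg2 : StronglyMeasurable g2) (bg : ∀ᵐ x, |g x| ≤ K)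
    (bg1 : ∀ᵐ x, |g1 x| ≤ K) (bg2 : ∀ᵐ x, |g2 x| ≤ K)
    {f1 f2 f3 : ℝ → E3} (h1 : MemLp f1 2) (h2 : MemLp f2 2) (h3 : MemLp f3 2) :
    MemLp (fluxDD g g1 g2 f1 f2 f3) 2 ∧
      l2 (fluxDD g g1 g2 f1 f2 f3) ≤ K * (l2 f1 + 2 * l2 f2 + l2 f3) := by
  have b : ∀ᵐ x, |2 * g1 x| ≤ 2 * K := bg1.mono fun x hx => by
    rw [abs_mul, abs_two]; linarith
  have m3 := memLp_bdd_smul sg.aestronglyMeasurable bg h3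
  have m2 := memLp_bdd_smul (sg1.const_mul 2).aestronglyMeasurable b h2
  have m1 := memLp_bdd_smul sg2.aestronglyMeasurable bg2 h1
  refine ⟨(m3.add m2).add m1, (l2_add_le (m3.add m2) m1).trans ?_⟩
  have := l2_add_le m3 m2
  have := l2_bdd_smul_le hK bg h3
  have := l2_bdd_smul_le (by linarith) b h2
  have := l2_bdd_smul_le hK bg2 h1
  have e : l2 (fluxDD g g1 g2 f1 f2 f3) =
    l2 (fun x => ((fun x => g x • f3 x) + fun x => (2 * g1 x) • f2 x) x + g2 x • f1 x) := rfl
  simp only [Pi.add_def] at *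
  linarith

theorem integral_bdd_inner_le {k : ℝ → ℝ} {K : ℝ} (hK : 0 ≤ K) (hk : ∀ᵐ x, |k x| ≤ K)
    {a b : ℝ → E3} (ha : MemLp a 2) (hb : MemLp b 2) :
    |∫ x, k x * inner ℝ (a x) (b x)| ≤ K * (l2 a * l2 b) := by
  refine norm_integral_le_mul (H := fun x => k x * inner ℝ (a x) (b x)) hK ha hb
    (hk.mono fun x hx => ?_)
  rw [norm_mul]
  exact mul_le_mul hx (abs_real_inner_le_norm _ _) (norm_nonneg _) hK

theorem Sol.l2_v1_le {T α K M : ℝ} {c : Coef T α K} (s : Sol c M) :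
    ∀ᵐ t ∂(volume.restrict (Ioo 0 T)), (MemLp (s.v t) 2 ∧ l2 (s.v t) ≤ K * (M + M)) ∧
      MemLp (s.v1 t) 2 ∧ l2 (s.v1 t) ≤ M * (K * (M + M)) + K * (M + 2 * M + M) := by
  filter_upwards [s.slice, c.slice] with t ⟨h, b1, b2, b3⟩ hc
  have hK := hc.K_nonneg
  have := hc.memLp_vel h
  exact ⟨⟨this.1, this.2.trans (by gcongr)⟩, hc.memLp_velD h b1 b2 b3⟩

/-- Young's inequality with weight τ. On an interval of length τ the rate (1/α + 1)/τ costs only a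
fixed exponential factor, whereas the forcing contributes τ · τ. This produces an increment of size
O(τ) in H¹, rather than the O(τ^{1/2}) of a fixed weight. -/
theorem increment_rate_le {α K B τ : ℝ} (hα : 0 < α) (hK : 0 ≤ K) (hB : 0 ≤ B) (hτ : 0 < τ)
    (a b n n1 : ℝ) :
    K * a ^ 2 + 2 * (K * B * (a * b)) + 2 * (K * (a * n1)) + 2 * (b * n) ≤
      (K / α + K * B * (1 / α + 1) + (1 / α + 1) / τ) * (α * a ^ 2 + b ^ 2)
        + τ * (K ^ 2 * n1 ^ 2 + n ^ 2) := by
  have y1 : 2 * (K * (a * n1)) ≤ a ^ 2 / τ + τ * (K ^ 2 * n1 ^ 2) := by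
    rw [← sub_nonneg]
    have : a ^ 2 / τ + τ * (K ^ 2 * n1 ^ 2) - 2 * (K * (a * n1)) = (a - τ * (K * n1)) ^ 2 / τ := by
      field_simp; ring
    rw [this]; positivity
  have y2 : 2 * (b * n) ≤ b ^ 2 / τ + τ * n ^ 2 := by
    rw [← sub_nonneg]
    have : b ^ 2 / τ + τ * n ^ 2 - 2 * (b * n) = (b - τ * n) ^ 2 / τ := by
      field_simp; ring
    rw [this]; positivity
  have e : 1 / α * (α * a ^ 2 + b ^ 2) = a ^ 2 + b ^ 2 / α := by field_simp
  have e0 : 0 ≤ b ^ 2 / α := by positivity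
  have e1 : 0 ≤ α * a ^ 2 := by positivity
  have z1 : a ^ 2 ≤ 1 / α * (α * a ^ 2 + b ^ 2) := by linarith
  have z2 : b ^ 2 ≤ α * a ^ 2 + b ^ 2 := by linarith
  have z : a ^ 2 + b ^ 2 ≤ (1 / α + 1) * (α * a ^ 2 + b ^ 2) := by linarith
  have z3 : K * B * (2 * (a * b)) ≤ K * B * ((1 / α + 1) * (α * a ^ 2 + b ^ 2)) :=
    mul_le_mul_of_nonneg_left (by linarith [sq_nonneg (a - b)]) (mul_nonneg hK hB)
  have z4 : K * a ^ 2 ≤ K * (1 / α * (α * a ^ 2 + b ^ 2)) := mul_le_mul_of_nonneg_left z1 hK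
  have z5 : 1 / τ * (a ^ 2 + b ^ 2) ≤ 1 / τ * ((1 / α + 1) * (α * a ^ 2 + b ^ 2)) :=
    mul_le_mul_of_nonneg_left z (by positivity)
  have z6 : a ^ 2 / τ + b ^ 2 / τ = 1 / τ * (a ^ 2 + b ^ 2) := by ring
  have z7 : (K / α + K * B * (1 / α + 1) + (1 / α + 1) / τ) * (α * a ^ 2 + b ^ 2) =
      K * (1 / α * (α * a ^ 2 + b ^ 2)) + K * B * ((1 / α + 1) * (α * a ^ 2 + b ^ 2)) +
      1 / τ * ((1 / α + 1) * (α * a ^ 2 + b ^ 2)) := by ring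
  rw [z7]
  linarith

theorem Sol.bound_nonneg {T α K M : ℝ} (hT : 0 < T) {c : Coef T α K} (s : Sol c M) : 0 ≤ M := by
  have : NeZero (volume.restrict (Ioo 0 T)) := ⟨by simp [hT]⟩
  obtain ⟨t, ht⟩ := s.slice.exists
  exact (l2_nonneg _).trans ht.2.1

/-- Linear growth in time of the increment from the initial datum. -/
theorem Sol.exists_init_increment_le {T α K : ℝ} (c : Coef T α K) (A B : ℝ)
    (hA0 : 0 ≤ A) (hB0 : 0 ≤ B) :
    ∃ C, 0 ≤ C ∧ ∀ (M : ℝ) (s : Sol c M), l2 s.i1 ≤ A → l2 s.i2 ≤ A → l2 s.i3 ≤ A →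
      (∀ᵐ t ∂(volume.restrict (Ioo 0 T)), l2 (s.u1 t) ≤ B ∧ l2 (s.u2 t) ≤ B) →
      ∀ τ ∈ Ioc 0 T, ∀ᵐ t ∂(volume.restrict (Ioo 0 τ)),
        α * l2 (fun x => s.u1 t x - s.i1 x) ^ 2 + l2 (fun x => s.u t x - s.i0 x) ^ 2 ≤ C * τ ^ 2 := by
  obtain ⟨hα, hK⟩ := c.gi_le
  set n := K * (A + A) with hn
  set n1 := B * (K * (A + A)) + K * (A + 2 * A + A) with hn1
  set κ := K ^ 2 * n1 ^ 2 + n ^ 2 with hκ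
  set C1 := K / α + K * B * (1 / α + 1) with hC1
  have n0 : 0 ≤ n := by positivity
  have n10 : 0 ≤ n1 := by positivity
  have C10 : 0 ≤ C1 := by positivity
  refine ⟨Real.exp (C1 * T + (1 / α + 1)) * κ, by positivity, fun M s hA1 hA2 hA3 hB τ hτ => ?_⟩
  have hτ0 := hτ.1
  have hT : 0 < T := hτ0.trans_le hτ.2
  have hM := s.bound_nonneg hT
  set V := K * (M + M)
  set V1 := M * (K * (M + M)) + K * (M + 2 * M + M)
  have hV : 0 ≤ V := by positivity
  have hV1 : 0 ≤ V1 := by positivity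
  have inc0 := TP.l2_sub_init hV s.tp s.ju s.jv s.init.sm (s.l2_v1_le.mono fun t h => h.1)
  have inc1 := TP.l2_sub_init hV1 s.tp1 s.ju1 s.jv1 s.init.sm1 (s.l2_v1_le.mono fun t h => h.2)
  set c' := c.restrict hτ.2
  have ltp : TP T (fun t x => s.u t x - s.i0 x) (fun _ => 0) s.v :=
    (s.tp.sub (TP.const T s.i0)).congr (fun _ _ => rfl) (fun _ => sub_self _)
      (fun _ _ => sub_zero _)
  have ltp1 : TP T (fun t x => s.u1 t x - s.i1 x) (fun _ => 0) s.v1 :=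
    (s.tp1.sub (TP.const T s.i1)).congr (fun _ _ => rfl) (fun _ => sub_self _)
      (fun _ _ => sub_zero _)
  have jw0 : JM (fun t x => s.u t x - s.i0 x) := s.ju.sub (JM.const s.init.sm)
  have jw1 : JM (fun t x => s.u1 t x - s.i1 x) := s.ju1.sub (JM.const s.init.sm1)
  -- Subtracting the datum gives u_t = u ∧ (g (u − u₀)_x)_x + u ∧ (g u₀')_x. The forcing, in which
  -- the datum is frozen, is bounded in H¹ because u₀ has three square integrable derivatives.
  have slice : ∀ᵐ t ∂(volume.restrict (Ioo 0 T)),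
      LinearSlice (c.g t) (c.g1 t) (T * V + T * V1 + V + V1) B (s.u t) (s.u1 t)
      (fun x => s.u t x - s.i0 x) (fun x => s.u1 t x - s.i1 x) (fun x => s.u2 t x - s.i2 x)
      (s.v t) (s.v1 t) (fun x => wedge (s.u t x) (fluxD (c.g t) (c.g1 t) s.i1 s.i2 x))
      (fun x => wedge (s.u1 t x) (fluxD (c.g t) (c.g1 t) s.i1 s.i2 x) +
        wedge (s.u t x) (fluxDD (c.g t) (c.g1 t) (c.g2 t) s.i1 s.i2 s.i3 x)) ∧
      l2 (fun x => wedge (s.u t x) (fluxD (c.g t) (c.g1 t) s.i1 s.i2 x)) ≤ n ∧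
      l2 (fun x => wedge (s.u1 t x) (fluxD (c.g t) (c.g1 t) s.i1 s.i2 x) +
        wedge (s.u t x) (fluxDD (c.g t) (c.g1 t) (c.g2 t) s.i1 s.i2 s.i3 x)) ≤ n1 := by
    filter_upwards [s.slice, c.slice, hB, inc0, inc1, s.l2_v1_le, ae_restrict_mem measurableSet_Ioo]
      with t ⟨h, _⟩ hc ⟨hb1, hb2⟩ ⟨p0, q0⟩ ⟨p1, q1⟩ ⟨⟨p2, q2⟩, p3, q3⟩ htI
    have tv : t * V ≤ T * V := by have := htI.2; gcongr
    have tv1 : t * V1 ≤ T * V1 := by have := htI.2; gcongr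
    have y1 : 0 ≤ T * V := by positivity
    have y2 : 0 ≤ T * V1 := by positivity
    have f1 := hc.memLp_flux s.init.m1 s.init.m2
    have f2 := hc.memLp_fluxDD s.init.m1 s.init.m2 s.init.m3
    have bU1 := h.ae_norm_u1_le hb1 hb2
    have g1 := memLp_wedge_left zero_le_one h.sm.aestronglyMeasurable
      (Eventually.of_forall fun x => (h.sph x).le) f1.1
    have g2 := memLp_wedge_left zero_le_one h.sm.aestronglyMeasurable
      (Eventually.of_forall fun x => (h.sph x).le) f2.1
    have g3 := memLp_wedge_left hB0 h.sm1.aestronglyMeasurable bU1 f1.1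
    have k1 : l2 (fluxD (c.g t) (c.g1 t) s.i1 s.i2) ≤ K * (A + A) := f1.2.trans (by gcongr)
    have k2 : l2 (fluxDD (c.g t) (c.g1 t) (c.g2 t) s.i1 s.i2 s.i3) ≤ K * (A + 2 * A + A) :=
      f2.2.trans (by gcongr)
    refine ⟨⟨h.wd.sub s.init.wd, h.wd1.sub s.init.wd1, hc.wd_vel h,
      h.wd.wedge (hc.wd_fluxD s.init.wd1 s.init.wd2), h.wd, h.sm1.aestronglyMeasurable,
      Eventually.of_forall fun x => (h.sph x).le, bU1, p0, by linarith, p1, by linarith,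
      h.m2.sub s.init.m2, p2, by linarith, p3, by linarith, g1.1, g3.1.add g2.1,
      Eventually.of_forall fun x => ?_⟩, ?_, ?_⟩
    · rw [← wedge_add_right]
      simp only [Sol.v, vel, fluxD]
      congr 1
      module
    · exact g1.2.trans (by rw [one_mul]; exact k1)
    · refine (l2_add_le g3.1 g2.1).trans (add_le_add (g3.2.trans ?_) (g2.2.trans ?_))
      · gcongr
      · rw [one_mul]; exact k2
  have slice' := ae_Ioo_mono hτ.2 slice
  obtain ⟨J, hJ, hJ1, hJ2⟩ := h1_energy hτ0 hB0 c' (ltp.mono hτ.2) (ltp1.mono hτ.2) jw0 jw1 s.jv s.jv1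
    stronglyMeasurable_const stronglyMeasurable_const MemLp.zero' MemLp.zero'
    (slice'.mono fun t h => h.1)
  have z0 : l2 (fun _ : ℝ => (0 : E3)) = 0 := by simp [l2]
  rw [z0] at hJ1
  have hY : IntegrableOn (fun t => α * l2 (fun x => s.u1 t x - s.i1 x) ^ 2
      + l2 (fun x => s.u t x - s.i0 x) ^ 2) (Ioo 0 τ) :=
    ((jw1.integrableOn_l2_sq (slice'.mono fun t h => ⟨h.1.m1, h.1.b1⟩)).const_mul α).add
      (jw0.integrableOn_l2_sq (slice'.mono fun t h => ⟨h.1.m, h.1.b⟩))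
  -- The increment starts from zero, so only the forcing contributes.
  have key := gronwall_of_le (A := 0) (B := τ * κ) (C := C1 + (1 / α + 1) / τ) hτ0 le_rfl
    (by positivity) (by positivity) hY hJ (hJ1.mono fun t h => by simpa using h) (by
      filter_upwards [hJ2, slice', ae_Ioo_mono hτ.2 c.slice] with t h1 ⟨h2, h3, h4⟩ hc
      set a := l2 (fun x => s.u1 t x - s.i1 x)
      set b := l2 (fun x => s.u t x - s.i0 x)
      have a0 : 0 ≤ a := l2_nonneg _
      have b0 : 0 ≤ b := l2_nonneg _
      have e1 := (abs_le.1 (integral_bdd_inner_le hK (Eventually.of_forall hc.bg) h2.m1 h2.mN1)).2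
      have e2 := (abs_le.1 (abs_integral_inner_le h2.m h2.mN)).2
      have e1' := e1.trans (mul_le_mul_of_nonneg_left (mul_le_mul_of_nonneg_left h4 a0) hK)
      have e2' := e2.trans (mul_le_mul_of_nonneg_left h3 b0)
      refine h1.trans ?_
      have hg : c'.g = c.g := rfl
      rw [hg]
      exact le_trans (by linarith) (increment_rate_le hα hK hB0 hτ0 a b n n1))
  filter_upwards [key] with t ht
  refine ht.trans ?_
  rw [zero_add, add_mul, div_mul_cancel₀ _ hτ0.ne']
  have : C1 * τ ≤ C1 * T := mul_le_mul_of_nonneg_left hτ.2 C10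
  have e : τ * (τ * κ) = κ * τ ^ 2 := by ring
  rw [e, ← mul_assoc]
  gcongr

end SchrodingerMap

namespace SchrodingerMap

/-! ### Estimates of increments in time -/

variable {E : Type*} [NormedAddCommGroup E] [NormedSpace ℝ E] [CompleteSpace E]

theorem TP.norm_increment_le {T K h : ℝ} (hh : 0 < h) {f f' : ℝ → ℝ → E} {f₀ : ℝ → E}
    (H : TP T f f₀ f') (jf : JM f) (jf' : JM f') (s0 : StronglyMeasurable f₀)
    (hb : ∀ t x, ‖f' t x‖ ≤ K) :
    ∀ᵐ t ∂(volume.restrict (Ioo 0 (T - h))), ∀ᵐ x, ‖f (t + h) x - f t x‖ ≤ K * h := by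
  have H' := H.ae_ae jf jf' s0
  filter_upwards [ae_Ioo_shift hh H', ae_Ioo_mono (by linarith) H',
    ae_restrict_mem measurableSet_Ioo] with t h1 h2 htI
  filter_upwards [h1, h2, H] with x e1 e2 ⟨hx, _⟩
  have e0 : (0:ℝ) ∈ Icc 0 T := ⟨le_rfl, by linarith [htI.1, htI.2]⟩
  have eh : t ∈ Icc 0 T := ⟨htI.1.le, by linarith [htI.2]⟩
  have et : t + h ∈ Icc 0 T := ⟨by linarith [htI.1], by linarith [htI.2]⟩
  rw [e1, e2, add_sub_add_left_eq_sub, intervalIntegral.integral_interval_sub_left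
    (intervalIntegrable_of_Ioo hx e0 et) (intervalIntegrable_of_Ioo hx e0 eh)]
  refine (intervalIntegral.norm_integral_le_of_norm_le_const fun s _ => hb s x).trans ?_
  rw [add_sub_cancel_left, abs_of_pos hh]

/-- Applying u ∧ to v_x = u1 ∧ p + u ∧ p1 and expanding the triple products recovers the tangential
part of p1. Thus p1 is v_x up to a rotation, a normal part ν and a term of lower order. -/
theorem fluxDD_decomp {g m ν : ℝ} {u u1 p p1 : E3} (h0 : ‖u‖ = 1) (o1 : inner ℝ u u1 = 0)
    (hp : inner ℝ u p = - (g * m)) (hν : inner ℝ u p1 = ν) :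
    p1 = ν • u - wedge u (wedge u1 p + wedge u p1) - (g * m) • u1 := by
  rw [wedge_add_right, wedge_wedge, wedge_wedge, o1, hp, hν, real_inner_self_eq_norm_sq, h0]
  module

section slices

variable {α K B : ℝ} {g g1 g2 : ℝ → ℝ} {u u1 u2 u3 : ℝ → E3}

theorem CoefSlice.inner_fluxD (s : MapSlice u u1 u2 u3) :
    ∀ᵐ x, inner ℝ (u x) (fluxD g g1 u1 u2 x) = - (g x * ‖u1 x‖ ^ 2) := by
  filter_upwards [s.inner_one, s.inner_two] with x o1 o2
  rw [fluxD, inner_add_right, real_inner_smul_right, real_inner_smul_right, o1, o2]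
  ring

/-- Along u the third derivative equals −3 u1 · u2, so the normal part of p1 involves only
derivatives of order at most two. -/
theorem CoefSlice.abs_inner_fluxDD_le (c : CoefSlice α K g g1 g2) (s : MapSlice u u1 u2 u3)
    (hB : ∀ᵐ x, ‖u1 x‖ ≤ B) :
    ∀ᵐ x, |inner ℝ (u x) (fluxDD g g1 g2 u1 u2 u3 x)| ≤
      3 * K * B * ‖u2 x‖ + 2 * K * B * ‖u1 x‖ := by
  have hK := c.K_nonneg
  filter_upwards [s.inner_one, s.inner_two, s.inner_three, hB] with x o1 o2 o3 hx
  rw [fluxDD, inner_add_right, inner_add_right, real_inner_smul_right, real_inner_smul_right,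
    real_inner_smul_right, o1, o2, o3]
  have h1 := c.bg x
  have h2 := c.bg1 x
  have h3 : |inner ℝ (u1 x) (u2 x)| ≤ B * ‖u2 x‖ :=
    (abs_real_inner_le_norm _ _).trans (by gcongr)
  have hB0 := (norm_nonneg _).trans hx
  calc |g x * (-3 * inner ℝ (u1 x) (u2 x)) + 2 * g1 x * -‖u1 x‖ ^ 2 + g2 x * 0|
      = |-3 * (g x * inner ℝ (u1 x) (u2 x)) + -2 * (g1 x * (‖u1 x‖ * ‖u1 x‖))| := by
        congr 1; ring
    _ ≤ |-3 * (g x * inner ℝ (u1 x) (u2 x))| + |-2 * (g1 x * (‖u1 x‖ * ‖u1 x‖))| := abs_add_le _ _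
    _ = 3 * (|g x| * |inner ℝ (u1 x) (u2 x)|) + 2 * (|g1 x| * (‖u1 x‖ * ‖u1 x‖)) := by
        simp only [abs_mul, abs_neg, abs_norm, Nat.abs_ofNat]
    _ ≤ 3 * (K * (B * ‖u2 x‖)) + 2 * (K * (B * ‖u1 x‖)) := by gcongr
    _ = _ := by ring

theorem CoefSlice.memLp_normal (c : CoefSlice α K g g1 g2) (s : MapSlice u u1 u2 u3)
    (hB0 : 0 ≤ B) (hB : ∀ᵐ x, ‖u1 x‖ ≤ B) (b1 : l2 u1 ≤ B) (b2 : l2 u2 ≤ B) :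
    MemLp (fun x => inner ℝ (u x) (fluxDD g g1 g2 u1 u2 u3 x)) 2 ∧
      l2 (fun x => inner ℝ (u x) (fluxDD g g1 g2 u1 u2 u3 x)) ≤ 5 * K * B ^ 2 := by
  have hK := c.K_nonneg
  have mp1 := (c.memLp_fluxDD s.m1 s.m2 s.m3).1
  have mm : MemLp (fun x => 3 * K * B * ‖u2 x‖ + 2 * K * B * ‖u1 x‖) 2 :=
    (s.m2.norm.const_mul _).add (s.m1.norm.const_mul _)
  have hb := (c.abs_inner_fluxDD_le s hB).mono fun x hx =>
    (show ‖(inner ℝ (u x) (fluxDD g g1 g2 u1 u2 u3 x) : ℝ)‖ ≤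
      1 * ‖3 * K * B * ‖u2 x‖ + 2 * K * B * ‖u1 x‖‖ by
        rw [one_mul]; exact hx.trans (le_abs_self _))
  refine ⟨memLp_of_le (s.sm.aestronglyMeasurable.inner mp1.1) mm hb,
    (l2_le zero_le_one mm hb).trans ?_⟩
  rw [one_mul]
  refine (l2_add_le (s.m2.norm.const_mul _) (s.m1.norm.const_mul _)).trans ?_
  have e1 := l2_const_smul (3 * K * B) (fun x => ‖u2 x‖)
  have e2 := l2_const_smul (2 * K * B) (fun x => ‖u1 x‖)
  simp only [smul_eq_mul, l2_norm] at e1 e2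
  rw [e1, e2, abs_of_nonneg (by positivity), abs_of_nonneg (by positivity)]
  calc _ ≤ 3 * K * B * B + 2 * K * B * B := by gcongr
    _ = _ := by ring

/-- Through `fluxDD_decomp` the second flux derivative is controlled by v_x, its normal part and u1;
dividing by g ≥ α isolates u3. One derivative of the velocity thus pays for three space derivatives,
with constants that ignore u3. -/
theorem CoefSlice.l2_three_le (c : CoefSlice α K g g1 g2) (s : MapSlice u u1 u2 u3)
    (hB0 : 0 ≤ B) (b1 : l2 u1 ≤ B) (b2 : l2 u2 ≤ B) :
    l2 u3 ≤ (l2 (velD g g1 g2 u u1 u2 u3) + (5 * K * B ^ 2 + K * B ^ 3 + 3 * K * B)) / α := by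
  have hK := c.K_nonneg
  have hα := c.pos
  have hB := s.ae_norm_u1_le b1 b2
  obtain ⟨mν, bν⟩ := c.memLp_normal s hB0 hB b1 b2
  have mp1 := (c.memLp_fluxDD s.m1 s.m2 s.m3).1
  have mv := (c.memLp_velD s ((le_max_left _ _).trans (le_max_left _ (l2 u3)))
    ((le_max_right _ _).trans (le_max_left _ _)) (le_max_right _ _)).1
  set p1 := fluxDD g g1 g2 u1 u2 u3 with hp1
  set v1 := velD g g1 g2 u u1 u2 u3 with hv1
  let S : ℝ → ℝ := fun x => ‖(inner ℝ (u x) (p1 x) : ℝ)‖ + ‖v1 x‖ + K * B ^ 2 * ‖u1 x‖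
    + 2 * K * ‖u2 x‖ + K * ‖u1 x‖
  have mS : MemLp S 2 := (((mν.norm.add mv.norm).add (s.m1.norm.const_mul _)).add
    (s.m2.norm.const_mul _)).add (s.m1.norm.const_mul _)
  have hS : ∀ᵐ x, ‖u3 x‖ ≤ α⁻¹ * ‖S x‖ := by
    filter_upwards [s.inner_one, inner_fluxD (g := g) (g1 := g1) s, hB] with x o1 o2 hx
    have d : p1 x = _ := fluxDD_decomp (p := fluxD g g1 u1 u2 x) (s.sph x) o1 o2
      (rfl : inner ℝ (u x) (p1 x) = _)
    have d1 : ‖p1 x‖ ≤ ‖(inner ℝ (u x) (p1 x) : ℝ)‖ + ‖v1 x‖ + K * B ^ 2 * ‖u1 x‖ := by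
      have n1 : ‖p1 x‖ ≤ ‖inner ℝ (u x) (p1 x) • u x‖ + ‖wedge (u x) (v1 x)‖
          + ‖(g x * ‖u1 x‖ ^ 2) • u1 x‖ := by
        conv_lhs => rw [d]
        exact (norm_sub_le _ _).trans (add_le_add (norm_sub_le _ _) le_rfl)
      have n2 : ‖wedge (u x) (v1 x)‖ ≤ ‖v1 x‖ := by
        have := norm_wedge_le (u x) (v1 x)
        rwa [s.sph, one_mul] at this
      have n3 : ‖(g x * ‖u1 x‖ ^ 2) • u1 x‖ ≤ K * B ^ 2 * ‖u1 x‖ := by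
        rw [norm_smul, norm_mul, norm_pow, norm_norm, Real.norm_eq_abs]
        have := c.bg x
        gcongr
      rw [norm_smul, s.sph, mul_one] at n1
      linarith
    have d2 : α * ‖u3 x‖ ≤ ‖p1 x‖ + 2 * K * ‖u2 x‖ + K * ‖u1 x‖ := by
      have e : g x • u3 x = p1 x - (2 * g1 x) • u2 x - g2 x • u1 x := by
        rw [hp1, fluxDD]; abel
      have e1 : α * ‖u3 x‖ ≤ ‖g x • u3 x‖ := by
        rw [norm_smul, Real.norm_of_nonneg (hα.le.trans (c.lower x))]
        exact mul_le_mul_of_nonneg_right (c.lower x) (norm_nonneg _)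
      refine e1.trans ?_
      rw [e]
      refine (norm_sub_le _ _).trans (add_le_add ((norm_sub_le _ _).trans
        (add_le_add le_rfl ?_)) ?_)
      · rw [norm_smul, norm_mul, Real.norm_ofNat, Real.norm_eq_abs]
        have := c.bg1 x
        gcongr
      · rw [norm_smul, Real.norm_eq_abs]
        have := c.bg2 x
        gcongr
    rw [← div_eq_inv_mul, le_div_iff₀ hα, mul_comm]
    refine le_trans ?_ (le_abs_self _)
    simp only [S]
    linarith
  have e0 := l2_le (inv_nonneg.2 hα.le) mS hS
  rw [← div_eq_inv_mul] at e0
  refine e0.trans ?_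
  gcongr
  have c1 := fun (k : ℝ) (f : ℝ → E3) => l2_const_smul k (fun x => ‖f x‖)
  simp only [smul_eq_mul, l2_norm] at c1
  have f1 := l2_add_le (((mν.norm.add mv.norm).add (s.m1.norm.const_mul (K * B ^ 2))).add
    (s.m2.norm.const_mul (2 * K))) (s.m1.norm.const_mul K)
  have f2 := l2_add_le ((mν.norm.add mv.norm).add (s.m1.norm.const_mul (K * B ^ 2)))
    (s.m2.norm.const_mul (2 * K))
  have f3 := l2_add_le (mν.norm.add mv.norm) (s.m1.norm.const_mul (K * B ^ 2))
  have f4 := l2_add_le mν.norm mv.norm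
  simp only [Pi.add_def, l2_norm] at f1 f2 f3 f4
  rw [c1, abs_of_nonneg (by positivity)] at f1 f2 f3
  have k1 : K * B ^ 2 * l2 u1 ≤ K * B ^ 2 * B := by gcongr
  have k2 : 2 * K * l2 u2 ≤ 2 * K * B := by gcongr
  have k3 : K * l2 u1 ≤ K * B := by gcongr
  have e : l2 S = l2 (fun x => ‖(inner ℝ (u x) (p1 x) : ℝ)‖ + ‖v1 x‖ + K * B ^ 2 * ‖u1 x‖
    + 2 * K * ‖u2 x‖ + K * ‖u1 x‖) := rfl
  rw [e]
  have k4 : K * B ^ 2 * B = K * B ^ 3 := by ring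
  linarith

/-- The critical trilinear term in the energy of time increments. -/
theorem CoefSlice.integral_det_increment_le (c : CoefSlice α K g g1 g2) (s : MapSlice u u1 u2 u3)
    (hB0 : 0 ≤ B) (b1 : l2 u1 ≤ B) (b2 : l2 u2 ≤ B) {U U1 W W1 : ℝ → E3} {h : ℝ} (hh : 0 < h)
    (nU : ∀ x, ‖U x‖ = 1) (oU : ∀ᵐ x, inner ℝ (U x) (U1 x) = 0) (bU : ∀ᵐ x, ‖U1 x‖ ≤ B)
    (eW : ∀ x, U x = u x + h • W x) (eW1 : ∀ x, U1 x = u1 x + h • W1 x)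
    (wd : WD W W1) (m : MemLp W 2) (m1 : MemLp W1 2) :
    |∫ x, g x * inner ℝ (W1 x) (wedge (W x) (fluxDD g g1 g2 u1 u2 u3 x))| ≤
      K * (l2 W1 + l2 W) * (5 * K * B ^ 2 * l2 W1) + K ^ 2 * B ^ 3 * (l2 W1 * l2 W)
      + K * B * (l2 W1 + l2 W) * (l2 W * l2 (velD g g1 g2 u u1 u2 u3))
      + K * (h / 2) * (l2 W1 + l2 W) ^ 2 * (l2 W1 * l2 (velD g g1 g2 u u1 u2 u3)) := by
  have hK := c.K_nonneg
  have hB := s.ae_norm_u1_le b1 b2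
  obtain ⟨mν, bν⟩ := c.memLp_normal s hB0 hB b1 b2
  have mv := (c.memLp_velD s ((le_max_left _ _).trans (le_max_left _ (l2 u3)))
    ((le_max_right _ _).trans (le_max_left _ _)) (le_max_right _ _)).1
  set p1 := fluxDD g g1 g2 u1 u2 u3 with hp1
  set v1 := velD g g1 g2 u u1 u2 u3 with hv1
  set a := l2 W1
  set b := l2 W
  have a0 : 0 ≤ a := l2_nonneg _
  have b0 : 0 ≤ b := l2_nonneg _
  have supW : ∀ᵐ x, ‖W x‖ ≤ a + b := (wd.ae_sq_le m m1).mono fun x hx => by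
    refine le_of_sq_le_sq (hx.trans ?_) (by positivity)
    change b * a ≤ _
    nlinarith [mul_nonneg a0 b0, sq_nonneg a, sq_nonneg b]
  have pt : ∀ᵐ x, ‖g x * inner ℝ (W1 x) (wedge (W x) (p1 x))‖ ≤
      K * (a + b) * (‖(inner ℝ (u x) (p1 x) : ℝ)‖ * ‖W1 x‖) + K ^ 2 * B ^ 3 * (‖W1 x‖ * ‖W x‖)
      + K * B * (a + b) * (‖W x‖ * ‖v1 x‖) + K * (h / 2) * (a + b) ^ 2 * (‖W1 x‖ * ‖v1 x‖) := by
    filter_upwards [s.inner_one, inner_fluxD (g := g) (g1 := g1) s, hB, oU, bU, supW]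
      with x o1 o2 hx oUx bUx sx
    have d : p1 x = _ := fluxDD_decomp (p := fluxD g g1 u1 u2 x) (s.sph x) o1 o2
      (rfl : inner ℝ (u x) (p1 x) = _)
    set ν := inner ℝ (u x) (p1 x)
    -- Both u and U = u + h W are unit vectors, hence W is tangent up to O(h). Differentiating U · U
    -- = 1 in x then gives the normal component of W1, free of derivatives of W.
    have wu : inner ℝ (W x) (u x) = - (h / 2) * ‖W x‖ ^ 2 := by
      have e1 := nU x
      rw [eW] at e1
      have e2 : ‖u x + h • W x‖ ^ 2 = 1 := by rw [e1]; norm_num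
      rw [norm_add_sq_real, s.sph, real_inner_smul_right, norm_smul, Real.norm_of_nonneg hh.le,
        real_inner_comm] at e2
      have : h * (2 * inner ℝ (W x) (u x) + h * ‖W x‖ ^ 2) = 0 := by linarith
      have := (mul_eq_zero.1 this).resolve_left hh.ne'
      linarith
    have w1u : inner ℝ (W1 x) (u x) = - inner ℝ (U1 x) (W x) := by
      have e1 : inner ℝ (U1 x) (U x) = 0 := by rw [real_inner_comm]; exact oUx
      have e2 : inner ℝ (U1 x) (u x) = h * inner ℝ (W1 x) (u x) := by
        rw [eW1, inner_add_left, real_inner_smul_left, real_inner_comm, o1, zero_add]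
      rw [eW, inner_add_right, real_inner_smul_right, e2, ← mul_add] at e1
      have := (mul_eq_zero.1 e1).resolve_left hh.ne'
      linarith
    have ev : velD g g1 g2 u u1 u2 u3 x = wedge (u1 x) (fluxD g g1 u1 u2 x) + wedge (u x) (p1 x) := rfl
    rw [← ev, ← hv1] at d
    -- The v_x part of p1 meets only the normal components of W and W1. One product is of lower
    -- order, the other carries the factor h.
    have ex : inner ℝ (W1 x) (wedge (W x) (p1 x)) = ν * det3 (W1 x) (W x) (u x)
        - (inner ℝ (W x) (v1 x) * inner ℝ (W1 x) (u x)
          - inner ℝ (W x) (u x) * inner ℝ (W1 x) (v1 x))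
        - g x * ‖u1 x‖ ^ 2 * det3 (W1 x) (W x) (u1 x) := by
      conv_lhs => rw [d]
      rw [wedge_sub_right, wedge_sub_right, wedge_smul_right, wedge_smul_right, wedge_wedge,
        inner_sub_right, inner_sub_right, real_inner_smul_right, real_inner_smul_right,
        inner_sub_right, real_inner_smul_right, real_inner_smul_right]
      rfl
    have q1 : |ν * det3 (W1 x) (W x) (u x)| ≤ (a + b) * (‖ν‖ * ‖W1 x‖) := by
      have := abs_det3_le (W1 x) (W x) (u x)
      rw [s.sph, mul_one] at this
      rw [abs_mul, Real.norm_eq_abs]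
      calc |ν| * |det3 (W1 x) (W x) (u x)| ≤ |ν| * (‖W1 x‖ * (a + b)) :=
            mul_le_mul_of_nonneg_left (this.trans (by gcongr)) (abs_nonneg _)
        _ = _ := by ring
    have q2 : |inner ℝ (W x) (v1 x) * inner ℝ (W1 x) (u x)| ≤ B * (a + b) * (‖W x‖ * ‖v1 x‖) := by
      rw [w1u, abs_mul, abs_neg]
      have k1 := abs_real_inner_le_norm (W x) (v1 x)
      have k2 : |inner ℝ (U1 x) (W x)| ≤ B * (a + b) :=
        (abs_real_inner_le_norm _ _).trans (by gcongr)
      calc _ ≤ (‖W x‖ * ‖v1 x‖) * (B * (a + b)) :=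
            mul_le_mul k1 k2 (abs_nonneg _) (by positivity)
        _ = _ := by ring
    have q3 : |inner ℝ (W x) (u x) * inner ℝ (W1 x) (v1 x)| ≤
        (h / 2) * (a + b) ^ 2 * (‖W1 x‖ * ‖v1 x‖) := by
      rw [wu, abs_mul, abs_mul, abs_neg, abs_of_nonneg (by positivity : 0 ≤ h / 2),
        abs_of_nonneg (by positivity : 0 ≤ ‖W x‖ ^ 2)]
      have k1 := abs_real_inner_le_norm (W1 x) (v1 x)
      gcongr
    have q4 : |g x * ‖u1 x‖ ^ 2 * det3 (W1 x) (W x) (u1 x)| ≤ K * B ^ 3 * (‖W1 x‖ * ‖W x‖) := by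
      rw [abs_mul, abs_mul, abs_of_nonneg (by positivity : 0 ≤ ‖u1 x‖ ^ 2)]
      have k1 := abs_det3_le (W1 x) (W x) (u1 x)
      have k2 := c.bg x
      have k3 : |det3 (W1 x) (W x) (u1 x)| ≤ ‖W1 x‖ * ‖W x‖ * B := k1.trans (by gcongr)
      calc _ ≤ K * B ^ 2 * (‖W1 x‖ * ‖W x‖ * B) := by gcongr
        _ = _ := by ring
    have q : |inner ℝ (W1 x) (wedge (W x) (p1 x))| ≤ (a + b) * (‖ν‖ * ‖W1 x‖)
        + (B * (a + b) * (‖W x‖ * ‖v1 x‖) + (h / 2) * (a + b) ^ 2 * (‖W1 x‖ * ‖v1 x‖))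
        + K * B ^ 3 * (‖W1 x‖ * ‖W x‖) := by
      rw [ex]
      exact (abs_sub _ _).trans (add_le_add ((abs_sub _ _).trans (add_le_add q1
        ((abs_sub _ _).trans (add_le_add q2 q3)))) q4)
    rw [norm_mul, Real.norm_eq_abs, Real.norm_eq_abs]
    refine (mul_le_mul (c.bg x) q (abs_nonneg _) hK).trans (le_of_eq ?_)
    ring
  have i1 := (integrable_norm_mul_norm mν m1).const_mul (K * (a + b))
  have i2 := (integrable_norm_mul_norm m1 m).const_mul (K ^ 2 * B ^ 3)
  have i3 := (integrable_norm_mul_norm m mv).const_mul (K * B * (a + b))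
  have i4 := (integrable_norm_mul_norm m1 mv).const_mul (K * (h / 2) * (a + b) ^ 2)
  have l1 := integral_norm_mul_le mν m1
  have l2' := integral_norm_mul_le m1 m
  have l3 := integral_norm_mul_le m mv
  have l4 := integral_norm_mul_le m1 mv
  have l1' : l2 (fun x => inner ℝ (u x) (p1 x)) * a ≤ 5 * K * B ^ 2 * a :=
    mul_le_mul_of_nonneg_right bν a0
  refine (norm_integral_le_of_norm_le (((i1.add i2).add i3).add i4) pt).trans ?_
  rw [integral_add' ((i1.add i2).add i3) i4, integral_add' (i1.add i2) i3, integral_add' i1 i2,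
    integral_const_mul, integral_const_mul, integral_const_mul, integral_const_mul]
  have l1'' := l1.trans l1'
  gcongr

end slices

end SchrodingerMap

namespace SchrodingerMap

/-! ### Difference quotients in time -/

/-- Here a and b stand for the norms of W_x and W, and R, R' for those of v_x at the times t and t +
h. The bound on b, which comes from the velocity, reduces the cubic term (a + b) b R to a quadratic
one. The constant depends on α, K and B alone. -/
theorem exists_increment_energy_rate {α K B : ℝ} (hα : 0 < α) (hK : 0 ≤ K) (hB : 0 ≤ B) :
    ∃ C, 0 ≤ C ∧ ∀ a b R R' : ℝ, 0 ≤ a → 0 ≤ b → 0 ≤ R → 0 ≤ R' → b ≤ K * (B + B) →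
      K * a ^ 2 + 2 * (K * B * (a * b))
        + 2 * (K * (a + b) * (5 * K * B ^ 2 * a) + K ^ 2 * B ^ 3 * (a * b)
          + K * B * (a + b) * (b * R))
        + 2 * (K * (a * (B * (K * (B + B)) + K * (B + 2 * B
          + (R' + (5 * K * B ^ 2 + K * B ^ 3 + 3 * K * B)) / α))))
        + 2 * (b * (K * (B + B))) ≤
      C * (α * a ^ 2 + b ^ 2) + C * (1 + R ^ 2 + R' ^ 2) := by
  set k := 5 * K * B ^ 2 + K * B ^ 3 + 3 * K * B with hk
  have k0 : 0 ≤ k := by positivity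
  set C0 := K + 2 * (K * B) + 2 * (K * (5 * K * B ^ 2) * 2 + K ^ 2 * B ^ 3
    + K * B * (K * (B + B)) * 2) + 2 * (K * (B * (K * (B + B)) + K * (B + 2 * B + (1 + k) / α)))
    + 2 * (K * (B + B)) with hC0
  have C00 : 0 ≤ C0 := by positivity
  refine ⟨C0 * (1 + 1 / α), by positivity, fun a b R R' a0 b0 R0 R'0 hb => ?_⟩
  set S := 1 + a ^ 2 + b ^ 2 + R ^ 2 + R' ^ 2 with hS
  have s1 : a ^ 2 ≤ S := by nlinarith
  have s2 : a * b ≤ S := by nlinarith [sq_nonneg (a - b)]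
  have s3 : (a + b) * a ≤ S * 2 := by nlinarith [sq_nonneg (a - b)]
  have s4 : (a + b) * R ≤ S * 2 := by nlinarith [sq_nonneg (a - R), sq_nonneg (b - R)]
  have s5 : a ≤ S := by nlinarith [sq_nonneg (a - 1)]
  have s6 : a * R' ≤ S := by nlinarith [sq_nonneg (a - R')]
  have s7 : b ≤ S := by nlinarith [sq_nonneg (b - 1)]
  have m1 : K * a ^ 2 ≤ K * S := by gcongr
  have m2 : K * B * (a * b) ≤ K * B * S := by gcongr
  have m3 : K * (5 * K * B ^ 2) * ((a + b) * a) ≤ K * (5 * K * B ^ 2) * (S * 2) := by gcongr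
  have m4 : K ^ 2 * B ^ 3 * (a * b) ≤ K ^ 2 * B ^ 3 * S := by gcongr
  have m5 : K * B * ((a + b) * R * b) ≤ K * B * (S * 2 * (K * (B + B))) := by gcongr
  have m6 : K * (B * (K * (B + B))) * a ≤ K * (B * (K * (B + B))) * S := by gcongr
  have m7 : K * (K * (B + 2 * B + k / α)) * a ≤ K * (K * (B + 2 * B + k / α)) * S := by gcongr
  have m8 : K * (K * (1 / α)) * (a * R') ≤ K * (K * (1 / α)) * S := by gcongr
  have m9 : K * (B + B) * b ≤ K * (B + B) * S := by gcongr
  have total : K * a ^ 2 + 2 * (K * B * (a * b))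
        + 2 * (K * (a + b) * (5 * K * B ^ 2 * a) + K ^ 2 * B ^ 3 * (a * b)
          + K * B * (a + b) * (b * R))
        + 2 * (K * (a * (B * (K * (B + B)) + K * (B + 2 * B + (R' + k) / α))))
        + 2 * (b * (K * (B + B))) ≤ C0 * S := by
    have e1 : (R' + k) / α = 1 / α * R' + k / α := by ring
    have e2 : (1 + k) / α = 1 / α + k / α := by ring
    rw [hC0, e1, e2]
    linarith
  have hS' : S ≤ (1 + 1 / α) * (α * a ^ 2 + b ^ 2 + (1 + R ^ 2 + R' ^ 2)) := by
    have e1 : 1 / α * (α * a ^ 2) = a ^ 2 := by field_simp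
    have e2 : 0 ≤ 1 / α * (b ^ 2 + (1 + R ^ 2 + R' ^ 2)) := by positivity
    have e3 : 0 ≤ α * a ^ 2 := by positivity
    have e4 : (1 + 1 / α) * (α * a ^ 2 + b ^ 2 + (1 + R ^ 2 + R' ^ 2)) = α * a ^ 2 + b ^ 2
      + (1 + R ^ 2 + R' ^ 2) + 1 / α * (α * a ^ 2) + 1 / α * (b ^ 2 + (1 + R ^ 2 + R' ^ 2)) := by ring
    rw [e4, e1]
    linarith
  refine total.trans ((mul_le_mul_of_nonneg_left hS' C00).trans (le_of_eq (by ring)))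

/-- Difference quotient in time. -/
noncomputable def timeDq {E : Type*} [AddCommGroup E] [Module ℝ E] (h : ℝ) (f : ℝ → ℝ → E) (t x : ℝ) :
    E := h⁻¹ • (f (t + h) x - f t x)

theorem JM.timeDq {E : Type*} [NormedAddCommGroup E] [NormedSpace ℝ E] [CompleteSpace E]
    {f : ℝ → ℝ → E} (jf : JM f)
    (h : ℝ) : JM (timeDq h f) :=
  ((jf.time_shift h).sub jf).const_smul h⁻¹

/-- A discrete Leibniz rule that keeps the map at the later time and the coefficients at the earlier
one in the main term. It has the form u_t = U ∧ (g W_x)_x + N with unit U required by `h1_energy`.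
-/
theorem timeDq_vel (h g g' g1 g1' : ℝ) (u u' u1 u1' u2 u2' : E3) :
    h⁻¹ • (wedge u' (g' • u2' + g1' • u1') - wedge u (g • u2 + g1 • u1)) =
      wedge u' (g • (h⁻¹ • (u2' - u2)) + g1 • (h⁻¹ • (u1' - u1))) +
      (wedge (h⁻¹ • (u' - u)) (g • u2 + g1 • u1) +
        wedge u' ((h⁻¹ • (g' - g)) • u2' + (h⁻¹ • (g1' - g1)) • u1')) := by
  apply E3.ext <;> simp only [wedge_zero, wedge_one, wedge_two, PiLp.add_apply, PiLp.sub_apply,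
    PiLp.smul_apply, smul_eq_mul] <;> ring

theorem integrable_bdd_inner {k : ℝ → ℝ} {K : ℝ} (sk : AEStronglyMeasurable k volume)
    (hk : ∀ᵐ x, |k x| ≤ K) {a b : ℝ → E3} (ha : MemLp a 2) (hb : MemLp b 2) :
    Integrable fun x => k x * inner ℝ (a x) (b x) := by
  refine integrable_of_le_mul (c := K) (sk.mul (ha.1.inner hb.1)) ha hb (hk.mono fun x hx => ?_)
  rw [norm_mul]
  exact mul_le_mul hx (abs_real_inner_le_norm _ _) (norm_nonneg _) ((abs_nonneg _).trans hx)

theorem inner_wedge_self (a b : E3) : inner ℝ a (wedge a b) = 0 := det3_self_left a b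

theorem ae_norm_le_of_WD {f f' : ℝ → E3} (h : WD f f') (hf : MemLp f 2) (hf' : MemLp f' 2) {M : ℝ}
    (h1 : l2 f ≤ M) (h2 : l2 f' ≤ M) : ∀ᵐ x, ‖f x‖ ≤ M := by
  have hM := (l2_nonneg f).trans h1
  filter_upwards [h.ae_sq_le hf hf'] with x hx
  refine le_of_sq_le_sq (hx.trans ?_) hM
  rw [sq]
  exact mul_le_mul h1 h2 (l2_nonneg _) hM

theorem memLp_wedge_right {a b : ℝ → E3} {M : ℝ} (hM : 0 ≤ M) (ha : MemLp a 2)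
    (hb : AEStronglyMeasurable b volume) (h : ∀ᵐ x, ‖b x‖ ≤ M) :
    MemLp (fun x => wedge (a x) (b x)) 2 ∧ l2 (fun x => wedge (a x) (b x)) ≤ M * l2 a := by
  have hle : ∀ᵐ x, ‖wedge (a x) (b x)‖ ≤ M * ‖a x‖ := h.mono fun x hx =>
    (norm_wedge_le _ _).trans (by rw [mul_comm]; exact mul_le_mul_of_nonneg_right hx (norm_nonneg _))
  exact ⟨memLp_of_le (aestronglyMeasurable_wedge ha.1 hb) ha hle, l2_le hM ha hle⟩

set_option maxHeartbeats 1600000 in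
-- The constant C depends on B but not on M. The constant D may depend on M; it is harmless because
-- it comes multiplied by h. It collects the O(h) part of the critical term and the error made in
-- shifting ‖v1‖² from time r + h to time r.
theorem Sol.exists_increment_energy {T α K : ℝ} (hT : 0 < T) (c : Coef T α K) {B : ℝ}
    (hB0 : 0 ≤ B) :
    ∃ C, 0 ≤ C ∧ ∀ (M : ℝ) (s : Sol c M),
      (∀ᵐ t ∂(volume.restrict (Ioo 0 T)), l2 (s.u1 t) ≤ B ∧ l2 (s.u2 t) ≤ B) →
      ∃ D, 0 ≤ D ∧ ∀ᵐ h ∂(volume.restrict (Ioo 0 T)), ∀ᵐ t ∂(volume.restrict (Ioo 0 (T - h))),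
        α * l2 (timeDq h s.u1 t) ^ 2 ≤ Real.exp (C * T) *
          (K * l2 (fun x => h⁻¹ • (s.u1 h x - s.i1 x)) ^ 2
            + l2 (fun x => h⁻¹ • (s.u h x - s.i0 x)) ^ 2 + C * T
            + 2 * C * (∫ r in (0:ℝ)..t, l2 (s.v1 r) ^ 2) + h * D) := by
  obtain ⟨hα, hK⟩ := c.gi_le
  obtain ⟨C, hC0, hC⟩ := exists_increment_energy_rate hα hK hB0
  refine ⟨C, hC0, fun M s hB => ?_⟩
  have hM := s.bound_nonneg hT
  set V := K * (M + M)
  set V1 := M * (K * (M + M)) + K * (M + 2 * M + M)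
  have hV : 0 ≤ V := by positivity
  have hV1 : 0 ≤ V1 := by positivity
  set D0 := K * (V1 + V) ^ 2 * (V1 * V1) with hD0
  have hD00 : 0 ≤ D0 := by positivity
  refine ⟨D0 * T + C * V1 ^ 2, by positivity, ?_⟩
  have vB : ∀ᵐ t ∂(volume.restrict (Ioo 0 T)), MemLp (s.v t) 2 ∧ l2 (s.v t) ≤ K * (B + B) := by
    filter_upwards [s.slice, c.slice, hB] with t ⟨h, _⟩ hc ⟨b1, b2⟩
    have := hc.memLp_vel h
    exact ⟨this.1, this.2.trans (by gcongr)⟩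
  have inc0' := TP.l2_sub_init hV s.tp s.ju s.jv s.init.sm (s.l2_v1_le.mono fun t h => h.1)
  have inc1' := TP.l2_sub_init hV1 s.tp1 s.ju1 s.jv1 s.init.sm1 (s.l2_v1_le.mono fun t h => h.2)
  filter_upwards [s.tp.shift s.ju s.jv s.init.sm, s.tp1.shift s.ju1 s.jv1 s.init.sm1,
    ae_restrict_mem measurableSet_Ioo, inc0', inc1'] with h sh0 sh1 hI in0 in1
  have hh := hI.1
  have hinv : 0 < h⁻¹ := inv_pos.2 hh
  have hS : T - h ≤ T := by linarith
  have hS0 : 0 < T - h := by linarith [hI.2]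
  have inc0 := TP.l2_increment (by positivity : 0 ≤ K * (B + B)) hh s.tp s.ju s.jv s.init.sm vB
  have inc00 := TP.l2_increment hV hh s.tp s.ju s.jv s.init.sm (s.l2_v1_le.mono fun t h => h.1)
  have inc1 := TP.l2_increment hV1 hh s.tp1 s.ju1 s.jv1 s.init.sm1 (s.l2_v1_le.mono fun t h => h.2)
  have ig0 := c.tp.norm_increment_le hh c.mg c.mgt c.init.sm c.bgt
  have ig1 := c.tp1.norm_increment_le hh c.mg1 c.mgt1 c.init.sm1 c.bgt1
  have ig2 := c.tp2.norm_increment_le hh c.mg2 c.mgt2 c.init.sm2 c.bgt2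
  let c' := c.restrict hS
  have tpW : TP (T - h) (timeDq h s.u) (fun x => h⁻¹ • (s.u h x - s.i0 x)) (timeDq h s.v) :=
    (sh0.sub (s.tp.mono hS)).clm (h⁻¹ • ContinuousLinearMap.id ℝ E3)
  have tpW1 : TP (T - h) (timeDq h s.u1) (fun x => h⁻¹ • (s.u1 h x - s.i1 x)) (timeDq h s.v1) :=
    (sh1.sub (s.tp1.mono hS)).clm (h⁻¹ • ContinuousLinearMap.id ℝ E3)
  have scale : ∀ {f : ℝ → E3} {X : ℝ}, MemLp f 2 ∧ l2 f ≤ h * X →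
      MemLp (fun x => h⁻¹ • f x) 2 ∧ l2 (fun x => h⁻¹ • f x) ≤ X := by
    intro f X hf
    refine ⟨hf.1.const_smul h⁻¹, ?_⟩
    rw [l2_const_smul, abs_of_pos hinv]
    calc _ ≤ h⁻¹ * (h * X) := by gcongr; exact hf.2
      _ = X := by field_simp
  have slice : ∀ᵐ t ∂(volume.restrict (Ioo 0 (T - h))),
      LinearSlice (c'.g t) (c'.g1 t) (V + V1 + h⁻¹ * (V + V) + h⁻¹ * (V1 + V1)) B (s.u (t + h))
      (s.u1 (t + h)) (timeDq h s.u t) (timeDq h s.u1 t) (timeDq h s.u2 t) (timeDq h s.v t)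
      (timeDq h s.v1 t)
      (fun x => wedge (timeDq h s.u t x) (s.p t x) + wedge (s.u (t + h) x)
        (fluxD (timeDq h c.g t) (timeDq h c.g1 t) (s.u1 (t + h)) (s.u2 (t + h)) x))
      (fun x => (wedge (timeDq h s.u1 t x) (s.p t x) + wedge (timeDq h s.u t x) (s.p1 t x)) +
        (wedge (s.u1 (t + h) x)
          (fluxD (timeDq h c.g t) (timeDq h c.g1 t) (s.u1 (t + h)) (s.u2 (t + h)) x) +
        wedge (s.u (t + h) x) (fluxDD (timeDq h c.g t) (timeDq h c.g1 t) (timeDq h c.g2 t)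
          (s.u1 (t + h)) (s.u2 (t + h)) (s.u3 (t + h)) x))) ∧
      l2 (timeDq h s.u t) ≤ K * (B + B) ∧ l2 (timeDq h s.u t) ≤ V ∧ l2 (timeDq h s.u1 t) ≤ V1 ∧
      |∫ x, inner ℝ (timeDq h s.u t x) (wedge (timeDq h s.u t x) (s.p t x) +
        wedge (s.u (t + h) x) (fluxD (timeDq h c.g t) (timeDq h c.g1 t) (s.u1 (t + h))
          (s.u2 (t + h)) x))| ≤ l2 (timeDq h s.u t) * (K * (B + B)) ∧
      |∫ x, c'.g t x * inner ℝ (timeDq h s.u1 t x)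
        ((wedge (timeDq h s.u1 t x) (s.p t x) + wedge (timeDq h s.u t x) (s.p1 t x)) +
        (wedge (s.u1 (t + h) x)
          (fluxD (timeDq h c.g t) (timeDq h c.g1 t) (s.u1 (t + h)) (s.u2 (t + h)) x) +
        wedge (s.u (t + h) x) (fluxDD (timeDq h c.g t) (timeDq h c.g1 t) (timeDq h c.g2 t)
          (s.u1 (t + h)) (s.u2 (t + h)) (s.u3 (t + h)) x)))| ≤
      (K * (l2 (timeDq h s.u1 t) + l2 (timeDq h s.u t)) * (5 * K * B ^ 2 * l2 (timeDq h s.u1 t))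
        + K ^ 2 * B ^ 3 * (l2 (timeDq h s.u1 t) * l2 (timeDq h s.u t))
        + K * B * (l2 (timeDq h s.u1 t) + l2 (timeDq h s.u t)) *
          (l2 (timeDq h s.u t) * l2 (s.v1 t))
        + K * (h / 2) * (l2 (timeDq h s.u1 t) + l2 (timeDq h s.u t)) ^ 2 *
          (l2 (timeDq h s.u1 t) * l2 (s.v1 t)))
        + K * (l2 (timeDq h s.u1 t) * (B * (K * (B + B)) + K * (B + 2 * B +
          (l2 (s.v1 (t + h)) + (5 * K * B ^ 2 + K * B ^ 3 + 3 * K * B)) / α))) := by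
    filter_upwards [ae_Ioo_shift hh s.slice, ae_Ioo_mono hS s.slice, ae_Ioo_shift hh c.slice,
      ae_Ioo_mono hS c.slice, ae_Ioo_shift hh hB, inc00, inc1, ae_Ioo_shift hh s.l2_v1_le,
      ae_Ioo_mono hS s.l2_v1_le, ig0, ig1, ig2, inc0, ae_Ioo_mono hS hB]
      with t ⟨h', _⟩ ⟨hm, b1, b2, b3⟩ hc' hc ⟨hb1, hb2⟩ i0 i1
        ⟨⟨p2, q2⟩, p3, q3⟩ ⟨⟨r2, r2'⟩, r3, r3'⟩ g0 g1 g2 i00 ⟨hb3, hb4⟩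
    have γ0 : ∀ᵐ x, |timeDq h c.g t x| ≤ K := g0.mono fun x hx => by
      rw [timeDq, smul_eq_mul, abs_mul, abs_of_pos hinv, ← div_eq_inv_mul, div_le_iff₀ hh]
      exact hx
    have γ1 : ∀ᵐ x, |timeDq h c.g1 t x| ≤ K := g1.mono fun x hx => by
      rw [timeDq, smul_eq_mul, abs_mul, abs_of_pos hinv, ← div_eq_inv_mul, div_le_iff₀ hh]
      exact hx
    have γ2 : ∀ᵐ x, |timeDq h c.g2 t x| ≤ K := g2.mono fun x hx => by
      rw [timeDq, smul_eq_mul, abs_mul, abs_of_pos hinv, ← div_eq_inv_mul, div_le_iff₀ hh]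
      exact hx
    have w0 : MemLp (timeDq h s.u t) 2 ∧ l2 (timeDq h s.u t) ≤ V := scale i0
    have w00 : MemLp (timeDq h s.u t) 2 ∧ l2 (timeDq h s.u t) ≤ K * (B + B) := scale i00
    have w1 : MemLp (timeDq h s.u1 t) 2 ∧ l2 (timeDq h s.u1 t) ≤ V1 := scale i1
    have wd : WD (timeDq h s.u t) (timeDq h s.u1 t) := (h'.wd.sub hm.wd).const_smul h⁻¹
    have wd1 : WD (timeDq h s.u1 t) (timeDq h s.u2 t) := (h'.wd1.sub hm.wd1).const_smul h⁻¹
    have wγ : WD (timeDq h c.g t) (timeDq h c.g1 t) := (hc'.wd.sub hc.wd).const_smul h⁻¹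
    have wγ1 : WD (timeDq h c.g1 t) (timeDq h c.g2 t) := (hc'.wd1.sub hc.wd1).const_smul h⁻¹
    have bU1 := h'.ae_norm_u1_le hb1 hb2
    have mq := memLp_fluxD_of_ae hK ((c.mg.timeDq h).slice t) ((c.mg1.timeDq h).slice t) γ0 γ1
      h'.m1 h'.m2
    have mq1 := memLp_fluxDD_of_ae hK ((c.mg.timeDq h).slice t) ((c.mg1.timeDq h).slice t)
      ((c.mg2.timeDq h).slice t) γ0 γ1 γ2 h'.m1 h'.m2 h'.m3
    have wq : WD (fluxD (timeDq h c.g t) (timeDq h c.g1 t) (s.u1 (t + h)) (s.u2 (t + h)))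
        (fluxDD (timeDq h c.g t) (timeDq h c.g1 t) (timeDq h c.g2 t)
          (s.u1 (t + h)) (s.u2 (t + h)) (s.u3 (t + h))) :=
      ((wγ.smul h'.wd2).add (wγ1.smul h'.wd1)).congr EventuallyEq.rfl
        (Eventually.of_forall fun x => by simp only [fluxDD, two_mul, add_smul]; abel)
    have mp := hc.memLp_flux hm.m1 hm.m2
    have mp1 := hc.memLp_fluxDD hm.m1 hm.m2 hm.m3
    have wp := hc.wd_fluxD hm.wd1 hm.wd2
    obtain ⟨P, hP0, hP⟩ : ∃ P, 0 ≤ P ∧ ∀ᵐ x, ‖s.p t x‖ ≤ P :=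
      ⟨_, (l2_nonneg (s.p t)).trans (le_max_left _ (l2 (s.p1 t))),
        ae_norm_le_of_WD wp mp.1 mp1.1 (le_max_left _ _) (le_max_right _ _)⟩
    obtain ⟨Q, hQ0, hQ⟩ : ∃ Q, 0 ≤ Q ∧ ∀ᵐ x, ‖timeDq h s.u t x‖ ≤ Q :=
      ⟨_, (l2_nonneg (timeDq h s.u t)).trans (le_max_left _ (l2 (timeDq h s.u1 t))),
        ae_norm_le_of_WD wd w0.1 w1.1 (le_max_left _ _) (le_max_right _ _)⟩
    have n1 := memLp_wedge_right hP0 w0.1 mp.1.1 hP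
    have n2 := memLp_wedge_left zero_le_one h'.sm.aestronglyMeasurable
      (Eventually.of_forall fun x => (h'.sph x).le) mq.1
    have n3 := memLp_wedge_right hP0 w1.1 mp.1.1 hP
    have n4 := memLp_wedge_left hQ0 w0.1.1 hQ mp1.1
    have n5 := memLp_wedge_left hB0 h'.sm1.aestronglyMeasurable bU1 mq.1
    have n6 := memLp_wedge_left zero_le_one h'.sm.aestronglyMeasurable
      (Eventually.of_forall fun x => (h'.sph x).le) mq1.1
    have hinvV : h⁻¹ * l2 (fun x => s.v (t + h) x - s.v t x) ≤ h⁻¹ * (V + V) := by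
      have := l2_sub_le p2 r2
      gcongr
      exact this.trans (add_le_add q2 r2')
    have hinvV1 : h⁻¹ * l2 (fun x => s.v1 (t + h) x - s.v1 t x) ≤ h⁻¹ * (V1 + V1) := by
      have := l2_sub_le p3 r3
      gcongr
      exact this.trans (add_le_add q3 r3')
    have y1 : 0 ≤ h⁻¹ * (V + V) := by positivity
    have y2 : 0 ≤ h⁻¹ * (V1 + V1) := by positivity
    have lt : l2 (timeDq h s.v t) ≤ h⁻¹ * (V + V) := by
      have : l2 (timeDq h s.v t) = |h⁻¹| * l2 (fun x => s.v (t + h) x - s.v t x) :=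
        l2_const_smul _ _
      rw [this, abs_of_pos hinv]; exact hinvV
    have lt1 : l2 (timeDq h s.v1 t) ≤ h⁻¹ * (V1 + V1) := by
      have : l2 (timeDq h s.v1 t) = |h⁻¹| * l2 (fun x => s.v1 (t + h) x - s.v1 t x) :=
        l2_const_smul _ _
      rw [this, abs_of_pos hinv]; exact hinvV1
    refine ⟨⟨wd, wd1, ((hc'.wd_vel h').sub (hc.wd_vel hm)).const_smul h⁻¹,
      (wd.wedge wp).add (h'.wd.wedge wq), h'.wd, h'.sm1.aestronglyMeasurable,
      Eventually.of_forall fun x => (h'.sph x).le, bU1, w0.1, by linarith [w0.2], w1.1,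
      by linarith [w1.2], (h'.m2.sub hm.m2).const_smul h⁻¹, (p2.sub r2).const_smul h⁻¹,
      by linarith, (p3.sub r3).const_smul h⁻¹, by linarith, n1.1.add n2.1,
      (n3.1.add n4.1).add (n5.1.add n6.1), Eventually.of_forall fun x => ?_⟩, w00.2, w0.2, w1.2,
      ?_, ?_⟩
    · exact timeDq_vel h _ _ _ _ _ _ _ _ _ _
    · simp only [inner_add_right, inner_wedge_self, zero_add]
      refine (abs_integral_inner_le w0.1 n2.1).trans (mul_le_mul_of_nonneg_left ?_ (l2_nonneg _))
      refine n2.2.trans ?_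
      rw [one_mul]
      exact mq.2.trans (by gcongr)
    · have key := hc.integral_det_increment_le hm hB0 hb3 hb4 hh h'.sph h'.inner_one bU1
        (W := timeDq h s.u t) (W1 := timeDq h s.u1 t)
        (fun x => by rw [timeDq, smul_smul, mul_inv_cancel₀ hh.ne', one_smul]; abel)
        (fun x => by rw [timeDq, smul_smul, mul_inv_cancel₀ hh.ne', one_smul]; abel) wd w0.1 w1.1
      have e : ∀ x, c'.g t x * inner ℝ (timeDq h s.u1 t x)
        ((wedge (timeDq h s.u1 t x) (s.p t x) + wedge (timeDq h s.u t x) (s.p1 t x)) +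
        (wedge (s.u1 (t + h) x)
          (fluxD (timeDq h c.g t) (timeDq h c.g1 t) (s.u1 (t + h)) (s.u2 (t + h)) x) +
        wedge (s.u (t + h) x) (fluxDD (timeDq h c.g t) (timeDq h c.g1 t) (timeDq h c.g2 t)
          (s.u1 (t + h)) (s.u2 (t + h)) (s.u3 (t + h)) x))) =
        c.g t x * inner ℝ (timeDq h s.u1 t x) (wedge (timeDq h s.u t x) (s.p1 t x)) +
        c.g t x * inner ℝ (timeDq h s.u1 t x) (wedge (s.u1 (t + h) x)
          (fluxD (timeDq h c.g t) (timeDq h c.g1 t) (s.u1 (t + h)) (s.u2 (t + h)) x) +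
        wedge (s.u (t + h) x) (fluxDD (timeDq h c.g t) (timeDq h c.g1 t) (timeDq h c.g2 t)
          (s.u1 (t + h)) (s.u2 (t + h)) (s.u3 (t + h)) x)) := fun x => by
        rw [inner_add_right, inner_add_right, inner_wedge_self, zero_add, mul_add]; rfl
      simp only [e]
      have sg := hc.sm.aestronglyMeasurable (μ := volume)
      have bg : ∀ᵐ x, |c.g t x| ≤ K := Eventually.of_forall hc.bg
      refine le_of_eq_of_le (congrArg abs (integral_add (integrable_bdd_inner sg bg w1.1 n4.1)
        (integrable_bdd_inner sg bg w1.1 (n5.1.add n6.1)))) ?_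
      refine (abs_add_le _ _).trans (add_le_add key ((integral_bdd_inner_le hK bg w1.1
        (n5.1.add n6.1)).trans ?_))
      refine mul_le_mul_of_nonneg_left (mul_le_mul_of_nonneg_left ?_ (l2_nonneg _)) hK
      refine (l2_add_le n5.1 n6.1).trans (add_le_add (n5.2.trans ?_) (n6.2.trans ?_))
      · gcongr
        exact mq.2.trans (by gcongr)
      · rw [one_mul]
        refine mq1.2.trans ?_
        have := hc'.l2_three_le h' hB0 hb1 hb2
        have e3 : l2 (s.u1 (t + h)) + 2 * l2 (s.u2 (t + h)) ≤ B + 2 * B := by linarith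
        exact mul_le_mul_of_nonneg_left (add_le_add e3 this) hK
  obtain ⟨J, hJ, hJ1, hJ2⟩ := h1_energy hS0 hB0 c' tpW tpW1 (s.ju.timeDq h) (s.ju1.timeDq h)
    (s.jv.timeDq h) (s.jv1.timeDq h)
    (((s.ju.slice h).sub s.init.sm).const_smul h⁻¹)
    (((s.ju1.slice h).sub s.init.sm1).const_smul h⁻¹) (in0.1.const_smul h⁻¹)
    (in1.1.const_smul h⁻¹) (slice.mono fun t h => h.1)
  have iR : IntegrableOn (fun t => l2 (s.v1 t) ^ 2) (Ioo 0 T) :=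
    s.jv1.integrableOn_l2_sq (s.l2_v1_le.mono fun t h => h.2)
  have iR1 : IntegrableOn (fun t => l2 (s.v1 t) ^ 2) (Ioo 0 (T - h)) :=
    iR.mono_set (Ioo_subset_Ioo_right hS)
  have iR2 : IntegrableOn (fun t => l2 (s.v1 (t + h)) ^ 2) (Ioo 0 (T - h)) :=
    (s.jv1.time_shift h).integrableOn_l2_sq ((ae_Ioo_shift hh s.l2_v1_le).mono fun t h => h.2)
  have ione : ∀ r : ℝ, IntegrableOn (fun _ => r) (Ioo 0 (T - h)) := fun r =>
    integrableOn_const (by simp)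
  have ib : IntegrableOn (fun r => C * (1 + l2 (s.v1 r) ^ 2 + l2 (s.v1 (r + h)) ^ 2) + h * D0)
      (Ioo 0 (T - h)) := ((((ione 1).add iR1).add iR2).const_mul C).add (ione (h * D0))
  have iY : IntegrableOn (fun t => α * l2 (timeDq h s.u1 t) ^ 2 + l2 (timeDq h s.u t) ^ 2)
      (Ioo 0 (T - h)) :=
    (((s.ju1.timeDq h).integrableOn_l2_sq (slice.mono fun t h => ⟨h.1.m1, h.1.b1⟩)).const_mul α).add
      ((s.ju.timeDq h).integrableOn_l2_sq (slice.mono fun t h => ⟨h.1.m, h.1.b⟩))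
  have key := gronwall_ae hS0 hC0 iY ib (Eventually.of_forall fun r => by positivity) (by
    filter_upwards [hJ1, ae_restrict_mem measurableSet_Ioo] with t ht htI
    refine ht.trans (add_le_add le_rfl (intervalIntegral_mono_ae htI hJ ((iY.const_mul C).add ib) ?_))
    filter_upwards [hJ2, slice, ae_Ioo_mono hS s.l2_v1_le] with r h1 ⟨h2, h3, h4, h5, h6, h7⟩ hr
    have rate := hC (l2 (timeDq h s.u1 r)) (l2 (timeDq h s.u r)) (l2 (s.v1 r)) (l2 (s.v1 (r + h)))
      (l2_nonneg _) (l2_nonneg _) (l2_nonneg _) (l2_nonneg _) h3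
    have h6' := (abs_le.1 h6).2
    have h7' := (abs_le.1 h7).2
    -- The only term beyond quadratic growth in the energy. It is bounded crudely with M, since its
    -- factor h sends it into D.
    have last : K * (h / 2) * (l2 (timeDq h s.u1 r) + l2 (timeDq h s.u r)) ^ 2 *
          (l2 (timeDq h s.u1 r) * l2 (s.v1 r)) ≤ K * (h / 2) * (V1 + V) ^ 2 * (V1 * V1) := by
      have := l2_nonneg (timeDq h s.u1 r)
      have := l2_nonneg (timeDq h s.u r)
      have := l2_nonneg (s.v1 r)
      have := hr.2.2
      gcongr
    have eD : 2 * (K * (h / 2) * (V1 + V) ^ 2 * (V1 * V1)) = h * D0 := by rw [hD0]; ring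
    linarith)
  filter_upwards [key, ae_restrict_mem measurableSet_Ioo] with t ht htI
  have nb := sq_nonneg (l2 (timeDq h s.u t))
  refine (le_add_of_nonneg_right nb).trans ?_
  have h0 : (0:ℝ) ∈ Icc 0 (T - h) := ⟨le_rfl, hS0.le⟩
  have tI := Ioo_subset_Icc_self htI
  have h0T : (0:ℝ) ∈ Icc 0 T := ⟨le_rfl, hT.le⟩
  have hT' : h ∈ Icc 0 T := Ioo_subset_Icc_self hI
  have tT : t ∈ Icc 0 T := ⟨htI.1.le, by linarith [htI.2]⟩
  have thT : t + h ∈ Icc 0 T := ⟨by linarith [htI.1], by linarith [htI.2]⟩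
  have j1 := intervalIntegrable_of_Ioo iR1 h0 tI
  have j2 := intervalIntegrable_of_Ioo iR2 h0 tI
  -- The shifted integral exceeds the other by at most its part over an interval of length h.
  have shiftR : ∫ r in (0:ℝ)..t, l2 (s.v1 (r + h)) ^ 2 ≤
      (∫ r in (0:ℝ)..t, l2 (s.v1 r) ^ 2) + h * V1 ^ 2 := by
    rw [intervalIntegral.integral_comp_add_right (fun r => l2 (s.v1 r) ^ 2), zero_add]
    have k1 := intervalIntegrable_of_Ioo iR h0T hT'
    have k2 := intervalIntegrable_of_Ioo iR hT' thT
    have k3 := intervalIntegrable_of_Ioo iR h0T tT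
    have k4 := intervalIntegrable_of_Ioo iR tT thT
    have a1 := intervalIntegral.integral_add_adjacent_intervals k1 k2
    have a2 := intervalIntegral.integral_add_adjacent_intervals k3 k4
    have a3 : 0 ≤ ∫ r in (0:ℝ)..h, l2 (s.v1 r) ^ 2 :=
      intervalIntegral.integral_nonneg hh.le fun r _ => by positivity
    have a4 : ∫ r in t..(t + h), l2 (s.v1 r) ^ 2 ≤ h * V1 ^ 2 := by
      have : ∫ r in t..(t + h), l2 (s.v1 r) ^ 2 ≤ ∫ r in t..(t + h), V1 ^ 2 := by
        rw [intervalIntegral.integral_of_le (by linarith), intervalIntegral.integral_of_le (by linarith)]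
        refine setIntegral_mono_ae_restrict k4.1 (integrableOn_const (by simp)) ?_
        rw [← Measure.restrict_congr_set Ioo_ae_eq_Ioc]
        have hsub : Ioo t (t + h) ⊆ Ioo 0 T := Ioo_subset_Ioo htI.1.le (by linarith [htI.2])
        filter_upwards [ae_restrict_of_ae_restrict_of_subset hsub s.l2_v1_le] with r hr
        exact pow_le_pow_left₀ (l2_nonneg _) hr.2.2 2
      refine this.trans (le_of_eq ?_)
      rw [intervalIntegral.integral_const, add_sub_cancel_left, smul_eq_mul]
    linarith
  have total : ∫ r in (0:ℝ)..t, (C * (1 + l2 (s.v1 r) ^ 2 + l2 (s.v1 (r + h)) ^ 2) + h * D0) ≤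
      C * T + 2 * C * (∫ r in (0:ℝ)..t, l2 (s.v1 r) ^ 2) + h * (D0 * T + C * V1 ^ 2) := by
    rw [intervalIntegral.integral_add (((intervalIntegrable_const.add j1).add j2).const_mul C)
      intervalIntegrable_const, intervalIntegral.integral_const_mul,
      intervalIntegral.integral_add (intervalIntegrable_const.add j1) j2,
      intervalIntegral.integral_add intervalIntegrable_const j1, intervalIntegral.integral_const,
      intervalIntegral.integral_const, smul_eq_mul, smul_eq_mul]
    have k1 : C * t ≤ C * T := mul_le_mul_of_nonneg_left tT.2 hC0
    have k2 : t * (h * D0) ≤ T * (h * D0) := mul_le_mul_of_nonneg_right tT.2 (by positivity)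
    have k3 := mul_le_mul_of_nonneg_left shiftR hC0
    linarith
  have eT : Real.exp (C * t) ≤ Real.exp (C * T) :=
    Real.exp_le_exp.2 (mul_le_mul_of_nonneg_left tT.2 hC0)
  have nn : 0 ≤ ∫ r in (0:ℝ)..t, (C * (1 + l2 (s.v1 r) ^ 2 + l2 (s.v1 (r + h)) ^ 2) + h * D0) :=
    intervalIntegral.integral_nonneg tT.1 fun r _ => by positivity
  refine ht.trans (mul_le_mul eT ?_ (by positivity) (by positivity))
  linarith

end SchrodingerMap

namespace SchrodingerMap

/-! ### A priori bounds -/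

theorem TP.tendsto_timeDq {T : ℝ} {f f' : ℝ → ℝ → E3} {f₀ : ℝ → E3} (H : TP T f f₀ f')
    (jf : JM f) (jf' : JM f') {h : ℕ → ℝ} (hpos : ∀ n, 0 < h n) (hl : Tendsto h atTop (𝓝 0)) :
    ∀ᵐ t ∂(volume.restrict (Ioo 0 T)), ∀ᵐ x, Tendsto (fun n => timeDq (h n) f t x) atTop
      (𝓝 (f' t x)) := by
  have hm : MeasurableSet {p : ℝ × ℝ | Tendsto (fun n => timeDq (h n) f p.1 p.2) atTop
      (𝓝 (f' p.1 p.2))} :=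
    measurableSet_tendsto_fun (fun n => StronglyMeasurable.measurable (jf.timeDq (h n)))
      (StronglyMeasurable.measurable jf')
  rw [Measure.ae_ae_comm hm]
  filter_upwards [H] with x ⟨hx, hx'⟩
  set k : ℝ → E3 := (Ioo 0 T).indicator (fun s => f' s x) with hk
  have ik : Integrable k := (integrable_indicator_iff measurableSet_Ioo).2 hx
  have hd := ae_restrict_of_ae (s := Ioo 0 T) (LocallyIntegrable.ae_hasDerivAt_integral (Integrable.locallyIntegrable ik))
  have hshift : ∀ᵐ t ∂(volume.restrict (Ioo 0 T)), ∀ n, t + h n < T →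
      f (t + h n) x = f₀ x + ∫ s in (0:ℝ)..(t + h n), f' s x := by
    rw [ae_all_iff]
    intro n
    have h1 := ae_Ioo_shift (hpos n) hx'
    rw [ae_restrict_iff' measurableSet_Ioo] at h1 ⊢
    filter_upwards [h1] with t ht htI htn
    exact ht ⟨htI.1, by linarith⟩
  have hF : ∀ t ∈ Ioo 0 T, ∫ s in (0:ℝ)..t, f' s x = ∫ s in (0:ℝ)..t, k s := fun t ht => by
    rw [intervalIntegral.integral_of_le ht.1.le, intervalIntegral.integral_of_le ht.1.le]
    refine setIntegral_congr_fun measurableSet_Ioc fun s hs => ?_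
    rw [hk, indicator_of_mem (show s ∈ Ioo 0 T from ⟨hs.1, hs.2.trans_lt ht.2⟩)]
  filter_upwards [hd, hx', hshift, ae_restrict_mem measurableSet_Ioo] with t h1 h2 h3 htI
  have h4 := (h1 0).tendsto_slope_zero
  rw [hk, indicator_of_mem htI, ← hk] at h4
  have h5 : Tendsto h atTop (𝓝[≠] 0) := tendsto_nhdsWithin_iff.2
    ⟨hl, Eventually.of_forall fun n => (hpos n).ne'⟩
  refine (h4.comp h5).congr' ?_
  filter_upwards [hl.eventually (gt_mem_nhds (by linarith [htI.2] : (0:ℝ) < T - t))] with n hn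
  have htn : t + h n < T := by linarith
  simp only [Function.comp, timeDq]
  rw [h2, h3 n htn, hF t htI, hF (t + h n) ⟨by linarith [htI.1, hpos n], htn⟩, add_sub_add_left_eq_sub]

/-- Fatou's lemma for the L² norm, together with an error h n · D that vanishes in the limit. -/
theorem l2_sq_le_of_tendsto {f : ℕ → ℝ → E3} {F : ℝ → E3} {Q D : ℝ} {h : ℕ → ℝ}
    (hm : ∀ᶠ n in atTop, MemLp (f n) 2) (hs : ∀ n, AEStronglyMeasurable (f n) volume)
    (hl : Tendsto h atTop (𝓝 0)) (hQ : 0 ≤ Q)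
    (hF : ∀ᵐ x, Tendsto (fun n => f n x) atTop (𝓝 (F x)))
    (hb : ∀ᶠ n in atTop, l2 (f n) ^ 2 ≤ Q + h n * D) : l2 F ^ 2 ≤ Q := by
  refine le_of_forall_pos_le_add fun ε hε => ?_
  have hlD : Tendsto (fun n => h n * D) atTop (𝓝 0) := by simpa using hl.mul_const D
  have key : eLpNorm F 2 volume ≤ ENNReal.ofReal (Real.sqrt (Q + ε)) := by
    refine (Lp.eLpNorm_lim_le_liminf_eLpNorm hs F hF).trans
      (Filter.liminf_le_of_frequently_le' (Eventually.frequently ?_))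
    filter_upwards [hm, hb, hlD.eventually (gt_mem_nhds hε)] with n h1 h2 h3
    rw [← ENNReal.ofReal_toReal h1.2.ne]
    exact ENNReal.ofReal_le_ofReal (Real.le_sqrt_of_sq_le (h2.trans (by linarith)))
  have h1 : l2 F ≤ Real.sqrt (Q + ε) := by
    have := ENNReal.toReal_mono ENNReal.ofReal_ne_top key
    rwa [ENNReal.toReal_ofReal (Real.sqrt_nonneg _)] at this
  have := pow_le_pow_left₀ (l2_nonneg _) h1 2
  rwa [Real.sq_sqrt (by positivity)] at this

/-- As h tends to 0 along a sequence, the energies of the quotients become ‖v_x(t)‖² ≤ const + const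
· ∫ ‖v_x‖², and Gronwall bounds v_x in terms of the data and B; u_xxx follows by
`CoefSlice.l2_three_le`. The quotients at time 0 are bounded by `Sol.exists_init_increment_le`. -/
theorem Sol.exists_bound_three {T α K : ℝ} (hT : 0 < T) (c : Coef T α K) (A B : ℝ) (hA0 : 0 ≤ A)
    (hB0 : 0 ≤ B) :
    ∃ D, 0 ≤ D ∧ ∀ (M : ℝ) (s : Sol c M), l2 s.i1 ≤ A → l2 s.i2 ≤ A → l2 s.i3 ≤ A →
      (∀ᵐ t ∂(volume.restrict (Ioo 0 T)), l2 (s.u1 t) ≤ B ∧ l2 (s.u2 t) ≤ B) →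
      ∀ᵐ t ∂(volume.restrict (Ioo 0 T)), l2 (s.u3 t) ≤ D := by
  obtain ⟨hα, hK⟩ := c.gi_le
  obtain ⟨C', hC'0, hC'⟩ := Sol.exists_init_increment_le c A B hA0 hB0
  obtain ⟨C, hC0, hC⟩ := Sol.exists_increment_energy hT c hB0
  set E0 := (K / α + 1) * (4 * C') with hE0
  have E00 : 0 ≤ E0 := by positivity
  set X := Real.exp (C * T) with hX
  have X0 : 0 < X := Real.exp_pos _
  set R0 := Real.sqrt (Real.exp (2 * C * X / α * T) * (X * (E0 + C * T) / α + T * 0)) with hR0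
  refine ⟨(R0 + (5 * K * B ^ 2 + K * B ^ 3 + 3 * K * B)) / α, by positivity,
    fun M s hA1 hA2 hA3 hB => ?_⟩
  obtain ⟨D, hD0, hD⟩ := hC M s hB
  have hM := s.bound_nonneg hT
  have hinit := hC' M s hA1 hA2 hA3 hB
  -- Only almost every h is admissible. Picking h between τ/2 and τ makes the available bound C' τ²
  -- at most 4 C' h², so the quotients at time 0 stay bounded.
  let τ : ℕ → ℝ := fun n => T / (n + 1)
  have hτ : ∀ n, τ n ∈ Ioc 0 T := fun n =>
    ⟨by positivity, div_le_self hT.le (by linarith [(Nat.cast_nonneg n : (0:ℝ) ≤ n)])⟩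
  have hex : ∀ n, ∃ h, h ∈ Ioo (τ n / 2) (τ n) ∧
      (∀ᵐ t ∂(volume.restrict (Ioo 0 (T - h))),
        α * l2 (timeDq h s.u1 t) ^ 2 ≤ X *
          (K * l2 (fun x => h⁻¹ • (s.u1 h x - s.i1 x)) ^ 2
            + l2 (fun x => h⁻¹ • (s.u h x - s.i0 x)) ^ 2 + C * T
            + 2 * C * (∫ r in (0:ℝ)..t, l2 (s.v1 r) ^ 2) + h * D)) ∧
      α * l2 (fun x => s.u1 h x - s.i1 x) ^ 2 + l2 (fun x => s.u h x - s.i0 x) ^ 2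
        ≤ C' * τ n ^ 2 := by
    intro n
    have hn := hτ n
    have : NeZero (volume.restrict (Ioo (τ n / 2) (τ n))) := ⟨by simp [hn.1]⟩
    have sub1 : Ioo (τ n / 2) (τ n) ⊆ Ioo 0 T :=
      Ioo_subset_Ioo (by linarith [hn.1]) hn.2
    have sub2 : Ioo (τ n / 2) (τ n) ⊆ Ioo 0 (τ n) := Ioo_subset_Ioo_left (by linarith [hn.1])
    obtain ⟨h, h1, h2, h3⟩ := ((ae_restrict_mem measurableSet_Ioo).and
      ((ae_restrict_of_ae_restrict_of_subset sub1 hD).and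
      (ae_restrict_of_ae_restrict_of_subset sub2 (hinit _ hn)))).exists
    exact ⟨h, h1, h2, h3⟩
  choose h hmem hen hin using hex
  have hpos : ∀ n, 0 < h n := fun n => by linarith [(hmem n).1, (hτ n).1]
  have hlim : Tendsto h atTop (𝓝 0) := by
    have t1 : Tendsto τ atTop (𝓝 0) := by
      have := (tendsto_one_div_add_atTop_nhds_zero_nat (𝕜 := ℝ)).const_mul T
      simpa [τ, div_eq_mul_inv] using this
    exact squeeze_zero (fun n => (hpos n).le) (fun n => (hmem n).2.le) t1
  have hE : ∀ n, K * l2 (fun x => (h n)⁻¹ • (s.u1 (h n) x - s.i1 x)) ^ 2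
      + l2 (fun x => (h n)⁻¹ • (s.u (h n) x - s.i0 x)) ^ 2 ≤ E0 := by
    intro n
    have hn := hpos n
    rw [l2_const_smul, l2_const_smul, abs_of_pos (inv_pos.2 hn)]
    set a := l2 (fun x => s.u1 (h n) x - s.i1 x)
    set b := l2 (fun x => s.u (h n) x - s.i0 x)
    have e1 : C' * τ n ^ 2 ≤ 4 * C' * h n ^ 2 := by
      have : τ n ≤ 2 * h n := by linarith [(hmem n).1]
      have h0 := (hτ n).1.le
      calc C' * τ n ^ 2 ≤ C' * (2 * h n) ^ 2 := by gcongr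
        _ = _ := by ring
    have e2 := (hin n).trans e1
    have e3 : K * a ^ 2 + b ^ 2 ≤ (K / α + 1) * (α * a ^ 2 + b ^ 2) := by
      have : (K / α + 1) * (α * a ^ 2 + b ^ 2) = K * a ^ 2 + b ^ 2 + (K / α * b ^ 2 + α * a ^ 2) := by
        field_simp; ring
      rw [this]
      have : 0 ≤ K / α * b ^ 2 + α * a ^ 2 := by positivity
      linarith
    have e4 : K * a ^ 2 + b ^ 2 ≤ E0 * h n ^ 2 := by
      refine e3.trans ((mul_le_mul_of_nonneg_left e2 (by positivity)).trans (le_of_eq ?_))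
      rw [hE0]; ring
    have e5 : K * ((h n)⁻¹ * a) ^ 2 + ((h n)⁻¹ * b) ^ 2 = (K * a ^ 2 + b ^ 2) / h n ^ 2 := by
      field_simp
    rw [e5, div_le_iff₀ (by positivity)]
    exact e4
  have hlen : ∀ᵐ t ∂(volume.restrict (Ioo 0 T)), ∀ n, t < T - h n →
      (MemLp (timeDq (h n) s.u1 t) 2 ∧
      l2 (timeDq (h n) s.u1 t) ^ 2 ≤ (X * (E0 + C * T) / α
        + ∫ r in (0:ℝ)..t, 2 * C * X / α * l2 (s.v1 r) ^ 2) + h n * (X * D / α)) := by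
    rw [ae_all_iff]
    intro n
    have inc := TP.l2_increment (by positivity :
      0 ≤ M * (K * (M + M)) + K * (M + 2 * M + M)) (hpos n) s.tp1 s.ju1 s.jv1 s.init.sm1
      (s.l2_v1_le.mono fun t h => h.2)
    have h1 := hen n
    rw [ae_restrict_iff' measurableSet_Ioo] at h1 inc ⊢
    filter_upwards [h1, inc] with t ht hi htI htn
    have htt : t ∈ Ioo 0 (T - h n) := ⟨htI.1, htn⟩
    refine ⟨(hi htt).1.const_smul (h n)⁻¹, ?_⟩
    have k := (ht htt).trans (mul_le_mul_of_nonneg_left (add_le_add_left (add_le_add_left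
      (add_le_add_left (hE n) _) _) _) X0.le)
    rw [intervalIntegral.integral_const_mul]
    have e : l2 (timeDq (h n) s.u1 t) ^ 2 = (α * l2 (timeDq (h n) s.u1 t) ^ 2) / α := by field_simp
    rw [e, div_le_iff₀ hα]
    refine k.trans (le_of_eq ?_)
    field_simp
  have iR : IntegrableOn (fun t => l2 (s.v1 t) ^ 2) (Ioo 0 T) :=
    s.jv1.integrableOn_l2_sq (s.l2_v1_le.mono fun t h => h.2)
  have key : ∀ᵐ t ∂(volume.restrict (Ioo 0 T)), l2 (s.v1 t) ^ 2 ≤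
      Real.exp (2 * C * X / α * T) * (X * (E0 + C * T) / α + T * 0) := by
    refine gronwall_of_le hT (by positivity) le_rfl (by positivity) iR
      (iR.const_mul (2 * C * X / α)) ?_ (Eventually.of_forall fun t => by simp)
    filter_upwards [hlen, s.tp1.tendsto_timeDq s.ju1 s.jv1 hpos hlim,
      ae_restrict_mem measurableSet_Ioo] with t h1 h2 htI
    have hev : ∀ᶠ n in atTop, t < T - h n := by
      filter_upwards [hlim.eventually (gt_mem_nhds (by linarith [htI.2] : (0:ℝ) < T - t))] with n hn
      linarith
    refine l2_sq_le_of_tendsto (D := X * D / α) (hev.mono fun n hn => (h1 n hn).1)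
      (fun n => ((s.ju1.timeDq (h n)).slice t).aestronglyMeasurable) hlim ?_ h2
      (hev.mono fun n hn => (h1 n hn).2)
    have : 0 ≤ ∫ r in (0:ℝ)..t, 2 * C * X / α * l2 (s.v1 r) ^ 2 :=
      intervalIntegral.integral_nonneg htI.1.le fun r _ => by positivity
    positivity
  filter_upwards [key, s.slice, c.slice, hB] with t h1 ⟨h2, _⟩ hc ⟨b1, b2⟩
  have h3 : l2 (s.v1 t) ≤ R0 := Real.le_sqrt_of_sq_le h1
  refine (hc.l2_three_le h2 hB0 b1 b2).trans ?_
  have h4 : l2 (velD (c.g t) (c.g1 t) (c.g2 t) (s.u t) (s.u1 t) (s.u2 t) (s.u3 t)) ≤ R0 := h3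
  gcongr

/-- A priori bound of the first three space derivatives in terms of those of the datum. -/
theorem Sol.exists_bound {T α K : ℝ} (hT : 0 < T) (c : Coef T α K) (A : ℝ) (hA0 : 0 ≤ A) :
    ∃ D, 0 ≤ D ∧ ∀ (M : ℝ) (s : Sol c M), l2 s.i1 ≤ A → l2 s.i2 ≤ A → l2 s.i3 ≤ A →
      ∀ᵐ t ∂(volume.restrict (Ioo 0 T)), l2 (s.u1 t) ≤ D ∧ l2 (s.u2 t) ≤ D ∧ l2 (s.u3 t) ≤ D := by
  obtain ⟨B1, h1, H1⟩ := Sol.exists_bound_one hT c A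
  obtain ⟨B2, h2, H2⟩ := Sol.exists_bound_two hT c A B1 h1
  obtain ⟨B3, h3, H3⟩ := Sol.exists_bound_three hT c A (max B1 B2) hA0 (h1.trans (le_max_left _ _))
  refine ⟨max (max B1 B2) B3, h3.trans (le_max_right _ _), fun M s a1 a2 a3 => ?_⟩
  have k1 := H1 M s a1
  have k2 := H2 M s a1 a2 k1
  have k3 := H3 M s a1 a2 a3 (by
    filter_upwards [k1, k2] with t x1 x2
    exact ⟨x1.trans (le_max_left _ _), x2.trans (le_max_right _ _)⟩)
  filter_upwards [k1, k2, k3] with t x1 x2 x3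
  exact ⟨x1.trans ((le_max_left _ _).trans (le_max_left _ _)),
    x2.trans ((le_max_right _ _).trans (le_max_left _ _)), x3.trans (le_max_right _ _)⟩

end SchrodingerMap

namespace SchrodingerMap

/-! ### Stability of differences of solutions in `H¹` -/

namespace Sol

/-- A solution with another bound of its derivatives. -/
def rebound {T α K M : ℝ} {c : Coef T α K} (s : Sol c M) {D : ℝ}
    (h : ∀ᵐ t ∂(volume.restrict (Ioo 0 T)),
      l2 (s.u1 t) ≤ D ∧ l2 (s.u2 t) ≤ D ∧ l2 (s.u3 t) ≤ D) : Sol c D where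
  u := s.u
  u1 := s.u1
  u2 := s.u2
  u3 := s.u3
  i0 := s.i0
  i1 := s.i1
  i2 := s.i2
  i3 := s.i3
  ju := s.ju
  ju1 := s.ju1
  ju2 := s.ju2
  ju3 := s.ju3
  slice := by
    filter_upwards [s.slice, h] with t h1 h2
    exact ⟨h1.1, h2⟩
  init := s.init
  tp := s.tp
  tp1 := s.tp1

variable {T α K D : ℝ} {c : Coef T α K}

/-- A qualitative fact: both solutions move from their data by a square integrable amount, so the
difference stays in L² once it starts there. The maps themselves, of norm one, are not in L². -/
theorem l2_difference_le (hT : 0 < T) (s r : Sol c D) (m0 : MemLp (fun x => s.i0 x - r.i0 x) 2) :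
    ∀ᵐ t ∂(volume.restrict (Ioo 0 T)), MemLp (fun x => s.u t x - r.u t x) 2 ∧
      l2 (fun x => s.u t x - r.u t x) ≤
        T * (K * (D + D)) + T * (K * (D + D)) + l2 (fun x => s.i0 x - r.i0 x) := by
  have hD := s.bound_nonneg hT
  obtain ⟨-, hK⟩ := c.gi_le
  have hV : 0 ≤ K * (D + D) := by positivity
  filter_upwards [TP.l2_sub_init hV s.tp s.ju s.jv s.init.sm (s.l2_v1_le.mono fun t h => h.1),
    TP.l2_sub_init hV r.tp r.ju r.jv r.init.sm (r.l2_v1_le.mono fun t h => h.1),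
    ae_restrict_mem measurableSet_Ioo] with t ⟨a1, a2⟩ ⟨b1, b2⟩ htI
  have e : (fun x => s.u t x - r.u t x) = fun x =>
      ((s.u t x - s.i0 x) - (r.u t x - r.i0 x)) + (s.i0 x - r.i0 x) := by
    funext x; abel
  have tv : t * (K * (D + D)) ≤ T * (K * (D + D)) := by have := htI.2; gcongr
  rw [e]
  refine ⟨(a1.sub b1).add m0, (l2_add_le (a1.sub b1) m0).trans ?_⟩
  refine (add_le_add (SchrodingerMap.l2_sub_le a1 b1) le_rfl).trans ?_
  linarith

/-- The bound of `w ↦ w ∧ p` in the equation of a difference of solutions. -/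
def fluxBound (K D : ℝ) : ℝ := K * (D + 2 * D + D)

theorem flux_le (hD : 0 ≤ D) (r : Sol c D) : ∀ᵐ t ∂(volume.restrict (Ioo 0 T)),
    WD (r.p t) (r.p1 t) ∧ MemLp (r.p t) 2 ∧ l2 (r.p t) ≤ fluxBound K D ∧
    MemLp (r.p1 t) 2 ∧ l2 (r.p1 t) ≤ fluxBound K D ∧ ∀ᵐ x, ‖r.p t x‖ ≤ fluxBound K D := by
  filter_upwards [r.slice, c.slice] with t ⟨h, b1, b2, b3⟩ hc
  have hK := hc.K_nonneg
  have w := hc.wd_fluxD h.wd1 h.wd2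
  have f := hc.memLp_flux h.m1 h.m2
  have f1 := hc.memLp_fluxDD h.m1 h.m2 h.m3
  have k : l2 (r.p t) ≤ fluxBound K D := f.2.trans (by
    have : K * (l2 (r.u1 t) + l2 (r.u2 t)) ≤ K * (D + D) := by gcongr
    refine this.trans (mul_le_mul_of_nonneg_left (by linarith) hK))
  have k1 : l2 (r.p1 t) ≤ fluxBound K D := f1.2.trans (by unfold fluxBound; gcongr)
  exact ⟨w, f.1, k, f1.1, k1, ae_norm_le_of_WD w f.1 f1.1 k k1⟩

/-- Writing the difference of the velocities as u ∧ (p − q) + (u − y) ∧ q puts it in the form of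
`h1_energy`, with forcing N = w ∧ q. The bound of N_x uses the sup norm of w against q_x, which is
only square integrable. -/
theorem difference_slice (hT : 0 < T) (s r : Sol c D) (m0 : MemLp (fun x => s.i0 x - r.i0 x) 2) :
    ∃ M, ∀ᵐ t ∂(volume.restrict (Ioo 0 T)),
      LinearSlice (c.g t) (c.g1 t) M D (s.u t) (s.u1 t)
      (fun x => s.u t x - r.u t x) (fun x => s.u1 t x - r.u1 t x) (fun x => s.u2 t x - r.u2 t x)
      (fun x => s.v t x - r.v t x) (fun x => s.v1 t x - r.v1 t x)
      (fun x => wedge (s.u t x - r.u t x) (r.p t x))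
      (fun x => wedge (s.u1 t x - r.u1 t x) (r.p t x) + wedge (s.u t x - r.u t x) (r.p1 t x)) ∧
      l2 (fun x => wedge (s.u1 t x - r.u1 t x) (r.p t x) + wedge (s.u t x - r.u t x) (r.p1 t x)) ≤
        fluxBound K D * l2 (fun x => s.u1 t x - r.u1 t x) +
        (l2 (fun x => s.u t x - r.u t x) + l2 (fun x => s.u1 t x - r.u1 t x)) * fluxBound K D := by
  have hD := s.bound_nonneg hT
  obtain ⟨-, hK⟩ := c.gi_le
  set V := K * (D + D)
  set V1 := D * (K * (D + D)) + K * (D + 2 * D + D)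
  have hV : 0 ≤ V := by positivity
  have hV1 : 0 ≤ V1 := by positivity
  have hP : 0 ≤ fluxBound K D := by unfold fluxBound; positivity
  set L := l2 (fun x => s.i0 x - r.i0 x)
  have hL : 0 ≤ L := l2_nonneg _
  have y1 : 0 ≤ T * V := by positivity
  refine ⟨T * V + T * V + L + 2 * D + 2 * V + 2 * V1, ?_⟩
  filter_upwards [s.slice, r.slice, c.slice, s.l2_v1_le, r.l2_v1_le, l2_difference_le hT s r m0,
    r.flux_le hD] with t ⟨h, a1, a2, a3⟩ ⟨k, b1, b2, b3⟩ hc ⟨⟨p0, q0⟩, p1, q1⟩ ⟨⟨p2, q2⟩, p3, q3⟩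
      ⟨mw, lw⟩ ⟨f1, f2, f3, f4, f5, f6⟩
  have ww : WD (fun x => s.u t x - r.u t x) (fun x => s.u1 t x - r.u1 t x) := h.wd.sub k.wd
  have mw1 : MemLp (fun x => s.u1 t x - r.u1 t x) 2 := h.m1.sub k.m1
  have lw1 := SchrodingerMap.l2_sub_le h.m1 k.m1
  have lv := SchrodingerMap.l2_sub_le p0 p2
  have lv1 := SchrodingerMap.l2_sub_le p1 p3
  have bw : ∀ᵐ x, ‖s.u t x - r.u t x‖ ≤
      l2 (fun x => s.u t x - r.u t x) + l2 (fun x => s.u1 t x - r.u1 t x) :=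
    ae_norm_le_of_WD ww mw mw1 (le_add_of_nonneg_right (l2_nonneg _))
      (le_add_of_nonneg_left (l2_nonneg _))
  have n0 := memLp_wedge_right hP mw f2.1 f6
  have n1 := memLp_wedge_right hP mw1 f2.1 f6
  have n2 := memLp_wedge_left (add_nonneg (l2_nonneg _) (l2_nonneg _)) mw.1 bw f4
  refine ⟨⟨ww, h.wd1.sub k.wd1, (hc.wd_vel h).sub (hc.wd_vel k), ww.wedge f1, h.wd,
    h.sm1.aestronglyMeasurable, Eventually.of_forall fun x => (h.sph x).le, h.ae_norm_u1_le a1 a2,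
    mw, by linarith, mw1, by linarith, h.m2.sub k.m2, p0.sub p2, by linarith, p1.sub p3,
    by linarith, n0.1, n1.1.add n2.1, Eventually.of_forall fun x => ?_⟩, ?_⟩
  · have e : fluxD (c.g t) (c.g1 t) (fun x => s.u1 t x - r.u1 t x) (fun x => s.u2 t x - r.u2 t x) x
        = s.p t x - r.p t x := by
      simp only [Sol.p, fluxD]
      module
    rw [e]
    simp only [Sol.v, vel, wedge_sub_left, wedge_sub_right]
    simp only [Sol.p]
    abel
  · refine (l2_add_le n1.1 n2.1).trans (add_le_add n1.2 (n2.2.trans ?_))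
    exact mul_le_mul_of_nonneg_left f5 (add_nonneg (l2_nonneg _) (l2_nonneg _))

theorem tp_sub (s r : Sol c D) : TP T (fun t x => s.u t x - r.u t x) (fun x => s.i0 x - r.i0 x)
    (fun t x => s.v t x - r.v t x) :=
  (s.tp.sub r.tp).congr (fun _ _ => rfl) (fun _ => rfl) (fun _ _ => rfl)

theorem tp1_sub (s r : Sol c D) : TP T (fun t x => s.u1 t x - r.u1 t x) (fun x => s.i1 x - r.i1 x)
    (fun t x => s.v1 t x - r.v1 t x) :=
  (s.tp1.sub r.tp1).congr (fun _ _ => rfl) (fun _ => rfl) (fun _ _ => rfl)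

/-- Stability in `H¹` for two solutions with the same bound. -/
theorem exists_difference_one (hT : 0 < T) (c : Coef T α K) (D : ℝ) :
    ∃ C, 0 ≤ C ∧ ∀ (s r : Sol c D), MemLp (fun x => s.i0 x - r.i0 x) 2 →
      ∀ᵐ t ∂(volume.restrict (Ioo 0 T)), MemLp (fun x => s.u t x - r.u t x) 2 ∧
        l2 (fun x => s.u1 t x - r.u1 t x) ^ 2 + l2 (fun x => s.u t x - r.u t x) ^ 2 ≤
        C * (l2 (fun x => s.i1 x - r.i1 x) ^ 2 + l2 (fun x => s.i0 x - r.i0 x) ^ 2) := by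
  obtain ⟨hα, hK⟩ := c.gi_le
  rcases lt_or_ge D 0 with hD | hD
  -- There is no solution with a negative bound, so this case is vacuous.
  · exact ⟨0, le_rfl, fun s => absurd (s.bound_nonneg hT) hD.not_ge⟩
  set P := fluxBound K D
  have hP : 0 ≤ P := by simp only [P, fluxBound]; positivity
  set Q := (K + 2 * (K * D) + 6 * (K * P)) with hQ
  have hQ0 : 0 ≤ Q := by positivity
  set C1 := Q * (1 / α + 1) with hC1
  have hC10 : 0 ≤ C1 := by positivity
  refine ⟨(1 / α + 1) * (Real.exp (C1 * T) * (K + 1)), by positivity, fun s r m0 => ?_⟩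
  obtain ⟨M, hM⟩ := difference_slice hT s r m0
  have jw : JM (fun t x => s.u t x - r.u t x) := s.ju.sub r.ju
  have jw1 : JM (fun t x => s.u1 t x - r.u1 t x) := s.ju1.sub r.ju1
  obtain ⟨J, hJ, hJ1, hJ2⟩ := h1_energy hT hD c (tp_sub s r) (tp1_sub s r) jw jw1
    (s.jv.sub r.jv) (s.jv1.sub r.jv1) (s.init.sm.sub r.init.sm) (s.init.sm1.sub r.init.sm1) m0
    (s.init.m1.sub r.init.m1) (hM.mono fun t h => h.1)
  set a0 := l2 (fun x => s.i1 x - r.i1 x)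
  set b0 := l2 (fun x => s.i0 x - r.i0 x)
  have hY : IntegrableOn (fun t => α * l2 (fun x => s.u1 t x - r.u1 t x) ^ 2
      + l2 (fun x => s.u t x - r.u t x) ^ 2) (Ioo 0 T) :=
    ((jw1.integrableOn_l2_sq (hM.mono fun t h => ⟨h.1.m1, h.1.b1⟩)).const_mul α).add
      (jw.integrableOn_l2_sq (hM.mono fun t h => ⟨h.1.m, h.1.b⟩))
  have key := gronwall_of_le (A := K * a0 ^ 2 + b0 ^ 2) (B := 0) (C := C1) hT (by positivity)
    le_rfl hC10 hY hJ hJ1 (by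
      filter_upwards [hJ2, hM, c.slice] with t h1 ⟨h2, h3⟩ hc
      set a := l2 (fun x => s.u1 t x - r.u1 t x)
      set b := l2 (fun x => s.u t x - r.u t x)
      have ha : 0 ≤ a := l2_nonneg _
      have hb : 0 ≤ b := l2_nonneg _
      have e1 := (abs_le.1 (integral_bdd_inner_le hK (Eventually.of_forall hc.bg) h2.m1 h2.mN1)).2
      have e1' := e1.trans (mul_le_mul_of_nonneg_left (mul_le_mul_of_nonneg_left h3 ha) hK)
      -- The forcing w ∧ q is orthogonal to w, so it does not enter the L² part of the energy.
      simp only [inner_wedge_self, integral_zero] at h1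
      refine h1.trans ?_
      have ab : a * b ≤ a ^ 2 + b ^ 2 := by nlinarith [sq_nonneg (a - b)]
      have e2 : K * a ^ 2 + 2 * (K * D * (a * b)) + 2 * (K * (a * (P * a + (b + a) * P)))
          ≤ Q * (a ^ 2 + b ^ 2) := by
        have i1 : K * D * (a * b) ≤ K * D * (a ^ 2 + b ^ 2) := by gcongr
        have i2 : K * P * (a * b) ≤ K * P * (a ^ 2 + b ^ 2) := by gcongr
        have i3 : 0 ≤ K * P * b ^ 2 := by positivity
        have i4 : 0 ≤ K * b ^ 2 := by positivity
        rw [hQ]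
        nlinarith
      have e3 : a ^ 2 + b ^ 2 ≤ (1 / α + 1) * (α * a ^ 2 + b ^ 2) := by
        have : (1 / α + 1) * (α * a ^ 2 + b ^ 2) = a ^ 2 + b ^ 2 + (b ^ 2 / α + α * a ^ 2) := by
          field_simp; ring
        rw [this]
        exact le_add_of_nonneg_right (by positivity)
      have e4 := mul_le_mul_of_nonneg_left e3 hQ0
      rw [hC1]
      linarith)
  filter_upwards [key, hM] with t h1 ⟨h2, _⟩
  refine ⟨h2.m, ?_⟩
  set a := l2 (fun x => s.u1 t x - r.u1 t x)
  set b := l2 (fun x => s.u t x - r.u t x)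
  have e3 : a ^ 2 + b ^ 2 ≤ (1 / α + 1) * (α * a ^ 2 + b ^ 2) := by
    have : (1 / α + 1) * (α * a ^ 2 + b ^ 2) = a ^ 2 + b ^ 2 + (b ^ 2 / α + α * a ^ 2) := by
      field_simp; ring
    rw [this]
    exact le_add_of_nonneg_right (by positivity)
  refine e3.trans ?_
  rw [mul_assoc]
  refine mul_le_mul_of_nonneg_left (h1.trans ?_) (by positivity)
  rw [mul_zero, add_zero, mul_assoc (Real.exp (C1 * T))]
  refine mul_le_mul_of_nonneg_left ?_ (Real.exp_pos _).le
  nlinarith [mul_nonneg hK (sq_nonneg b0), sq_nonneg a0]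

end Sol

end SchrodingerMap

namespace SchrodingerMap

/-! ### The remainder in the second energy of a difference -/

/-- The remainder in the second energy identity of a difference of solutions. -/
noncomputable def diffRemainder (g g1 gt gt1 ν ν' : ℝ) (u u1 u2 w w1 w2 z z1 q1 p1 : E3) : ℝ :=
  inner ℝ z (gt1 • w1 + gt • w2) + g * det3 z w1 q1 - g * inner ℝ z1 u * det3 u w p1
    - g * inner ℝ w u * det3 z1 u p1 + (g1 * ν + g * ν') * det3 z w u
    + g * ν * (det3 z w1 u + det3 z w u1) - g * inner ℝ z1 u * det3 u u1 z
    + (g1 * inner ℝ z u + g * (inner ℝ z1 u + inner ℝ z u1)) * det3 z u1 u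
    + g * inner ℝ z u * det3 z u2 u

/-- The derivative of the flux in the second energy identity of a difference of solutions. -/
noncomputable def diffFluxD (g g1 gt gt1 ν ν' : ℝ) (u u1 u2 w w1 w2 z z1 q q1 : E3) : ℝ :=
  (inner ℝ z1 (gt • w1) + inner ℝ z (gt1 • w1 + gt • w2))
    + (det3 z1 (g • w1) q + det3 z z q + det3 z (g • w1) q1)
    + ((g1 * ν + g * ν') * det3 z w u + (g * ν) * (det3 z1 w u + det3 z w1 u + det3 z w u1))
    + ((g1 * inner ℝ z u + g * (inner ℝ z1 u + inner ℝ z u1)) * det3 z u1 u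
      + (g * inner ℝ z u) * (det3 z1 u1 u + det3 z u2 u + det3 z u1 u1))

/-- The determinants of z1, u1, z and of z1, w, q1 are expanded along u. The factors z1 · u, w · u
and p1 · u are of lower order, and u1 · u = 0. Terms in which z1 stands beside lower order factors
only are completed to x-derivatives, collected in `diffFluxD`; the products in the remainder either
avoid z1 or see it only through z1 · u or with the factor w · u. -/
theorem diff_identity {g g1 gt gt1 ν ν' : ℝ} {u u1 u2 w w1 w2 z z1 q q1 p1 : E3} (hu : ‖u‖ = 1)
    (o : inner ℝ u u1 = 0) (hq : p1 = q1 + z1) (hν : inner ℝ p1 u = ν) :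
    - inner ℝ z1 (gt • w1 + g • ((wedge u1 z + wedge w1 q) + (wedge u z1 + wedge w q1))) =
      - diffFluxD g g1 gt gt1 ν ν' u u1 u2 w w1 w2 z z1 q q1
        + diffRemainder g g1 gt gt1 ν ν' u u1 u2 w w1 w2 z z1 q1 p1 := by
  have d1 := det3_decomp u z1 w p1 hu
  have d2 := det3_decomp u z1 u1 z hu
  -- Replacing q1 by p1 = q1 + z1 is free, because z1 already occupies another entry. The gain is
  -- that p1 · u is a known lower order quantity, u being the map whose flux is p.
  have d3 : det3 z1 w p1 = det3 z1 w q1 := by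
    rw [hq]
    simp only [det3, wedge_add_right, inner_add_right]
    have := det3_self_outer z1 w
    rw [det3] at this
    linarith
  have d4 : det3 z z q = 0 := det3_self_left _ _
  have d5 : det3 z u1 u1 = 0 := det3_self_right _ _
  have d6 : det3 z1 u z1 = 0 := det3_self_outer _ _
  have d7 : det3 z1 (g • w1) q = g * det3 z1 w1 q := by
    rw [det3, wedge_smul_left, real_inner_smul_right, det3]
  have d8 : det3 z (g • w1) q1 = g * det3 z w1 q1 := by
    rw [det3, wedge_smul_left, real_inner_smul_right, det3]
  have o' : inner ℝ u1 u = 0 := by rw [real_inner_comm]; exact o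
  rw [d3] at d1
  rw [hν] at d1
  rw [o'] at d2
  have e : inner ℝ z1 (gt • w1 + g • ((wedge u1 z + wedge w1 q) + (wedge u z1 + wedge w q1))) =
      inner ℝ z1 (gt • w1) + g * (det3 z1 u1 z + det3 z1 w1 q + (det3 z1 u z1 + det3 z1 w q1)) := by
    simp only [inner_add_right, real_inner_smul_right, det3]
  rw [e, diffFluxD, diffRemainder, d4, d5, d6, d7, d8, d1, d2]
  ring

/-- The constant bounding the remainder. -/
def diffConst (K D : ℝ) : ℝ :=
  2 * K ^ 2 + 2 * K ^ 3 + 2 * K ^ 3 * (3 * D + 2) + 2 * K ^ 3 + 15 * K ^ 3 * D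
    + 5 * K ^ 3 * D ^ 2 * (1 + D) + K ^ 3 * D * (3 * D + 2) + K ^ 3 * D * (4 * D + 3) + K ^ 3 * D

/-- The vectors p1, q1, z1 contain third derivatives and have no pointwise bound. They occur
multiplied by w or w1, whose sup norms are small, and this explains the product form of three of the
hypotheses. -/
theorem abs_diffRemainder_le {K D e g g1 gt gt1 ν ν' : ℝ} {u u1 u2 w w1 w2 z z1 q1 p1 : E3}
    (hK : 0 ≤ K) (hD : 0 ≤ D) (he : 0 ≤ e) (bg : |g| ≤ K) (bg1 : |g1| ≤ K) (bgt : |gt| ≤ K)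
    (bgt1 : |gt1| ≤ K) (hu : ‖u‖ = 1) (hu1 : ‖u1‖ ≤ D) (hu2 : ‖u2‖ ≤ D) (hw : ‖w‖ ≤ e)
    (hw1 : ‖w1‖ ≤ e) (hw2 : ‖w2‖ ≤ e) (hz : ‖z‖ ≤ K * e) (hq1 : ‖w1‖ * ‖q1‖ ≤ 2 * K * e)
    (hp1 : ‖w‖ * ‖p1‖ ≤ 2 * K * e) (hz1 : ‖w‖ * ‖z1‖ ≤ 2 * K * e)
    (hzu : |inner ℝ z1 u| ≤ K * (3 * D + 2) * e) (hwu : |inner ℝ w u| ≤ ‖w‖ ^ 2 / 2)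
    (hν : |ν| ≤ 5 * K * D ^ 2) (hν' : |g1 * ν + g * ν'| * ‖w‖ ≤ 15 * K ^ 2 * D * e) :
    |diffRemainder g g1 gt gt1 ν ν' u u1 u2 w w1 w2 z z1 q1 p1| ≤ diffConst K D * e ^ 2 := by
  have hn : |inner ℝ z u| ≤ K * e := by
    have := abs_real_inner_le_norm z u
    rw [hu, mul_one] at this
    exact this.trans hz
  have hm : |inner ℝ z u1| ≤ K * e * D := (abs_real_inner_le_norm _ _).trans (by gcongr)
  have t1 : |inner ℝ z (gt1 • w1 + gt • w2)| ≤ 2 * K ^ 2 * e ^ 2 := by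
    refine (abs_real_inner_le_norm _ _).trans ?_
    have : ‖gt1 • w1 + gt • w2‖ ≤ K * e + K * e := by
      refine (norm_add_le _ _).trans ?_
      rw [norm_smul, norm_smul, Real.norm_eq_abs, Real.norm_eq_abs]
      gcongr
    calc _ ≤ (K * e) * (K * e + K * e) := by gcongr
      _ = _ := by ring
  have t2 : |g * det3 z w1 q1| ≤ 2 * K ^ 3 * e ^ 2 := by
    rw [abs_mul]
    calc _ ≤ K * (‖z‖ * ‖w1‖ * ‖q1‖) := by gcongr; exact abs_det3_le _ _ _
      _ = K * (‖z‖ * (‖w1‖ * ‖q1‖)) := by ring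
      _ ≤ K * ((K * e) * (2 * K * e)) := by gcongr
      _ = _ := by ring
  have t3 : |g * inner ℝ z1 u * det3 u w p1| ≤ 2 * K ^ 3 * (3 * D + 2) * e ^ 2 := by
    rw [abs_mul, abs_mul]
    calc _ ≤ K * (K * (3 * D + 2) * e) * (‖u‖ * ‖w‖ * ‖p1‖) := by gcongr; exact abs_det3_le _ _ _
      _ = K * (K * (3 * D + 2) * e) * (‖w‖ * ‖p1‖) := by rw [hu]; ring
      _ ≤ K * (K * (3 * D + 2) * e) * (2 * K * e) := by gcongr
      _ = _ := by ring
  have t4 : |g * inner ℝ w u * det3 z1 u p1| ≤ 2 * K ^ 3 * e ^ 2 := by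
    rw [abs_mul, abs_mul]
    calc _ ≤ K * (‖w‖ ^ 2 / 2) * (‖z1‖ * ‖u‖ * ‖p1‖) := by gcongr; exact abs_det3_le _ _ _
      _ = K / 2 * ((‖w‖ * ‖z1‖) * (‖w‖ * ‖p1‖)) := by rw [hu]; ring
      _ ≤ K / 2 * ((2 * K * e) * (2 * K * e)) := by gcongr
      _ = _ := by ring
  have t5 : |(g1 * ν + g * ν') * det3 z w u| ≤ 15 * K ^ 3 * D * e ^ 2 := by
    rw [abs_mul]
    calc _ ≤ |g1 * ν + g * ν'| * (‖z‖ * ‖w‖ * ‖u‖) := by gcongr; exact abs_det3_le _ _ _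
      _ = (|g1 * ν + g * ν'| * ‖w‖) * ‖z‖ := by rw [hu]; ring
      _ ≤ (15 * K ^ 2 * D * e) * (K * e) := by gcongr
      _ = _ := by ring
  have t6 : |g * ν * (det3 z w1 u + det3 z w u1)| ≤ 5 * K ^ 3 * D ^ 2 * (1 + D) * e ^ 2 := by
    rw [abs_mul, abs_mul]
    have : |det3 z w1 u + det3 z w u1| ≤ K * e * e * 1 + K * e * e * D := by
      refine (abs_add_le _ _).trans (add_le_add ((abs_det3_le _ _ _).trans ?_)
        ((abs_det3_le _ _ _).trans ?_))
      · rw [hu]; gcongr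
      · gcongr
    calc _ ≤ K * (5 * K * D ^ 2) * (K * e * e * 1 + K * e * e * D) := by gcongr
      _ = _ := by ring
  have t7 : |g * inner ℝ z1 u * det3 u u1 z| ≤ K ^ 3 * D * (3 * D + 2) * e ^ 2 := by
    rw [abs_mul, abs_mul]
    calc _ ≤ K * (K * (3 * D + 2) * e) * (‖u‖ * ‖u1‖ * ‖z‖) := by gcongr; exact abs_det3_le _ _ _
      _ = K * (K * (3 * D + 2) * e) * (‖u1‖ * ‖z‖) := by rw [hu]; ring
      _ ≤ K * (K * (3 * D + 2) * e) * (D * (K * e)) := by gcongr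
      _ = _ := by ring
  have t8 : |(g1 * inner ℝ z u + g * (inner ℝ z1 u + inner ℝ z u1)) * det3 z u1 u| ≤
      K ^ 3 * D * (4 * D + 3) * e ^ 2 := by
    rw [abs_mul]
    have : |g1 * inner ℝ z u + g * (inner ℝ z1 u + inner ℝ z u1)| ≤
        K * (K * e) + K * (K * (3 * D + 2) * e + K * e * D) := by
      refine (abs_add_le _ _).trans ?_
      rw [abs_mul, abs_mul]
      have := abs_add_le (inner ℝ z1 u) (inner ℝ z u1)
      have := this.trans (add_le_add hzu hm)
      gcongr
    calc _ ≤ (K * (K * e) + K * (K * (3 * D + 2) * e + K * e * D)) * (‖z‖ * ‖u1‖ * ‖u‖) := by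
          gcongr; exact abs_det3_le _ _ _
      _ = (K * (K * e) + K * (K * (3 * D + 2) * e + K * e * D)) * (‖z‖ * ‖u1‖) := by rw [hu]; ring
      _ ≤ (K * (K * e) + K * (K * (3 * D + 2) * e + K * e * D)) * (K * e * D) := by gcongr
      _ = _ := by ring
  have t9 : |g * inner ℝ z u * det3 z u2 u| ≤ K ^ 3 * D * e ^ 2 := by
    rw [abs_mul, abs_mul]
    calc _ ≤ K * (K * e) * (‖z‖ * ‖u2‖ * ‖u‖) := by gcongr; exact abs_det3_le _ _ _
      _ = K * (K * e) * (‖z‖ * ‖u2‖) := by rw [hu]; ring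
      _ ≤ K * (K * e) * (K * e * D) := by gcongr
      _ = _ := by ring
  rw [diffRemainder, diffConst]
  rw [abs_le] at *
  constructor <;> linarith [t1.1, t1.2]

/-- The flux in the second energy identity of a difference of solutions. -/
noncomputable def diffFlux (g gt ν : ℝ) (u u1 w w1 z q : E3) : ℝ :=
  inner ℝ z (gt • w1) + det3 z (g • w1) q + g * ν * det3 z w u + g * inner ℝ z u * det3 z u1 u

theorem abs_diffFlux_le {K D e g gt ν : ℝ} {u u1 w w1 z q : E3}
    (hK : 0 ≤ K) (hD : 0 ≤ D) (he : 0 ≤ e) (bg : |g| ≤ K) (bgt : |gt| ≤ K)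
    (hu : ‖u‖ = 1) (hu1 : ‖u1‖ ≤ D) (hw : ‖w‖ ≤ e)
    (hw1 : ‖w1‖ ≤ e) (hz : ‖z‖ ≤ K * e) (hq : ‖q‖ ≤ 2 * K * D) (hν : |ν| ≤ 5 * K * D ^ 2) :
    |diffFlux g gt ν u u1 w w1 z q| ≤
      (K ^ 2 + 2 * K ^ 3 * D + 5 * K ^ 3 * D ^ 2 + K ^ 3 * D) * e ^ 2 := by
  have hn : |inner ℝ z u| ≤ K * e := by
    have := abs_real_inner_le_norm z u
    rw [hu, mul_one] at this
    exact this.trans hz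
  have hs : ∀ {r : ℝ}, |r| ≤ K → ‖r • w1‖ ≤ K * e := fun h => by
    rw [norm_smul, Real.norm_eq_abs]; gcongr
  have t1 : |inner ℝ z (gt • w1)| ≤ K ^ 2 * e ^ 2 := by
    have := hs bgt
    calc _ ≤ _ := abs_real_inner_le_norm _ _
      _ ≤ (K * e) * (K * e) := by gcongr
      _ = _ := by ring
  have t2 : |det3 z (g • w1) q| ≤ 2 * K ^ 3 * D * e ^ 2 := by
    have := hs bg
    calc _ ≤ _ := abs_det3_le _ _ _
      _ ≤ (K * e) * (K * e) * (2 * K * D) := by gcongr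
      _ = _ := by ring
  have t3 : |g * ν * det3 z w u| ≤ 5 * K ^ 3 * D ^ 2 * e ^ 2 := by
    rw [abs_mul, abs_mul]
    calc _ ≤ K * (5 * K * D ^ 2) * (‖z‖ * ‖w‖ * ‖u‖) := by gcongr; exact abs_det3_le _ _ _
      _ ≤ K * (5 * K * D ^ 2) * ((K * e) * e * 1) := by rw [hu]; gcongr
      _ = _ := by ring
  have t4 : |g * inner ℝ z u * det3 z u1 u| ≤ K ^ 3 * D * e ^ 2 := by
    rw [abs_mul, abs_mul]
    calc _ ≤ K * (K * e) * (‖z‖ * ‖u1‖ * ‖u‖) := by gcongr; exact abs_det3_le _ _ _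
      _ ≤ K * (K * e) * ((K * e) * D * 1) := by rw [hu]; gcongr
      _ = _ := by ring
  rw [diffFlux]
  rw [abs_le] at *
  constructor <;> linarith [t1.1, t1.2]

theorem norm_fluxD_le {g g1 K : ℝ} {a b : E3} (bg : |g| ≤ K) (bg1 : |g1| ≤ K) :
    ‖g • b + g1 • a‖ ≤ K * (‖a‖ + ‖b‖) := by
  refine (norm_add_le _ _).trans ?_
  rw [norm_smul, norm_smul, Real.norm_eq_abs, Real.norm_eq_abs, mul_add, add_comm]
  gcongr

theorem norm_fluxDD_le {g g1 g2 K : ℝ} {a b c : E3} (bg : |g| ≤ K) (bg1 : |g1| ≤ K)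
    (bg2 : |g2| ≤ K) : ‖g • c + (2 * g1) • b + g2 • a‖ ≤ 2 * K * (‖a‖ + ‖b‖ + ‖c‖) := by
  have hK := (abs_nonneg _).trans bg
  refine (norm_add₃_le).trans ?_
  rw [norm_smul, norm_smul, norm_smul, Real.norm_eq_abs, Real.norm_eq_abs, Real.norm_eq_abs,
    abs_mul, abs_two]
  have h1 := mul_le_mul_of_nonneg_right bg (norm_nonneg c)
  have h2 := mul_le_mul_of_nonneg_right bg1 (norm_nonneg b)
  have h3 := mul_le_mul_of_nonneg_right bg2 (norm_nonneg a)
  have := mul_nonneg hK (norm_nonneg a)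
  have := mul_nonneg hK (norm_nonneg c)
  linarith

end SchrodingerMap

namespace SchrodingerMap

/-! ### The normal component of the second flux derivative -/

/-- The normal component of `(g u_x)_{xx}`, and its derivative. -/
noncomputable def normalPart (g g1 : ℝ) (u1 u2 : E3) : ℝ :=
  (-3 : ℝ) * (g * inner ℝ u1 u2) - 2 * (g1 * inner ℝ u1 u1)

noncomputable def normalPartD (g g1 g2 : ℝ) (u1 u2 u3 : E3) : ℝ :=
  (-3 : ℝ) * (g1 * inner ℝ u1 u2 + g * (inner ℝ u2 u2 + inner ℝ u1 u3))
    - 2 * (g2 * inner ℝ u1 u1 + g1 * (inner ℝ u2 u1 + inner ℝ u1 u2))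

theorem abs_inner_le_mul {a b : E3} {D : ℝ} (ha : ‖a‖ ≤ D) : |inner ℝ a b| ≤ D * ‖b‖ :=
  (abs_real_inner_le_norm _ _).trans (by gcongr)

theorem abs_normalPart_le {K D g g1 : ℝ} {u1 u2 : E3} (bg : |g| ≤ K) (bg1 : |g1| ≤ K)
    (h1 : ‖u1‖ ≤ D) : |normalPart g g1 u1 u2| ≤ K * D * (3 * ‖u2‖ + 2 * ‖u1‖) := by
  have hK := (abs_nonneg _).trans bg
  have a1 : |g * inner ℝ u1 u2| ≤ K * (D * ‖u2‖) := by
    rw [abs_mul]; gcongr; exact abs_inner_le_mul h1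
  have a2 : |g1 * inner ℝ u1 u1| ≤ K * (D * ‖u1‖) := by
    rw [abs_mul]; gcongr; exact abs_inner_le_mul h1
  rw [normalPart]
  rw [abs_le] at *
  constructor <;> linarith

theorem abs_normalPartD_le {K D g g1 g2 : ℝ} {u1 u2 u3 : E3} (bg : |g| ≤ K) (bg1 : |g1| ≤ K)
    (bg2 : |g2| ≤ K) (h1 : ‖u1‖ ≤ D) (h2 : ‖u2‖ ≤ D) :
    |normalPartD g g1 g2 u1 u2 u3| ≤ K * D * (10 * (‖u1‖ + ‖u2‖ + ‖u3‖)) := by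
  have hK := (abs_nonneg _).trans bg
  have hD := (norm_nonneg _).trans h1
  have a1 : |g1 * inner ℝ u1 u2| ≤ K * (D * ‖u2‖) := by
    rw [abs_mul]; gcongr; exact abs_inner_le_mul h1
  have a2 : |g * inner ℝ u2 u2| ≤ K * (D * ‖u2‖) := by
    rw [abs_mul]; gcongr; exact abs_inner_le_mul h2
  have a3 : |g * inner ℝ u1 u3| ≤ K * (D * ‖u3‖) := by
    rw [abs_mul]; gcongr; exact abs_inner_le_mul h1
  have a4 : |g2 * inner ℝ u1 u1| ≤ K * (D * ‖u1‖) := by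
    rw [abs_mul]; gcongr; exact abs_inner_le_mul h1
  have a5 : |g1 * inner ℝ u2 u1| ≤ K * (D * ‖u2‖) := by
    rw [abs_mul, real_inner_comm]; gcongr; exact abs_inner_le_mul h1
  have b1 : 0 ≤ K * (D * ‖u1‖) := by positivity
  have b2 : 0 ≤ K * (D * ‖u2‖) := by positivity
  have b3 : 0 ≤ K * (D * ‖u3‖) := by positivity
  rw [normalPartD]
  rw [abs_le] at *
  constructor <;> linarith

/-- The majorant of the terms in the second energy identity. -/
noncomputable def majorant (Q : ℝ) (w w1 w2 u1 u2 u3 y1 y2 y3 : E3) : ℝ :=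
  ‖w‖ + ‖w1‖ + ‖w2‖ + Q * (‖u1‖ + ‖u2‖ + ‖u3‖ + (‖y1‖ + ‖y2‖ + ‖y3‖))

section slices

variable {α K D : ℝ} {g g1 g2 gt gt1 : ℝ → ℝ} {u u1 u2 u3 y y1 y2 y3 : ℝ → E3}

/-- Subtracting u3 · u = −3 u1 · u2 and y3 · y = −3 y1 · y2 expresses (u3 − y3) · u through
differences of derivatives of order one and two, plus (u − y) · y3. In the last term the small
factor u − y is taken in sup norm. -/
theorem CoefSlice.inner_diffFluxDD_le (c : CoefSlice α K g g1 g2) (s : MapSlice u u1 u2 u3)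
    (r : MapSlice y y1 y2 y3) {Q : ℝ} (bw : ∀ᵐ x, ‖u x - y x‖ ≤ Q) (bu2 : ∀ᵐ x, ‖u2 x‖ ≤ D)
    (by1 : ∀ᵐ x, ‖y1 x‖ ≤ D) (hD : 0 ≤ D) :
    ∀ᵐ x, |inner ℝ (fluxDD g g1 g2 (fun x => u1 x - y1 x) (fun x => u2 x - y2 x)
      (fun x => u3 x - y3 x) x) (u x)| ≤
      K * (3 * D + 2) * majorant Q (u x - y x) (u1 x - y1 x) (u2 x - y2 x) (u1 x) (u2 x) (u3 x)
        (y1 x) (y2 x) (y3 x) := by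
  have hK := c.K_nonneg
  filter_upwards [s.inner_two, s.inner_three, r.inner_two, r.inner_three, bw, bu2, by1]
    with x a2 a3 b2 b3 h0 h2 h1
  have e3 : inner ℝ (u3 x - y3 x) (u x) = -3 * (inner ℝ (u2 x) (u1 x - y1 x)
      + inner ℝ (y1 x) (u2 x - y2 x)) - inner ℝ (u x - y x) (y3 x) := by
    rw [inner_sub_left, inner_sub_left, inner_sub_right, inner_sub_right, b3,
      real_inner_comm, a3, real_inner_comm (u1 x) (u2 x), real_inner_comm (y3 x) (u x),
      real_inner_comm (y1 x) (u2 x)]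
    ring
  have i3 : |inner ℝ (u3 x - y3 x) (u x)| ≤
      3 * (D * ‖u1 x - y1 x‖) + 3 * (D * ‖u2 x - y2 x‖) + Q * ‖y3 x‖ := by
    have c1 := abs_inner_le_mul (b := u1 x - y1 x) h2
    have c2 := abs_inner_le_mul (b := u2 x - y2 x) h1
    have c3 := abs_inner_le_mul (b := y3 x) h0
    rw [e3]
    rw [abs_le] at *
    constructor <;> linarith
  have i2 : |inner ℝ (u2 x - y2 x) (u x)| ≤ ‖u2 x - y2 x‖ := by
    simpa [s.sph] using abs_real_inner_le_norm (u2 x - y2 x) (u x)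
  have i1 : |inner ℝ (u1 x - y1 x) (u x)| ≤ ‖u1 x - y1 x‖ := by
    simpa [s.sph] using abs_real_inner_le_norm (u1 x - y1 x) (u x)
  have hQ := (norm_nonneg _).trans h0
  rw [fluxDD, inner_add_left, inner_add_left, real_inner_smul_left, real_inner_smul_left,
    real_inner_smul_left]
  set a := ‖u1 x - y1 x‖
  set b := ‖u2 x - y2 x‖
  have f3 : |g x * inner ℝ (u3 x - y3 x) (u x)| ≤ K * (3 * (D * a) + 3 * (D * b) + Q * ‖y3 x‖) := by
    rw [abs_mul]; have := c.bg x; gcongr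
  have f2 : |2 * g1 x * inner ℝ (u2 x - y2 x) (u x)| ≤ 2 * K * b := by
    rw [abs_mul, abs_mul, abs_two]; have := c.bg1 x; gcongr
  have f1 : |g2 x * inner ℝ (u1 x - y1 x) (u x)| ≤ K * a := by
    rw [abs_mul]; have := c.bg2 x; gcongr
  refine (abs_add_le _ _).trans ((add_le_add ((abs_add_le _ _).trans (add_le_add f3 f2)) f1).trans ?_)
  have ha : 0 ≤ a := norm_nonneg _
  have hb : 0 ≤ b := norm_nonneg _
  set E := majorant Q (u x - y x) (u1 x - y1 x) (u2 x - y2 x) (u1 x) (u2 x) (u3 x)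
        (y1 x) (y2 x) (y3 x) with hE
  have m1 : a + b + Q * ‖y3 x‖ ≤ E := by
    rw [hE, majorant]
    have p : 0 ≤ Q * (‖u1 x‖ + ‖u2 x‖ + ‖u3 x‖ + (‖y1 x‖ + ‖y2 x‖)) := by positivity
    have := norm_nonneg (u x - y x)
    linarith
  have m2 : a + b ≤ E := by have : 0 ≤ Q * ‖y3 x‖ := by positivity
                            linarith
  have m3 : K * (3 * D) * (a + b) ≤ K * (3 * D) * E := by gcongr
  have m4 : K * 2 * (a + b + Q * ‖y3 x‖) ≤ K * 2 * E := by gcongr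
  have m5 : 0 ≤ K * (Q * ‖y3 x‖) := by positivity
  have m6 : 0 ≤ K * a := by positivity
  linarith

/-- The weight Q in front of the derivatives of u and y makes the L² norm of the majorant linear in
Q, although third derivatives occur in it. -/
theorem memLp_majorant (s : MapSlice u u1 u2 u3) (r : MapSlice y y1 y2 y3) {Q : ℝ} (hQ : 0 ≤ Q)
    (hs : l2 u1 ≤ D ∧ l2 u2 ≤ D ∧ l2 u3 ≤ D) (hr : l2 y1 ≤ D ∧ l2 y2 ≤ D ∧ l2 y3 ≤ D)
    (mw : MemLp (fun x => u x - y x) 2)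
    (hl : l2 (fun x => u x - y x) + l2 (fun x => u1 x - y1 x) + l2 (fun x => u2 x - y2 x) ≤ Q) :
    MemLp (fun x => majorant Q (u x - y x) (u1 x - y1 x) (u2 x - y2 x) (u1 x) (u2 x) (u3 x)
        (y1 x) (y2 x) (y3 x)) 2 ∧
    l2 (fun x => majorant Q (u x - y x) (u1 x - y1 x) (u2 x - y2 x) (u1 x) (u2 x) (u3 x)
        (y1 x) (y2 x) (y3 x)) ≤ (1 + 6 * D) * Q := by
  have m1 := (s.m1.sub r.m1).norm
  have m2 := (s.m2.sub r.m2).norm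
  have k1 := l2_add_le mw.norm m1
  have k2 := l2_add_le (mw.norm.add m1) m2
  have a1 := l2_add_le s.m1.norm s.m2.norm
  have a2 := l2_add_le (s.m1.norm.add s.m2.norm) s.m3.norm
  have b1 := l2_add_le r.m1.norm r.m2.norm
  have b2 := l2_add_le (r.m1.norm.add r.m2.norm) r.m3.norm
  have ms := (s.m1.norm.add s.m2.norm).add s.m3.norm
  have mr := (r.m1.norm.add r.m2.norm).add r.m3.norm
  have d := l2_add_le ms mr
  have e := l2_const_smul Q (fun x => ‖u1 x‖ + ‖u2 x‖ + ‖u3 x‖ + (‖y1 x‖ + ‖y2 x‖ + ‖y3 x‖))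
  have f := l2_add_le ((mw.norm.add m1).add m2) ((ms.add mr).const_mul Q)
  refine ⟨((mw.norm.add m1).add m2).add ((ms.add mr).const_mul Q), f.trans ?_⟩
  rw [abs_of_nonneg hQ] at e
  have t1 : l2 (fun x => ‖u1 x‖ + ‖u2 x‖ + ‖u3 x‖ + (‖y1 x‖ + ‖y2 x‖ + ‖y3 x‖)) ≤ 6 * D := by
    refine d.trans ((add_le_add (a2.trans (add_le_add a1 le_rfl))
      (b2.trans (add_le_add b1 le_rfl))).trans ?_)
    simp only [l2_norm]
    linarith
  have t2 : l2 (fun x => ‖u x - y x‖ + ‖u1 x - y1 x‖ + ‖u2 x - y2 x‖) ≤ Q := by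
    refine k2.trans ((add_le_add k1 le_rfl).trans ?_)
    have e1 := l2_norm (fun x => u x - y x)
    have e2 := l2_norm (fun x => u1 x - y1 x)
    have e3 := l2_norm (fun x => u2 x - y2 x)
    refine le_trans (le_of_eq ?_) hl
    rw [← e1, ← e2, ← e3]
    rfl
  have t3 : Q * l2 (fun x => ‖u1 x‖ + ‖u2 x‖ + ‖u3 x‖ + (‖y1 x‖ + ‖y2 x‖ + ‖y3 x‖)) ≤ Q * (6 * D) :=
    mul_le_mul_of_nonneg_left t1 hQ
  calc _ ≤ Q + Q * (6 * D) := add_le_add t2 (e.le.trans t3)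
    _ = _ := by ring

end slices

end SchrodingerMap

namespace SchrodingerMap

/-! ### Absorption of the critical terms -/

section slices

variable {α K D : ℝ} {g g1 g2 gt gt1 : ℝ → ℝ} {u u1 u2 u3 y y1 y2 y3 : ℝ → E3}

theorem wd_normalPart (c : CoefSlice α K g g1 g2) (s : MapSlice u u1 u2 u3) :
    WD (fun x => normalPart (g x) (g1 x) (u1 x) (u2 x))
      (fun x => normalPartD (g x) (g1 x) (g2 x) (u1 x) (u2 x) (u3 x)) :=
  ((c.wd.mul (s.wd1.inner s.wd2)).const_smul (-3)).sub
    ((c.wd1.mul (s.wd1.inner s.wd1)).const_smul 2)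

theorem inner_fluxDD_eq_normalPart (s : MapSlice u u1 u2 u3) :
    ∀ᵐ x, inner ℝ (fluxDD g g1 g2 u1 u2 u3 x) (u x) = normalPart (g x) (g1 x) (u1 x) (u2 x) := by
  filter_upwards [s.inner_one, s.inner_two, s.inner_three] with x h1 h2 h3
  rw [fluxDD, inner_add_left, inner_add_left, real_inner_smul_left, real_inner_smul_left,
    real_inner_smul_left, real_inner_comm (u x) (u3 x), h3, real_inner_comm (u x) (u2 x), h2,
    real_inner_comm (u x) (u1 x), h1, normalPart,
    real_inner_self_eq_norm_sq]
  ring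

set_option maxHeartbeats 1600000 in
-- The left-hand side is half the rate of ‖z‖². By `diff_identity` its integrand is minus an exact
-- derivative plus a remainder, and the remainder is quadratic in the majorant. The result is a
-- multiple of the squared H² norm of the difference, with no third derivative of the difference in
-- it.
theorem CoefSlice.integral_diff_le (c : CoefSlice α K g g1 g2) (s : MapSlice u u1 u2 u3)
    (r : MapSlice y y1 y2 y3) (hs : l2 u1 ≤ D ∧ l2 u2 ≤ D ∧ l2 u3 ≤ D)
    (hr : l2 y1 ≤ D ∧ l2 y2 ≤ D ∧ l2 y3 ≤ D) (wdt : WD gt gt1) (bgt : ∀ x, |gt x| ≤ K)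
    (bgt1 : ∀ x, |gt1 x| ≤ K) (sgt : StronglyMeasurable gt)
    (mw : MemLp (fun x => u x - y x) 2) :
    - ∫ x, inner ℝ (fluxDD g g1 g2 (fun x => u1 x - y1 x) (fun x => u2 x - y2 x)
      (fun x => u3 x - y3 x) x) (gt x • (u1 x - y1 x) +
        g x • (velD g g1 g2 u u1 u2 u3 x - velD g g1 g2 y y1 y2 y3 x)) ≤
    diffConst K D * ((1 + 6 * D) * (l2 (fun x => u x - y x) + l2 (fun x => u1 x - y1 x)
      + l2 (fun x => u2 x - y2 x))) ^ 2 := by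
  have hK := c.K_nonneg
  have hD : 0 ≤ D := (l2_nonneg _).trans hs.1
  set Q := l2 (fun x => u x - y x) + l2 (fun x => u1 x - y1 x) + l2 (fun x => u2 x - y2 x) with hQd
  have q0 := l2_nonneg (fun x => u x - y x)
  have q1 := l2_nonneg (fun x => u1 x - y1 x)
  have q2 := l2_nonneg (fun x => u2 x - y2 x)
  have hQ : 0 ≤ Q := by positivity
  have m1 : MemLp (fun x => u1 x - y1 x) 2 := s.m1.sub r.m1
  have m2 : MemLp (fun x => u2 x - y2 x) 2 := s.m2.sub r.m2
  have m3 : MemLp (fun x => u3 x - y3 x) 2 := s.m3.sub r.m3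
  have ww : WD (fun x => u x - y x) (fun x => u1 x - y1 x) := s.wd.sub r.wd
  have ww1 : WD (fun x => u1 x - y1 x) (fun x => u2 x - y2 x) := s.wd1.sub r.wd1
  have ww2 : WD (fun x => u2 x - y2 x) (fun x => u3 x - y3 x) := s.wd2.sub r.wd2
  have bw : ∀ᵐ x, ‖u x - y x‖ ≤ Q := ae_norm_le_of_WD ww mw m1 (by linarith) (by linarith)
  have bw1 : ∀ᵐ x, ‖u1 x - y1 x‖ ≤ Q := ae_norm_le_of_WD ww1 m1 m2 (by linarith) (by linarith)
  have bu1 := s.ae_norm_u1_le hs.1 hs.2.1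
  have bu2 : ∀ᵐ x, ‖u2 x‖ ≤ D := ae_norm_le_of_WD s.wd2 s.m2 s.m3 hs.2.1 hs.2.2
  have by1 := r.ae_norm_u1_le hr.1 hr.2.1
  have by2 : ∀ᵐ x, ‖y2 x‖ ≤ D := ae_norm_le_of_WD r.wd2 r.m2 r.m3 hr.2.1 hr.2.2
  obtain ⟨mE, lE⟩ := memLp_majorant s r hQ hs hr mw hQd.ge
  have hzu := c.inner_diffFluxDD_le s r bw bu2 by1 hD
  set E : ℝ → ℝ := fun x => majorant Q (u x - y x) (u1 x - y1 x) (u2 x - y2 x) (u1 x) (u2 x) (u3 x)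
    (y1 x) (y2 x) (y3 x) with hE
  set z := fluxD g g1 (fun x => u1 x - y1 x) (fun x => u2 x - y2 x) with hz
  set z1 := fluxDD g g1 g2 (fun x => u1 x - y1 x) (fun x => u2 x - y2 x) (fun x => u3 x - y3 x)
    with hz1
  set ν : ℝ → ℝ := fun x => normalPart (g x) (g1 x) (u1 x) (u2 x) with hν
  set ν' : ℝ → ℝ := fun x => normalPartD (g x) (g1 x) (g2 x) (u1 x) (u2 x) (u3 x) with hν'
  set q := fluxD g g1 y1 y2 with hq
  set q1 := fluxDD g g1 g2 y1 y2 y3 with hq1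
  set p1 := fluxDD g g1 g2 u1 u2 u3 with hp1
  have wz : WD z z1 := c.wd_fluxD ww1 ww2
  have wq : WD q q1 := c.wd_fluxD r.wd1 r.wd2
  have wν : WD ν ν' := wd_normalPart c s
  have mz1 : MemLp z1 2 := (c.memLp_fluxDD m1 m2 m3).1
  set F : ℝ → ℝ := fun x => diffFlux (g x) (gt x) (ν x) (u x) (u1 x) (u x - y x) (u1 x - y1 x) (z x) (q x)
    with hF
  set F' : ℝ → ℝ := fun x => diffFluxD (g x) (g1 x) (gt x) (gt1 x) (ν x) (ν' x) (u x) (u1 x) (u2 x)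
    (u x - y x) (u1 x - y1 x) (u2 x - y2 x) (z x) (z1 x) (q x) (q1 x) with hF'
  set R : ℝ → ℝ := fun x => diffRemainder (g x) (g1 x) (gt x) (gt1 x) (ν x) (ν' x) (u x) (u1 x) (u2 x)
    (u x - y x) (u1 x - y1 x) (u2 x - y2 x) (z x) (z1 x) (q1 x) (p1 x) with hR
  set ζ : ℝ → E3 := fun x => gt x • (u1 x - y1 x) +
        g x • (velD g g1 g2 u u1 u2 u3 x - velD g g1 g2 y y1 y2 y3 x) with hζ
  -- The product rule applied to the four terms of the flux in turn.
  have wF : WD F F' := by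
    have h1 := wz.inner (wdt.smul ww1)
    have h2 := wz.det3 (c.wd_flux ww1) wq
    have h3 := (c.wd.mul wν).mul (wz.det3 ww s.wd)
    have h4 := (c.wd.mul (wz.inner s.wd)).mul (wz.det3 s.wd1 s.wd)
    exact ((h1.add h2).add h3).add h4
  have dz1 : ∀ x, p1 x = q1 x + z1 x := fun x => by
    simp only [hp1, hq1, hz1, fluxDD]; module
  have dz : ∀ x, fluxD g g1 u1 u2 x = q x + z x := fun x => by
    simp only [hq, hz, fluxD]; module
  have bE : ∀ x, ‖u x - y x‖ ≤ E x ∧ ‖u1 x - y1 x‖ ≤ E x ∧ ‖u1 x - y1 x‖ + ‖u2 x - y2 x‖ ≤ E x ∧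
      Q * (‖u1 x‖ + ‖u2 x‖ + ‖u3 x‖ + (‖y1 x‖ + ‖y2 x‖ + ‖y3 x‖)) ≤ E x := fun x => by
    have k : 0 ≤ Q * (‖u1 x‖ + ‖u2 x‖ + ‖u3 x‖ + (‖y1 x‖ + ‖y2 x‖ + ‖y3 x‖)) := by positivity
    have k0 := norm_nonneg (u x - y x)
    have k1 := norm_nonneg (u1 x - y1 x)
    have k2 := norm_nonneg (u2 x - y2 x)
    simp only [hE, majorant]
    refine ⟨?_, ?_, ?_, ?_⟩ <;> linarith
  have bz : ∀ x, ‖z x‖ ≤ K * E x := fun x =>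
    (norm_fluxD_le (c.bg x) (c.bg1 x)).trans (mul_le_mul_of_nonneg_left (bE x).2.2.1 hK)
  have bν : ∀ᵐ x, |ν x| ≤ 5 * K * D ^ 2 := by
    filter_upwards [bu1, bu2] with x h1 h2
    refine (abs_normalPart_le (c.bg x) (c.bg1 x) h1).trans ?_
    calc K * D * (3 * ‖u2 x‖ + 2 * ‖u1 x‖) ≤ K * D * (3 * D + 2 * D) := by gcongr
      _ = _ := by ring
  have id : ∀ᵐ x, - inner ℝ (z1 x) (ζ x) = - F' x + R x := by
    filter_upwards [s.inner_one, inner_fluxDD_eq_normalPart (g := g) (g1 := g1) (g2 := g2) s]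
      with x o hn
    have e : velD g g1 g2 u u1 u2 u3 x - velD g g1 g2 y y1 y2 y3 x =
        (wedge (u1 x) (z x) + wedge (u1 x - y1 x) (q x)) +
          (wedge (u x) (z1 x) + wedge (u x - y x) (q1 x)) := by
      simp only [velD, dz]
      rw [← hp1, dz1, ← hq1]
      simp only [wedge_add_right, wedge_sub_left]
      abel
    simp only [hζ]
    rw [e]
    exact diff_identity (s.sph x) o (dz1 x) hn
  have bR : ∀ᵐ x, ‖R x‖ ≤ diffConst K D * (‖E x‖ * ‖E x‖) := by
    filter_upwards [bw, bw1, bu1, bu2, bν, hzu] with x w0 w1 h1 h2 hνx hzux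
    obtain ⟨e0, e1, e2, e3⟩ := bE x
    have eE : 0 ≤ E x := (norm_nonneg _).trans e0
    have np1 : ‖p1 x‖ ≤ 2 * K * (‖u1 x‖ + ‖u2 x‖ + ‖u3 x‖) :=
      norm_fluxDD_le (c.bg x) (c.bg1 x) (c.bg2 x)
    have nq1 : ‖q1 x‖ ≤ 2 * K * (‖y1 x‖ + ‖y2 x‖ + ‖y3 x‖) :=
      norm_fluxDD_le (c.bg x) (c.bg1 x) (c.bg2 x)
    have nz1 : ‖z1 x‖ ≤ ‖p1 x‖ + ‖q1 x‖ := by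
      rw [eq_sub_of_add_eq' (dz1 x).symm]; exact norm_sub_le _ _
    set su := ‖u1 x‖ + ‖u2 x‖ + ‖u3 x‖ with hsu
    set sy := ‖y1 x‖ + ‖y2 x‖ + ‖y3 x‖ with hsy
    have su0 : 0 ≤ su := by positivity
    have sy0 : 0 ≤ sy := by positivity
    have tot : ∀ {a b : ℝ}, 0 ≤ a → a ≤ Q → 0 ≤ b → b ≤ 2 * K * (su + sy) → a * b ≤ 2 * K * E x :=
      fun {a b} _ h h' h'' => by
        calc a * b ≤ Q * (2 * K * (su + sy)) := by gcongr
          _ = 2 * K * (Q * (su + sy)) := by ring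
          _ ≤ _ := by gcongr
    have Ksu : 0 ≤ K * su := by positivity
    have Ksy : 0 ≤ K * sy := by positivity
    rw [Real.norm_eq_abs (E x), abs_of_nonneg eE, ← sq]
    have nn := fun v : E3 => norm_nonneg v
    refine abs_diffRemainder_le hK hD eE (c.bg x) (c.bg1 x) (bgt x) (bgt1 x) (s.sph x) h1 h2 e0 e1
      (by linarith [nn (u1 x - y1 x)]) (bz x)
      (tot (nn _) w1 (nn _) (by linarith)) (tot (nn _) w0 (nn _) (by linarith))
      (tot (nn _) w0 (nn _) (by linarith)) hzux (le_of_eq ?_) hνx ?_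
    -- Since u and y are unit vectors, the normal component of u − y is exactly half its square.
    · have e : ‖u x - (u x - y x)‖ = 1 := by rw [sub_sub_cancel]; exact r.sph x
      have e' : ‖u x - (u x - y x)‖ ^ 2 = 1 := by rw [e]; norm_num
      rw [norm_sub_sq_real, s.sph, real_inner_comm] at e'
      have : inner ℝ (u x - y x) (u x) = ‖u x - y x‖ ^ 2 / 2 := by linarith
      rw [this, abs_of_nonneg (by positivity)]
    · have a1 := abs_normalPart_le (c.bg x) (c.bg1 x) h1 (u2 := u2 x)
      have a2 := abs_normalPartD_le (c.bg x) (c.bg1 x) (c.bg2 x) h1 h2 (u3 := u3 x)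
      have a3 : |g1 x * ν x| ≤ K * (K * D * (3 * ‖u2 x‖ + 2 * ‖u1 x‖)) := by
        rw [abs_mul]; have := c.bg1 x; gcongr
      have a4 : |g x * ν' x| ≤ K * (K * D * (10 * su)) := by
        rw [abs_mul]; have := c.bg x; gcongr
      have a5 : |g1 x * ν x + g x * ν' x| ≤ 15 * K ^ 2 * D * su := by
        refine (abs_add_le _ _).trans ((add_le_add a3 a4).trans ?_)
        have : 3 * ‖u2 x‖ + 2 * ‖u1 x‖ ≤ 5 * su := by
          have := nn (u1 x); have := nn (u2 x); have := nn (u3 x); linarith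
        calc _ ≤ K * (K * D * (5 * su)) + K * (K * D * (10 * su)) := by gcongr
          _ = _ := by ring
      calc _ ≤ 15 * K ^ 2 * D * su * Q := by gcongr
        _ = 15 * K ^ 2 * D * (Q * su) := by ring
        _ ≤ _ := by
          have : Q * su ≤ Q * (su + sy) := by gcongr; linarith
          have := this.trans e3
          gcongr
  have bF : ∀ᵐ x, ‖F x‖ ≤
      (K ^ 2 + 2 * K ^ 3 * D + 5 * K ^ 3 * D ^ 2 + K ^ 3 * D) * (‖E x‖ * ‖E x‖) := by
    filter_upwards [bu1, bν, by1, by2] with x h1 hνx k1 k2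
    obtain ⟨e0, e1, e2, e3⟩ := bE x
    have eE : 0 ≤ E x := (norm_nonneg _).trans e0
    rw [Real.norm_eq_abs (E x), abs_of_nonneg eE, ← sq]
    have nq : ‖q x‖ ≤ 2 * K * D := (norm_fluxD_le (c.bg x) (c.bg1 x)).trans (by
      calc _ ≤ K * (D + D) := by gcongr
        _ = _ := by ring)
    exact abs_diffFlux_le hK hD eE (c.bg x) (bgt x) (s.sph x) h1 e0 e1 (bz x) nq hνx
  have mζ : MemLp ζ 2 := by
    have mv := (c.memLp_velD s hs.1 hs.2.1 hs.2.2).1.sub (c.memLp_velD r hr.1 hr.2.1 hr.2.2).1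
    exact (memLp_bdd_smul sgt.aestronglyMeasurable (Eventually.of_forall bgt) m1).add
      (memLp_bdd_smul c.sm.aestronglyMeasurable (Eventually.of_forall c.bg) mv)
  have iI : Integrable fun x => inner ℝ (z1 x) (ζ x) := integrable_inner mz1 mζ
  -- The identity itself expresses R by functions already known to be measurable; the same device
  -- makes F' integrable below.
  have mR : AEStronglyMeasurable R volume := by
    have : R =ᵐ[volume] fun x => - inner ℝ (z1 x) (ζ x) + F' x := by
      filter_upwards [id] with x hx
      rw [hx]; ring
    exact (iI.neg.1.add wF.loc.aestronglyMeasurable).congr this.symm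
  have iR : Integrable R := integrable_of_le_mul mR mE mE bR
  have iF : Integrable F := integrable_of_le_mul wF.locallyIntegrable.aestronglyMeasurable mE mE bF
  have iF' : Integrable F' := by
    refine (iI.add iR).congr ?_
    filter_upwards [id] with x hx
    simp only [Pi.add_apply]
    linarith
  have z0 := wF.integral_eq_zero iF iF'
  have iN : Integrable fun x => - F' x := iF'.neg
  rw [← integral_neg, integral_congr_ae id, integral_add iN iR, integral_neg, z0, neg_zero, zero_add]
  have hC : 0 ≤ diffConst K D := by unfold diffConst; positivity
  refine (le_abs_self _).trans ((norm_integral_le_mul hC mE mE bR).trans ?_)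
  rw [← sq]
  have := l2_nonneg E
  gcongr

end slices

end SchrodingerMap

namespace SchrodingerMap

/-! ### Stability of differences of solutions in `H²` -/

theorem CoefSlice.mul_l2_le {α K : ℝ} {g g1 g2 : ℝ → ℝ} (c : CoefSlice α K g g1 g2)
    {f1 f2 : ℝ → E3} (h1 : MemLp f1 2) (h2 : MemLp f2 2) :
    l2 f2 ≤ α⁻¹ * (l2 (fluxD g g1 f1 f2) + K * l2 f1) := by
  have hα := c.pos
  have m1 := memLp_bdd_smul c.sm1.aestronglyMeasurable (Eventually.of_forall c.bg1) h1
  have m2 := c.memLp_smul h2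
  have a1 := l2_bdd_smul_le c.K_nonneg (Eventually.of_forall c.bg1) h1
  have a2 : l2 f2 ≤ α⁻¹ * l2 (fun x => g x • f2 x) := by
    refine l2_le (by positivity) m2 (Eventually.of_forall fun x => ?_)
    rw [norm_smul, Real.norm_of_nonneg (hα.le.trans (c.lower x)), ← mul_assoc]
    refine le_mul_of_one_le_left (norm_nonneg _) ?_
    rw [← inv_mul_cancel₀ hα.ne']
    have := c.lower x
    gcongr
  refine a2.trans (mul_le_mul_of_nonneg_left ?_ (by positivity))
  have e : (fun x => g x • f2 x) = fun x => fluxD g g1 f1 f2 x - g1 x • f1 x := by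
    funext x; simp only [fluxD]; abel
  rw [e]
  exact (l2_sub_le (c.memLp_flux h1 h2).1 m1).trans (add_le_add le_rfl a1)

namespace Sol

variable {T α K D : ℝ}

set_option maxHeartbeats 1000000 in
/-- Stability of second derivatives for two solutions with the same bound. -/
theorem exists_difference_two (hT : 0 < T) (c : Coef T α K) (D : ℝ) :
    ∃ C, 0 ≤ C ∧ ∀ (s r : Sol c D), MemLp (fun x => s.i0 x - r.i0 x) 2 →
      ∀ᵐ t ∂(volume.restrict (Ioo 0 T)),
        l2 (fun x => s.u2 t x - r.u2 t x) ^ 2 ≤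
        C * (l2 (fun x => s.i2 x - r.i2 x) ^ 2 + l2 (fun x => s.i1 x - r.i1 x) ^ 2
          + l2 (fun x => s.i0 x - r.i0 x) ^ 2) := by
  obtain ⟨hα, hK⟩ := c.gi_le
  rcases lt_or_ge D 0 with hD | hD
  · exact ⟨0, le_rfl, fun s => absurd (s.bound_nonneg hT) hD.not_ge⟩
  obtain ⟨C1, hC1, H1⟩ := exists_difference_one hT c D
  set κ := diffConst K D * (1 + 6 * D) ^ 2 with hκ
  have hκ0 : 0 ≤ κ := by simp only [hκ, diffConst]; positivity
  set A := 12 * κ * α⁻¹ ^ 2 with hA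
  set B := (6 * κ + 12 * κ * α⁻¹ ^ 2 * K ^ 2) * C1 with hB
  have hA0 : 0 ≤ A := by positivity
  have hB0 : 0 ≤ B := by positivity
  refine ⟨2 * α⁻¹ ^ 2 * (Real.exp (A * T) * (2 * K ^ 2 + T * B) + K ^ 2 * C1), by positivity,
    fun s r m0 => ?_⟩
  set V := D * (K * (D + D)) + K * (D + 2 * D + D) with hV
  set z : ℝ → ℝ → E3 := fun t => fluxD (c.g t) (c.g1 t) (fun x => s.u1 t x - r.u1 t x)
    (fun x => s.u2 t x - r.u2 t x) with hz
  set z1 : ℝ → ℝ → E3 := fun t => fluxDD (c.g t) (c.g1 t) (c.g2 t) (fun x => s.u1 t x - r.u1 t x)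
    (fun x => s.u2 t x - r.u2 t x) (fun x => s.u3 t x - r.u3 t x) with hz1
  set ζt : ℝ → ℝ → E3 := fun t x => c.gt t x • (s.u1 t x - r.u1 t x)
    + c.g t x • (s.v1 t x - r.v1 t x) with hζt
  have jw1 : JM (fun t x => s.u1 t x - r.u1 t x) := s.ju1.sub r.ju1
  have jz : JM z := JM.fluxD c.mg c.mg1 jw1 (s.ju2.sub r.ju2)
  have jz1 : JM z1 := JM.fluxDD c.mg c.mg1 c.mg2 jw1 (s.ju2.sub r.ju2) (s.ju3.sub r.ju3)
  have jζt : JM ζt := (c.mgt.smul jw1).add (c.mg.smul (s.jv1.sub r.jv1))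
  set M := K * (2 * D + 2 * D) + K * (2 * D + 2 * (2 * D) + 2 * D) + (K * (2 * D) + K * (V + V))
    with hM
  have hV0 : 0 ≤ V := by positivity
  have slice : ∀ᵐ t ∂(volume.restrict (Ioo 0 T)), (MemLp (z t) 2 ∧ l2 (z t) ≤ M) ∧
      (MemLp (z1 t) 2 ∧ l2 (z1 t) ≤ M) ∧ MemLp (ζt t) 2 ∧ l2 (ζt t) ≤ M := by
    filter_upwards [s.slice, r.slice, c.slice, s.l2_v1_le, r.l2_v1_le]
      with t ⟨h, a1, a2, a3⟩ ⟨k, b1, b2, b3⟩ hc ⟨_, p1, p2⟩ ⟨_, q1, q2⟩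
    have m1 : MemLp (fun x => s.u1 t x - r.u1 t x) 2 := h.m1.sub k.m1
    have m2 : MemLp (fun x => s.u2 t x - r.u2 t x) 2 := h.m2.sub k.m2
    have m3 : MemLp (fun x => s.u3 t x - r.u3 t x) 2 := h.m3.sub k.m3
    have mv : MemLp (fun x => s.v1 t x - r.v1 t x) 2 := p1.sub q1
    have l1 : l2 (fun x => s.u1 t x - r.u1 t x) ≤ 2 * D :=
      (SchrodingerMap.l2_sub_le h.m1 k.m1).trans (by linarith)
    have l2' : l2 (fun x => s.u2 t x - r.u2 t x) ≤ 2 * D :=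
      (SchrodingerMap.l2_sub_le h.m2 k.m2).trans (by linarith)
    have l3 : l2 (fun x => s.u3 t x - r.u3 t x) ≤ 2 * D :=
      (SchrodingerMap.l2_sub_le h.m3 k.m3).trans (by linarith)
    have lv : l2 (fun x => s.v1 t x - r.v1 t x) ≤ V + V :=
      (SchrodingerMap.l2_sub_le p1 q1).trans (by linarith)
    have f1 := hc.memLp_flux m1 m2
    have f2 := hc.memLp_fluxDD m1 m2 m3
    have f3 := memLp_bdd_smul (c.mgt.slice t).aestronglyMeasurable (Eventually.of_forall (c.bgt t)) m1
    have f4 := l2_bdd_smul_le hK (Eventually.of_forall (c.bgt t)) m1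
    have f5 := l2_bdd_smul_le hK (Eventually.of_forall hc.bg) mv
    have x1 := f1.2.trans (mul_le_mul_of_nonneg_left (add_le_add l1 l2') hK)
    have x2 := f2.2.trans (mul_le_mul_of_nonneg_left
      (add_le_add (add_le_add l1 (mul_le_mul_of_nonneg_left l2' zero_le_two)) l3) hK)
    have x3 := f4.trans (mul_le_mul_of_nonneg_left l1 hK)
    have x4 := f5.trans (mul_le_mul_of_nonneg_left lv hK)
    have y1 : 0 ≤ K * (2 * D + 2 * D) := by positivity
    have y2 : 0 ≤ K * (2 * D + 2 * (2 * D) + 2 * D) := by positivity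
    have y3 : 0 ≤ K * (2 * D) + K * (V + V) := by positivity
    refine ⟨⟨f1.1, x1.trans ?_⟩, ⟨f2.1, x2.trans ?_⟩, f3.add (hc.memLp_smul mv),
      (l2_add_le f3 (hc.memLp_smul mv)).trans ((add_le_add x3 x4).trans ?_)⟩
    all_goals rw [hM]; linarith
  have n1 : MemLp (fun x => s.i1 x - r.i1 x) 2 := s.init.m1.sub r.init.m1
  have n2 : MemLp (fun x => s.i2 x - r.i2 x) 2 := s.init.m2.sub r.init.m2
  have wi : WD (fun x => s.i1 x - r.i1 x) (fun x => s.i2 x - r.i2 x) := s.init.wd1.sub r.init.wd1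
  have si1 : StronglyMeasurable (fun x => s.i1 x - r.i1 x) := s.init.sm1.sub r.init.sm1
  have si2 : StronglyMeasurable (fun x => s.i2 x - r.i2 x) := s.init.sm2.sub r.init.sm2
  have hdiff := TP.deriv_energy (M := M) hT (ζ1 := z) (ζ2 := z1)
    (ζ01 := fluxD c.gi c.gi1 (fun x => s.i1 x - r.i1 x) (fun x => s.i2 x - r.i2 x))
    (TP.smul hT c.tp (tp1_sub s r)) (c.mg.smul jw1) jz1 jz jζt (c.init.sm.smul si1)
    ((JM.fluxD (JM.const c.init.sm) (JM.const c.init.sm1) (JM.const si1)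
      (JM.const si2)).slice 0) (c.init.wd_flux wi) (c.init.memLp_smul n1)
    (c.init.memLp_flux n1 n2).1 (by
      filter_upwards [slice, s.slice, r.slice, c.slice] with t ⟨k1, k2, k3⟩ h k hc
      have w1 : WD (fun x => s.u1 t x - r.u1 t x) (fun x => s.u2 t x - r.u2 t x) :=
        h.1.wd1.sub k.1.wd1
      exact ⟨hc.wd_flux w1, hc.wd_fluxD w1 (h.1.wd2.sub k.1.wd2),
        hc.memLp_smul (h.1.m1.sub k.1.m1), k1, k2, k3⟩)
  set N0 := l2 (fun x => s.i1 x - r.i1 x) ^ 2 + l2 (fun x => s.i0 x - r.i0 x) ^ 2 with hN0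
  have hN0' : 0 ≤ N0 := by positivity
  set d2 := l2 (fun x => s.i2 x - r.i2 x) with hd2
  have J1 : IntegrableOn (fun t => -2 * ∫ x, inner ℝ (z1 t x) (ζt t x)) (Ioo 0 T) := by
    refine ((jz1.inner jζt).integrableOn_integral (C := M * M) (slice.mono fun t h => ?_)).const_mul _
    refine (abs_integral_inner_le h.2.1.1 h.2.2.1).trans ?_
    exact mul_le_mul h.2.1.2 h.2.2.2 (l2_nonneg _) ((l2_nonneg _).trans h.2.1.2)
  -- Gronwall runs on ‖z‖². The second derivative of w is recovered from z and w_x by dividing by g,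
  -- and the H¹ norm of w is already bounded by the data, so it acts as a source term.
  have key := gronwall_of_le (Y := fun t => l2 (z t) ^ 2) (A := 2 * K ^ 2 * (N0 + d2 ^ 2))
    (B := B * N0) (C := A) hT (by positivity) (by positivity) hA0
    (jz.integrableOn_l2_sq (slice.mono fun t h => h.1)) J1 (by
      filter_upwards [hdiff] with t ht
      refine ht.trans (add_le_add ?_ le_rfl)
      refine (pow_le_pow_left₀ (l2_nonneg _) (c.init.memLp_flux n1 n2).2 2).trans ?_
      rw [mul_pow, mul_comm 2, mul_assoc]
      refine mul_le_mul_of_nonneg_left ?_ (by positivity)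
      rw [hN0]
      nlinarith [sq_nonneg (l2 (fun x => s.i1 x - r.i1 x) - d2),
        sq_nonneg (l2 (fun x => s.i0 x - r.i0 x))]) (by
      filter_upwards [H1 s r m0, s.slice, r.slice, c.slice, c.wdt] with t ⟨mw, hw⟩ ⟨h, a⟩ ⟨k, b⟩ hc hwt
      have m1 : MemLp (fun x => s.u1 t x - r.u1 t x) 2 := h.m1.sub k.m1
      have m2 : MemLp (fun x => s.u2 t x - r.u2 t x) 2 := h.m2.sub k.m2
      have e1 := hc.integral_diff_le h k a b hwt (c.bgt t) (c.bgt1 t) (c.mgt.slice t) mw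
      have e2 := hc.mul_l2_le m1 m2
      change -∫ x, inner ℝ (z1 t x) (ζt t x) ≤ _ at e1
      change _ ≤ α⁻¹ * (l2 (z t) + _) at e2
      set Z := l2 (z t)
      set x0 := l2 (fun x => s.u t x - r.u t x)
      set x1 := l2 (fun x => s.u1 t x - r.u1 t x)
      set x2 := l2 (fun x => s.u2 t x - r.u2 t x)
      have hx2 : 0 ≤ x2 := l2_nonneg _
      have e3 : x2 ^ 2 ≤ α⁻¹ ^ 2 * (2 * Z ^ 2 + 2 * K ^ 2 * x1 ^ 2) := by
        refine (pow_le_pow_left₀ hx2 e2 2).trans ?_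
        rw [mul_pow]
        refine mul_le_mul_of_nonneg_left ?_ (by positivity)
        linarith [sq_nonneg (Z - K * x1)]
      have e4 : (x0 + x1 + x2) ^ 2 ≤ 3 * (x1 ^ 2 + x0 ^ 2) + 3 * x2 ^ 2 := by
        linarith [sq_nonneg (x0 - x1), sq_nonneg (x0 - x2), sq_nonneg (x1 - x2)]
      have e5 : x1 ^ 2 ≤ C1 * N0 := (le_add_of_nonneg_right (sq_nonneg x0)).trans hw
      have e6 : (x0 + x1 + x2) ^ 2 ≤ 6 * α⁻¹ ^ 2 * Z ^ 2 + (3 + 6 * α⁻¹ ^ 2 * K ^ 2) * (C1 * N0) := by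
        have : α⁻¹ ^ 2 * K ^ 2 * x1 ^ 2 ≤ α⁻¹ ^ 2 * K ^ 2 * (C1 * N0) := by gcongr
        linarith
      have e7 : diffConst K D * ((1 + 6 * D) * (x0 + x1 + x2)) ^ 2 = κ * (x0 + x1 + x2) ^ 2 := by
        rw [hκ]; ring
      rw [e7] at e1
      have e8 := e1.trans (mul_le_mul_of_nonneg_left e6 hκ0)
      rw [hA, hB]
      linarith)
  filter_upwards [key, H1 s r m0, s.slice, r.slice, c.slice] with t ht ⟨_, hw⟩ ⟨h, _⟩ ⟨k, _⟩ hc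
  have e2 := hc.mul_l2_le (h.m1.sub k.m1) (h.m2.sub k.m2)
  change _ ≤ α⁻¹ * (l2 (z t) + K * l2 (fun x => s.u1 t x - r.u1 t x)) at e2
  change l2 (fun x => s.u2 t x - r.u2 t x) ≤ _ at e2
  set Z := l2 (z t)
  set x0 := l2 (fun x => s.u t x - r.u t x)
  set x1 := l2 (fun x => s.u1 t x - r.u1 t x)
  set x2 := l2 (fun x => s.u2 t x - r.u2 t x)
  have hx2 : 0 ≤ x2 := l2_nonneg _
  have e3 : x2 ^ 2 ≤ α⁻¹ ^ 2 * (2 * Z ^ 2 + 2 * K ^ 2 * x1 ^ 2) := by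
    refine (pow_le_pow_left₀ hx2 e2 2).trans ?_
    rw [mul_pow]
    refine mul_le_mul_of_nonneg_left ?_ (by positivity)
    linarith [sq_nonneg (Z - K * x1)]
  have e5 : x1 ^ 2 ≤ C1 * N0 := (le_add_of_nonneg_right (sq_nonneg x0)).trans hw
  have e6 : N0 ≤ N0 + d2 ^ 2 := le_add_of_nonneg_right (sq_nonneg _)
  have e7 : Z ^ 2 ≤ Real.exp (A * T) * (2 * K ^ 2 + T * B) * (N0 + d2 ^ 2) := by
    refine ht.trans ?_
    rw [mul_assoc (Real.exp (A * T))]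
    refine mul_le_mul_of_nonneg_left ?_ (Real.exp_pos _).le
    have : T * (B * N0) ≤ T * (B * (N0 + d2 ^ 2)) := by gcongr
    linarith
  have e8 : K ^ 2 * x1 ^ 2 ≤ K ^ 2 * (C1 * (N0 + d2 ^ 2)) := by
    have := e5.trans (mul_le_mul_of_nonneg_left e6 hC1)
    gcongr
  have e9 : d2 ^ 2 + l2 (fun x => s.i1 x - r.i1 x) ^ 2 + l2 (fun x => s.i0 x - r.i0 x) ^ 2
      = N0 + d2 ^ 2 := by rw [hN0]; ring
  rw [e9]
  calc x2 ^ 2 ≤ α⁻¹ ^ 2 * (2 * Z ^ 2 + 2 * K ^ 2 * x1 ^ 2) := e3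
    _ = 2 * α⁻¹ ^ 2 * (Z ^ 2 + K ^ 2 * x1 ^ 2) := by ring
    _ ≤ 2 * α⁻¹ ^ 2 * (Real.exp (A * T) * (2 * K ^ 2 + T * B) * (N0 + d2 ^ 2)
        + K ^ 2 * (C1 * (N0 + d2 ^ 2))) := by gcongr
    _ = _ := by ring

end Sol

end SchrodingerMap

namespace SchrodingerMap

variable {E : Type*} [NormedAddCommGroup E] [NormedSpace ℝ E] [CompleteSpace E]

/-! ### Weak derivatives on the line and on slabs -/

/-- The one-variable statement follows from the two-variable one by adding a dummy variable and then
freezing it at a generic value. -/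
theorem WD.of_weak {f f' : ℝ → E} (hf : LocallyIntegrable f volume)
    (hf' : LocallyIntegrable f' volume)
    (H : ∀ φ : ℝ → ℝ, ContDiff ℝ ∞ φ → HasCompactSupport φ →
      ∫ x, deriv φ x • f x = - ∫ x, φ x • f' x) : WD f f' := by
  have sf' := hf'.aestronglyMeasurable
  have e' := sf'.ae_eq_mk
  have hm' : LocallyIntegrable (sf'.mk f') volume := by
    refine locallyIntegrable_iff.2 fun k hk => ?_
    exact (hf'.integrableOn_isCompact hk).congr (ae_restrict_of_ae e')
  have hfst : ∀ {h : ℝ → E}, LocallyIntegrable h volume →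
      LocallyIntegrable (fun p : ℝ × ℝ => h p.1) volume := fun {h} hh => by
    refine locallyIntegrable_iff.2 fun k hk => ?_
    have h1 : IntegrableOn (fun p : ℝ × ℝ => h p.1) ((Prod.fst '' k) ×ˢ (Prod.snd '' k)) volume := by
      rw [IntegrableOn, Measure.volume_eq_prod, ← Measure.prod_restrict]
      have : IsFiniteMeasure (volume.restrict (Prod.snd '' k)) :=
        ⟨by simpa using (hk.image continuous_snd).measure_lt_top⟩
      exact (hh.integrableOn_isCompact (hk.image continuous_fst)).comp_fst _
    exact h1.mono_set fun p hp => ⟨⟨p, hp, rfl⟩, ⟨p, hp, rfl⟩⟩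
  obtain ⟨C, hC⟩ := exists_ae_eq_primitive_of_tensor (f := fun p : ℝ × ℝ => f p.1)
    (f' := fun p => sf'.mk f' p.1) (hfst hf)
    (sf'.stronglyMeasurable_mk.comp_measurable measurable_fst) (hfst hm') isOpen_univ
    ordConnected_univ (mem_univ (0:ℝ)) isOpen_univ (by
      intro a b ha sa _ hb sb _
      have k1 : ∀ h : ℝ → E, ∀ c : ℝ → ℝ, ∫ p : ℝ × ℝ, (c p.1 * b p.2) • h p.1 =
          (∫ y, b y) • ∫ x, c x • h x := fun h c => by
        rw [Measure.volume_eq_prod]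
        have := integral_prod_smul (μ := (volume : Measure ℝ)) (ν := (volume : Measure ℝ)) b
          (fun x => c x • h x)
        rw [← this, ← integral_prod_swap]
        refine integral_congr_ae (Eventually.of_forall fun p => ?_)
        simp only [Prod.fst_swap, Prod.snd_swap]
        rw [mul_comm, mul_smul]
      rw [k1, k1, H a ha sa, smul_neg]
      congr 2
      exact integral_congr_ae (e'.mono fun x hx => by simp only [hx]))
  rw [Measure.volume_eq_prod] at hC
  have hC' := Measure.ae_ae_of_ae_prod (Measure.measurePreserving_swap.quasiMeasurePreserving.ae hC)
  obtain ⟨y, hy⟩ := hC'.exists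
  refine ⟨hf', C y, hy.mono fun x hx => ?_⟩
  have := hx (mem_univ _) (mem_univ _)
  simp only [Prod.fst_swap, Prod.snd_swap] at this
  rw [this]
  congr 1
  exact intervalIntegral.integral_congr_ae (e'.mono fun s hs _ => hs.symm)

theorem hasWeakDeriv_iff {f f' : ℝ → E3} : HasWeakDeriv f f' ↔ WD f f' := by
  refine ⟨fun h => WD.of_weak h.locInt h.locInt' fun φ hφ hs => ?_, fun h =>
    ⟨h.locallyIntegrable, h.loc, fun φ => h.weak ?_ φ.hasCompactSupport⟩⟩
  · exact h.integral_eq ⟨φ, hφ, hs, fun _ _ => trivial⟩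
  · exact φ.contDiff.of_le (by norm_cast)

/-- Integrability on bounded pieces of `]0,T[ × ℝ`. -/
def SlabLoc (T : ℝ) (v : ℝ → ℝ → E) : Prop := ∀ R : ℝ,
  Integrable (Function.uncurry v) ((volume.restrict (Ioo 0 T)).prod (volume.restrict (Icc (-R) R)))

theorem SlabLoc.of_bdd {T C : ℝ} {v : ℝ → ℝ → E} (jv : JM v) (h : ∀ t x, ‖v t x‖ ≤ C) :
    SlabLoc T v := fun _ =>
  Integrable.mono' (integrable_const C) jv.aestronglyMeasurable
    (Eventually.of_forall fun p => h p.1 p.2)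

theorem integral_norm_Icc_le {f : ℝ → E} (hf : MemLp f 2) (R : ℝ) :
    IntegrableOn f (Icc (-R) R) ∧
      ∫ x in Icc (-R) R, ‖f x‖ ≤ l2 ((Icc (-R) R).indicator fun _ => (1:ℝ)) * l2 f := by
  have hi : MemLp ((Icc (-R) R).indicator fun _ => (1:ℝ)) 2 volume :=
    memLp_indicator_const _ measurableSet_Icc _ (Or.inr (by simp))
  refine ⟨(hf.restrict _).integrable (by norm_num), ?_⟩
  refine le_trans (le_of_eq ?_) (integral_norm_mul_le hi hf)
  rw [← integral_indicator measurableSet_Icc]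
  refine integral_congr_ae (Eventually.of_forall fun x => ?_)
  by_cases hx : x ∈ Icc (-R) R
  · simp only [indicator_of_mem hx, norm_one, one_mul]
  · simp only [indicator_of_notMem hx, norm_zero, zero_mul]

theorem SlabLoc.of_l2 {T C : ℝ} {v : ℝ → ℝ → E} (jv : JM v)
    (h : ∀ᵐ t ∂(volume.restrict (Ioo 0 T)), MemLp (v t) 2 ∧ l2 (v t) ≤ C) : SlabLoc T v := by
  intro R
  rw [integrable_prod_iff jv.aestronglyMeasurable]
  refine ⟨h.mono fun t ht => (integral_norm_Icc_le ht.1 R).1, ?_⟩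
  refine Integrable.mono' (integrable_const (l2 ((Icc (-R) R).indicator fun _ => (1:ℝ)) * C))
    (StronglyMeasurable.norm jv).integral_prod_right.aestronglyMeasurable ?_
  filter_upwards [h] with t ht
  rw [Real.norm_of_nonneg (integral_nonneg fun x => norm_nonneg _)]
  exact (integral_norm_Icc_le ht.1 R).2.trans (mul_le_mul_of_nonneg_left ht.2 (l2_nonneg _))

theorem SlabLoc.mono {T S : ℝ} {v : ℝ → ℝ → E} (h : SlabLoc T v) (hS : S ≤ T) : SlabLoc S v :=
  fun R => by
    have := h R
    rw [Measure.prod_restrict] at this ⊢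
    exact this.mono_measure (Measure.restrict_mono
      (prod_mono (Ioo_subset_Ioo_right hS) Subset.rfl) le_rfl)

theorem SlabLoc.integrable_smul {T : ℝ} {v : ℝ → ℝ → E} (h : SlabLoc T v) {ψ : ℝ → ℝ}
    (hψ : Continuous ψ) (sψ : HasCompactSupport ψ) :
    Integrable (fun p : ℝ × ℝ => ψ p.2 • v p.1 p.2) (slab T) := by
  obtain ⟨R, hR⟩ := sψ.isCompact.isBounded.subset_closedBall 0
  rw [Real.closedBall_eq_Icc, zero_sub, zero_add] at hR
  obtain ⟨C, hC⟩ := hψ.bounded_above_of_compact_support sψ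
  have hm : (volume.restrict (Ioo 0 T)).prod (volume.restrict (Icc (-R) R)) =
      (slab T).restrict (univ ×ˢ Icc (-R) R) := by
    rw [slab, ← Measure.prod_restrict, Measure.restrict_univ]
  have hv := h R
  rw [hm] at hv
  rw [← integrableOn_iff_integrable_of_support_subset (s := univ ×ˢ Icc (-R) R)]
  · refine Integrable.mono' (hv.norm.const_mul C)
      ((hψ.comp continuous_snd).aestronglyMeasurable.smul hv.1) (Eventually.of_forall fun p => ?_)
    rw [norm_smul]
    exact mul_le_mul_of_nonneg_right (hC _) (norm_nonneg _)
  · intro p hp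
    refine ⟨trivial, hR (subset_tsupport _ ?_)⟩
    intro h0
    exact hp (by simp only [h0, zero_smul])

/-- Test against φ, exchange the integrals, and apply the weak formula on each slice. With
uniqueness of weak derivatives this transfers a primitive in time to the space derivatives. -/
theorem WD.integral_time {T : ℝ} (hT : 0 ≤ T) {v v1 : ℝ → ℝ → E} (hv : SlabLoc T v)
    (hv1 : SlabLoc T v1) (hs : ∀ᵐ s ∂(volume.restrict (Ioo 0 T)), WD (v s) (v1 s)) :
    WD (fun x => ∫ s in (0:ℝ)..T, v s x) (fun x => ∫ s in (0:ℝ)..T, v1 s x) := by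
  have e : ∀ w : ℝ → ℝ → E, (fun x => ∫ s in (0:ℝ)..T, w s x) =
      fun x => ∫ s in Ioo 0 T, w s x := fun w => by
    funext x
    rw [intervalIntegral.integral_of_le hT, integral_Ioc_eq_integral_Ioo]
  rw [e, e]
  have hloc : ∀ {w : ℝ → ℝ → E}, SlabLoc T w →
      LocallyIntegrable (fun x => ∫ s in Ioo 0 T, w s x) volume := fun {w} hw => by
    refine locallyIntegrable_iff.2 fun k hk => ?_
    obtain ⟨R, hR⟩ := hk.isBounded.subset_closedBall 0
    rw [Real.closedBall_eq_Icc, zero_sub, zero_add] at hR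
    have : IntegrableOn (fun x => ∫ s in Ioo 0 T, w s x) (Icc (-R) R) := (hw R).integral_prod_right
    exact this.mono_set hR
  have sw : ∀ {w : ℝ → ℝ → E}, SlabLoc T w → ∀ ψ : ℝ → ℝ, Continuous ψ → HasCompactSupport ψ →
      ∫ x, ψ x • ∫ s in Ioo 0 T, w s x = ∫ s in Ioo 0 T, ∫ x, ψ x • w s x :=
    fun {w} hw ψ hψ sψ => by
      rw [integral_integral_swap (hw.integrable_smul hψ sψ)]
      exact integral_congr_ae (Eventually.of_forall fun x => (integral_smul _ _).symm)
  refine WD.of_weak (hloc hv) (hloc hv1) fun φ hφ sφ => ?_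
  rw [sw hv _ (hφ.continuous_deriv (by simp)) sφ.deriv, sw hv1 _ hφ.continuous sφ, ← integral_neg]
  exact integral_congr_ae (hs.mono fun s h => h.weak (hφ.of_le (by norm_cast)) sφ)

theorem TP.of_ae_ae {T : ℝ} {f f' : ℝ → ℝ → E} {f₀ : ℝ → E} (hf : JM f)
    (hf' : JM f') (hf₀ : StronglyMeasurable f₀) (hv : SlabLoc T f')
    (h : ∀ᵐ t ∂(volume.restrict (Ioo 0 T)), ∀ᵐ x : ℝ, f t x = f₀ x + ∫ s in (0:ℝ)..t, f' s x) :
    TP T f f₀ f' := by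
  have hm : MeasurableSet {p : ℝ × ℝ | f p.1 p.2 = f₀ p.2 + ∫ s in (0:ℝ)..p.1, f' s p.2} :=
    StronglyMeasurable.measurableSet_eq_fun hf ((JM.const hf₀).add (hf'.primitive 0))
  rw [Measure.ae_ae_comm hm] at h
  have hi : ∀ᵐ x : ℝ, IntegrableOn (fun s => f' s x) (Ioo 0 T) := by
    have : ∀ n : ℕ, ∀ᵐ x : ℝ, x ∈ Icc (-(n:ℝ)) n → IntegrableOn (fun s => f' s x) (Ioo 0 T) :=
      fun n => (ae_restrict_iff' measurableSet_Icc).1 (hv n).prod_left_ae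
    filter_upwards [ae_all_iff.2 this] with x hx
    obtain ⟨n, hn⟩ := exists_nat_ge |x|
    exact hx n (abs_le.1 hn)
  filter_upwards [h, hi] with x h1 h2 using ⟨h2, h1⟩

/-- The space derivative of a primitive in time. -/
theorem TP.space_deriv {T : ℝ} {f f' g g' : ℝ → ℝ → E} {f₀ g₀ : ℝ → E} (H : TP T f f₀ f')
    (jf : JM f) (jf' : JM f') (jg : JM g) (jg' : JM g') (s0 : StronglyMeasurable f₀)
    (s1 : StronglyMeasurable g₀) (hv : SlabLoc T f') (hv1 : SlabLoc T g') (w0 : WD f₀ g₀)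
    (hw : ∀ᵐ t ∂(volume.restrict (Ioo 0 T)), WD (f t) (g t))
    (hw' : ∀ᵐ t ∂(volume.restrict (Ioo 0 T)), WD (f' t) (g' t)) : TP T g g₀ g' := by
  refine TP.of_ae_ae jg jg' s1 hv1 ?_
  filter_upwards [H.ae_ae jf jf' s0, hw, ae_restrict_mem measurableSet_Ioo] with t h1 h2 ht
  have h3 := w0.add (WD.integral_time ht.1.le (hv.mono ht.2.le) (hv1.mono ht.2.le)
    (ae_Ioo_mono ht.2.le hw'))
  exact h2.unique h3 h1

end SchrodingerMap

namespace SchrodingerMap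

variable {E : Type*} [NormedAddCommGroup E] [NormedSpace ℝ E] [CompleteSpace E]

/-! ### Regular representatives of the coefficient -/

theorem exists_tensor {Ω : TopologicalSpace.Opens (ℝ × ℝ)} {a b : ℝ → ℝ} (ha : ContDiff ℝ ∞ a)
    (sa : HasCompactSupport a) (hb : ContDiff ℝ ∞ b) (sb : HasCompactSupport b)
    (hΩ : ∀ p : ℝ × ℝ, p.1 ∈ tsupport a → p ∈ Ω) :
    ∃ φ : 𝓓(Ω, ℝ), (∀ p, φ p = a p.1 * b p.2) ∧
      (∀ p, fderiv ℝ φ p (1, 0) = deriv a p.1 * b p.2) ∧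
      ∀ p, fderiv ℝ φ p (0, 1) = a p.1 * deriv b p.2 := by
  have hsub : tsupport (fun p : ℝ × ℝ => a p.1 * b p.2) ⊆ tsupport a ×ˢ tsupport b :=
    closure_minimal (fun p hp => ⟨subset_tsupport _ (left_ne_zero_of_mul hp),
      subset_tsupport _ (right_ne_zero_of_mul hp)⟩)
      ((isClosed_tsupport a).prod (isClosed_tsupport b))
  have hc : ContDiff ℝ ∞ (fun p : ℝ × ℝ => a p.1 * b p.2) :=
    (ha.comp contDiff_fst).mul (hb.comp contDiff_snd)
  refine ⟨⟨fun p => a p.1 * b p.2, hc,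
    (sa.isCompact.prod sb.isCompact).of_isClosed_subset (isClosed_tsupport _) hsub,
    fun p hp => hΩ p (hsub hp).1⟩, fun p => rfl, ?_⟩
  have key : ∀ p : ℝ × ℝ, HasFDerivAt (fun p : ℝ × ℝ => a p.1 * b p.2)
      (a p.1 • (deriv b p.2 • ContinuousLinearMap.snd ℝ ℝ ℝ)
        + b p.2 • (deriv a p.1 • ContinuousLinearMap.fst ℝ ℝ ℝ)) p := fun p => by
    have h1 : HasFDerivAt (fun p : ℝ × ℝ => a p.1) (deriv a p.1 • ContinuousLinearMap.fst ℝ ℝ ℝ) p :=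
      ((ha.differentiable (by simp)) p.1).hasDerivAt.comp_hasFDerivAt p hasFDerivAt_fst
    have h2 : HasFDerivAt (fun p : ℝ × ℝ => b p.2) (deriv b p.2 • ContinuousLinearMap.snd ℝ ℝ ℝ) p :=
      ((hb.differentiable (by simp)) p.2).hasDerivAt.comp_hasFDerivAt p hasFDerivAt_snd
    exact h1.mul h2
  refine ⟨fun p => ?_, fun p => ?_⟩
  · change fderiv ℝ (fun p : ℝ × ℝ => a p.1 * b p.2) p (1, 0) = _
    rw [(key p).fderiv]
    simp [mul_comm]
  · change fderiv ℝ (fun p : ℝ × ℝ => a p.1 * b p.2) p (0, 1) = _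
    rw [(key p).fderiv]
    simp

theorem exists_clamp {X : Type*} [MeasurableSpace X] {μ : Measure X} {f : X → ℝ} {lo hi : ℝ}
    (hlo : lo ≤ hi) (hf : AEStronglyMeasurable f μ) (h : ∀ᵐ p ∂μ, lo ≤ f p ∧ f p ≤ hi) :
    ∃ F : X → ℝ, StronglyMeasurable F ∧ (∀ p, lo ≤ F p ∧ F p ≤ hi) ∧ F =ᵐ[μ] f := by
  refine ⟨fun p => max lo (min hi (hf.mk f p)),
    stronglyMeasurable_const.sup (stronglyMeasurable_const.inf hf.stronglyMeasurable_mk),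
    fun p => ⟨le_max_left _ _, max_le hlo (min_le_left _ _)⟩, ?_⟩
  filter_upwards [hf.ae_eq_mk, h] with p hp ⟨h1, h2⟩
  rw [← hp, min_eq_right h2, max_eq_right h1]

/-- The primitive lemma with the two coordinates exchanged: x becomes the variable of integration
and t the parameter. -/
theorem ae_WD_of_tensor {f f' : ℝ → ℝ → E} (jf : JM f) (jf' : JM f') {C : ℝ}
    (bf : ∀ t x, ‖f t x‖ ≤ C) (bf' : ∀ t x, ‖f' t x‖ ≤ C) {I : Set ℝ} (hI : IsOpen I)
    (H : ∀ a b : ℝ → ℝ, ContDiff ℝ ∞ a → HasCompactSupport a → tsupport a ⊆ I →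
      ContDiff ℝ ∞ b → HasCompactSupport b →
      ∫ p : ℝ × ℝ, (a p.1 * deriv b p.2) • f p.1 p.2 = - ∫ p : ℝ × ℝ, (a p.1 * b p.2) • f' p.1 p.2) :
    ∀ᵐ t, t ∈ I → WD (f t) (f' t) := by
  have hloc : ∀ {w : ℝ → ℝ → E}, JM w → (∀ t x, ‖w t x‖ ≤ C) →
      LocallyIntegrable (fun p : ℝ × ℝ => w p.2 p.1) volume := fun {w} jw bw =>
    (locallyIntegrable_const C).mono (jw.comp_measurable measurable_swap).aestronglyMeasurable
      (Eventually.of_forall fun p => (bw _ _).trans (le_abs_self C))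
  obtain ⟨c, hc⟩ := exists_ae_eq_primitive_of_tensor (f := fun p : ℝ × ℝ => f p.2 p.1)
    (f' := fun p => f' p.2 p.1) (hloc jf bf) (jf'.comp_measurable measurable_swap) (hloc jf' bf')
    isOpen_univ ordConnected_univ (mem_univ (0:ℝ)) hI (by
      intro b a hb sb _ ha sa hs
      have := H a b ha sa hs hb sb
      rw [Measure.volume_eq_prod, ← integral_prod_swap,
        ← integral_prod_swap (fun p : ℝ × ℝ => (b p.1 * a p.2) • f' p.2 p.1)]
      rw [Measure.volume_eq_prod] at this
      simpa only [Prod.fst_swap, Prod.snd_swap, mul_comm] using this)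
  rw [Measure.volume_eq_prod] at hc
  have hc' := Measure.ae_ae_of_ae_prod (Measure.measurePreserving_swap.quasiMeasurePreserving.ae hc)
  filter_upwards [hc'] with t ht htI
  refine ⟨(locallyIntegrable_const C).mono (jf'.slice t).aestronglyMeasurable
    (Eventually.of_forall fun x => (bf' _ _).trans (le_abs_self C)), c t, ?_⟩
  filter_upwards [ht] with x hx
  exact hx (mem_univ _) htI

/-- A weak partial derivative on the half plane, tested against tensor products, after passing to
representatives. -/
theorem HasWeakPartial.integral_congr {e : ℝ × ℝ} {f f' F F' : ℝ × ℝ → ℝ}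
    (h : HasWeakPartial e f f') (hF : F =ᵐ[volume.restrict (posTime : Set (ℝ × ℝ))] f)
    (hF' : F' =ᵐ[volume.restrict (posTime : Set (ℝ × ℝ))] f') (φ : 𝓓(posTime, ℝ)) :
    ∫ p, fderiv ℝ φ p e * F p = -∫ p, φ p * F' p := by
  have hm : MeasurableSet (posTime : Set (ℝ × ℝ)) := posTime.isOpen.measurableSet
  rw [Filter.EventuallyEq, ae_restrict_iff' hm] at hF hF'
  have e1 : ∫ p, fderiv ℝ φ p e * F p = ∫ p, fderiv ℝ φ p e * f p := by
    refine integral_congr_ae (hF.mono fun p hp => ?_)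
    by_cases hpt : p ∈ (posTime : Set (ℝ × ℝ))
    · simp only [hp hpt]
    · have : fderiv ℝ φ p = 0 := by
        by_contra h0
        exact hpt (φ.tsupport_subset (support_fderiv_subset ℝ h0))
      simp [this]
  have e2 : ∫ p, φ p * F' p = ∫ p, φ p * f' p := by
    refine integral_congr_ae (hF'.mono fun p hp => ?_)
    by_cases hpt : p ∈ (posTime : Set (ℝ × ℝ))
    · simp only [hp hpt]
    · have : φ p = 0 := by
        by_contra h0
        exact hpt (φ.tsupport_subset (subset_tsupport _ h0))
      simp [this]
  rw [e1, e2, h.integral_eq]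

theorem mem_posTime_of_tsupport {a : ℝ → ℝ} (ha : tsupport a ⊆ Ioi 0) (p : ℝ × ℝ)
    (hp : p.1 ∈ tsupport a) : p ∈ posTime := ha hp

theorem HasWeakPartial.ae_WD {f f' : ℝ × ℝ → ℝ} (h : HasWeakPartial (0, 1) f f') {F F' : ℝ → ℝ → ℝ}
    (hF : Function.uncurry F =ᵐ[volume.restrict (posTime : Set (ℝ × ℝ))] f)
    (hF' : Function.uncurry F' =ᵐ[volume.restrict (posTime : Set (ℝ × ℝ))] f') (jF : JM F) (jF' : JM F')
    {C : ℝ} (bF : ∀ t x, |F t x| ≤ C) (bF' : ∀ t x, |F' t x| ≤ C) :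
    ∀ᵐ t, 0 < t → WD (F t) (F' t) := by
  refine ae_WD_of_tensor jF jF' bF bF' isOpen_Ioi fun a b ha sa ta hb sb => ?_
  obtain ⟨φ, h1, h2, h3⟩ := exists_tensor ha sa hb sb (mem_posTime_of_tsupport ta)
  have := h.integral_congr hF hF' φ
  simpa only [h1, h3, smul_eq_mul, Function.uncurry_def] using this

/-- The base time 1 is an arbitrary point of the open half-line. Time 0 lies on its boundary and is
reached only later, through a trace. -/
theorem HasWeakPartial.ae_eq_primitive {f f' : ℝ × ℝ → ℝ} (h : HasWeakPartial (1, 0) f f')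
    {F F' : ℝ → ℝ → ℝ}
    (hF : Function.uncurry F =ᵐ[volume.restrict (posTime : Set (ℝ × ℝ))] f)
    (hF' : Function.uncurry F' =ᵐ[volume.restrict (posTime : Set (ℝ × ℝ))] f') (jF : JM F) (jF' : JM F')
    {C : ℝ} (bF : ∀ t x, |F t x| ≤ C) (bF' : ∀ t x, |F' t x| ≤ C) :
    ∃ c : ℝ → ℝ, ∀ᵐ t, 0 < t → ∀ᵐ x, F t x = c x + ∫ s in (1:ℝ)..t, F' s x := by
  have hloc : ∀ {w : ℝ → ℝ → ℝ}, JM w → (∀ t x, |w t x| ≤ C) →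
      LocallyIntegrable (fun p : ℝ × ℝ => w p.1 p.2) volume := fun {w} jw bw =>
    (locallyIntegrable_const C).mono jw.aestronglyMeasurable
      (Eventually.of_forall fun p => (bw _ _).trans (le_abs_self C))
  obtain ⟨c, hc⟩ := exists_ae_eq_primitive_of_tensor (f := fun p : ℝ × ℝ => F p.1 p.2)
    (f' := fun p => F' p.1 p.2) (hloc jF bF) jF' (hloc jF' bF')
    isOpen_Ioi ordConnected_Ioi (mem_Ioi.2 zero_lt_one) isOpen_univ (by
      intro a b ha sa ta hb sb _
      obtain ⟨φ, h1, h2, h3⟩ := exists_tensor ha sa hb sb (mem_posTime_of_tsupport ta)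
      have := h.integral_congr hF hF' φ
      simpa only [h1, h2, smul_eq_mul, Function.uncurry_def] using this)
  rw [Measure.volume_eq_prod] at hc
  refine ⟨c, ?_⟩
  filter_upwards [Measure.ae_ae_of_ae_prod hc] with t ht h0
  filter_upwards [ht] with x hx using hx h0 (mem_univ _)

end SchrodingerMap

/-! ### The trace of the coefficient at time zero -/

namespace SchrodingerMap

theorem TP.congr_init {E : Type*} [NormedAddCommGroup E] [NormedSpace ℝ E] {T : ℝ}
    {f f' : ℝ → ℝ → E} {f₀ g₀ : ℝ → E} (h : TP T f f₀ f') (e : g₀ =ᵐ[volume] f₀) : TP T f g₀ f' := by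
  filter_upwards [h, e] with x hx ex
  exact ⟨hx.1, hx.2.mono fun t ht => by rw [ht, ex]⟩

/-- Along almost every line f is Lipschitz in time, so its initial value is within any ε of values
taken at small positive times and inherits their bounds. -/
theorem TP.init_mem {T lo hi C : ℝ} (hT : 0 < T) {f f' : ℝ → ℝ → ℝ} {f₀ : ℝ → ℝ} (h : TP T f f₀ f')
    (bf : ∀ t x, lo ≤ f t x ∧ f t x ≤ hi) (bf' : ∀ t x, |f' t x| ≤ C) :
    ∀ᵐ x, lo ≤ f₀ x ∧ f₀ x ≤ hi := by
  filter_upwards [h] with x ⟨_, hx⟩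
  have hC : 0 ≤ C := (abs_nonneg _).trans (bf' 0 0)
  have near : ∀ ε > 0, lo ≤ f₀ x + ε ∧ f₀ x ≤ hi + ε := by
    intro ε hε
    set τ := min T (ε / (C + 1)) with hτ
    have hτ0 : 0 < τ := lt_min hT (by positivity)
    have hx' := ae_Ioo_mono (min_le_left _ _ : τ ≤ T) hx
    have : NeBot (ae (volume.restrict (Ioo 0 τ))) := by
      rw [ae_neBot, Ne, Measure.restrict_eq_zero, Real.volume_Ioo]
      simpa using hτ0
    obtain ⟨t, ht, htI⟩ := (hx'.and (ae_restrict_mem measurableSet_Ioo)).exists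
    have hb : ‖∫ s in (0:ℝ)..t, f' s x‖ ≤ C * |t - 0| :=
      intervalIntegral.norm_integral_le_of_norm_le_const fun s _ => bf' s x
    rw [sub_zero, abs_of_pos htI.1, Real.norm_eq_abs] at hb
    have hε' : C * t ≤ ε := by
      have h1 : t ≤ ε / (C + 1) := htI.2.le.trans (min_le_right _ _)
      have h2 : (C + 1) * t ≤ ε := by rwa [le_div_iff₀ (by positivity), mul_comm] at h1
      linarith [htI.1]
    have := abs_le.1 hb
    have := bf t x
    constructor <;> linarith
  exact ⟨le_of_forall_pos_le_add fun ε hε => (near ε hε).1,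
    le_of_forall_pos_le_add fun ε hε => (near ε hε).2⟩

theorem exists_repr {μ : Measure (ℝ × ℝ)} {f : ℝ × ℝ → ℝ} {lo hi : ℝ}
    (hlo : lo ≤ hi) (hf : AEStronglyMeasurable f μ) (h : ∀ᵐ p ∂μ, lo ≤ f p ∧ f p ≤ hi) :
    ∃ F : ℝ → ℝ → ℝ, JM F ∧ (∀ t x, lo ≤ F t x ∧ F t x ≤ hi) ∧ Function.uncurry F =ᵐ[μ] f := by
  obtain ⟨F, h1, h2, h3⟩ := exists_clamp hlo hf h
  exact ⟨fun t x => F (t, x), h1, fun t x => h2 _, h3⟩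

theorem slab_le_posTime (T : ℝ) : slab T ≤ volume.restrict (posTime : Set (ℝ × ℝ)) := by
  have : slab T = volume.restrict (Ioo 0 T ×ˢ univ) := by
    rw [slab, Measure.volume_eq_prod, ← Measure.prod_restrict, Measure.restrict_univ]
  rw [this]
  exact Measure.restrict_mono (fun p hp => hp.1.1) le_rfl

theorem MemW1infty.exists_bound {m : ℕ} {G : ℕ → ℕ → ℝ × ℝ → ℝ}
    (h : ∀ i ≤ 1, ∀ j ≤ m, MemLp (G i j) ⊤ (volume.restrict (posTime : Set (ℝ × ℝ)))) :
    ∃ K : ℝ, 0 ≤ K ∧ ∀ i ≤ 1, ∀ j ≤ m,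
      ∀ᵐ p ∂(volume.restrict (posTime : Set (ℝ × ℝ))), |G i j p| ≤ K := by
  set B : ℕ → ℕ → ℝ := fun i j => (eLpNorm (G i j) ⊤ (volume.restrict (posTime : Set (ℝ × ℝ)))).toReal
  have B0 : ∀ i j, 0 ≤ B i j := fun i j => ENNReal.toReal_nonneg
  refine ⟨∑ i ∈ Finset.range 2, ∑ j ∈ Finset.range (m + 1), B i j,
    Finset.sum_nonneg fun i _ => Finset.sum_nonneg fun j _ => B0 i j, fun i hi j hj => ?_⟩
  have hle : B i j ≤ ∑ i ∈ Finset.range 2, ∑ j ∈ Finset.range (m + 1), B i j :=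
    (Finset.single_le_sum (f := fun j => B i j) (fun j _ => B0 i j)
      (Finset.mem_range.2 (by omega))).trans
    (Finset.single_le_sum (f := fun i => ∑ j ∈ Finset.range (m + 1), B i j)
      (fun i _ => Finset.sum_nonneg fun j _ => B0 i j) (Finset.mem_range.2 (by omega)))
  have hm := h i hi j hj
  filter_upwards [ae_le_eLpNormEssSup (f := G i j)] with p hp
  refine le_trans ?_ hle
  rw [← eLpNorm_exponent_top] at hp
  have := ENNReal.toReal_mono hm.2.ne hp
  rwa [toReal_enorm, Real.norm_eq_abs] at this

/-- The coefficient and its derivatives have regular representatives. -/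
theorem exists_coef {g : ℝ → ℝ → ℝ} (hg : MemW1infty 3 g) {α : ℝ} (hα : 0 < α)
    (hgα : ∀ᵐ p ∂(volume.restrict (posTime : Set (ℝ × ℝ))), α ≤ g p.1 p.2) {T : ℝ} (hT : 0 < T) :
    ∃ (K : ℝ) (c : Coef T α K), ∀ᵐ p ∂(slab T), c.g p.1 p.2 = g p.1 p.2 := by
  obtain ⟨G, hG0, hGm, hGt, hGx⟩ := hg
  obtain ⟨B, hB0, hB⟩ := MemW1infty.exists_bound hGm
  -- The summand α guarantees α ≤ K, so that g can be truncated to values in [α, K].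
  set K := α + B with hK
  have hαK : α ≤ K := by linarith
  have hK0 : 0 ≤ K := by linarith
  have rep : ∀ i ≤ 1, ∀ j ≤ 3, ∃ F : ℝ → ℝ → ℝ, JM F ∧ (∀ t x, |F t x| ≤ K) ∧
      Function.uncurry F =ᵐ[volume.restrict (posTime : Set (ℝ × ℝ))] G i j := by
    intro i hi j hj
    obtain ⟨F, h1, h2, h3⟩ := exists_repr (lo := -K) (hi := K) (by linarith) (hGm i hi j hj).1
      ((hB i hi j hj).mono fun p hp => abs_le.1 (hp.trans (by linarith)))
    exact ⟨F, h1, fun t x => abs_le.2 (h2 t x), h3⟩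
  obtain ⟨g0, jg, bg', eg⟩ := exists_repr hαK (hGm 0 (by norm_num) 0 (by norm_num)).1 (by
    filter_upwards [hB 0 (by norm_num) 0 (by norm_num), hgα] with p hp h'
    refine ⟨?_, by linarith [(abs_le.1 hp).2]⟩
    rw [hG0]; exact h')
  have bg : ∀ t x, |g0 t x| ≤ K := fun t x =>
    abs_le.2 ⟨by linarith [(bg' t x).1], (bg' t x).2⟩
  obtain ⟨g1, jg1, bg1, eg1⟩ := rep 0 (by norm_num) 1 (by norm_num)
  obtain ⟨g2, jg2, bg2, eg2⟩ := rep 0 (by norm_num) 2 (by norm_num)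
  obtain ⟨gt, jgt, bgt, egt⟩ := rep 1 le_rfl 0 (by norm_num)
  obtain ⟨gt1, jgt1, bgt1, egt1⟩ := rep 1 le_rfl 1 (by norm_num)
  obtain ⟨gt2, jgt2, bgt2, egt2⟩ := rep 1 le_rfl 2 (by norm_num)
  have toT : ∀ {P : ℝ → Prop}, (∀ᵐ t, 0 < t → P t) → ∀ᵐ t ∂(volume.restrict (Ioo 0 T)), P t :=
    fun {P} h => by
      filter_upwards [ae_restrict_of_ae h, ae_restrict_mem measurableSet_Ioo] with t h1 h2
      exact h1 h2.1
  have w0 := toT ((hGx 0 (by norm_num) 0 (by norm_num)).ae_WD eg eg1 jg jg1 bg bg1)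
  have w1 := toT ((hGx 0 (by norm_num) 1 (by norm_num)).ae_WD eg1 eg2 jg1 jg2 bg1 bg2)
  have wt0 := toT ((hGx 1 le_rfl 0 (by norm_num)).ae_WD egt egt1 jgt jgt1 bgt bgt1)
  have wt1 := toT ((hGx 1 le_rfl 1 (by norm_num)).ae_WD egt1 egt2 jgt1 jgt2 bgt1 bgt2)
  obtain ⟨k, hk⟩ := hGt.ae_eq_primitive eg egt jg jgt bg bgt
  have hk' := toT hk
  have : NeBot (ae (volume.restrict (Ioo 0 T))) := by
    rw [ae_neBot, Ne, Measure.restrict_eq_zero, Real.volume_Ioo]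
    simpa using hT
  -- A good time τ, from which the trace at time 0 is found by running back: g(τ) minus the integral
  -- of g_t over (0, τ), and likewise for the space derivatives.
  obtain ⟨τ, ⟨⟨v0, v1⟩, vk⟩, hτ⟩ :=
    (((w0.and w1).and hk').and (ae_restrict_mem measurableSet_Ioo)).exists
  have ii : ∀ (x a b : ℝ), IntervalIntegrable (fun s => gt s x) volume a b := fun x a b =>
    (intervalIntegrable_const (c := K)).mono_fun (jgt.slice' x).aestronglyMeasurable
      (Eventually.of_forall fun s => (bgt s x).trans (le_abs_self K))
  have S : ∀ {w : ℝ → ℝ → ℝ}, JM w → (∀ t x, |w t x| ≤ K) → SlabLoc T w := fun jw bw =>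
    SlabLoc.of_bdd jw bw
  have prim : ∀ {w : ℝ → ℝ → ℝ}, JM w → StronglyMeasurable (fun x => ∫ s in (0:ℝ)..τ, w s x) :=
    fun jw => (jw.primitive 0).slice τ
  have s0 : StronglyMeasurable (fun x => g0 τ x - ∫ s in (0:ℝ)..τ, gt s x) :=
    (jg.slice τ).sub (prim jgt)
  have s1 : StronglyMeasurable (fun x => g1 τ x - ∫ s in (0:ℝ)..τ, gt1 s x) :=
    (jg1.slice τ).sub (prim jgt1)
  have s2 : StronglyMeasurable (fun x => g2 τ x - ∫ s in (0:ℝ)..τ, gt2 s x) :=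
    (jg2.slice τ).sub (prim jgt2)
  have tp : TP T g0 (fun x => g0 τ x - ∫ s in (0:ℝ)..τ, gt s x) gt := by
    refine TP.of_ae_ae jg jgt s0 (S jgt bgt) ?_
    filter_upwards [hk'] with t ht
    filter_upwards [ht, vk] with x h1 h2
    have := intervalIntegral.integral_interval_sub_left (ii x 1 t) (ii x 1 0)
    have := intervalIntegral.integral_interval_sub_left (ii x 1 τ) (ii x 1 0)
    rw [h1, h2]
    linarith
  have wi0 : WD (fun x => g0 τ x - ∫ s in (0:ℝ)..τ, gt s x)
      (fun x => g1 τ x - ∫ s in (0:ℝ)..τ, gt1 s x) :=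
    v0.sub (WD.integral_time hτ.1.le ((S jgt bgt).mono hτ.2.le) ((S jgt1 bgt1).mono hτ.2.le)
      (ae_Ioo_mono hτ.2.le wt0))
  have wi1 : WD (fun x => g1 τ x - ∫ s in (0:ℝ)..τ, gt1 s x)
      (fun x => g2 τ x - ∫ s in (0:ℝ)..τ, gt2 s x) :=
    v1.sub (WD.integral_time hτ.1.le ((S jgt1 bgt1).mono hτ.2.le) ((S jgt2 bgt2).mono hτ.2.le)
      (ae_Ioo_mono hτ.2.le wt1))
  have tp1 := tp.space_deriv jg jgt jg1 jgt1 s0 s1 (S jgt bgt) (S jgt1 bgt1) wi0 w0 wt0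
  have tp2 := tp1.space_deriv jg1 jgt1 jg2 jgt2 s1 s2 (S jgt1 bgt1) (S jgt2 bgt2) wi1 w1 wt1
  -- The traces satisfy their bounds almost everywhere; truncation makes the bounds hold at every
  -- point.
  obtain ⟨i0, m0, b0, e0⟩ := exists_clamp hαK s0.aestronglyMeasurable (tp.init_mem hT bg' bgt)
  obtain ⟨i1, m1, b1, e1⟩ := exists_clamp (by linarith : -K ≤ K) s1.aestronglyMeasurable
    (tp1.init_mem hT (fun t x => abs_le.1 (bg1 t x)) bgt1)
  obtain ⟨i2, m2, b2, e2⟩ := exists_clamp (by linarith : -K ≤ K) s2.aestronglyMeasurable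
    (tp2.init_mem hT (fun t x => abs_le.1 (bg2 t x)) bgt2)
  refine ⟨K, ⟨g0, g1, g2, gt, gt1, gt2, i0, i1, i2, jg, jg1, jg2, jgt, jgt1, jgt2, bgt, bgt1, bgt2,
    fun t x => (bg' t x).1, bg, ?_, wt0, ?_, tp.congr_init e0, tp1.congr_init e1,
    tp2.congr_init e2⟩, ?_⟩
  · filter_upwards [w0, w1] with t h0 h1
    exact ⟨hα, fun x => (bg' t x).1, bg t, bg1 t, bg2 t, jg.slice t, jg1.slice t, jg2.slice t, h0, h1⟩
  · exact ⟨hα, fun x => (b0 x).1, fun x => abs_le.2 ⟨by linarith [(b0 x).1], (b0 x).2⟩,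
      fun x => abs_le.2 (b1 x), fun x => abs_le.2 (b2 x), m0, m1, m2, wi0.congr e0.symm e1.symm,
      wi1.congr e1.symm e2.symm⟩
  · have := (slab_le_posTime T).absolutelyContinuous.ae_le eg
    filter_upwards [this] with p hp
    rw [hG0] at hp
    exact hp

end SchrodingerMap

namespace SchrodingerMap

/-! ### The Sobolev norms -/

theorem IsWeakDerivChain.ae_eq {k : ℕ} {f : ℝ → E3} {F F' : ℕ → ℝ → E3} (h : IsWeakDerivChain k f F)
    (h' : IsWeakDerivChain k f F') : ∀ j ≤ k, F j =ᵐ[volume] F' j := by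
  intro j
  induction j with
  | zero => intro _; rw [h.1, h'.1]
  | succ j ih =>
    intro hj
    exact (hasWeakDeriv_iff.1 (h.2 j hj)).unique (hasWeakDeriv_iff.1 (h'.2 j hj)) (ih (by omega))

theorem IsWeakDerivChain.sobolevNorm_eq {k : ℕ} {f : ℝ → E3} {F : ℕ → ℝ → E3}
    (h : IsWeakDerivChain k f F) :
    sobolevNorm k f = (∑ j ∈ Finset.range (k + 1), eLpNorm (F j) 2 volume ^ 2) ^ (1 / 2 : ℝ) := by
  refine le_antisymm (iInf₂_le F h) (le_iInf₂ fun F' h' => le_of_eq ?_)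
  congr 1
  refine Finset.sum_congr rfl fun j hj => ?_
  rw [eLpNorm_congr_ae (h.ae_eq h' j (by simpa [Nat.lt_succ_iff] using hj))]

/-- The sequence `f, f1, f2, f2, …`. -/
def derivSeq (f f1 f2 : ℝ → E3) : ℕ → ℝ → E3
  | 0 => f
  | 1 => f1
  | _ => f2

theorem isWeakDerivChain_one {f f1 : ℝ → E3} (h : WD f f1) :
    IsWeakDerivChain 1 f (derivSeq f f1 f1) := by
  refine ⟨rfl, fun j hj => ?_⟩
  obtain rfl : j = 0 := by omega
  exact hasWeakDeriv_iff.2 h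

theorem isWeakDerivChain_two {f f1 f2 : ℝ → E3} (h : WD f f1) (h1 : WD f1 f2) :
    IsWeakDerivChain 2 f (derivSeq f f1 f2) := by
  refine ⟨rfl, fun j hj => ?_⟩
  obtain rfl | rfl : j = 0 ∨ j = 1 := by omega
  · exact hasWeakDeriv_iff.2 h
  · exact hasWeakDeriv_iff.2 h1

theorem eLpNorm_eq_ofReal {f : ℝ → E3} (hf : MemLp f 2) : eLpNorm f 2 volume = ENNReal.ofReal (l2 f) :=
  (ENNReal.ofReal_toReal hf.2.ne).symm

theorem sobolevNorm_one_eq {f f1 : ℝ → E3} (h : WD f f1) (m : MemLp f 2) (m1 : MemLp f1 2) :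
    sobolevNorm 1 f = ENNReal.ofReal (Real.sqrt (l2 f1 ^ 2 + l2 f ^ 2)) := by
  rw [(isWeakDerivChain_one h).sobolevNorm_eq]
  simp only [Finset.sum_range_succ, Finset.sum_range_zero, zero_add, derivSeq]
  rw [eLpNorm_eq_ofReal m, eLpNorm_eq_ofReal m1, ← ENNReal.ofReal_pow (l2_nonneg _),
    ← ENNReal.ofReal_pow (l2_nonneg _), ← ENNReal.ofReal_add (by positivity) (by positivity),
    ENNReal.ofReal_rpow_of_nonneg (by positivity) (by norm_num), Real.sqrt_eq_rpow, add_comm]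

theorem sobolevNorm_two_eq {f f1 f2 : ℝ → E3} (h : WD f f1) (h1 : WD f1 f2) (m : MemLp f 2)
    (m1 : MemLp f1 2) (m2 : MemLp f2 2) :
    sobolevNorm 2 f = ENNReal.ofReal (Real.sqrt (l2 f2 ^ 2 + (l2 f1 ^ 2 + l2 f ^ 2))) := by
  rw [(isWeakDerivChain_two h h1).sobolevNorm_eq]
  simp only [Finset.sum_range_succ, Finset.sum_range_zero, zero_add, derivSeq]
  rw [eLpNorm_eq_ofReal m, eLpNorm_eq_ofReal m1, eLpNorm_eq_ofReal m2,
    ← ENNReal.ofReal_pow (l2_nonneg _), ← ENNReal.ofReal_pow (l2_nonneg _),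
    ← ENNReal.ofReal_pow (l2_nonneg _), ← ENNReal.ofReal_add (by positivity) (by positivity),
    ← ENNReal.ofReal_add (by positivity) (by positivity),
    ENNReal.ofReal_rpow_of_nonneg (by positivity) (by norm_num), Real.sqrt_eq_rpow, add_comm,
    add_comm (l2 f1 ^ 2)]

theorem exists_of_sobolevNorm_two {f : ℝ → E3} (h : sobolevNorm 2 f < ⊤) :
    ∃ f1 f2, WD f f1 ∧ WD f1 f2 ∧ MemLp f 2 ∧ MemLp f1 2 ∧ MemLp f2 2 := by
  obtain ⟨F, hF⟩ := iInf_lt_iff.1 h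
  obtain ⟨hc, hF⟩ := iInf_lt_iff.1 hF
  have w0 := hasWeakDeriv_iff.1 (hc.2 0 (by norm_num))
  have w1 := hasWeakDeriv_iff.1 (hc.2 1 (by norm_num))
  rw [hc.1] at w0
  have fin : ∀ j < 3, eLpNorm (F j) 2 volume < ⊤ := fun j hj => by
    have h1 := (ENNReal.rpow_lt_top_iff_of_pos (by norm_num)).1 hF
    have h2 := (ENNReal.sum_lt_top.1 h1) j (Finset.mem_range.2 hj)
    by_contra h3
    rw [not_lt, top_le_iff] at h3
    rw [h3] at h2
    simp at h2
  have f0 := fin 0 (by norm_num)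
  rw [hc.1] at f0
  exact ⟨F 1, F 2, w0, w1, ⟨w0.locallyIntegrable.aestronglyMeasurable, f0⟩,
    ⟨w0.loc.aestronglyMeasurable, fin 1 (by norm_num)⟩,
    ⟨w1.loc.aestronglyMeasurable, fin 2 (by norm_num)⟩⟩

/-! ### Weak limits -/

/-- Bounded sequences of `L²(ℝ)` have weak limits along ultrafilters. -/
theorem exists_weak_limit {f : ℕ → ℝ → E3} {M : ℝ} (m : ∀ n, MemLp (f n) 2) (b : ∀ n, l2 (f n) ≤ M)
    (U : Ultrafilter ℕ) : ∃ F : ℝ → E3, MemLp F 2 ∧ ∀ ψ : ℝ → E3, MemLp ψ 2 →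
      Tendsto (fun n => ∫ x, inner ℝ (f n x) (ψ x)) U (𝓝 (∫ x, inner ℝ (F x) (ψ x))) := by
  let H := Lp E3 2 (volume : Measure ℝ)
  let L : ℕ → WeakDual ℝ H := fun n =>
    StrongDual.toWeakDual (InnerProductSpace.toDual ℝ H ((m n).toLp (f n)))
  have hL : ∀ n, L n ∈ WeakDual.toStrongDual ⁻¹' Metric.closedBall (0 : StrongDual ℝ H) M := fun n => by
    rw [mem_preimage, mem_closedBall_zero_iff]
    change ‖InnerProductSpace.toDual ℝ H ((m n).toLp (f n))‖ ≤ M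
    rw [LinearIsometryEquiv.norm_map, Lp.norm_toLp]
    exact b n
  obtain ⟨ℓ, -, hℓ⟩ := (WeakDual.isCompact_closedBall (0 : StrongDual ℝ H) M).ultrafilter_le_nhds
    (U.map L) (le_principal_iff.2 (Filter.mem_map.2 (Eventually.of_forall hL)))
  have hℓ' : Tendsto L U (𝓝 ℓ) := hℓ
  set F : H := (InnerProductSpace.toDual ℝ H).symm (WeakDual.toStrongDual ℓ) with hF
  have pair : ∀ (a : H) {f ψ : ℝ → E3} (mψ : MemLp ψ 2), f =ᵐ[volume] a →
      ∫ x, inner ℝ (f x) (ψ x) = inner ℝ a (mψ.toLp ψ) := fun a f ψ mψ ha => by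
    rw [L2.inner_def]
    refine integral_congr_ae ?_
    filter_upwards [ha, mψ.coeFn_toLp] with x h1 h2
    rw [h1, h2]
  refine ⟨F, Lp.memLp F, fun ψ mψ => ?_⟩
  have h1 := ((WeakDual.eval_continuous (mψ.toLp ψ)).tendsto ℓ).comp hℓ'
  have e1 : ∀ n, ∫ x, inner ℝ (f n x) (ψ x) = (L n) (mψ.toLp ψ) := fun n => by
    rw [pair ((m n).toLp (f n)) mψ (m n).coeFn_toLp.symm]
    rfl
  have e2 : ∫ x, inner ℝ (F x) (ψ x) = ℓ (mψ.toLp ψ) := by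
    rw [pair F mψ EventuallyEq.rfl, ← InnerProductSpace.toDual_apply_apply, hF,
      LinearIsometryEquiv.apply_symm_apply]
    rfl
  rw [e2]
  exact h1.congr fun n => (e1 n).symm

/-- The weak formula, paired with a fixed vector e, tests f and f' against the L² functions φ' e and
φ e only, so it passes to weak limits. -/
theorem WD.of_weak_limit {f f' : ℕ → ℝ → E3} {F F' : ℝ → E3} {U : Filter ℕ} [NeBot U]
    (h : ∀ n, WD (f n) (f' n)) (m : ∀ n, MemLp (f n) 2) (m' : ∀ n, MemLp (f' n) 2)
    (mF : MemLp F 2) (mF' : MemLp F' 2)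
    (hf : ∀ ψ : ℝ → E3, MemLp ψ 2 →
      Tendsto (fun n => ∫ x, inner ℝ (f n x) (ψ x)) U (𝓝 (∫ x, inner ℝ (F x) (ψ x))))
    (hf' : ∀ ψ : ℝ → E3, MemLp ψ 2 →
      Tendsto (fun n => ∫ x, inner ℝ (f' n x) (ψ x)) U (𝓝 (∫ x, inner ℝ (F' x) (ψ x)))) : WD F F' := by
  have loc : ∀ {a : ℝ → E3}, MemLp a 2 → LocallyIntegrable a volume := fun ha =>
    ha.locallyIntegrable (by norm_num)
  refine WD.of_weak (loc mF) (loc mF') fun φ hφ sφ => ?_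
  refine ext_inner_right ℝ fun e => ?_
  have tst : ∀ {ψ : ℝ → ℝ}, Continuous ψ → HasCompactSupport ψ →
      MemLp (fun x => ψ x • e) 2 (volume : Measure ℝ) := fun {ψ} c s =>
    (c.smul continuous_const).memLp_of_hasCompactSupport (s.smul_right)
  have pr : ∀ {a : ℝ → E3}, MemLp a 2 → ∀ {ψ : ℝ → ℝ}, Continuous ψ → HasCompactSupport ψ →
      inner ℝ (∫ x, ψ x • a x) e = ∫ x, inner ℝ (a x) (ψ x • e) := fun {a} ha {ψ} c s => by
    have i : Integrable fun x => ψ x • a x :=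
      (loc ha).integrable_smul_left_of_hasCompactSupport c s
    rw [real_inner_comm, ← _root_.integral_inner i]
    refine integral_congr_ae (Eventually.of_forall fun x => ?_)
    simp only [real_inner_smul_right]
    rw [real_inner_comm]
  have c1 : Continuous (deriv φ) := hφ.continuous_deriv (by simp)
  have t1 := hf _ (tst c1 sφ.deriv)
  have t2 := (hf' _ (tst hφ.continuous sφ)).neg
  rw [pr mF c1 sφ.deriv, inner_neg_left, pr mF' hφ.continuous sφ]
  refine tendsto_nhds_unique t1 (t2.congr fun n => ?_)
  rw [← pr (m n) c1 sφ.deriv, ← pr (m' n) hφ.continuous sφ, ← inner_neg_left,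
    (h n).weak (hφ.of_le (by norm_cast)) sφ]

/-! ### Space derivatives as limits of difference quotients -/

/-- The limit of the difference quotients with increments `1 / (n + 1)`. -/
noncomputable def spaceDeriv (f : ℝ → E3) (x : ℝ) : E3 :=
  limUnder atTop fun n : ℕ => ((1 : ℝ) / (n + 1))⁻¹ • (f (x + 1 / (n + 1)) - f x)

theorem WD.spaceDeriv_eq {f f' : ℝ → E3} (h : WD f f') : spaceDeriv f =ᵐ[volume] f' := by
  obtain ⟨c, hc⟩ := h.eq
  have sh : ∀ᵐ x, ∀ n : ℕ, f (x + 1 / ((n : ℝ) + 1)) = c + ∫ t in (0:ℝ)..(x + 1 / (n + 1)), f' t := by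
    rw [ae_all_iff]
    intro n
    exact (measurePreserving_add_right volume _).quasiMeasurePreserving.ae hc
  filter_upwards [hc, sh, LocallyIntegrable.ae_hasDerivAt_integral h.loc] with x h1 h2 h3
  have h4 := (h3 0).tendsto_slope_zero
  have h5 : Tendsto (fun n : ℕ => 1 / ((n : ℝ) + 1)) atTop (𝓝[≠] 0) := tendsto_nhdsWithin_iff.2
    ⟨tendsto_one_div_add_atTop_nhds_zero_nat, Eventually.of_forall fun n =>
      (by positivity : (0:ℝ) < 1 / ((n : ℝ) + 1)).ne'⟩
  refine ((h4.comp h5).congr fun n => ?_).limUnder_eq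
  simp only [Function.comp]
  rw [h1, h2, add_sub_add_left_eq_sub]

/-- Weak derivatives obtained slice by slice carry no joint measurability in (t, x). A limit of
difference quotients does, and by `WD.spaceDeriv_eq` it agrees with the weak derivative on each
slice that has one. -/
theorem JM.spaceDeriv {f : ℝ → ℝ → E3} (jf : JM f) : JM (fun t => spaceDeriv (f t)) := by
  refine StronglyMeasurable.limUnder (f := fun (n : ℕ) (p : ℝ × ℝ) =>
    ((1 : ℝ) / (n + 1))⁻¹ • (f p.1 (p.2 + 1 / (n + 1)) - f p.1 p.2)) fun n => ?_
  have h1 := jf.shift 0 (1 / ((n : ℝ) + 1))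
  simp only [add_zero] at h1
  exact (JM.sub h1 jf).const_smul _

end SchrodingerMap

namespace SchrodingerMap

/-! ### Regular representatives of solutions -/

theorem slab_eq (T : ℝ) : slab T = volume.restrict (Ioo 0 T ×ˢ univ) := by
  rw [slab, Measure.volume_eq_prod, ← Measure.prod_restrict, Measure.restrict_univ]

/-- Extend f by the datum for t ≤ 0 and f' by zero. The weak equation with its initial term then
becomes a plain weak derivative in time on the half plane t < T, whose boundary plays no role, and f
is a primitive there. -/
theorem TP.of_tensor_init {T C : ℝ} (hT : 0 < T) {f f' : ℝ → ℝ → E3} {f₀ : ℝ → E3} (jf : JM f)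
    (jf' : JM f') (s0 : StronglyMeasurable f₀) (bf : ∀ t x, ‖f t x‖ ≤ C) (b0 : ∀ x, ‖f₀ x‖ ≤ C)
    (hv : SlabLoc T f')
    (H : ∀ a b : ℝ → ℝ, ContDiff ℝ ∞ a → HasCompactSupport a → tsupport a ⊆ Iio T →
      ContDiff ℝ ∞ b → HasCompactSupport b →
      (∫ p, (deriv a p.1 * b p.2) • f p.1 p.2 ∂(slab T)) + ∫ x, (a 0 * b x) • f₀ x =
        - ∫ p, (a p.1 * b p.2) • f' p.1 p.2 ∂(slab T)) : TP T f f₀ f' := by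
  set F : ℝ × ℝ → E3 := fun p => if p.1 ≤ 0 then f₀ p.2 else f p.1 p.2 with hF
  set F' : ℝ × ℝ → E3 := (Ioo 0 T ×ˢ univ).indicator (Function.uncurry f') with hF'
  have ms : MeasurableSet {p : ℝ × ℝ | p.1 ≤ 0} := measurableSet_le measurable_fst measurable_const
  have mI : MeasurableSet (Ioo 0 T ×ˢ (univ : Set ℝ)) := measurableSet_Ioo.prod MeasurableSet.univ
  have sF : StronglyMeasurable F := StronglyMeasurable.ite ms (s0.comp_measurable measurable_snd) jf
  have sF' : StronglyMeasurable F' := StronglyMeasurable.indicator jf' mI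
  have lF : LocallyIntegrable F volume :=
    (locallyIntegrable_const C).mono sF.aestronglyMeasurable (Eventually.of_forall fun p => by
      refine le_trans ?_ (le_abs_self C)
      simp only [hF]
      split_ifs
      · exact b0 _
      · exact bf _ _)
  have lF' : LocallyIntegrable F' volume := by
    refine locallyIntegrable_iff.2 fun k hk => ?_
    obtain ⟨R, hR⟩ := hk.isBounded.subset_closedBall 0
    have h1 := hv R
    rw [Measure.prod_restrict, ← Measure.volume_eq_prod] at h1
    have h2 : IntegrableOn F' (univ ×ˢ Icc (-R) R) volume := by
      rw [hF', IntegrableOn, integrable_indicator_iff mI, IntegrableOn, Measure.restrict_restrict mI,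
        prod_inter_prod, inter_univ, univ_inter]
      exact h1
    refine h2.mono_set fun p hp => ⟨trivial, ?_⟩
    have h3 := hR hp
    rw [mem_closedBall_zero_iff] at h3
    exact abs_le.1 ((norm_snd_le p).trans h3)
  obtain ⟨k, hk⟩ := exists_ae_eq_primitive_of_tensor lF sF' lF' isOpen_Iio ordConnected_Iio
    (mem_Iio.2 hT) isOpen_univ (by
      intro a b ha sa ta hb sb _
      have ca : Continuous (deriv a) := ha.continuous_deriv (by simp)
      have i1 := integrable_tensor_smul lF ca sa.deriv hb.continuous sb
      have a0 : ∀ t, T ≤ t → deriv a t = 0 := fun t ht => by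
        by_contra h0
        exact absurd (ta (support_deriv_subset h0)) (not_lt.2 ht)
      rw [← integral_add_compl ms i1]
      have e1 : ∫ p in {p : ℝ × ℝ | p.1 ≤ 0}, (deriv a p.1 * b p.2) • F p =
          ∫ x, (a 0 * b x) • f₀ x := by
        have hs : {p : ℝ × ℝ | p.1 ≤ 0} = Iic 0 ×ˢ univ := by ext p; simp
        have h1 : ∫ p in {p : ℝ × ℝ | p.1 ≤ 0}, (deriv a p.1 * b p.2) • F p =
            ∫ p in {p : ℝ × ℝ | p.1 ≤ 0}, deriv a p.1 • (b p.2 • f₀ p.2) := by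
          refine setIntegral_congr_fun ms fun p hp => ?_
          simp only [hF, if_pos (show p.1 ≤ 0 from hp), mul_smul]
        rw [h1, hs, Measure.volume_eq_prod, ← Measure.prod_restrict, Measure.restrict_univ,
          integral_prod_smul (deriv a) (fun x => b x • f₀ x),
          HasCompactSupport.integral_Iic_deriv_eq (ha.of_le (by norm_cast)) sa, ← integral_smul]
        simp only [mul_smul]
      have e2 : ∫ p in {p : ℝ × ℝ | p.1 ≤ 0}ᶜ, (deriv a p.1 * b p.2) • F p =
          ∫ p, (deriv a p.1 * b p.2) • f p.1 p.2 ∂(slab T) := by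
        rw [slab_eq]
        have h1 : ∫ p in {p : ℝ × ℝ | p.1 ≤ 0}ᶜ, (deriv a p.1 * b p.2) • F p =
            ∫ p in Ioo 0 T ×ˢ univ, (deriv a p.1 * b p.2) • F p := by
          refine setIntegral_eq_of_subset_of_forall_sdiff_eq_zero ms.compl
            (fun p hp => not_le.2 hp.1.1) fun p hp => ?_
          have : T ≤ p.1 := by
            by_contra h0
            exact hp.2 ⟨⟨not_le.1 hp.1, not_le.1 h0⟩, trivial⟩
          rw [a0 _ this, zero_mul, zero_smul]
        rw [h1]
        refine setIntegral_congr_fun mI fun p hp => ?_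
        simp only [hF, if_neg (not_le.2 hp.1.1)]
      have e3 : ∫ p : ℝ × ℝ, (a p.1 * b p.2) • F' p = ∫ p, (a p.1 * b p.2) • f' p.1 p.2 ∂(slab T) := by
        rw [slab_eq, ← integral_indicator mI]
        refine integral_congr_ae (Eventually.of_forall fun p => ?_)
        by_cases hp : p ∈ Ioo 0 T ×ˢ (univ : Set ℝ)
        · simp only [hF', indicator_of_mem hp, Function.uncurry]
        · simp only [hF', indicator_of_notMem hp, smul_zero]
      rw [e1, e2, e3, add_comm]
      exact H a b ha sa ta hb sb)
  rw [Measure.volume_eq_prod] at hk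
  have hk' := Measure.ae_ae_of_ae_prod hk
  -- The constant of integration is read off at a negative time, where the extended function is the
  -- datum and its derivative vanishes.
  have ek : ∀ᵐ x, k x = f₀ x := by
    have : NeBot (ae (volume.restrict (Iio (0:ℝ)))) := by
      rw [ae_neBot, Ne, Measure.restrict_eq_zero]
      simp
    obtain ⟨t, h1, ht⟩ := ((ae_restrict_of_ae (s := Iio (0:ℝ)) hk').and
      (ae_restrict_mem measurableSet_Iio)).exists
    have ht : t < 0 := ht
    filter_upwards [h1] with x hx
    have h2 := hx (show t < T by linarith) trivial
    have h3 : ∫ s in (0:ℝ)..t, F' (s, x) = 0 := by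
      rw [intervalIntegral.integral_symm, intervalIntegral.integral_of_le ht.le, neg_eq_zero]
      refine setIntegral_eq_zero_of_forall_eq_zero fun s hs => ?_
      exact indicator_of_notMem (fun h => absurd h.1.1 (not_lt.2 hs.2)) _
    simp only [hF, if_pos ht.le] at h2
    rw [h3, add_zero] at h2
    exact h2.symm
  refine TP.of_ae_ae jf jf' s0 hv ?_
  filter_upwards [ae_restrict_of_ae (s := Ioo 0 T) hk', ae_restrict_mem measurableSet_Ioo] with t ht htI
  filter_upwards [ht, ek] with x hx ex
  have h2 := hx htI.2 trivial
  simp only [hF, if_neg (not_le.2 htI.1)] at h2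
  rw [h2, ex]
  congr 1
  rw [intervalIntegral.integral_of_le htI.1.le, intervalIntegral.integral_of_le htI.1.le]
  refine setIntegral_congr_fun measurableSet_Ioc fun s hs => ?_
  exact indicator_of_mem (show (s, x) ∈ Ioo 0 T ×ˢ univ from ⟨⟨hs.1, hs.2.trans_lt htI.2⟩, trivial⟩) _

theorem SlabLoc.integrable_tensor {T : ℝ} {v : ℝ → ℝ → E3} (h : SlabLoc T v) {a ψ : ℝ → ℝ}
    (ha : Continuous a) (sa : HasCompactSupport a) (hψ : Continuous ψ) (sψ : HasCompactSupport ψ) :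
    Integrable (fun p : ℝ × ℝ => (a p.1 * ψ p.2) • v p.1 p.2) (slab T) := by
  obtain ⟨C, hC⟩ := ha.bounded_above_of_compact_support sa
  have i := h.integrable_smul hψ sψ
  refine Integrable.mono' (g := fun p => C * ‖ψ p.2 • v p.1 p.2‖) (i.norm.const_mul C) ?_
    (Eventually.of_forall fun p => ?_)
  · have := (ha.comp continuous_fst).aestronglyMeasurable.smul i.1
    refine this.congr (Eventually.of_forall fun p => ?_)
    simp only [Pi.smul_apply', Function.comp, mul_smul]
  · rw [mul_smul, norm_smul]
    exact mul_le_mul_of_nonneg_right (hC _) (norm_nonneg _)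

theorem integral_tensor_deriv {T : ℝ} {w w' : ℝ → ℝ → E3} (hw : SlabLoc T w) (hw' : SlabLoc T w')
    (h : ∀ᵐ t ∂(volume.restrict (Ioo 0 T)), WD (w t) (w' t)) {a b : ℝ → ℝ}
    (ha : Continuous a) (sa : HasCompactSupport a) (hb : ContDiff ℝ ∞ b) (sb : HasCompactSupport b) :
    ∫ p, (a p.1 * deriv b p.2) • w p.1 p.2 ∂(slab T) =
      - ∫ p, (a p.1 * b p.2) • w' p.1 p.2 ∂(slab T) := by
  have i1 := hw.integrable_tensor ha sa (hb.continuous_deriv (by simp)) sb.deriv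
  have i2 := hw'.integrable_tensor ha sa hb.continuous sb
  rw [slab] at i1 i2 ⊢
  rw [integral_prod _ i1, integral_prod _ i2, ← integral_neg]
  refine integral_congr_ae (h.mono fun t ht => ?_)
  simp only [mul_smul]
  rw [integral_smul, integral_smul, ht.weak (hb.of_le (by norm_cast)) sb, smul_neg]

theorem exists_sphere_repr {X : Type*} [MeasurableSpace X] {μ : Measure X} {f : X → E3}
    (hf : AEStronglyMeasurable f μ) (h : ∀ᵐ p ∂μ, ‖f p‖ = 1) :
    ∃ F : X → E3, StronglyMeasurable F ∧ (∀ p, ‖F p‖ = 1) ∧ F =ᵐ[μ] f := by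
  classical
  have s := hf.stronglyMeasurable_mk
  have ms : MeasurableSet {p | ‖hf.mk f p‖ = 1} :=
    StronglyMeasurable.measurableSet_eq_fun s.norm stronglyMeasurable_const
  -- Off the set where the representative has norm one, a fixed unit vector is substituted, so that
  -- the constraint holds everywhere.
  refine ⟨fun p => if ‖hf.mk f p‖ = 1 then hf.mk f p else EuclideanSpace.single 0 1,
    StronglyMeasurable.ite ms s stronglyMeasurable_const, fun p => ?_, ?_⟩
  · dsimp only
    split_ifs with hp
    · exact hp
    · simp
  · filter_upwards [hf.ae_eq_mk, h] with p h1 h2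
    rw [if_pos (by rw [← h1]; exact h2), h1]

end SchrodingerMap

/-! ### Regularity of the datum and representatives of solutions -/

namespace SchrodingerMap

/-- The trace at time `0` of a function with values in `H²`. -/
theorem exists_init_derivs {T M V : ℝ} (hT : 0 < T) {f f1 f2 : ℝ → ℝ → E3} {f₀ : ℝ → E3}
    (m₀ : MemLp f₀ 2)
    (hs : ∀ᵐ t ∂(volume.restrict (Ioo 0 T)), WD (f t) (f1 t) ∧ WD (f1 t) (f2 t) ∧ MemLp (f t) 2 ∧
      (MemLp (f1 t) 2 ∧ l2 (f1 t) ≤ M) ∧ (MemLp (f2 t) 2 ∧ l2 (f2 t) ≤ M))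
    (hc : ∀ᵐ t ∂(volume.restrict (Ioo 0 T)), l2 (fun x => f t x - f₀ x) ≤ t * V) :
    ∃ i1 i2 : ℝ → E3, WD f₀ i1 ∧ WD i1 i2 ∧ MemLp i1 2 ∧ MemLp i2 2 := by
  have ex : ∀ n : ℕ, ∃ t, (WD (f t) (f1 t) ∧ WD (f1 t) (f2 t) ∧ MemLp (f t) 2 ∧
      (MemLp (f1 t) 2 ∧ l2 (f1 t) ≤ M) ∧ (MemLp (f2 t) 2 ∧ l2 (f2 t) ≤ M)) ∧
      l2 (fun x => f t x - f₀ x) ≤ t * V ∧ t ∈ Ioo 0 (min T (1 / ((n:ℝ) + 1))) := fun n => by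
    have h0 : 0 < min T (1 / ((n:ℝ) + 1)) := lt_min hT (by positivity)
    have : NeBot (ae (volume.restrict (Ioo 0 (min T (1 / ((n:ℝ) + 1)))))) := by
      rw [ae_neBot, Ne, Measure.restrict_eq_zero, Real.volume_Ioo]
      simpa using h0
    obtain ⟨t, h1, h2, h3⟩ := ((ae_Ioo_mono (min_le_left T (1 / ((n:ℝ) + 1))) hs).and
      ((ae_Ioo_mono (min_le_left T (1 / ((n:ℝ) + 1))) hc).and (ae_restrict_mem measurableSet_Ioo))).exists
    exact ⟨t, h1, h2, h3⟩
  choose t h1 h2 h3 using ex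
  -- Along times tending to 0 the functions converge strongly to the datum and their derivatives are
  -- bounded in L². Weak limits of the derivatives along a common ultrafilter are the derivatives of
  -- the datum.
  obtain ⟨U, hU⟩ := Ultrafilter.exists_le (atTop : Filter ℕ)
  obtain ⟨i1, m1, c1⟩ := exists_weak_limit (f := fun n => f1 (t n)) (fun n => (h1 n).2.2.2.1.1)
    (fun n => (h1 n).2.2.2.1.2) U
  obtain ⟨i2, m2, c2⟩ := exists_weak_limit (f := fun n => f2 (t n)) (fun n => (h1 n).2.2.2.2.1)
    (fun n => (h1 n).2.2.2.2.2) U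
  have t0 : Tendsto t atTop (𝓝 0) := squeeze_zero (fun n => (h3 n).1.le)
    (fun n => (h3 n).2.le.trans (min_le_right _ _)) tendsto_one_div_add_atTop_nhds_zero_nat
  have c0 : ∀ ψ : ℝ → E3, MemLp ψ 2 →
      Tendsto (fun n => ∫ x, inner ℝ (f (t n) x) (ψ x)) U (𝓝 (∫ x, inner ℝ (f₀ x) (ψ x))) := by
    intro ψ mψ
    refine Tendsto.mono_left ?_ hU
    rw [tendsto_iff_norm_sub_tendsto_zero]
    have hlim : Tendsto (fun n => t n * V * l2 ψ) atTop (𝓝 0) := by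
      simpa using (t0.mul_const V).mul_const (l2 ψ)
    refine squeeze_zero (fun n => norm_nonneg _) (fun n => ?_) hlim
    have md : MemLp (fun x => f (t n) x - f₀ x) 2 := (h1 n).2.2.1.sub m₀
    rw [← integral_sub (integrable_inner (h1 n).2.2.1 mψ) (integrable_inner m₀ mψ)]
    simp only [← inner_sub_left]
    exact (abs_integral_inner_le md mψ).trans (mul_le_mul_of_nonneg_right (h2 n) (l2_nonneg _))
  have w0 : WD f₀ i1 := WD.of_weak_limit (U := U) (fun n => (h1 n).1) (fun n => (h1 n).2.2.1)
    (fun n => (h1 n).2.2.2.1.1) m₀ m1 c0 c1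
  exact ⟨i1, i2, w0, WD.of_weak_limit (U := U) (fun n => (h1 n).2.1) (fun n => (h1 n).2.2.2.1.1)
    (fun n => (h1 n).2.2.2.2.1) m1 m2 c1 c2, m1, m2⟩

theorem exists_of_sobolevNorm_two_le {f : ℝ → E3} {M : ℝ≥0} (h : sobolevNorm 2 f ≤ M) :
    ∃ f1 f2, WD f f1 ∧ WD f1 f2 ∧ (MemLp f 2 ∧ l2 f ≤ M) ∧ (MemLp f1 2 ∧ l2 f1 ≤ M) ∧
      MemLp f2 2 ∧ l2 f2 ≤ M := by
  obtain ⟨f1, f2, w, w1, m, m1, m2⟩ := exists_of_sobolevNorm_two (h.trans_lt ENNReal.coe_lt_top)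
  rw [sobolevNorm_two_eq w w1 m m1 m2, ← ENNReal.ofReal_coe_nnreal,
    ENNReal.ofReal_le_ofReal_iff (NNReal.coe_nonneg M)] at h
  have key : ∀ {a : ℝ}, 0 ≤ a → a ^ 2 ≤ l2 f2 ^ 2 + (l2 f1 ^ 2 + l2 f ^ 2) → a ≤ M := fun ha h' =>
    (Real.le_sqrt ha (by positivity)).2 h' |>.trans h
  refine ⟨f1, f2, w, w1, ⟨m, key (l2_nonneg _) ?_⟩, ⟨m1, key (l2_nonneg _) ?_⟩, m2,
    key (l2_nonneg _) ?_⟩ <;>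
  nlinarith [sq_nonneg (l2 f), sq_nonneg (l2 f1), sq_nonneg (l2 f2)]

/-- A solution in the sense of distributions has a regular representative. -/
theorem exists_sol {g : ℝ → ℝ → ℝ} {α K T : ℝ} (hT : 0 < T) (c : Coef T α K)
    (hc : ∀ᵐ p ∂(slab T), c.g p.1 p.2 = g p.1 p.2) {u₀ u₀x : ℝ → E3} {u ux : ℝ → ℝ → E3}
    (h0 : HasWeakDeriv u₀ u₀x) (h : IsSolution g T u₀ u ux) (hr : MemLinftySobolev T 2 ux) :
    ∃ (M : ℝ) (s : Sol c M), (∀ᵐ t ∂(volume.restrict (Ioo 0 T)), s.u t =ᵐ[volume] u t) ∧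
      s.i0 =ᵐ[volume] u₀ ∧ s.i1 =ᵐ[volume] u₀x := by
  obtain ⟨hα, hK⟩ := c.gi_le
  obtain ⟨-, M, hM⟩ := hr
  obtain ⟨W, jW, nW, eW⟩ := exists_sphere_repr h.meas h.sphere
  obtain ⟨i0, si0, ni0, ei0⟩ := exists_sphere_repr h.meas_init h.sphere_init
  have sd := h0.locInt'.aestronglyMeasurable
  set i1 : ℝ → E3 := sd.mk u₀x with hi1
  have si1 : StronglyMeasurable i1 := sd.stronglyMeasurable_mk
  have ei1 : i1 =ᵐ[volume] u₀x := sd.ae_eq_mk.symm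
  set w : ℝ → ℝ → E3 := fun t x => W (t, x) with hw
  have jw : JM w := jW
  set D : ℝ × ℝ → E3 := h.meas_deriv.mk _ with hD
  have eD := h.meas_deriv.ae_eq_mk
  set w1 : ℝ → ℝ → E3 := fun t x => D (t, x) with hw1
  have jw1 : JM w1 := h.meas_deriv.stronglyMeasurable_mk
  set w2 : ℝ → ℝ → E3 := fun t => spaceDeriv (w1 t) with hw2
  have jw2 : JM w2 := jw1.spaceDeriv
  set w3 : ℝ → ℝ → E3 := fun t => spaceDeriv (w2 t) with hw3
  have jw3 : JM w3 := jw2.spaceDeriv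
  have eu : ∀ᵐ t ∂(volume.restrict (Ioo 0 T)), w t =ᵐ[volume] u t := Measure.ae_ae_of_ae_prod eW
  have eu1 : ∀ᵐ t ∂(volume.restrict (Ioo 0 T)), ux t =ᵐ[volume] w1 t := Measure.ae_ae_of_ae_prod eD
  have slice : ∀ᵐ t ∂(volume.restrict (Ioo 0 T)), MapSlice (w t) (w1 t) (w2 t) (w3 t) ∧
      l2 (w1 t) ≤ M ∧ l2 (w2 t) ≤ M ∧ l2 (w3 t) ≤ M := by
    filter_upwards [eu, eu1, h.hasWeakDeriv, hM] with t a1 a2 a3 a4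
    obtain ⟨f1, f2, b1, b2, ⟨m0, l0⟩, ⟨m1, l1⟩, m2, l2'⟩ := exists_of_sobolevNorm_two_le a4
    have c1 : WD (w1 t) f1 := b1.congr a2 EventuallyEq.rfl
    have e1 : f1 =ᵐ[volume] w2 t := c1.spaceDeriv_eq.symm
    have c2 : WD (w2 t) f2 := b2.congr e1 EventuallyEq.rfl
    have e2 : f2 =ᵐ[volume] w3 t := c2.spaceDeriv_eq.symm
    refine ⟨⟨fun x => nW _, jw.slice t, jw1.slice t, jw2.slice t, jw3.slice t,
      (hasWeakDeriv_iff.1 a3).congr a1.symm a2, c1.congr EventuallyEq.rfl e1,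
      c2.congr EventuallyEq.rfl e2, (memLp_congr_ae a2).1 m0, (memLp_congr_ae e1).1 m1,
      (memLp_congr_ae e2).1 m2⟩, ?_, ?_, ?_⟩
    · rwa [← l2_congr a2]
    · rwa [← l2_congr e1]
    · rwa [← l2_congr e2]
  set v : ℝ → ℝ → E3 := fun t => vel (c.g t) (c.g1 t) (w t) (w1 t) (w2 t) with hv
  set v1 : ℝ → ℝ → E3 := fun t =>
    velD (c.g t) (c.g1 t) (c.g2 t) (w t) (w1 t) (w2 t) (w3 t) with hv1
  have jv : JM v := jw.wedge (JM.fluxD c.mg c.mg1 jw1 jw2)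
  have jv1 : JM v1 := (jw1.wedge (JM.fluxD c.mg c.mg1 jw1 jw2)).add
    (jw.wedge (JM.fluxDD c.mg c.mg1 c.mg2 jw1 jw2 jw3))
  have hM0 : (0:ℝ) ≤ M := M.2
  have bv : ∀ᵐ t ∂(volume.restrict (Ioo 0 T)), (MemLp (v t) 2 ∧ l2 (v t) ≤ K * (M + M)) ∧
      MemLp (v1 t) 2 ∧ l2 (v1 t) ≤ M * (K * (M + M)) + K * (M + 2 * M + M) := by
    filter_upwards [slice, c.slice] with t ⟨a, b1, b2, b3⟩ hct
    have := hct.memLp_vel a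
    exact ⟨⟨this.1, this.2.trans (by gcongr)⟩, hct.memLp_velD a b1 b2 b3⟩
  have lv : SlabLoc T v := SlabLoc.of_l2 jv (bv.mono fun t a => a.1)
  have lv1 : SlabLoc T v1 := SlabLoc.of_l2 jv1 (bv.mono fun t a => a.2)
  -- The flux of the divergence form. Its space derivative is the velocity v, because u_x ∧ u_x = 0;
  -- this is where the two forms of the equation meet.
  set q : ℝ → ℝ → E3 := fun t x => c.g t x • wedge (w t x) (w1 t x) with hq
  have jq : JM q := c.mg.smul (jw.wedge jw1)
  have bq : ∀ᵐ t ∂(volume.restrict (Ioo 0 T)), WD (q t) (v t) ∧ MemLp (q t) 2 ∧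
      l2 (q t) ≤ K * M := by
    filter_upwards [slice, c.slice] with t ⟨a, b1, b2, b3⟩ hct
    have n := memLp_wedge_left zero_le_one a.sm.aestronglyMeasurable
      (Eventually.of_forall fun x => (a.sph x).le) a.m1
    refine ⟨(hct.wd.smul (a.wd.wedge a.wd1)).congr EventuallyEq.rfl (Eventually.of_forall fun x => ?_),
      hct.memLp_smul n.1, (l2_bdd_smul_le hK (Eventually.of_forall hct.bg) n.1).trans ?_⟩
    · simp only [hv, vel, fluxD, wedge_self, zero_add, wedge_add_right, wedge_smul_right]
      rw [add_comm]
    · have := n.2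
      rw [one_mul] at this
      exact mul_le_mul_of_nonneg_left (this.trans b1) hK
  have lq : SlabLoc T q := SlabLoc.of_l2 jq (bq.mono fun t a => a.2)
  have tp : TP T w i0 v := by
    refine TP.of_tensor_init (C := 1) hT jw jv si0 (fun t x => (nW _).le) (fun x => (ni0 x).le) lv ?_
    intro a b ha sa ta hb sb
    obtain ⟨φ, p1, p2, p3⟩ := exists_tensor (Ω := beforeTime T) ha sa hb sb fun p hp => ta hp
    have e := h.equation φ
    simp only [p1, p2, p3] at e
    rw [← integral_tensor_deriv lq lv (bq.mono fun t a => a.1) ha.continuous sa hb sb]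
    refine Eq.trans (congrArg₂ _ (integral_congr_ae ?_) (integral_congr_ae ?_))
      (e.trans (integral_congr_ae ?_))
    · filter_upwards [eW] with p hp
      have : w p.1 p.2 = u p.1 p.2 := hp
      rw [this]
    · filter_upwards [ei0] with x hx
      rw [hx]
    · filter_upwards [eW, eD, hc] with p hp hp1 hp2
      have t1 : w p.1 p.2 = u p.1 p.2 := hp
      have t2 : ux p.1 p.2 = w1 p.1 p.2 := hp1
      simp only [hq]
      rw [hp2, t1, t2]
  have wi0 : WD i0 i1 := (hasWeakDeriv_iff.1 h0).congr ei0.symm ei1.symm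
  have wv : ∀ᵐ t ∂(volume.restrict (Ioo 0 T)), WD (v t) (v1 t) := by
    filter_upwards [slice, c.slice] with t a hct
    exact hct.wd_vel a.1
  have tp1 : TP T w1 i1 v1 := tp.space_deriv jw jv jw1 jv1 si0 si1 lv lv1 wi0
    (slice.mono fun t a => a.1.wd) wv
  have inc := TP.l2_sub_init (by positivity) tp1 jw1 jv1 si1 (bv.mono fun t a => a.2)
  -- At a generic time both u_x and its increment from the datum are in L², hence so is the
  -- derivative of the datum.
  have mi1 : MemLp i1 2 := by
    have : NeBot (ae (volume.restrict (Ioo 0 T))) := by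
      rw [ae_neBot, Ne, Measure.restrict_eq_zero, Real.volume_Ioo]
      simpa using hT
    obtain ⟨t, a, b⟩ := (slice.and inc).exists
    have := a.1.m1.sub b.1
    refine (memLp_congr_ae (Eventually.of_forall fun x => ?_)).1 this
    simp
  -- That u₀' belongs to H² is not among the hypotheses; it is inherited from the solution at small
  -- times.
  obtain ⟨j2, j3, k1, k2, n2, n3⟩ := exists_init_derivs hT mi1 (f := w1) (f1 := w2) (f2 := w3)
    (M := M) (slice.mono fun t a => ⟨a.1.wd1, a.1.wd2, a.1.m1, ⟨a.1.m2, a.2.2.1⟩, a.1.m3, a.2.2.2⟩)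
    (inc.mono fun t a => a.2)
  have f2 := n2.1.ae_eq_mk
  have f3 := n3.1.ae_eq_mk
  refine ⟨M, ⟨w, w1, w2, w3, i0, i1, n2.1.mk j2, n3.1.mk j3, jw, jw1, jw2, jw3, slice,
    ⟨ni0, si0, si1, n2.1.stronglyMeasurable_mk, n3.1.stronglyMeasurable_mk, wi0,
      k1.congr EventuallyEq.rfl f2, k2.congr f2 f3, mi1, (memLp_congr_ae f2).1 n2,
      (memLp_congr_ae f3).1 n3⟩, tp, tp1⟩, eu, ei0, ei1⟩

end SchrodingerMap

/-! ### Passage to Sobolev norms and conclusion -/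

namespace SchrodingerMap

theorem Sol.init_le {T α K M : ℝ} {c : Coef T α K} (s : Sol c M) {f : ℝ → E3}
    (e : s.i1 =ᵐ[volume] f) :
    l2 s.i1 ≤ (sobolevNorm 2 f).toReal ∧ l2 s.i2 ≤ (sobolevNorm 2 f).toReal ∧
      l2 s.i3 ≤ (sobolevNorm 2 f).toReal := by
  have w : WD f s.i2 := s.init.wd1.congr e EventuallyEq.rfl
  rw [sobolevNorm_two_eq w s.init.wd2 ((memLp_congr_ae e).1 s.init.m1) s.init.m2 s.init.m3,
    ← l2_congr e, ENNReal.toReal_ofReal (Real.sqrt_nonneg _)]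
  refine ⟨Real.le_sqrt_of_sq_le ?_, Real.le_sqrt_of_sq_le ?_, Real.le_sqrt_of_sq_le ?_⟩ <;>
  linarith [sq_nonneg (l2 s.i1), sq_nonneg (l2 s.i2), sq_nonneg (l2 s.i3)]

theorem ofReal_sqrt_le {C x y : ℝ} (hC : 0 ≤ C) (h : x ≤ C * y) :
    ENNReal.ofReal (Real.sqrt x) ≤
      ((Real.sqrt C + 1).toNNReal : ℝ≥0∞) * ENNReal.ofReal (Real.sqrt y) := by
  rw [← ENNReal.ofReal, ← ENNReal.ofReal_mul (by positivity)]
  refine ENNReal.ofReal_le_ofReal ((Real.sqrt_le_sqrt h).trans ?_)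
  rw [Real.sqrt_mul hC]
  have := Real.sqrt_nonneg y
  gcongr
  linarith

end SchrodingerMap

open SchrodingerMap
theorem theorem4 (g : ℝ → ℝ → ℝ) (hg : MemW1infty 3 g)
    (α : ℝ) (hα : 0 < α)
    (hgα : ∀ᵐ p ∂(volume.restrict (posTime : Set (ℝ × ℝ))), α ≤ g p.1 p.2)
    (T : ℝ) (hT : 0 < T) :
    ∃ C₁ C₂ : ℝ≥0∞ → ℝ≥0∞ → ℝ≥0,
      (∀ a b, 0 < C₁ a b ∧ 0 < C₂ a b) ∧
      ∀ (u₀ u₀x ũ₀ ũ₀x : ℝ → E3) (u ux ũ ũx : ℝ → ℝ → E3),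
        HasWeakDeriv u₀ u₀x → HasWeakDeriv ũ₀ ũ₀x →
        IsSolution g T u₀ u ux → IsSolution g T ũ₀ ũ ũx →
        MemSobolev 2 (fun x => u₀ x - ũ₀ x) →
        MemLinftySobolev T 2 ux → MemLinftySobolev T 2 ũx →
        ∀ᵐ t ∂(volume.restrict (Ioo 0 T)),
          sobolevNorm 1 (fun x => u t x - ũ t x)
              ≤ C₁ (sobolevNorm 2 u₀x) (sobolevNorm 2 ũ₀x)
                * sobolevNorm 1 (fun x => u₀ x - ũ₀ x) ∧
          sobolevNorm 2 (fun x => u t x - ũ t x)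
              ≤ C₂ (sobolevNorm 2 u₀x) (sobolevNorm 2 ũ₀x)
                * sobolevNorm 2 (fun x => u₀ x - ũ₀ x) := by
  obtain ⟨K, c, hc⟩ := exists_coef hg hα hgα hT
  choose D hD HD using fun A : ℝ≥0 => Sol.exists_bound hT c A A.2
  choose B₁ hB₁ H₁ using fun d : ℝ => Sol.exists_difference_one hT c d
  choose B₂ hB₂ H₂ using fun d : ℝ => Sol.exists_difference_two hT c d
  -- The common a priori bound of both solutions, a function of the norms of the data. An infinite
  -- norm would be read as 0, which does no harm: the norms of the data of solutions are finite.
  let d : ℝ≥0∞ → ℝ≥0∞ → ℝ := fun a b => D (max a.toNNReal b.toNNReal)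
  -- The summand 1 makes the constants positive. The second constant contains B₁ as well, since the
  -- squared H² norm is the squared H¹ norm plus the part of order two.
  refine ⟨fun a b => (Real.sqrt (B₁ (d a b)) + 1).toNNReal,
    fun a b => (Real.sqrt (B₂ (d a b) + B₁ (d a b)) + 1).toNNReal,
    fun a b => ⟨Real.toNNReal_pos.2 (by positivity), Real.toNNReal_pos.2 (by positivity)⟩, ?_⟩
  intro u₀ u₀x ũ₀ ũ₀x u ux ũ ũx h0 h0' h h' hs hr hr'
  obtain ⟨M, s, es, es0, es1⟩ := exists_sol hT c hc h0 h hr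
  obtain ⟨M', r, er, er0, er1⟩ := exists_sol hT c hc h0' h' hr'
  set a := sobolevNorm 2 u₀x
  set b := sobolevNorm 2 ũ₀x
  have ia : a.toReal ≤ (max a.toNNReal b.toNNReal : ℝ≥0) := NNReal.coe_le_coe.2 (le_max_left _ _)
  have ib : b.toReal ≤ (max a.toNNReal b.toNNReal : ℝ≥0) := NNReal.coe_le_coe.2 (le_max_right _ _)
  obtain ⟨p1, p2, p3⟩ := s.init_le es1
  obtain ⟨q1, q2, q3⟩ := r.init_le er1
  -- The bounds M and M' of the two solutions are replaced by one bound that depends on the data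
  -- only, so that the stability constants do too.
  set s' := s.rebound (HD _ M s (p1.trans ia) (p2.trans ia) (p3.trans ia))
  set r' := r.rebound (HD _ M' r (q1.trans ib) (q2.trans ib) (q3.trans ib))
  have e0 : (fun x => s'.i0 x - r'.i0 x) =ᵐ[volume] fun x => u₀ x - ũ₀ x := es0.sub er0
  obtain ⟨-, -, -, -, m0, -, -⟩ := exists_of_sobolevNorm_two hs.2
  have n0 : MemLp (fun x => s'.i0 x - r'.i0 x) 2 := (memLp_congr_ae e0).2 m0
  have w0 : WD (fun x => u₀ x - ũ₀ x) (fun x => s'.i1 x - r'.i1 x) :=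
    (s'.init.wd.sub r'.init.wd).congr e0 Filter.EventuallyEq.rfl
  have w1 : WD (fun x => s'.i1 x - r'.i1 x) (fun x => s'.i2 x - r'.i2 x) :=
    s'.init.wd1.sub r'.init.wd1
  have m1 : MemLp (fun x => s'.i1 x - r'.i1 x) 2 := s'.init.m1.sub r'.init.m1
  have m2 : MemLp (fun x => s'.i2 x - r'.i2 x) 2 := s'.init.m2.sub r'.init.m2
  filter_upwards [H₁ _ s' r' n0, H₂ _ s' r' n0, s'.slice, r'.slice, es, er]
    with t ⟨mt, k1⟩ k2 ⟨x, _⟩ ⟨y, _⟩ ex ey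
  have et : (fun x => s'.u t x - r'.u t x) =ᵐ[volume] fun x => u t x - ũ t x := ex.sub ey
  have wt : WD (fun x => u t x - ũ t x) (fun x => s'.u1 t x - r'.u1 t x) :=
    (x.wd.sub y.wd).congr et Filter.EventuallyEq.rfl
  have wt1 : WD (fun x => s'.u1 t x - r'.u1 t x) (fun x => s'.u2 t x - r'.u2 t x) :=
    x.wd1.sub y.wd1
  have mt0 : MemLp (fun x => u t x - ũ t x) 2 := (memLp_congr_ae et).1 mt
  have mt1 : MemLp (fun x => s'.u1 t x - r'.u1 t x) 2 := x.m1.sub y.m1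
  have mt2 : MemLp (fun x => s'.u2 t x - r'.u2 t x) 2 := x.m2.sub y.m2
  rw [l2_congr et, l2_congr e0] at k1
  rw [l2_congr e0] at k2
  rw [sobolevNorm_one_eq wt mt0 mt1, sobolevNorm_one_eq w0 m0 m1,
    sobolevNorm_two_eq wt wt1 mt0 mt1 mt2, sobolevNorm_two_eq w0 w1 m0 m1 m2]
  refine ⟨ofReal_sqrt_le (hB₁ _) k1, ofReal_sqrt_le (add_nonneg (hB₂ _) (hB₁ _)) ?_⟩
  have h1 := mul_nonneg (hB₁ (d a b)) (sq_nonneg (l2 (fun x => s'.i2 x - r'.i2 x)))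
  rw [add_assoc] at k2
  refine (add_le_add k2 k1).trans ?_
  rw [add_mul]
  refine add_le_add le_rfl (mul_le_mul_of_nonneg_left ?_ (hB₁ _))
  exact le_add_of_nonneg_left (sq_nonneg _)
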